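/- Let $n\ge 2$, let $N$ be a smooth $n$-manifold (Hausdorff, second countable, without boundary) with a projective structure, i.e. a projective equivalence class of smooth torsion-free affine connections, and let $\nabla$ be a connection in the class, with Christoffel symbols $\Gamma_{ij}^k$ and projective Schouten tensor $\mathrm P_{ij}=\frac{1}{n^2-1}(nR_{ij}+R_{ji})$, where $R_{jl}=R_{kj}{}^k{}_l$ and $(\nabla_i\nabla_j-\nabla_j\nabla_i)V^k=R_{ij}{}^k{}_lV^l$. Identify the associated affine bundle with $M=T^*N$ by means of $\nabla$. In the local coordinates $(x^i,\xi_i)$ of $T^*N$ put $$g=\big(d\xi_j-(\Gamma_{ij}^k\xi_k-\xi_i\xi_j-\mathrm P_{(ij)})dx^i\big)\odot dx^j,\qquad \Omega=d\xi_i\wedge dx^i+\mathrm P_{[ij]}dx^i\wedge dx^j,$$ with $a\odot b=\frac12(a\otimes b+b\otimes a)$, $a\wedge b=\frac12(a\otimes b-b\otimes a)$, and let $J$ be defined by $\Omega(X,Y)=g(JX,Y)$. Then: (1) $(g,J)$ is an almost para-Hermitian structure ($J^2=1$, $g(JX,JY)=-g(X,Y)$) on $M$, and $(M,g,J)$ has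 a para-c-projective compactification: there are a smooth manifold with boundary $\overline M$ of dimension $2n$ with interior $M$, a smooth function $T$ on $\overline M$, positive on $M$, whose zero set is $\partial M$ and with $dT\ne0$ on $\partial M$, and an affine connection $\nabla^L$ on $M$ that preserves $g$ and $J$ and whose torsion is a constant multiple of the Nijenhuis tensor of $J$, such that the connection $$\nabla^L_XY+\Upsilon(X)Y+\Upsilon(JX)JY+\Upsilon(Y)X+\Upsilon(JY)JX,\qquad \Upsilon=\frac{dT}{2T},$$ extends smoothly to $\overline M$. The projection $M\to N$ extends to a proper smooth map $\overline M\to N$. (2) The boundary $\partial M$, of dimension $2n-1$, is diffeomorphic to the ray projectivization $\mathbb P_+(T^*N)=(T^*N\setminus0)/\mathbb R_{>0}$, the ray of $\xi\neq0$ being the limit of $s\xi$ as $s\to\infty$. (3) $J$ extends smoothly to $\overline M$. With $\theta=dT\circ J$, the restriction of $\theta$ to $\partial M$ is a contact form, with contact distribution $\mathcal D=T\partial M\cap J(T\partial M)$, and $J$ restricts to an (almost, partially integrable) para-CR structure on $\mathcal D$: $J^2=1$ on $\mathcal D$, both eigenbundles have rank $n-1$, and $d\theta(JX,JY)=-d\theta(X,Y)$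 on $\mathcal D$. (4) $h=Tg+\frac1{4T}(dT^2-\theta^2)$ extends smoothly to $\overline M$, and it restricts to a nondegenerate symmetric form on $\mathcal D$ with $h(X,JY)=\frac14d\theta(X,Y)$, where $d\theta(X,Y)=X\theta(Y)-Y\theta(X)-\theta([X,Y])$. Explicitly, let $(x^i)$ be a chart of $N$ and $k$ an index, and, on the part of $\mathbb P_+(T^*N)$ where $\xi_k\ne0$, put $Y=x^k$, and $X^A=x^A$, $Z_A=\xi_A/\xi_k$ for $A\ne k$. Then $\mathcal D=\ker(dY+Z_AdX^A)$, and the restriction of $h$ to $\mathcal D$ is a multiple, by a nowhere zero function with the sign of $\xi_k$, of $$h_{\mathcal D}=(dZ_A-\Theta_{AB}dX^B)\odot dX^A,$$ $$\Theta_{AB}=\Gamma_{AB}^CZ_C+\Gamma_{AB}^k+(\Gamma_{kk}^CZ_C+\Gamma_{kk}^k)Z_AZ_B-2(\Gamma_{Ak}^CZ_C+\Gamma_{Ak}^k)Z_B .$$ -/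

import Mathlib

open Bundle Set Filter
open scoped Manifold ContDiff Topology

namespace ParaCProjective

/-! ### Smooth fields on manifolds (possibly with boundary) -/

section Fields

variable {E : Type*} [NormedAddCommGroup E] [NormedSpace ℝ E]
  {H : Type*} [TopologicalSpace H] (I : ModelWithCorners ℝ E H)
  {M : Type*} [TopologicalSpace M] [ChartedSpace H M] [IsManifold I ∞ M]

/-- `X` is a smooth vector field. -/
def IsSmoothVectorField (X : ∀ p : M, TangentSpace I p) : Prop :=
  ContMDiff I (I.prod 𝓘(ℝ, E)) ∞ (fun p => TotalSpace.mk' E p (X p))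

/-- `α` is a smooth one-form. -/
def IsSmoothOneForm (α : ∀ p : M, TangentSpace I p →L[ℝ] ℝ) : Prop :=
  ContMDiff I (I.prod 𝓘(ℝ, E →L[ℝ] ℝ)) ∞ (fun p => TotalSpace.mk' (E →L[ℝ] ℝ) p (α p))

/-- `J` is a smooth field of endomorphisms of the tangent spaces. -/
def IsSmoothEndomorphism (J : ∀ p : M, TangentSpace I p →L[ℝ] TangentSpace I p) : Prop :=
  ContMDiff I (I.prod 𝓘(ℝ, E →L[ℝ] E)) ∞ (fun p => TotalSpace.mk' (E →L[ℝ] E) p (J p))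

/-- `b` is a smooth field of bilinear forms on the tangent spaces. -/
def IsSmoothBilinearForm
    (b : ∀ p : M, TangentSpace I p →L[ℝ] TangentSpace I p →L[ℝ] ℝ) : Prop :=
  ContMDiff I (I.prod 𝓘(ℝ, E →L[ℝ] E →L[ℝ] ℝ)) ∞
    (fun p => TotalSpace.mk' (E →L[ℝ] E →L[ℝ] ℝ) p (b p))

variable (M) in
/-- Affine connections: Mathlib's covariant derivatives on the tangent bundle.
Beware of the order of arguments: `D Y p v` is `(∇_v Y)(p)`. -/
abbrev AffineConnection : Type _ :=
  CovariantDerivative I E (TangentSpace I : M → Type _)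

variable {I}

/-- The symmetric product `a ⊙ b = (a ⊗ b + b ⊗ a) / 2` of two covectors. -/
noncomputable def symProd {p : M} (a b : TangentSpace I p →L[ℝ] ℝ) :
    TangentSpace I p →L[ℝ] TangentSpace I p →L[ℝ] ℝ :=
  (1 / 2 : ℝ) • (a.smulRight b + b.smulRight a)

/-- The wedge product `a ∧ b = (a ⊗ b - b ⊗ a) / 2` of two covectors. -/
noncomputable def wedgeProd {p : M} (a b : TangentSpace I p →L[ℝ] ℝ) :
    TangentSpace I p →L[ℝ] TangentSpace I p →L[ℝ] ℝ :=
  (1 / 2 : ℝ) • (a.smulRight b - b.smulRight a)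

end Fields

/-! ### Affine connections and projective structures on an `n`-manifold -/

section Projective

variable {n : ℕ} {N : Type*} [TopologicalSpace N] [ChartedSpace (EuclideanSpace ℝ (Fin n)) N]
  [IsManifold (𝓡 n) ∞ N]

/-- Smooth torsion-free affine connections. -/
def IsSmoothTorsionFree (D : AffineConnection (𝓡 n) N) : Prop :=
  D.ContMDiffCovariantDerivative ∞ ∧ D.torsion = 0

/-- `D'_v Y = D_v Y + Υ(v) Y + Υ(Y) v` for some smooth one-form `Υ`. -/
def ProjectivelyEquivalent (D D' : AffineConnection (𝓡 n) N) : Prop :=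
  ∃ Υ : ∀ x : N, TangentSpace (𝓡 n) x →L[ℝ] ℝ, IsSmoothOneForm (𝓡 n) Υ ∧
    ∀ Y : ∀ x : N, TangentSpace (𝓡 n) x, IsSmoothVectorField (𝓡 n) Y →
      ∀ (x : N) (v : TangentSpace (𝓡 n) x),
        D' Y x v = D Y x v + Υ x v • Y x + Υ x (Y x) • v

variable (n N) in
/-- A projective structure: a projective equivalence class of torsion-free affine connections. -/
structure ProjectiveStructure where
  /-- the connections in the class -/
  connections : Set (AffineConnection (𝓡 n) N)
  isClass : ∃ D : AffineConnection (𝓡 n) N, IsSmoothTorsionFree D ∧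
    connections = {D' | IsSmoothTorsionFree D' ∧ ProjectivelyEquivalent D D'}

/-- The coordinate vector field `∂/∂xⁱ` of the chart at `x₀` (zero outside of the chart). -/
noncomputable def coordField (x₀ : N) (i : Fin n) (y : N) : TangentSpace (𝓡 n) y :=
  (trivializationAt (EuclideanSpace ℝ (Fin n)) (TangentSpace (𝓡 n)) x₀).symmL ℝ y
    (EuclideanSpace.single i (1 : ℝ))

/-- The Christoffel symbol `Γ_{ij}^k = dx^k (∇_{∂_i} ∂_j)` in the chart at `x₀`, as a function of
the coordinates `u ∈ ℝⁿ`. -/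
noncomputable def christoffel (D : AffineConnection (𝓡 n) N) (x₀ : N) (i j k : Fin n)
    (u : EuclideanSpace ℝ (Fin n)) : ℝ :=
  mvfderiv (𝓡 n) (fun y => extChartAt (𝓡 n) x₀ y k) ((extChartAt (𝓡 n) x₀).symm u)
    (D (coordField x₀ j) ((extChartAt (𝓡 n) x₀).symm u)
      (coordField x₀ i ((extChartAt (𝓡 n) x₀).symm u)))

/-- The partial derivative `∂f/∂uⁱ` on `ℝⁿ`. -/
noncomputable def partialDeriv (i : Fin n) (f : EuclideanSpace ℝ (Fin n) → ℝ)
    (u : EuclideanSpace ℝ (Fin n)) : ℝ :=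
  fderiv ℝ f u (EuclideanSpace.single i (1 : ℝ))

/-- The curvature `R_{ij}^k_l`, with `(∇_i ∇_j - ∇_j ∇_i) V^k = R_{ij}^k_l V^l`. -/
noncomputable def curvature (D : AffineConnection (𝓡 n) N) (x₀ : N) (i j k l : Fin n)
    (u : EuclideanSpace ℝ (Fin n)) : ℝ :=
  partialDeriv i (christoffel D x₀ j l k) u - partialDeriv j (christoffel D x₀ i l k) u +
    ∑ m, (christoffel D x₀ i m k u * christoffel D x₀ j l m u -
      christoffel D x₀ j m k u * christoffel D x₀ i l m u)

/-- The Ricci tensor `R_{jl} = R_{kj}^k_l` (in general not symmetric). -/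
noncomputable def ricci (D : AffineConnection (𝓡 n) N) (x₀ : N) (j l : Fin n)
    (u : EuclideanSpace ℝ (Fin n)) : ℝ :=
  ∑ k, curvature D x₀ k j k l u

/-- The projective Schouten tensor `P_{ij} = (n R_{ij} + R_{ji}) / (n² - 1)`, that is
`P_{(ij)} = R_{(ij)} / (n - 1)` and `P_{[ij]} = R_{[ij]} / (n + 1)`. -/
noncomputable def schouten (D : AffineConnection (𝓡 n) N) (x₀ : N) (i j : Fin n)
    (u : EuclideanSpace ℝ (Fin n)) : ℝ :=
  (n * ricci D x₀ i j u + ricci D x₀ j i u) / ((n : ℝ) ^ 2 - 1)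

end Projective

/-! ### The cotangent bundle, its metric and two-form, and its ray projectivization -/

section Cotangent

variable (n : ℕ) (N : Type*) [TopologicalSpace N] [ChartedSpace (EuclideanSpace ℝ (Fin n)) N]
  [IsManifold (𝓡 n) ∞ N]

/-- The total space of the cotangent bundle, with the smooth structure of Mathlib. -/
abbrev CotangentBundle : Type _ :=
  TotalSpace (EuclideanSpace ℝ (Fin n) →L[ℝ] ℝ)
    (fun x : N => TangentSpace (𝓡 n) x →L[ℝ] ℝ)

/-- The model with corners of the cotangent bundle. -/
noncomputable abbrev cotangentModel := (𝓡 n).prod 𝓘(ℝ, EuclideanSpace ℝ (Fin n) →L[ℝ] ℝ)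

variable {n N}

/-- The coordinate `xⁱ` on the cotangent bundle, for the chart of `N` at `x₀`. -/
noncomputable def position (x₀ : N) (i : Fin n) (p : CotangentBundle n N) : ℝ :=
  extChartAt (𝓡 n) x₀ p.proj i

/-- The fibre coordinate `ξ_i` on the cotangent bundle, for the chart of `N` at `x₀`. -/
noncomputable def momentum (x₀ : N) (i : Fin n) (p : CotangentBundle n N) : ℝ :=
  p.2 (coordField x₀ i p.proj)

/-- The covector `dxⁱ` at a point of the cotangent bundle. -/
noncomputable def dPosition (x₀ : N) (i : Fin n) (p : CotangentBundle n N) :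
    TangentSpace (cotangentModel n) p →L[ℝ] ℝ :=
  mvfderiv (cotangentModel n) (position x₀ i) p

/-- The covector `dξ_i` at a point of the cotangent bundle. -/
noncomputable def dMomentum (x₀ : N) (i : Fin n) (p : CotangentBundle n N) :
    TangentSpace (cotangentModel n) p →L[ℝ] ℝ :=
  mvfderiv (cotangentModel n) (momentum x₀ i) p

/-- `(dξ_j - (Γ_{ij}^k ξ_k - ξ_i ξ_j - P_{(ij)}) dxⁱ) ⊙ dx^j`, in the coordinates of the chart
of `N` at `x₀`. -/
noncomputable def neutralMetricIn (D : AffineConnection (𝓡 n) N) (x₀ : N)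
    (p : CotangentBundle n N) :
    TangentSpace (cotangentModel n) p →L[ℝ] TangentSpace (cotangentModel n) p →L[ℝ] ℝ :=
  let u := extChartAt (𝓡 n) x₀ p.proj
  ∑ j, symProd
    (dMomentum x₀ j p - ∑ i, (∑ k, christoffel D x₀ i j k u * momentum x₀ k p
        - momentum x₀ i p * momentum x₀ j p
        - (schouten D x₀ i j u + schouten D x₀ j i u) / 2) • dPosition x₀ i p)
    (dPosition x₀ j p)

/-- `dξ_i ∧ dxⁱ + P_{[ij]} dxⁱ ∧ dx^j`, in the coordinates of the chart of `N` at `x₀`. -/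
noncomputable def neutralFormIn (D : AffineConnection (𝓡 n) N) (x₀ : N)
    (p : CotangentBundle n N) :
    TangentSpace (cotangentModel n) p →L[ℝ] TangentSpace (cotangentModel n) p →L[ℝ] ℝ :=
  let u := extChartAt (𝓡 n) x₀ p.proj
  ∑ i, wedgeProd (dMomentum x₀ i p) (dPosition x₀ i p) +
    ∑ i, ∑ j, ((schouten D x₀ i j u - schouten D x₀ j i u) / 2) •
      wedgeProd (dPosition x₀ i p) (dPosition x₀ j p)

/-- The metric `g` of a torsion-free connection. The coordinate expression does not depend on the
chart; at each point the preferred chart at its projection is used. -/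
noncomputable def neutralMetric (D : AffineConnection (𝓡 n) N) (p : CotangentBundle n N) :
    TangentSpace (cotangentModel n) p →L[ℝ] TangentSpace (cotangentModel n) p →L[ℝ] ℝ :=
  neutralMetricIn D p.proj p

/-- The two-form `Ω` of a torsion-free connection. -/
noncomputable def neutralForm (D : AffineConnection (𝓡 n) N) (p : CotangentBundle n N) :
    TangentSpace (cotangentModel n) p →L[ℝ] TangentSpace (cotangentModel n) p →L[ℝ] ℝ :=
  neutralFormIn D p.proj p

variable (n N) in
/-- The nonzero covectors of `N`. -/
abbrev NonzeroCovector : Type _ := {p : CotangentBundle n N // p.2 ≠ 0}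

variable (n N) in
/-- Two nonzero covectors are equivalent if one is a positive multiple of the other. -/
def raySetoid : Setoid (NonzeroCovector n N) where
  r p q := ∃ c : ℝ, 0 < c ∧ q.1 = ⟨p.1.proj, c • p.1.2⟩
  iseqv :=
    { refl := fun p => ⟨1, one_pos, by simp⟩
      symm := by
        rintro ⟨⟨x, ξ⟩, hp⟩ ⟨q, hq⟩ ⟨c, hc, rfl⟩
        exact ⟨c⁻¹, inv_pos.2 hc, by simp [smul_smul, inv_mul_cancel₀ hc.ne']⟩
      trans := by
        rintro ⟨⟨x, ξ⟩, hp⟩ ⟨q, hq⟩ ⟨r, hr⟩ ⟨c, hc, rfl⟩ ⟨d, hd, rfl⟩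
        exact ⟨d * c, mul_pos hd hc, by simp [smul_smul]⟩ }

variable (n N) in
/-- The fibrewise ray projectivization `ℙ₊(T*N) = (T*N ∖ 0) / ℝ₊`, with the quotient topology. -/
def RayCotangent : Type _ := Quotient (raySetoid n N)

instance : TopologicalSpace (RayCotangent n N) :=
  inferInstanceAs (TopologicalSpace (Quotient (raySetoid n N)))

/-- The ray of a nonzero covector. -/
def rayOf (p : CotangentBundle n N) (hp : p.2 ≠ 0) : RayCotangent n N :=
  Quotient.mk (raySetoid n N) ⟨p, hp⟩

end Cotangent

/-! ### Para-Hermitian structures and para-c-projective compactifications -/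

section Compactification

variable {E : Type*} [NormedAddCommGroup E] [NormedSpace ℝ E]
  {H : Type*} [TopologicalSpace H] (I : ModelWithCorners ℝ E H)
  {M : Type*} [TopologicalSpace M] [ChartedSpace H M] [IsManifold I ∞ M]
  {E' : Type*} [NormedAddCommGroup E'] [NormedSpace ℝ E']
  {H' : Type*} [TopologicalSpace H'] (I' : ModelWithCorners ℝ E' H')
  {M' : Type*} [TopologicalSpace M'] [ChartedSpace H' M'] [IsManifold I' ∞ M']

/-- `(g, J)` is an (almost) para-Hermitian structure: `g` is a pseudo-Riemannian metric, `J² = 1`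
and `g(JX, JY) = -g(X, Y)`. (The eigenspaces of `J` for `1` and `-1` are then totally null, hence
have the same dimension, and `g` has neutral signature.) -/
structure IsParaHermitian (g : ∀ p : M, TangentSpace I p →L[ℝ] TangentSpace I p →L[ℝ] ℝ)
    (J : ∀ p : M, TangentSpace I p →L[ℝ] TangentSpace I p) : Prop where
  smooth_metric : IsSmoothBilinearForm I g
  smooth_J : IsSmoothEndomorphism I J
  symm : ∀ (p : M) (v w : TangentSpace I p), g p v w = g p w v
  nondegenerate : ∀ (p : M) (v : TangentSpace I p), (∀ w, g p v w = 0) → v = 0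
  sq : ∀ (p : M) (v : TangentSpace I p), J p (J p v) = v
  compatible : ∀ (p : M) (v w : TangentSpace I p), g p (J p v) (J p w) = -g p v w

/-- The Nijenhuis tensor `[X, Y] + [JX, JY] - J[JX, Y] - J[X, JY]` of `J` with `J² = 1`. -/
noncomputable def nijenhuis (J : ∀ p : M, TangentSpace I p →L[ℝ] TangentSpace I p)
    (X Y : ∀ p : M, TangentSpace I p) (p : M) : TangentSpace I p :=
  VectorField.mlieBracket I X Y p
    + VectorField.mlieBracket I (fun q => J q (X q)) (fun q => J q (Y q)) p
    - J p (VectorField.mlieBracket I (fun q => J q (X q)) Y p)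
    - J p (VectorField.mlieBracket I X (fun q => J q (Y q)) p)

/-- `D` preserves `g` and `J` and has minimal torsion, i.e. its torsion is a constant multiple of
the Nijenhuis tensor of `J`. -/
structure IsAdmissibleConnection
    (g : ∀ p : M, TangentSpace I p →L[ℝ] TangentSpace I p →L[ℝ] ℝ)
    (J : ∀ p : M, TangentSpace I p →L[ℝ] TangentSpace I p)
    (D : AffineConnection I M) : Prop where
  smooth : D.ContMDiffCovariantDerivative ∞
  metric : ∀ X Y : ∀ p : M, TangentSpace I p,
    IsSmoothVectorField I X → IsSmoothVectorField I Y → ∀ (p : M) (v : TangentSpace I p),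
      mvfderiv I (fun q => g q (X q) (Y q)) p v = g p (D X p v) (Y p) + g p (X p) (D Y p v)
  parallel : ∀ X : ∀ p : M, TangentSpace I p, IsSmoothVectorField I X →
    ∀ (p : M) (v : TangentSpace I p), D (fun q => J q (X q)) p v = J p (D X p v)
  minimal : ∃ c : ℝ, ∀ X Y : ∀ p : M, TangentSpace I p,
    IsSmoothVectorField I X → IsSmoothVectorField I Y → ∀ p : M,
      D Y p (X p) - D X p (Y p) - VectorField.mlieBracket I X Y p = c • nijenhuis I J X Y p

/-- `ι` is a diffeomorphism of `M` onto the interior of the manifold with boundary `M'`. -/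
structure IsInteriorInclusion (ι : M → M') : Prop where
  isLocalDiffeomorph : IsLocalDiffeomorph I I' ∞ ι
  injective : Function.Injective ι
  range_eq : range ι = I'.interior M'

/-- `T` is a smooth function whose zero set is the boundary, with `dT ≠ 0` along the boundary. -/
structure IsBoundaryDefining (T : M' → ℝ) : Prop where
  smooth : ContMDiff I' 𝓘(ℝ, ℝ) ∞ T
  zero_iff : ∀ P : M', T P = 0 ↔ P ∈ I'.boundary M'
  deriv_ne_zero : ∀ P ∈ I'.boundary M', mvfderiv I' T P ≠ 0

/-- The para-c-projective change of connection
`∇_v Y + Υ(v) Y + Υ(Jv) JY + Υ(Y) v + Υ(JY) Jv`. -/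
noncomputable def paraCChange (J : ∀ p : M, TangentSpace I p →L[ℝ] TangentSpace I p)
    (D : AffineConnection I M) (Υ : ∀ p : M, TangentSpace I p →L[ℝ] ℝ)
    (Y : ∀ p : M, TangentSpace I p) (p : M) (v : TangentSpace I p) : TangentSpace I p :=
  D Y p v + Υ p v • Y p + Υ p (J p v) • J p (Y p) + Υ p (Y p) • v + Υ p (J p (Y p)) • J p v

/-- The manifold with boundary `M'`, with interior `ι : M → M'` and boundary defining function `T`,
is a para-c-projective compactification of `(M, g, J)`: for the connection `D` which preserves `g`
and `J` and has minimal torsion, the connection obtained from `D` by the para-c-projective change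
with `Υ = dT / (2T)` extends to a smooth affine connection on `M'`. -/
structure IsParaCProjectiveCompactification
    (g : ∀ p : M, TangentSpace I p →L[ℝ] TangentSpace I p →L[ℝ] ℝ)
    (J : ∀ p : M, TangentSpace I p →L[ℝ] TangentSpace I p) (ι : M → M') (T : M' → ℝ) : Prop where
  paraHermitian : IsParaHermitian I g J
  interior : IsInteriorInclusion I I' ι
  defining : IsBoundaryDefining I' T
  extends_connection : ∃ D : AffineConnection I M, IsAdmissibleConnection I g J D ∧
    ∃ D' : AffineConnection I' M', D'.ContMDiffCovariantDerivative ∞ ∧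
      ∀ Y : ∀ P : M', TangentSpace I' P, IsSmoothVectorField I' Y →
        ∀ (p : M) (v : TangentSpace I p),
          D' Y (ι p) (mfderiv I I' ι p v) =
            mfderiv I I' ι p (paraCChange I J D
              (fun q => (2 * T (ι q))⁻¹ • mvfderiv I (fun q' => T (ι q')) q)
              (VectorField.mpullback I I' ι Y) p v)

/-- `J'` is a smooth extension of `J` to `M'`. -/
structure IsExtensionOfJ (J : ∀ p : M, TangentSpace I p →L[ℝ] TangentSpace I p) (ι : M → M')
    (J' : ∀ P : M', TangentSpace I' P →L[ℝ] TangentSpace I' P) : Prop where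
  smooth : IsSmoothEndomorphism I' J'
  eq_interior : ∀ (p : M) (v : TangentSpace I p),
    J' (ι p) (mfderiv I I' ι p v) = mfderiv I I' ι p (J p v)

/-- The one-form `θ = dT ∘ J'`. -/
noncomputable def thetaForm (J' : ∀ P : M', TangentSpace I' P →L[ℝ] TangentSpace I' P)
    (T : M' → ℝ) (P : M') : TangentSpace I' P →L[ℝ] ℝ :=
  (mvfderiv I' T P).comp (J' P)

/-- `h` is a smooth extension to `M'` of `T g + (dT² - θ²) / (4 T)`. -/
structure IsRescaledMetric (g : ∀ p : M, TangentSpace I p →L[ℝ] TangentSpace I p →L[ℝ] ℝ)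
    (ι : M → M') (T : M' → ℝ) (J' : ∀ P : M', TangentSpace I' P →L[ℝ] TangentSpace I' P)
    (h : ∀ P : M', TangentSpace I' P →L[ℝ] TangentSpace I' P →L[ℝ] ℝ) : Prop where
  smooth : IsSmoothBilinearForm I' h
  eq_interior : ∀ (p : M) (v w : TangentSpace I p),
    h (ι p) (mfderiv I I' ι p v) (mfderiv I I' ι p w) =
      T (ι p) * g p v w + (4 * T (ι p))⁻¹ *
        (mvfderiv I' T (ι p) (mfderiv I I' ι p v) * mvfderiv I' T (ι p) (mfderiv I I' ι p w) -
          thetaForm I' J' T (ι p) (mfderiv I I' ι p v) *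
            thetaForm I' J' T (ι p) (mfderiv I I' ι p w))

end Compactification

/-! ### Contact forms and para-CR structures -/

section Contact

variable {m : ℕ} {B : Type*} [TopologicalSpace B] [ChartedSpace (EuclideanSpace ℝ (Fin m)) B]
  [IsManifold (𝓡 m) ∞ B]

/-- The expression of the one-form `α` in the chart at `b`. -/
noncomputable def oneFormInChart (α : ∀ x : B, TangentSpace (𝓡 m) x →L[ℝ] ℝ) (b : B)
    (u : EuclideanSpace ℝ (Fin m)) : EuclideanSpace ℝ (Fin m) →L[ℝ] ℝ :=
  (α ((extChartAt (𝓡 m) b).symm u)).comp (mfderiv (𝓡 m) (𝓡 m) (extChartAt (𝓡 m) b).symm u)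

/-- The exterior derivative of a one-form at `b`: in the chart at `b`,
`dα(v, w) = v(α(w)) - w(α(v))` for constant vector fields `v`, `w`. -/
noncomputable def dOneForm (α : ∀ x : B, TangentSpace (𝓡 m) x →L[ℝ] ℝ) (b : B)
    (v w : TangentSpace (𝓡 m) b) : ℝ :=
  let A := fderiv ℝ (oneFormInChart α b) (extChartAt (𝓡 m) b b)
  let c : TangentSpace (𝓡 m) b → EuclideanSpace ℝ (Fin m) :=
    mfderiv (𝓡 m) (𝓡 m) (extChartAt (𝓡 m) b) b
  A (c v) (c w) - A (c w) (c v)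

/-- `α` is a contact form: it is nowhere zero, and `dα` is nondegenerate on `ker α`. -/
structure IsContactForm (α : ∀ x : B, TangentSpace (𝓡 m) x →L[ℝ] ℝ) : Prop where
  smooth : IsSmoothOneForm (𝓡 m) α
  ne_zero : ∀ b : B, α b ≠ 0
  nondegenerate : ∀ (b : B) (v : TangentSpace (𝓡 m) b), α b v = 0 →
    (∀ w : TangentSpace (𝓡 m) b, α b w = 0 → dOneForm α b v w = 0) → v = 0

/-- The hyperplane distribution `ker α`. -/
noncomputable abbrev contactDistribution (α : ∀ x : B, TangentSpace (𝓡 m) x →L[ℝ] ℝ) (b : B) :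
    Submodule ℝ (TangentSpace (𝓡 m) b) :=
  LinearMap.ker (α b).toLinearMap

/-- `φ` is an (almost, partially integrable) para-CR structure on the contact distribution `ker α`:
`φ² = 1`, the two eigenbundles have the same rank `r`, and the Levi form `dα` on `ker α` satisfies
`dα(φ v, φ w) = -dα(v, w)`. -/
structure IsParaCRStructure (α : ∀ x : B, TangentSpace (𝓡 m) x →L[ℝ] ℝ)
    (φ : ∀ b : B, contactDistribution α b →ₗ[ℝ] contactDistribution α b) (r : ℕ) : Prop where
  sq : ∀ (b : B) (v : contactDistribution α b), φ b (φ b v) = v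
  rank_pos : ∀ b : B, Module.finrank ℝ (Module.End.eigenspace (φ b) 1) = r
  rank_neg : ∀ b : B, Module.finrank ℝ (Module.End.eigenspace (φ b) (-1)) = r
  levi : ∀ (b : B) (v w : contactDistribution α b),
    dOneForm α b (φ b v) (φ b w) = -dOneForm α b v w

end Contact

/-! ### The explicit contact distribution and metric on it -/

section Explicit

variable {n : ℕ} {N : Type*} [TopologicalSpace N] [ChartedSpace (EuclideanSpace ℝ (Fin n)) N]
  [IsManifold (𝓡 n) ∞ N]

/-- The function `Z_i = ξ_i / ξ_k` on the nonzero covectors with `ξ_k ≠ 0`. It is homogeneous of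
degree `0`, and together with the `xⁱ` the functions `Z_A`, `A ≠ k`, are local coordinates on the
ray projectivization (on each of `ξ_k > 0` and `ξ_k < 0`). -/
noncomputable def slope (x₀ : N) (k i : Fin n) (p : CotangentBundle n N) : ℝ :=
  momentum x₀ i p / momentum x₀ k p

/-- The covector `dY + Z_A dX^A`, where `Y = x^k` and `X^A = x^A` for `A ≠ k`. -/
noncomputable def contactCovector (x₀ : N) (k : Fin n) (p : CotangentBundle n N) :
    TangentSpace (cotangentModel n) p →L[ℝ] ℝ :=
  dPosition x₀ k p + ∑ A ∈ Finset.univ.erase k, slope x₀ k A p • dPosition x₀ A p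

/-- `Γ_{ij}^C Z_C + Γ_{ij}^k`, where `C` is summed over the indices different from `k`. -/
noncomputable def slopeGamma (D : AffineConnection (𝓡 n) N) (x₀ : N) (k i j : Fin n)
    (p : CotangentBundle n N) : ℝ :=
  ∑ C ∈ Finset.univ.erase k,
      christoffel D x₀ i j C (extChartAt (𝓡 n) x₀ p.proj) * slope x₀ k C p
    + christoffel D x₀ i j k (extChartAt (𝓡 n) x₀ p.proj)

/-- `Θ_{AB} = Γ_{AB}^C Z_C + Γ_{AB}^k + (Γ_{kk}^C Z_C + Γ_{kk}^k) Z_A Z_B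
  - 2 (Γ_{Ak}^C Z_C + Γ_{Ak}^k) Z_B`. -/
noncomputable def bigTheta (D : AffineConnection (𝓡 n) N) (x₀ : N) (k A B : Fin n)
    (p : CotangentBundle n N) : ℝ :=
  slopeGamma D x₀ k A B p + slopeGamma D x₀ k k k p * slope x₀ k A p * slope x₀ k B p
    - 2 * slopeGamma D x₀ k A k p * slope x₀ k B p

/-- `h_𝒟 = (dZ_A - Θ_{AB} dX^B) ⊙ dX^A`, with `A`, `B` summed over the indices different from
`k`; written on the nonzero covectors. -/
noncomputable def boundaryMetric (D : AffineConnection (𝓡 n) N) (x₀ : N) (k : Fin n)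
    (p : CotangentBundle n N) :
    TangentSpace (cotangentModel n) p →L[ℝ] TangentSpace (cotangentModel n) p →L[ℝ] ℝ :=
  ∑ A ∈ Finset.univ.erase k, symProd
    (mvfderiv (cotangentModel n) (slope x₀ k A) p
      - ∑ B ∈ Finset.univ.erase k, bigTheta D x₀ k A B p • dPosition x₀ B p)
    (dPosition x₀ A p)

end Explicit

/-! ### The boundary as the ray projectivization of the cotangent bundle -/

section Boundary

variable {n : ℕ} {N : Type*} [TopologicalSpace N] [ChartedSpace (EuclideanSpace ℝ (Fin n)) N]
  [IsManifold (𝓡 n) ∞ N]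
  {m : ℕ} [ChartedSpace (EuclideanSpace ℝ (Fin m)) (RayCotangent n N)]
  [IsManifold (𝓡 m) ∞ (RayCotangent n N)]
  {E' : Type*} [NormedAddCommGroup E'] [NormedSpace ℝ E']
  {H' : Type*} [TopologicalSpace H'] (I' : ModelWithCorners ℝ E' H')
  {M' : Type*} [TopologicalSpace M'] [ChartedSpace H' M'] [IsManifold I' ∞ M']

variable (m) in
/-- `q` is the projection of the nonzero covectors to their rays (with arbitrary values on the zero
section), and it is a smooth submersion. This says that the smooth structure of `ℙ₊(T*N)` is the
standard one, namely the unique one for which the projection is a submersion. -/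
structure IsRayProjection (q : CotangentBundle n N → RayCotangent n N) : Prop where
  eq_rayOf : ∀ (p : CotangentBundle n N) (hp : p.2 ≠ 0), q p = rayOf p hp
  smooth : ContMDiffOn (cotangentModel n) (𝓡 m) ∞ q {p | p.2 ≠ 0}
  submersion : ∀ p : CotangentBundle n N, p.2 ≠ 0 →
    Function.Surjective (mfderiv (cotangentModel n) (𝓡 m) q p)

variable (m) in
/-- `j` is a diffeomorphism of `ℙ₊(T*N)` onto the boundary of `M'` (a smooth embedding whose image
is the boundary), and the ray of `ξ` is the limit of `ι(s ξ)` as `s → ∞`. -/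
structure IsBoundaryIdentification (ι : CotangentBundle n N → M')
    (j : RayCotangent n N → M') : Prop where
  smooth : ContMDiff (𝓡 m) I' ∞ j
  isEmbedding : Topology.IsEmbedding j
  immersion : ∀ b : RayCotangent n N, Function.Injective (mfderiv (𝓡 m) I' j b)
  range_eq : range j = I'.boundary M'
  tendsto : ∀ (p : CotangentBundle n N) (hp : p.2 ≠ 0),
    Tendsto (fun s : ℝ => ι ⟨p.proj, s • p.2⟩) atTop (𝓝 (j (rayOf p hp)))

variable (m) in
/-- The pullback of `θ = dT ∘ J'` to the boundary. As `T∂M = ker dT`, its kernel is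
`T∂M ∩ J'(T∂M)`. -/
noncomputable def boundaryForm (J' : ∀ P : M', TangentSpace I' P →L[ℝ] TangentSpace I' P)
    (T : M' → ℝ) (j : RayCotangent n N → M') (b : RayCotangent n N) :
    TangentSpace (𝓡 m) b →L[ℝ] ℝ :=
  (thetaForm I' J' T (j b)).comp (mfderiv (𝓡 m) I' j b)

variable (m) in
/-- The pullback of the tensor `h` to the boundary. -/
noncomputable def boundaryTensor
    (h : ∀ P : M', TangentSpace I' P →L[ℝ] TangentSpace I' P →L[ℝ] ℝ)
    (j : RayCotangent n N → M') (b : RayCotangent n N) (v w : TangentSpace (𝓡 m) b) : ℝ :=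
  h (j b) (mfderiv (𝓡 m) I' j b v) (mfderiv (𝓡 m) I' j b w)

end Boundary

end ParaCProjective

open ParaCProjective

universe u

namespace ParaCProjective

/-- The model space `ℝⁿ`. -/
local notation:max "𝕍" n:max => EuclideanSpace ℝ (Fin n)

/-- The model with corners of the compactification, of dimension `2n`. -/
local notation:max "𝓗" n:max => 𝓡∂ (2 * n)

/-- The model with corners of the boundary, of dimension `2n - 1`. -/
local notation:max "𝓢" n:max => 𝓡 (2 * n - 1)

set_option synthInstance.maxHeartbeats 400000

set_option maxSynthPendingDepth 3

set_option linter.unusedSectionVars false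

local instance {A B : Type*} [TopologicalSpace A] [TopologicalSpace B] [AddCommMonoid A]
    [AddCommMonoid B] [Module ℝ A] [Module ℝ B] : ZeroHomClass (A →L[ℝ] B) A B := inferInstance

local instance {A B : Type*} [TopologicalSpace A] [TopologicalSpace B] [AddCommMonoid A]
    [AddCommMonoid B] [Module ℝ A] [Module ℝ B] : AddHomClass (A →L[ℝ] B) A B := inferInstance

local instance {A B : Type*} [TopologicalSpace A] [TopologicalSpace B] [AddCommMonoid A]
    [AddCommMonoid B] [Module ℝ A] [Module ℝ B] : AddMonoidHomClass (A →L[ℝ] B) A B :=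
  inferInstance

local instance {A B : Type*} [TopologicalSpace A] [TopologicalSpace B] [AddCommMonoid A]
    [AddCommMonoid B] [Module ℝ A] [Module ℝ B] :
    MulActionSemiHomClass (A →L[ℝ] B) (id : ℝ → ℝ) A B := inferInstance

noncomputable local instance {n : ℕ} {N : Type*} [TopologicalSpace N]
    [ChartedSpace 𝕍 n N] [IsManifold (𝓡 n) ∞ N] :
    TopologicalSpace (CotangentBundle n N) := inferInstance

noncomputable local instance {n : ℕ} {N : Type*} [TopologicalSpace N]
    [ChartedSpace 𝕍 n N] [IsManifold (𝓡 n) ∞ N] :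
    ChartedSpace (ModelProd 𝕍 n (𝕍 n →L[ℝ] ℝ))
      (CotangentBundle n N) := inferInstance

section Coordinates

variable {E : Type*} [NormedAddCommGroup E] [NormedSpace ℝ E]
  {H : Type*} [TopologicalSpace H] (I : ModelWithCorners ℝ E H)
  {M : Type*} [TopologicalSpace M] [ChartedSpace H M]
  {Z : Type*} [NormedAddCommGroup Z] [NormedSpace ℝ Z] (L : E ≃L[ℝ] Z)
  {F : Type*} [NormedAddCommGroup F] [NormedSpace ℝ F]

/-- The coordinates of the preferred chart at `x₀`, with values in a space `Z` isomorphic to the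
model space. -/

noncomputable def coordMap (x₀ P : M) : Z := L (extChartAt I x₀ P)

/-- The inverse of `coordMap`. -/
noncomputable def coordInv (x₀ : M) (z : Z) : M := (extChartAt I x₀).symm (L.symm z)

/-- The range of the model with corners in `Z`. -/
def coordRange : Set Z := L.symm ⁻¹' range I

variable {I L}

lemma coordInv_coordMap {x₀ P : M} (hP : P ∈ (chartAt H x₀).source) :
    coordInv I L x₀ (coordMap I L x₀ P) = P := by
  simp [coordInv, coordMap, hP]

lemma coordMap_mem_coordRange (x₀ P : M) : coordMap I L x₀ P ∈ coordRange I L := by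
  simp [coordRange, coordMap]

lemma uniqueDiffOn_coordRange : UniqueDiffOn ℝ (coordRange I L) :=
  L.symm.uniqueDiffOn_preimage_iff.2 I.uniqueDiffOn

lemma uniqueDiffWithinAt_coordRange (x₀ P : M) :
    UniqueDiffWithinAt ℝ (coordRange I L) (coordMap I L x₀ P) :=
  uniqueDiffOn_coordRange _ (coordMap_mem_coordRange x₀ P)

lemma contMDiffAt_coordMap [IsManifold I ∞ M] {x₀ P : M} (hP : P ∈ (chartAt H x₀).source) :
    ContMDiffAt I 𝓘(ℝ, Z) ∞ (coordMap I L x₀) P :=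
  L.contDiff.contMDiff.contMDiffAt.comp P (contMDiffAt_extChartAt' hP)

lemma continuousAt_coordMap {x₀ P : M} (hP : P ∈ (chartAt H x₀).source) :
    ContinuousAt (coordMap I L x₀) P :=
  L.continuous.continuousAt.comp (continuousAt_extChartAt' (by simpa using hP))

lemma eventually_mem_source {x₀ P : M} (hP : P ∈ (chartAt H x₀).source) :
    ∀ᶠ Q in 𝓝 P, Q ∈ (chartAt H x₀).source :=
  (chartAt H x₀).open_source.mem_nhds hP

/-- The set of coordinates of the chart at `x₀`. -/
def coordTarget (I : ModelWithCorners ℝ E H) (L : E ≃L[ℝ] Z) (x₀ : M) : Set Z :=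
  L.symm ⁻¹' (extChartAt I x₀).target

lemma coordMap_coordInv {x₀ : M} {z : Z} (hz : z ∈ coordTarget I L x₀) :
    coordMap I L x₀ (coordInv I L x₀ z) = z := by
  have := (extChartAt I x₀).right_inv hz
  rw [coordInv, coordMap, this, L.apply_symm_apply]

lemma coordInv_mem_source {x₀ : M} {z : Z} (hz : z ∈ coordTarget I L x₀) :
    coordInv I L x₀ z ∈ (chartAt H x₀).source := by
  have := (extChartAt I x₀).map_target hz
  rwa [extChartAt_source] at this

lemma coordMap_mem_coordTarget {x₀ P : M} (hP : P ∈ (chartAt H x₀).source) :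
    coordMap I L x₀ P ∈ coordTarget I L x₀ := by
  simpa [coordTarget, coordMap] using (extChartAt I x₀).map_source (by simpa using hP)

lemma coordTarget_mem_nhdsWithin {x₀ P : M} (hP : P ∈ (chartAt H x₀).source) :
    coordTarget I L x₀ ∈ 𝓝[coordRange I L] (coordMap I L x₀ P) := by
  have h1 := extChartAt_target_mem_nhdsWithin' (I := I) (x := x₀) (y := P) (by simpa using hP)
  have h2 : Tendsto L.symm (𝓝[coordRange I L] (coordMap I L x₀ P))
      (𝓝[range I] (extChartAt I x₀ P)) := by
    refine tendsto_nhdsWithin_of_tendsto_nhds_of_eventually_within _ ?_ ?_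
    · have := (L.symm.continuous.tendsto (coordMap I L x₀ P)).mono_left
        (nhdsWithin_le_nhds (s := coordRange I L))
      simpa [coordMap] using this
    · exact eventually_mem_nhdsWithin
  exact h2 h1

lemma contMDiffWithinAt_coordInv [IsManifold I ∞ M] {x₀ : M} {z : Z}
    (hz : z ∈ coordTarget I L x₀) :
    ContMDiffWithinAt 𝓘(ℝ, Z) I ∞ (coordInv I L x₀) (coordRange I L) z := by
  have h1 : ContMDiffWithinAt 𝓘(ℝ, E) I ∞ (extChartAt I x₀).symm (range I) (L.symm z) :=
    contMDiffWithinAt_extChartAt_symm_range x₀ hz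
  exact h1.comp z L.symm.contDiff.contMDiff.contMDiffAt.contMDiffWithinAt (fun y hy => hy)

lemma ContMDiffAt.comp_coordInv [IsManifold I ∞ M] {f : M → F} {x₀ P : M}
    (hP : P ∈ (chartAt H x₀).source) (hf : ContMDiffAt I 𝓘(ℝ, F) ∞ f P) :
    ContDiffWithinAt ℝ ∞ (f ∘ coordInv I L x₀) (coordRange I L) (coordMap I L x₀ P) := by
  rw [← contMDiffWithinAt_iff_contDiffWithinAt]
  have h2 := contMDiffWithinAt_coordInv (I := I) (L := L) (coordMap_mem_coordTarget hP)
  refine ContMDiffAt.comp_contMDiffWithinAt _ ?_ h2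
  rwa [coordInv_coordMap hP]

lemma MDifferentiableAt.comp_coordInv [IsManifold I ∞ M] {f : M → F} {x₀ P : M}
    (hP : P ∈ (chartAt H x₀).source) (hf : MDifferentiableAt I 𝓘(ℝ, F) f P) :
    DifferentiableWithinAt ℝ (f ∘ coordInv I L x₀) (coordRange I L) (coordMap I L x₀ P) := by
  rw [← mdifferentiableWithinAt_iff_differentiableWithinAt]
  have h2 := (contMDiffWithinAt_coordInv (I := I) (L := L)
    (coordMap_mem_coordTarget hP)).mdifferentiableWithinAt (by simp)
  refine MDifferentiableAt.comp_mdifferentiableWithinAt _ ?_ h2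
  rwa [coordInv_coordMap hP]

lemma contMDiffAt_of_comp_coordMap [IsManifold I ∞ M] {f : M → F} {g : Z → F} {x₀ P : M}
    (hP : P ∈ (chartAt H x₀).source) (hg : ContDiffWithinAt ℝ ∞ g (coordRange I L)
      (coordMap I L x₀ P))
    (hfg : ∀ᶠ Q in 𝓝 P, f Q = g (coordMap I L x₀ Q)) : ContMDiffAt I 𝓘(ℝ, F) ∞ f P := by
  have h1 : ContMDiffAt I 𝓘(ℝ, F) ∞ (g ∘ coordMap I L x₀) P := by
    rw [← contMDiffWithinAt_univ]
    exact (contMDiffWithinAt_iff_contDiffWithinAt.2 hg).comp P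
      (contMDiffAt_coordMap hP).contMDiffWithinAt (fun Q _ => coordMap_mem_coordRange x₀ Q)
  exact h1.congr_of_eventuallyEq hfg

variable [IsManifold I ∞ M]

variable (I L) in
/-- The derivative of `coordMap`, in terms of the trivialization of the tangent bundle. -/
noncomputable def coordDeriv (x₀ P : M) : TangentSpace I P →L[ℝ] Z :=
  (L : E →L[ℝ] Z) ∘L (trivializationAt E (TangentSpace I) x₀).continuousLinearMapAt ℝ P

variable (I L) in
/-- The inverse of `coordDeriv`. -/
noncomputable def coordLift (x₀ P : M) : Z →L[ℝ] TangentSpace I P :=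
  (trivializationAt E (TangentSpace I) x₀).symmL ℝ P ∘L (L.symm : Z →L[ℝ] E)

lemma coordDeriv_coordLift {x₀ P : M} (hP : P ∈ (chartAt H x₀).source) (z : Z) :
    coordDeriv I L x₀ P (coordLift I L x₀ P z) = z := by
  have := (trivializationAt E (TangentSpace I) x₀).continuousLinearMapAt_symmL (R := ℝ) (b := P)
    (by simpa using hP) (L.symm z)
  simp only [coordDeriv, coordLift, ContinuousLinearMap.comp_apply, ContinuousLinearEquiv.coe_coe]
  rw [this, L.apply_symm_apply]

lemma coordLift_coordDeriv {x₀ P : M} (hP : P ∈ (chartAt H x₀).source) (v : TangentSpace I P) :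
    coordLift I L x₀ P (coordDeriv I L x₀ P v) = v := by
  simp only [coordDeriv, coordLift, ContinuousLinearMap.comp_apply, ContinuousLinearEquiv.coe_coe,
    L.symm_apply_apply]
  exact (trivializationAt E (TangentSpace I) x₀).symmL_continuousLinearMapAt (R := ℝ) (b := P)
    (by simpa using hP) v

lemma mfderiv_coordMap {x₀ P : M} (hP : P ∈ (chartAt H x₀).source) :
    mfderiv I 𝓘(ℝ, Z) (coordMap I L x₀) P = coordDeriv I L x₀ P := by
  have h1 : MDifferentiableAt I 𝓘(ℝ, E) (extChartAt I x₀) P := mdifferentiableAt_extChartAt hP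
  have h2 : MDifferentiableAt 𝓘(ℝ, E) 𝓘(ℝ, Z) L (extChartAt I x₀ P) :=
    L.differentiableAt.mdifferentiableAt
  have h3 := mfderiv_comp P h2 h1
  change mfderiv I 𝓘(ℝ, Z) (L ∘ extChartAt I x₀) P = _
  rw [h3, coordDeriv, TangentBundle.continuousLinearMapAt_trivializationAt hP, mfderiv_eq_fderiv]
  congr 1
  exact L.fderiv

lemma mfderiv_eq_fderivWithin_comp {f : M → F} {x₀ P : M} (hP : P ∈ (chartAt H x₀).source)
    (hf : MDifferentiableAt I 𝓘(ℝ, F) f P) (v : TangentSpace I P) :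
    mvfderiv I f P v = fderivWithin ℝ (f ∘ coordInv I L x₀) (coordRange I L)
      (coordMap I L x₀ P) (coordDeriv I L x₀ P v) := by
  have h1 : f =ᶠ[𝓝 P] (f ∘ coordInv I L x₀) ∘ coordMap I L x₀ := by
    filter_upwards [eventually_mem_source hP] with Q hQ
    simp [coordInv_coordMap hQ]
  have h2 := (MDifferentiableAt.comp_coordInv (L := L) hP hf).hasFDerivWithinAt
  have h3 : HasMFDerivAt I 𝓘(ℝ, Z) (coordMap I L x₀) P (coordDeriv I L x₀ P) := by
    rw [← mfderiv_coordMap hP]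
    exact ((contMDiffAt_coordMap hP).mdifferentiableAt (by simp)).hasMFDerivAt
  have h4 : HasMFDerivAt I 𝓘(ℝ, F) f P ((fderivWithin ℝ (f ∘ coordInv I L x₀) (coordRange I L)
      (coordMap I L x₀ P)).comp (coordDeriv I L x₀ P)) := by
    refine HasMFDerivAt.congr_of_eventuallyEq ?_ h1
    exact hasMFDerivWithinAt_univ.1 (h2.hasMFDerivWithinAt.comp P h3.hasMFDerivWithinAt
      (fun Q _ => coordMap_mem_coordRange x₀ Q))
  have h5 := h4.mfderiv
  unfold mvfderiv
  rw [h5]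
  rfl

section Sections

variable {P : M}

lemma contMDiffAt_vectorField_iff {x₀ : M} (hP : P ∈ (chartAt H x₀).source)
    (X : ∀ p : M, TangentSpace I p) :
    ContMDiffAt I (I.prod 𝓘(ℝ, E)) ∞ (fun p => TotalSpace.mk' E p (X p)) P ↔
      ContMDiffAt I 𝓘(ℝ, Z) ∞ (fun p => coordDeriv I L x₀ p (X p)) P := by
  rw [(trivializationAt E (TangentSpace I) x₀).contMDiffAt_section_iff (by simpa using hP)]
  have h1 : (fun p => coordDeriv I L x₀ p (X p)) =ᶠ[𝓝 P]
      L ∘ (fun p => (trivializationAt E (TangentSpace I) x₀ ⟨p, X p⟩).2) := by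
    filter_upwards [eventually_mem_source hP] with Q hQ
    simp only [coordDeriv, ContinuousLinearMap.comp_apply, ContinuousLinearEquiv.coe_coe,
      Function.comp]
    rw [Trivialization.continuousLinearMapAt_apply, Trivialization.coe_linearMapAt_of_mem]
    simpa using hQ
  rw [h1.contMDiffAt_iff]
  constructor
  · intro h
    exact L.contDiff.contMDiff.contMDiffAt.comp P h
  · intro h
    have := L.symm.contDiff.contMDiff.contMDiffAt.comp P h
    refine this.congr_of_eventuallyEq (Eventually.of_forall fun Q => ?_)
    simp

lemma mdifferentiableAt_vectorField_iff {x₀ : M} (hP : P ∈ (chartAt H x₀).source)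
    (X : ∀ p : M, TangentSpace I p) :
    MDifferentiableAt I (I.prod 𝓘(ℝ, E)) (fun p => TotalSpace.mk' E p (X p)) P ↔
      MDifferentiableAt I 𝓘(ℝ, Z) (fun p => coordDeriv I L x₀ p (X p)) P := by
  rw [(trivializationAt E (TangentSpace I) x₀).mdifferentiableAt_section_iff I _ (by simpa using hP)]
  have h1 : (fun p => coordDeriv I L x₀ p (X p)) =ᶠ[𝓝 P]
      L ∘ (fun p => (trivializationAt E (TangentSpace I) x₀ ⟨p, X p⟩).2) := by
    filter_upwards [eventually_mem_source hP] with Q hQ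
    simp only [coordDeriv, ContinuousLinearMap.comp_apply, ContinuousLinearEquiv.coe_coe,
      Function.comp]
    rw [Trivialization.continuousLinearMapAt_apply, Trivialization.coe_linearMapAt_of_mem]
    simpa using hQ
  rw [h1.mdifferentiableAt_iff]
  constructor
  · intro h
    exact (L.contDiff.contMDiff (n := 1)).mdifferentiable (by simp) _ |>.comp P h
  · intro h
    have := ((L.symm.contDiff.contMDiff (n := 1)).mdifferentiable (by simp) _).comp P h
    refine this.congr_of_eventuallyEq (Eventually.of_forall fun Q => ?_)
    simp

lemma contMDiffAt_oneForm_iff {x₀ : M} (hP : P ∈ (chartAt H x₀).source)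
    (α : ∀ p : M, TangentSpace I p →L[ℝ] ℝ) :
    ContMDiffAt I (I.prod 𝓘(ℝ, E →L[ℝ] ℝ)) ∞ (fun p => TotalSpace.mk' (E →L[ℝ] ℝ) p (α p)) P ↔
      ContMDiffAt I 𝓘(ℝ, Z →L[ℝ] ℝ) ∞ (fun p => (α p) ∘L coordLift I L x₀ p) P := by
  rw [(trivializationAt (E →L[ℝ] ℝ) (fun p : M => TangentSpace I p →L[ℝ] ℝ)
    x₀).contMDiffAt_section_iff (by simpa using hP)]
  have h1 : (fun p => (α p) ∘L coordLift I L x₀ p) =ᶠ[𝓝 P]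
      (fun A : E →L[ℝ] ℝ => A ∘L (L.symm : Z →L[ℝ] E)) ∘ (fun p => (trivializationAt (E →L[ℝ] ℝ)
        (fun p : M => TangentSpace I p →L[ℝ] ℝ) x₀ ⟨p, α p⟩).2) := by
    filter_upwards [eventually_mem_source hP] with Q hQ
    rw [Function.comp_apply, hom_trivializationAt, Trivialization.continuousLinearMap_apply]
    ext z
    simp [coordLift]
  rw [h1.contMDiffAt_iff]
  have s1 : ContDiff ℝ ∞ (fun A : E →L[ℝ] ℝ => A ∘L (L.symm : Z →L[ℝ] E)) :=
    contDiff_id.clm_comp contDiff_const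
  have s2 : ContDiff ℝ ∞ (fun A : Z →L[ℝ] ℝ => A ∘L (L : E →L[ℝ] Z)) :=
    contDiff_id.clm_comp contDiff_const
  constructor
  · intro h
    exact s1.contMDiff.contMDiffAt.comp P h
  · intro h
    have := s2.contMDiff.contMDiffAt.comp P h
    refine this.congr_of_eventuallyEq (Eventually.of_forall fun Q => ?_)
    ext z
    simp

lemma contMDiffAt_endomorphism_iff {x₀ : M} (hP : P ∈ (chartAt H x₀).source)
    (A : ∀ p : M, TangentSpace I p →L[ℝ] TangentSpace I p) :
    ContMDiffAt I (I.prod 𝓘(ℝ, E →L[ℝ] E)) ∞ (fun p => TotalSpace.mk' (E →L[ℝ] E) p (A p)) P ↔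
      ContMDiffAt I 𝓘(ℝ, Z →L[ℝ] Z) ∞
        (fun p => coordDeriv I L x₀ p ∘L A p ∘L coordLift I L x₀ p) P := by
  rw [(trivializationAt (E →L[ℝ] E) (fun p : M => TangentSpace I p →L[ℝ] TangentSpace I p)
    x₀).contMDiffAt_section_iff (by simpa using hP)]
  have h1 : (fun p => coordDeriv I L x₀ p ∘L A p ∘L coordLift I L x₀ p) =ᶠ[𝓝 P]
      (fun A : E →L[ℝ] E => (L : E →L[ℝ] Z) ∘L A ∘L (L.symm : Z →L[ℝ] E)) ∘
      (fun p => (trivializationAt (E →L[ℝ] E)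
        (fun p : M => TangentSpace I p →L[ℝ] TangentSpace I p) x₀ ⟨p, A p⟩).2) := by
    filter_upwards [eventually_mem_source hP] with Q hQ
    rw [Function.comp_apply, hom_trivializationAt, Trivialization.continuousLinearMap_apply]
    rfl
  rw [h1.contMDiffAt_iff]
  have s1 : ContDiff ℝ ∞ (fun A : E →L[ℝ] E => (L : E →L[ℝ] Z) ∘L A ∘L (L.symm : Z →L[ℝ] E)) :=
    contDiff_const.clm_comp (contDiff_id.clm_comp contDiff_const)
  have s2 : ContDiff ℝ ∞ (fun A : Z →L[ℝ] Z => (L.symm : Z →L[ℝ] E) ∘L A ∘L (L : E →L[ℝ] Z)) :=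
    contDiff_const.clm_comp (contDiff_id.clm_comp contDiff_const)
  constructor
  · intro h
    exact s1.contMDiff.contMDiffAt.comp P h
  · intro h
    have := s2.contMDiff.contMDiffAt.comp P h
    refine this.congr_of_eventuallyEq (Eventually.of_forall fun Q => ?_)
    ext z
    simp

/-- The pullback of a bilinear form by a linear map. -/
noncomputable def pullBilinear {V V' : Type*} [AddCommGroup V] [Module ℝ V] [TopologicalSpace V]
    [AddCommGroup V'] [Module ℝ V'] [TopologicalSpace V'] (b : V →L[ℝ] V →L[ℝ] ℝ)
    (A : V' →L[ℝ] V) : V' →L[ℝ] V' →L[ℝ] ℝ :=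
  ContinuousLinearMap.precomp ℝ A ∘L b ∘L A

@[simp]
lemma pullBilinear_apply {V V' : Type*} [AddCommGroup V] [Module ℝ V] [TopologicalSpace V]
    [AddCommGroup V'] [Module ℝ V'] [TopologicalSpace V'] (b : V →L[ℝ] V →L[ℝ] ℝ)
    (A : V' →L[ℝ] V) (v w : V') : pullBilinear b A v w = b (A v) (A w) := rfl

lemma ContDiff.pullBilinear {V V' : Type*} [NormedAddCommGroup V] [NormedSpace ℝ V]
    [NormedAddCommGroup V'] [NormedSpace ℝ V'] (A : V' →L[ℝ] V) :
    ContDiff ℝ ∞ (fun b : V →L[ℝ] V →L[ℝ] ℝ => pullBilinear b A) :=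
  contDiff_const.clm_comp (contDiff_id.clm_comp contDiff_const)

set_option maxHeartbeats 1000000 in
lemma contMDiffAt_bilinearForm_iff {x₀ : M} (hP : P ∈ (chartAt H x₀).source)
    (b : ∀ p : M, TangentSpace I p →L[ℝ] TangentSpace I p →L[ℝ] ℝ) :
    ContMDiffAt I (I.prod 𝓘(ℝ, E →L[ℝ] E →L[ℝ] ℝ)) ∞
        (fun p => TotalSpace.mk' (E →L[ℝ] E →L[ℝ] ℝ) p (b p)) P ↔
      ContMDiffAt I 𝓘(ℝ, Z →L[ℝ] Z →L[ℝ] ℝ) ∞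
        (fun p => pullBilinear (b p) (coordLift I L x₀ p)) P := by
  rw [(trivializationAt (E →L[ℝ] E →L[ℝ] ℝ)
    (fun p : M => TangentSpace I p →L[ℝ] TangentSpace I p →L[ℝ] ℝ)
    x₀).contMDiffAt_section_iff (by simpa using hP)]
  have h1 : (fun p => pullBilinear (b p) (coordLift I L x₀ p)) =ᶠ[𝓝 P]
      (fun A : E →L[ℝ] E →L[ℝ] ℝ => pullBilinear A (L.symm : Z →L[ℝ] E)) ∘
      (fun p => (trivializationAt (E →L[ℝ] E →L[ℝ] ℝ)
        (fun p : M => TangentSpace I p →L[ℝ] TangentSpace I p →L[ℝ] ℝ) x₀ ⟨p, b p⟩).2) := by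
    filter_upwards [eventually_mem_source hP] with Q hQ
    rw [Function.comp_apply, hom_trivializationAt, Trivialization.continuousLinearMap_apply]
    ext v w
    have hQ' : Q ∈ (trivializationAt (E →L[ℝ] ℝ)
      (fun p : M => TangentSpace I p →L[ℝ] ℝ) x₀).baseSet := by simpa using hQ
    simp only [pullBilinear_apply, ContinuousLinearMap.comp_apply,
      ContinuousLinearEquiv.coe_coe]
    rw [Trivialization.continuousLinearMapAt_apply, Trivialization.coe_linearMapAt_of_mem _ hQ',
      hom_trivializationAt]
    beta_reduce
    rw [Trivialization.continuousLinearMap_apply]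
    simp [coordLift]
  rw [h1.contMDiffAt_iff]
  constructor
  · intro h
    exact (ContDiff.pullBilinear (L.symm : Z →L[ℝ] E)).contMDiff.contMDiffAt.comp P h
  · intro h
    have := (ContDiff.pullBilinear (L : E →L[ℝ] Z)).contMDiff.contMDiffAt.comp P h
    refine this.congr_of_eventuallyEq (Eventually.of_forall fun Q => ?_)
    ext v w
    simp

end Sections

section Maps

variable {E' : Type*} [NormedAddCommGroup E'] [NormedSpace ℝ E']
  {H' : Type*} [TopologicalSpace H'] {I' : ModelWithCorners ℝ E' H'}
  {M' : Type*} [TopologicalSpace M'] [ChartedSpace H' M'] [IsManifold I' ∞ M']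
  {Z' : Type*} [NormedAddCommGroup Z'] [NormedSpace ℝ Z'] {L' : E' ≃L[ℝ] Z'}

lemma coordDeriv_mfderiv {G : M → M'} {x₀ P : M} {y₀ : M'} (hP : P ∈ (chartAt H x₀).source)
    (hGP : G P ∈ (chartAt H' y₀).source) (hG : MDifferentiableAt I I' G P)
    (v : TangentSpace I P) :
    coordDeriv I' L' y₀ (G P) (mfderiv I I' G P v) =
      fderivWithin ℝ (coordMap I' L' y₀ ∘ G ∘ coordInv I L x₀) (coordRange I L)
        (coordMap I L x₀ P) (coordDeriv I L x₀ P v) := by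
  have h1 : MDifferentiableAt I' 𝓘(ℝ, Z') (coordMap I' L' y₀) (G P) :=
    (contMDiffAt_coordMap hGP).mdifferentiableAt (by simp)
  have h2 := mfderiv_eq_fderivWithin_comp (L := L) hP (h1.comp P hG) v
  have h3 := mfderiv_comp P h1 hG
  rw [mfderiv_coordMap hGP] at h3
  rw [Function.comp_assoc] at h2
  rw [← h2]
  unfold mvfderiv
  rw [h3]
  rfl

lemma coordDeriv_mfderiv_of_eventuallyEq [I.Boundaryless] {G : M → M'} {F : Z → Z'} {x₀ P : M}
    {y₀ : M'} (hP : P ∈ (chartAt H x₀).source)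
    (hGP : G P ∈ (chartAt H' y₀).source) (hG : MDifferentiableAt I I' G P)
    (hF : ∀ᶠ z in 𝓝 (coordMap I L x₀ P), coordMap I' L' y₀ (G (coordInv I L x₀ z)) = F z)
    (v : TangentSpace I P) :
    coordDeriv I' L' y₀ (G P) (mfderiv I I' G P v) =
      fderiv ℝ F (coordMap I L x₀ P) (coordDeriv I L x₀ P v) := by
  rw [coordDeriv_mfderiv (L := L) (L' := L') hP hGP hG]
  have : coordRange I L = univ := by simp [coordRange, I.range_eq_univ]
  rw [this, fderivWithin_univ]
  have h : (coordMap I' L' y₀ ∘ G ∘ coordInv I L x₀) =ᶠ[𝓝 (coordMap I L x₀ P)] F := hF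
  rw [h.fderiv_eq]

end Maps

end Coordinates

section Coordinates

variable {E : Type*} [NormedAddCommGroup E] [NormedSpace ℝ E]
  {H : Type*} [TopologicalSpace H] {I : ModelWithCorners ℝ E H}
  {M : Type*} [TopologicalSpace M] [ChartedSpace H M] [IsManifold I ∞ M]
  {Z : Type*} [NormedAddCommGroup Z] [NormedSpace ℝ Z] {L : E ≃L[ℝ] Z}

/-- The expression of a vector field in coordinates. -/
lemma coordField_coordMap {x₀ P : M} (hP : P ∈ (chartAt H x₀).source)
    (Y : ∀ p : M, TangentSpace I p) :
    ((fun p => coordDeriv I L x₀ p (Y p)) ∘ coordInv I L x₀) (coordMap I L x₀ P) =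
      coordDeriv I L x₀ P (Y P) :=
  congrArg (fun p => coordDeriv I L x₀ p (Y p)) (coordInv_coordMap hP)

section LocalConnections

variable (I L)

/-- The expression in coordinates of the covariant derivative with Christoffel symbols `Γ`. -/
noncomputable def localCov (x₀ : M) (Γ : Z →L[ℝ] Z →L[ℝ] Z) (Y : ∀ p : M, TangentSpace I p)
    (P : M) : TangentSpace I P →L[ℝ] TangentSpace I P :=
  coordLift I L x₀ P ∘L (fderivWithin ℝ ((fun p => coordDeriv I L x₀ p (Y p)) ∘ coordInv I L x₀)
    (coordRange I L) (coordMap I L x₀ P) + Γ.flip (coordDeriv I L x₀ P (Y P))) ∘L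
    coordDeriv I L x₀ P

variable {I L}

lemma localCov_add {x₀ P : M} (hP : P ∈ (chartAt H x₀).source) (Γ : Z →L[ℝ] Z →L[ℝ] Z)
    {Y Y' : ∀ p : M, TangentSpace I p}
    (hY : MDifferentiableAt I (I.prod 𝓘(ℝ, E)) (fun p => TotalSpace.mk' E p (Y p)) P)
    (hY' : MDifferentiableAt I (I.prod 𝓘(ℝ, E)) (fun p => TotalSpace.mk' E p (Y' p)) P) :
    localCov I L x₀ Γ (Y + Y') P = localCov I L x₀ Γ Y P + localCov I L x₀ Γ Y' P := by
  have h1 := MDifferentiableAt.comp_coordInv (L := L) hP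
    ((mdifferentiableAt_vectorField_iff (L := L) hP Y).1 hY)
  have h2 := MDifferentiableAt.comp_coordInv (L := L) hP
    ((mdifferentiableAt_vectorField_iff (L := L) hP Y').1 hY')
  have h3 : (fun p => coordDeriv I L x₀ p ((Y + Y') p)) ∘ coordInv I L x₀ =
      ((fun p => coordDeriv I L x₀ p (Y p)) ∘ coordInv I L x₀) +
      ((fun p => coordDeriv I L x₀ p (Y' p)) ∘ coordInv I L x₀) := by
    ext z; simp
  unfold localCov
  rw [h3, fderivWithin_add (uniqueDiffWithinAt_coordRange x₀ P) h1 h2]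
  ext v
  simp only [Pi.add_apply, map_add, ContinuousLinearMap.comp_apply, add_apply]
  abel

lemma localCov_leibniz {x₀ P : M} (hP : P ∈ (chartAt H x₀).source) (Γ : Z →L[ℝ] Z →L[ℝ] Z)
    {Y : ∀ p : M, TangentSpace I p} {g : M → ℝ}
    (hY : MDifferentiableAt I (I.prod 𝓘(ℝ, E)) (fun p => TotalSpace.mk' E p (Y p)) P)
    (hg : MDifferentiableAt I 𝓘(ℝ, ℝ) g P) :
    localCov I L x₀ Γ (g • Y) P =
      g P • localCov I L x₀ Γ Y P + (mvfderiv I g P).smulRight (Y P) := by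
  have h1 := MDifferentiableAt.comp_coordInv (L := L) hP
    ((mdifferentiableAt_vectorField_iff (L := L) hP Y).1 hY)
  have h2 := MDifferentiableAt.comp_coordInv (L := L) hP hg
  have h3 : (fun p => coordDeriv I L x₀ p ((g • Y) p)) ∘ coordInv I L x₀ =
      (g ∘ coordInv I L x₀) • ((fun p => coordDeriv I L x₀ p (Y p)) ∘ coordInv I L x₀) := by
    ext z; simp
  unfold localCov
  rw [h3, fderivWithin_smul (uniqueDiffWithinAt_coordRange x₀ P) h2 h1]
  ext v
  have h4 := mfderiv_eq_fderivWithin_comp (L := L) hP hg v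
  rw [coordField_coordMap hP]
  simp only [Function.comp_apply, coordInv_coordMap hP, ContinuousLinearMap.comp_apply,
    add_apply, smul_apply,
    ContinuousLinearMap.smulRight_apply, map_add, map_smul, Pi.smul_apply', h4,
    coordLift_coordDeriv hP, smul_add]
  abel

/-- The covariant derivative which at each point `P` is given by Christoffel symbols in the
coordinates of the preferred chart at `P`. -/

noncomputable def connectionOfChristoffel (L : M → (E ≃L[ℝ] Z))
    (Γ : M → Z → Z →L[ℝ] Z →L[ℝ] Z) : AffineConnection I M where
  toFun Y P := localCov I (L P) P (Γ P (coordMap I (L P) P P)) Y P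
  isCovariantDerivativeOnUniv :=
    { add := fun hσ hσ' _ => localCov_add (mem_chart_source H _) _ hσ hσ'
      leibniz := fun hσ hg _ => localCov_leibniz (mem_chart_source H _) _ hσ hg }

lemma contMDiffAt_localCov {x₀ P : M} (hP : P ∈ (chartAt H x₀).source)
    {Γ : Z → Z →L[ℝ] Z →L[ℝ] Z}
    (hΓ : ContDiffWithinAt ℝ ∞ Γ (coordRange I L) (coordMap I L x₀ P))
    {Y : ∀ p : M, TangentSpace I p} (hY : IsSmoothVectorField I Y) :
    ContMDiffAt I (I.prod 𝓘(ℝ, E →L[ℝ] E)) ∞ (fun p => TotalSpace.mk' (E →L[ℝ] E) p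
      (localCov I L x₀ (Γ (coordMap I L x₀ p)) Y p)) P := by
  rw [contMDiffAt_endomorphism_iff (L := L) hP]
  set Yh : Z → Z := (fun p => coordDeriv I L x₀ p (Y p)) ∘ coordInv I L x₀ with hYh
  have h1 : ContDiffWithinAt ℝ ∞ Yh (coordRange I L) (coordMap I L x₀ P) :=
    ContMDiffAt.comp_coordInv hP ((contMDiffAt_vectorField_iff hP Y).1 (hY P))
  have h2 : ContDiffWithinAt ℝ ∞ (fderivWithin ℝ Yh (coordRange I L)) (coordRange I L)
      (coordMap I L x₀ P) :=
    h1.fderivWithin_right uniqueDiffOn_coordRange (by simp) (coordMap_mem_coordRange x₀ P)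
  refine contMDiffAt_of_comp_coordMap (L := L) (g := fun z => fderivWithin ℝ Yh (coordRange I L) z +
    (Γ z).flip (Yh z)) hP ?_ ?_
  · refine h2.add (ContDiffWithinAt.clm_apply ?_ h1)
    exact (ContinuousLinearMap.flipₗᵢ ℝ Z Z Z).contDiff.comp_contDiffWithinAt hΓ
  · filter_upwards [eventually_mem_source hP] with Q hQ
    ext v
    simp only [localCov, ContinuousLinearMap.comp_apply, coordDeriv_coordLift hQ]
    rw [hYh, coordField_coordMap hQ]

section Naturality

variable {E' : Type*} [NormedAddCommGroup E'] [NormedSpace ℝ E']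
  {H' : Type*} [TopologicalSpace H'] {I' : ModelWithCorners ℝ E' H'}
  {M' : Type*} [TopologicalSpace M'] [ChartedSpace H' M'] [IsManifold I' ∞ M']
  {Z' : Type*} [NormedAddCommGroup Z'] [NormedSpace ℝ Z'] {L' : E' ≃L[ℝ] Z'}

/-- The coordinate change `F` takes the Christoffel symbols `Γ` at `z` to `Γ'` at `F z`. -/
def ChristoffelsCorrespond (F : Z → Z') (z : Z) (Γ : Z →L[ℝ] Z →L[ℝ] Z)
    (Γ' : Z' →L[ℝ] Z' →L[ℝ] Z') : Prop :=
  ∀ v w, fderiv ℝ F z (Γ v w) =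
    fderiv ℝ (fderiv ℝ F) z v w + Γ' (fderiv ℝ F z v) (fderiv ℝ F z w)

/-- Covariant derivatives with corresponding Christoffel symbols correspond under `G`. -/
lemma mfderiv_localCov [I.Boundaryless] {G : M → M'} {F : Z → Z'} {x₀ P : M} {y₀ : M'}
    (hP : P ∈ (chartAt H x₀).source) (hGP : G P ∈ (chartAt H' y₀).source)
    (hG : ContMDiffAt I I' ∞ G P)
    (hF : ∀ᶠ z in 𝓝 (coordMap I L x₀ P), coordMap I' L' y₀ (G (coordInv I L x₀ z)) = F z)
    (hF2 : ContDiffAt ℝ ∞ F (coordMap I L x₀ P))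
    {Γ : Z →L[ℝ] Z →L[ℝ] Z} {Γ' : Z' →L[ℝ] Z' →L[ℝ] Z'}
    (hΓ : ChristoffelsCorrespond F (coordMap I L x₀ P) Γ Γ')
    {Y : ∀ p : M, TangentSpace I p} {Y' : ∀ p : M', TangentSpace I' p}
    (hY : MDifferentiableAt I (I.prod 𝓘(ℝ, E)) (fun p => TotalSpace.mk' E p (Y p)) P)
    (hY' : MDifferentiableAt I' (I'.prod 𝓘(ℝ, E')) (fun p => TotalSpace.mk' E' p (Y' p)) (G P))
    (hYY' : ∀ᶠ p in 𝓝 P, mfderiv I I' G p (Y p) = Y' (G p)) (v : TangentSpace I P) :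
    localCov I' L' y₀ Γ' Y' (G P) (mfderiv I I' G P v) =
      mfderiv I I' G P (localCov I L x₀ Γ Y P v) := by
  have hr : coordRange I L = univ := by simp [coordRange, I.range_eq_univ]
  set z₀ := coordMap I L x₀ P with hz₀
  have hinv : coordInv I L x₀ z₀ = P := coordInv_coordMap hP
  have hcinv : ContinuousAt (coordInv I L x₀) z₀ := by
    have := (contMDiffWithinAt_coordInv (I := I) (L := L)
      (coordMap_mem_coordTarget hP)).continuousWithinAt
    rwa [hr, continuousWithinAt_univ] at this
  set Yh : Z → Z := (fun p => coordDeriv I L x₀ p (Y p)) ∘ coordInv I L x₀ with hYh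
  set Yh' : Z' → Z' := (fun p => coordDeriv I' L' y₀ p (Y' p)) ∘ coordInv I' L' y₀ with hYh'
  have d1 : DifferentiableAt ℝ Yh z₀ := by
    have := MDifferentiableAt.comp_coordInv (L := L) hP
      ((mdifferentiableAt_vectorField_iff (L := L) hP Y).1 hY)
    rwa [hr, differentiableWithinAt_univ] at this
  have hFz : F z₀ = coordMap I' L' y₀ (G P) := by
    rw [← hF.self_of_nhds, hinv]
  have d2 : DifferentiableWithinAt ℝ Yh' (coordRange I' L') (F z₀) := by
    rw [hFz]
    exact MDifferentiableAt.comp_coordInv (L := L') hGP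
      ((mdifferentiableAt_vectorField_iff (L := L') hGP Y').1 hY')
  have dF : DifferentiableAt ℝ F z₀ := hF2.differentiableAt (by simp)
  have dF' : DifferentiableAt ℝ (fderiv ℝ F) z₀ :=
    (hF2.fderiv_right (m := 1) (by norm_cast)).differentiableAt (by simp)
  have e1 : (fun z => fderiv ℝ F z (Yh z)) =ᶠ[𝓝 z₀] Yh' ∘ F := by
    have hPn : ∀ᶠ p in 𝓝 P, p ∈ (chartAt H x₀).source ∧ G p ∈ (chartAt H' y₀).source ∧
        mfderiv I I' G p (Y p) = Y' (G p) ∧ MDifferentiableAt I I' G p := by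
      filter_upwards [eventually_mem_source hP, hG.continuousAt (eventually_mem_source hGP), hYY',
        ((contMDiffAt_iff_contMDiffAt_nhds (by simp)).1 (hG.of_le (m := 1) (by norm_cast)))]
        with p h1 h2 h3 h4
      exact ⟨h1, h2, h3, h4.mdifferentiableAt (by simp)⟩
    have htar : ∀ᶠ z in 𝓝 z₀, z ∈ coordTarget I L x₀ := by
      have := coordTarget_mem_nhdsWithin (I := I) (L := L) hP
      rwa [hr, nhdsWithin_univ] at this
    have hPn' := hcinv.tendsto.eventually (by rw [hinv]; exact hPn)
    filter_upwards [hPn', htar, hF.eventually_nhds] with z ⟨h1, h2, h3, h4⟩ h5 h6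
    have h7 := coordDeriv_mfderiv_of_eventuallyEq (L := L) (L' := L') (F := F) h1 h2 h4
      (by rw [coordMap_coordInv h5]; exact h6) (Y (coordInv I L x₀ z))
    rw [coordMap_coordInv h5, h3] at h7
    simp only [hYh, hYh', Function.comp_apply]
    rw [← h7, ← h6.self_of_nhds, coordInv_coordMap h2]
  have e2 : fderiv ℝ (fun z => fderiv ℝ F z (Yh z)) z₀ =
      (fderivWithin ℝ Yh' (coordRange I' L') (F z₀)).comp (fderiv ℝ F z₀) := by
    rw [e1.fderiv_eq]
    refine HasFDerivAt.fderiv ?_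
    refine HasFDerivWithinAt.comp_hasFDerivAt z₀ d2.hasFDerivWithinAt dF.hasFDerivAt ?_
    filter_upwards [hF] with z hz
    rw [← hz]
    exact coordMap_mem_coordRange _ _
  have e3 : ∀ u, fderiv ℝ (fun z => fderiv ℝ F z (Yh z)) z₀ u =
      fderiv ℝ F z₀ (fderiv ℝ Yh z₀ u) + fderiv ℝ (fderiv ℝ F) z₀ u (Yh z₀) := by
    intro u
    rw [fderiv_clm_apply dF' d1]
    simp [ContinuousLinearMap.flip_apply]
  have e4 : Yh z₀ = coordDeriv I L x₀ P (Y P) := coordField_coordMap hP Y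
  have e5 := e1.self_of_nhds
  have e6 : Yh' (F z₀) = coordDeriv I' L' y₀ (G P) (Y' (G P)) := by
    rw [hFz]
    exact coordField_coordMap hGP Y'
  have hGd : MDifferentiableAt I I' G P := hG.mdifferentiableAt (by simp)
  have inj : Function.Injective (coordDeriv I' L' y₀ (G P)) :=
    Function.LeftInverse.injective (coordLift_coordDeriv hGP)
  apply inj
  rw [coordDeriv_mfderiv_of_eventuallyEq (L := L) (L' := L') (F := F) hP hGP hGd hF]
  simp only [localCov, ContinuousLinearMap.comp_apply, coordDeriv_coordLift hP,
    coordDeriv_coordLift hGP, add_apply, ContinuousLinearMap.flip_apply]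
  rw [coordDeriv_mfderiv_of_eventuallyEq (L := L) (L' := L') (F := F) hP hGP hGd hF,
    ← hz₀, map_add, hr, fderivWithin_univ, ← hYh, ← hYh', ← hFz, ← e6, ← e4, hΓ _ _, ← add_assoc,
    ← e3, e2]
  simp only [ContinuousLinearMap.comp_apply]
  rw [show fderiv ℝ F z₀ (Yh z₀) = Yh' (F z₀) from e5]

end Naturality

end LocalConnections

end Coordinates

section BilinearMaps

variable {D Z U U' G K : Type*} [NormedAddCommGroup D] [NormedSpace ℝ D]
  [NormedAddCommGroup Z] [NormedSpace ℝ Z] [NormedAddCommGroup U] [NormedSpace ℝ U]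
  [NormedAddCommGroup U'] [NormedSpace ℝ U'] [NormedAddCommGroup G] [NormedSpace ℝ G]
  [NormedAddCommGroup K] [NormedSpace ℝ K]

/-- The bilinear map `A (B (p x) (p' y))`. -/
noncomputable def bilinComp (A : G →L[ℝ] K) (B : U →L[ℝ] U' →L[ℝ] G) (p : Z →L[ℝ] U)
    (p' : Z →L[ℝ] U') : Z →L[ℝ] Z →L[ℝ] K :=
  ContinuousLinearMap.compL ℝ Z G K A ∘L (ContinuousLinearMap.compL ℝ Z U' G).flip p' ∘L B ∘L p

@[simp]
lemma bilinComp_apply (A : G →L[ℝ] K) (B : U →L[ℝ] U' →L[ℝ] G) (p : Z →L[ℝ] U)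
    (p' : Z →L[ℝ] U') (x y : Z) : bilinComp A B p p' x y = A (B (p x) (p' y)) := rfl

lemma ContDiffWithinAt.bilinComp {A : D → G →L[ℝ] K} {B : D → U →L[ℝ] U' →L[ℝ] G}
    {p : D → Z →L[ℝ] U} {p' : D → Z →L[ℝ] U'} {s : Set D} {d : D}
    (hA : ContDiffWithinAt ℝ ∞ A s d) (hB : ContDiffWithinAt ℝ ∞ B s d)
    (hp : ContDiffWithinAt ℝ ∞ p s d) (hp' : ContDiffWithinAt ℝ ∞ p' s d) :
    ContDiffWithinAt ℝ ∞ (fun d => bilinComp (A d) (B d) (p d) (p' d)) s d := by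
  unfold ParaCProjective.bilinComp
  refine ContDiffWithinAt.clm_comp ?_ (ContDiffWithinAt.clm_comp ?_ (hB.clm_comp hp))
  · exact (ContinuousLinearMap.contDiff (E := G →L[ℝ] K) (F := (Z →L[ℝ] G) →L[ℝ] Z →L[ℝ] K)
      (ContinuousLinearMap.compL ℝ Z G K)).comp_contDiffWithinAt hA
  · exact (ContinuousLinearMap.contDiff (E := Z →L[ℝ] U') (F := (U' →L[ℝ] G) →L[ℝ] Z →L[ℝ] G)
      (ContinuousLinearMap.compL ℝ Z U' G).flip).comp_contDiffWithinAt hp'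

lemma ContDiffWithinAt.clm_flip {B : D → U →L[ℝ] U' →L[ℝ] G} {s : Set D} {d : D}
    (hB : ContDiffWithinAt ℝ ∞ B s d) : ContDiffWithinAt ℝ ∞ (fun d => (B d).flip) s d := by
  have h := LinearIsometryEquiv.contDiff (E := U →L[ℝ] U' →L[ℝ] G) (F := U' →L[ℝ] U →L[ℝ] G)
    (𝕜 := ℝ) (n := ∞) (ContinuousLinearMap.flipₗᵢ ℝ U U' G)
  exact h.comp_contDiffWithinAt hB

/-- The tensor `Υ(X) X' + Υ(JX) JX' + Υ(X') X + Υ(JX') JX`. -/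
noncomputable def paraCTensor (J : Z →L[ℝ] Z) (Υ : Z →L[ℝ] ℝ) : Z →L[ℝ] Z →L[ℝ] Z :=
  (Υ.smulRight (ContinuousLinearMap.id ℝ Z) + (Υ ∘L J).smulRight J) +
    (Υ.smulRight (ContinuousLinearMap.id ℝ Z) + (Υ ∘L J).smulRight J).flip

lemma paraCTensor_apply (J : Z →L[ℝ] Z) (Υ : Z →L[ℝ] ℝ) (X X' : Z) :
    paraCTensor J Υ X X' = Υ X • X' + Υ (J X) • J X' + Υ X' • X + Υ (J X') • J X := by
  simp [paraCTensor, add_assoc]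

lemma ContDiffWithinAt.paraCTensor {J : D → Z →L[ℝ] Z} {Υ : D → Z →L[ℝ] ℝ} {s : Set D} {d : D}
    (hJ : ContDiffWithinAt ℝ ∞ J s d) (hΥ : ContDiffWithinAt ℝ ∞ Υ s d) :
    ContDiffWithinAt ℝ ∞ (fun d => paraCTensor (J d) (Υ d)) s d := by
  have h : ContDiffWithinAt ℝ ∞ (fun d => (Υ d).smulRight (ContinuousLinearMap.id ℝ Z) +
      (Υ d ∘L J d).smulRight (J d)) s d :=
    (hΥ.smulRight contDiffWithinAt_const).add ((hΥ.clm_comp hJ).smulRight hJ)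
  exact h.add h.clm_flip

end BilinearMaps

section Splitting

variable {V : Type*} [NormedAddCommGroup V] [NormedSpace ℝ V]
  {Y : Type*} [NormedAddCommGroup Y] [NormedSpace ℝ Y]
  {Y' : Type*} [NormedAddCommGroup Y'] [NormedSpace ℝ Y']

/-- The para-complex structure on `V × Y` which is `-1` on the graph of `l` and `1` on `Y`. -/
noncomputable def splitJ (l : V →L[ℝ] Y) : V × Y →L[ℝ] V × Y :=
  ContinuousLinearMap.inr ℝ V Y ∘L (ContinuousLinearMap.snd ℝ V Y -
    (2 : ℝ) • l ∘L ContinuousLinearMap.fst ℝ V Y) -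
    ContinuousLinearMap.inl ℝ V Y ∘L ContinuousLinearMap.fst ℝ V Y

@[simp]
lemma splitJ_apply (l : V →L[ℝ] Y) (X : V × Y) :
    splitJ l X = (-X.1, X.2 - (2 : ℝ) • l X.1) := by
  simp [splitJ]

/-- The Christoffel symbols of the connection which preserves the splitting of the tangent spaces
of `V × Y` into the graphs of `l` and the fibres, acts on the graphs by `C`, and has vertical

torsion. -/

noncomputable def splitChristoffel (l : V × Y → V →L[ℝ] Y) (C : V →L[ℝ] V →L[ℝ] V) (z : V × Y) :
    V × Y →L[ℝ] V × Y →L[ℝ] V × Y :=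
  bilinComp (ContinuousLinearMap.inl ℝ V Y + ContinuousLinearMap.inr ℝ V Y ∘L l z) C
      (ContinuousLinearMap.fst ℝ V Y) (ContinuousLinearMap.fst ℝ V Y)
  - bilinComp (ContinuousLinearMap.inr ℝ V Y) (fderiv ℝ l z) (ContinuousLinearMap.id ℝ (V × Y))
      (ContinuousLinearMap.fst ℝ V Y)
  - (bilinComp (ContinuousLinearMap.inr ℝ V Y) (fderiv ℝ l z) (ContinuousLinearMap.inr ℝ V Y ∘L
      (ContinuousLinearMap.snd ℝ V Y - l z ∘L ContinuousLinearMap.fst ℝ V Y))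
      (ContinuousLinearMap.fst ℝ V Y)).flip

lemma splitChristoffel_apply (l : V × Y → V →L[ℝ] Y) (C : V →L[ℝ] V →L[ℝ] V) (z X X' : V × Y) :
    splitChristoffel l C z X X' = (C X.1 X'.1, l z (C X.1 X'.1) - fderiv ℝ l z X X'.1 -
      fderiv ℝ l z (0, X'.2 - l z X'.1) X.1) := by
  simp [splitChristoffel]

lemma contDiffAt_splitJ {l : V × Y → V →L[ℝ] Y} {s : Set (V × Y)} {z : V × Y}
    (hl : ContDiffWithinAt ℝ ∞ l s z) : ContDiffWithinAt ℝ ∞ (fun z => splitJ (l z)) s z := by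
  unfold splitJ
  refine ContDiffWithinAt.sub ?_ contDiffWithinAt_const
  refine contDiffWithinAt_const.clm_comp (contDiffWithinAt_const.sub ?_)
  exact ContDiffWithinAt.const_smul (2 : ℝ) (hl.clm_comp contDiffWithinAt_const)

lemma contDiffAt_splitChristoffel {l : V × Y → V →L[ℝ] Y} {C : V × Y → V →L[ℝ] V →L[ℝ] V}
    {z : V × Y} (hl : ContDiffAt ℝ ∞ l z) (hC : ContDiffAt ℝ ∞ C z) :
    ContDiffAt ℝ ∞ (fun z => splitChristoffel l (C z) z) z := by
  have hl' : ContDiffAt ℝ ∞ (fderiv ℝ l) z := hl.fderiv_right (by simp)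
  unfold splitChristoffel
  simp only [← contDiffWithinAt_univ] at *
  refine ContDiffWithinAt.sub (ContDiffWithinAt.sub ?_ ?_) (ContDiffWithinAt.clm_flip ?_)
  · exact ContDiffWithinAt.bilinComp
      (contDiffWithinAt_const.add (contDiffWithinAt_const.clm_comp hl)) hC
      contDiffWithinAt_const contDiffWithinAt_const
  · exact ContDiffWithinAt.bilinComp contDiffWithinAt_const hl'
      contDiffWithinAt_const contDiffWithinAt_const
  · exact ContDiffWithinAt.bilinComp contDiffWithinAt_const hl'
      (contDiffWithinAt_const.clm_comp (contDiffWithinAt_const.sub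
        (hl.clm_comp contDiffWithinAt_const))) contDiffWithinAt_const

lemma paraCTensor_splitJ (l : V →L[ℝ] Y) (Υ : V × Y →L[ℝ] ℝ) (X X' : V × Y) :
    paraCTensor (splitJ l) Υ X X' =
      (2 * Υ (X.1, l X.1)) • (X'.1, l X'.1) + (2 * Υ (X'.1, l X'.1)) • (X.1, l X.1) +
      (2 * Υ (0, X.2 - l X.1)) • (0, X'.2 - l X'.1) +
      (2 * Υ (0, X'.2 - l X'.1)) • (0, X.2 - l X.1) := by
  obtain ⟨x, a⟩ := X
  obtain ⟨x', a'⟩ := X'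
  obtain ⟨p, rfl⟩ : ∃ p, a = l x + p := ⟨a - l x, by abel⟩
  obtain ⟨p', rfl⟩ : ∃ p', a' = l x' + p' := ⟨a' - l x', by abel⟩
  have e : ∀ x p, Υ (x, l x + p) = Υ (x, l x) + Υ (0, p) := by
    intro x p; rw [← map_add]; simp
  have e' : ∀ x p, Υ (-x, l x + p - (2 : ℝ) • l x) = - Υ (x, l x) + Υ (0, p) := by
    intro x p; rw [← map_neg, ← map_add]; congr 1; ext1 <;> simp; module
  rw [paraCTensor_apply]
  simp only [splitJ_apply, e, e', add_sub_cancel_left]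
  ext1 <;> simp <;> module

section Naturality

variable {l : V × Y → V →L[ℝ] Y} {l' : V × Y' → V →L[ℝ] Y'} {ψ : V → V} {G : V × Y → Y'}
  {z : V × Y}

/-- A fibred map intertwines the splittings at `z`. -/
def IntertwinesLifts (l : V × Y → V →L[ℝ] Y) (l' : V × Y' → V →L[ℝ] Y') (ψ : V → V)
    (G : V × Y → Y') (z : V × Y) : Prop :=
  ∀ x : V, l' (ψ z.1, G z) (fderiv ℝ ψ z.1 x) = fderiv ℝ G z (x, l z x)

lemma hasFDerivAt_fibred (hψ : DifferentiableAt ℝ ψ z.1) (hG : DifferentiableAt ℝ G z) :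
    HasFDerivAt (fun z : V × Y => (ψ z.1, G z))
      ((fderiv ℝ ψ z.1 ∘L ContinuousLinearMap.fst ℝ V Y).prod (fderiv ℝ G z)) z :=
  (hψ.hasFDerivAt.comp z hasFDerivAt_fst).prodMk hG.hasFDerivAt

lemma fderiv_fibred (hψ : DifferentiableAt ℝ ψ z.1) (hG : DifferentiableAt ℝ G z) (X : V × Y) :
    fderiv ℝ (fun z : V × Y => (ψ z.1, G z)) z X = (fderiv ℝ ψ z.1 X.1, fderiv ℝ G z X) := by
  rw [(hasFDerivAt_fibred hψ hG).fderiv]; rfl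

lemma fderiv_fderiv_fibred (hψ : ContDiffAt ℝ ∞ ψ z.1) (hG : ContDiffAt ℝ ∞ G z)
    (X X' : V × Y) :
    fderiv ℝ (fderiv ℝ (fun z : V × Y => (ψ z.1, G z))) z X X' =
      (fderiv ℝ (fderiv ℝ ψ) z.1 X.1 X'.1, fderiv ℝ (fderiv ℝ G) z X X') := by
  have e : fderiv ℝ (fun z : V × Y => (ψ z.1, G z)) =ᶠ[𝓝 z] fun z =>
      ContinuousLinearMap.inl ℝ V Y' ∘L (fderiv ℝ ψ z.1 ∘L ContinuousLinearMap.fst ℝ V Y) +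
        ContinuousLinearMap.inr ℝ V Y' ∘L fderiv ℝ G z := by
    have h1 : ∀ᶠ w in 𝓝 z, DifferentiableAt ℝ ψ w.1 :=
      continuousAt_fst.eventually ((hψ.of_le (m := 1) (by norm_cast)).eventually (by simp) |>.mono
        fun w hw => hw.differentiableAt (by simp))
    have h2 : ∀ᶠ w in 𝓝 z, DifferentiableAt ℝ G w :=
      (hG.of_le (m := 1) (by norm_cast)).eventually (by simp) |>.mono
        fun w hw => hw.differentiableAt (by simp)
    filter_upwards [h1, h2] with w hw1 hw2
    refine ContinuousLinearMap.ext fun X => ?_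
    rw [fderiv_fibred hw1 hw2]
    ext1 <;> simp
  have d1 : DifferentiableAt ℝ (fderiv ℝ ψ) z.1 :=
    (hψ.fderiv_right (m := 1) (by norm_cast)).differentiableAt (by simp)
  have d2 : DifferentiableAt ℝ (fderiv ℝ G) z :=
    (hG.fderiv_right (m := 1) (by norm_cast)).differentiableAt (by simp)
  have d3 : HasFDerivAt (fun w : V × Y => fderiv ℝ ψ w.1 ∘L ContinuousLinearMap.fst ℝ V Y)
      (((ContinuousLinearMap.compL ℝ (V × Y) V V).flip (ContinuousLinearMap.fst ℝ V Y)) ∘L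
        (fderiv ℝ (fderiv ℝ ψ) z.1 ∘L ContinuousLinearMap.fst ℝ V Y)) z :=
    ((ContinuousLinearMap.compL ℝ (V × Y) V V).flip
      (ContinuousLinearMap.fst ℝ V Y)).hasFDerivAt.comp z (d1.hasFDerivAt.comp z hasFDerivAt_fst)
  have d4 := (ContinuousLinearMap.compL ℝ (V × Y) V (V × Y')
    (ContinuousLinearMap.inl ℝ V Y')).hasFDerivAt.comp z d3
  have d5 := (ContinuousLinearMap.compL ℝ (V × Y) Y' (V × Y')
    (ContinuousLinearMap.inr ℝ V Y')).hasFDerivAt.comp z d2.hasFDerivAt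
  have d6 := (d4.add d5).congr_of_eventuallyEq e
  rw [d6.fderiv]
  simp

lemma fderiv_splitJ_of_intertwines (hψ : DifferentiableAt ℝ ψ z.1) (hG : DifferentiableAt ℝ G z)
    (h : IntertwinesLifts l l' ψ G z) (X : V × Y) :
    fderiv ℝ (fun z : V × Y => (ψ z.1, G z)) z (splitJ (l z) X) =
      splitJ (l' (ψ z.1, G z)) (fderiv ℝ (fun z : V × Y => (ψ z.1, G z)) z X) := by
  rw [fderiv_fibred hψ hG, fderiv_fibred hψ hG, splitJ_apply, splitJ_apply]
  have h1 := h X.1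
  have h2 : fderiv ℝ G z (-X.1, X.2 - (2 : ℝ) • l z X.1) =
      fderiv ℝ G z X - (2 : ℝ) • fderiv ℝ G z (X.1, l z X.1) := by
    rw [← (fderiv ℝ G z).map_smul, ← (fderiv ℝ G z).map_sub]
    congr 1
    ext1 <;> simp; module
  ext1
  · simp
  · simp only [h1, h2]

lemma fderiv_intertwines (hψ : ContDiffAt ℝ ∞ ψ z.1) (hG : ContDiffAt ℝ ∞ G z)
    (hl : DifferentiableAt ℝ l z) (hl' : DifferentiableAt ℝ l' (ψ z.1, G z))
    (h : ∀ᶠ w in 𝓝 z, IntertwinesLifts l l' ψ G w) (X : V × Y) (x : V) :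
    fderiv ℝ l' (ψ z.1, G z) (fderiv ℝ ψ z.1 X.1, fderiv ℝ G z X) (fderiv ℝ ψ z.1 x) +
        l' (ψ z.1, G z) (fderiv ℝ (fderiv ℝ ψ) z.1 X.1 x) =
      fderiv ℝ (fderiv ℝ G) z X (x, l z x) + fderiv ℝ G z (0, fderiv ℝ l z X x) := by
  have dψ : DifferentiableAt ℝ ψ z.1 := hψ.differentiableAt (by simp)
  have dG : DifferentiableAt ℝ G z := hG.differentiableAt (by simp)
  have d1 : DifferentiableAt ℝ (fderiv ℝ ψ) z.1 :=
    (hψ.fderiv_right (m := 1) (by norm_cast)).differentiableAt (by simp)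
  have d2 : DifferentiableAt ℝ (fderiv ℝ G) z :=
    (hG.fderiv_right (m := 1) (by norm_cast)).differentiableAt (by simp)
  have e : (fun w : V × Y => l' (ψ w.1, G w) (fderiv ℝ ψ w.1 x)) =ᶠ[𝓝 z]
      fun w => fderiv ℝ G w (x, l w x) := h.mono fun w hw => hw x
  have h1 := (hl'.hasFDerivAt.comp z (hasFDerivAt_fibred dψ dG)).clm_apply
    (d1.hasFDerivAt.comp z hasFDerivAt_fst |>.clm_apply (hasFDerivAt_const x z))
  have h2 := d2.hasFDerivAt.clm_apply
    ((hasFDerivAt_const x z).prodMk (hl.hasFDerivAt.clm_apply (hasFDerivAt_const x z)))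
  have h3 := h1.unique (h2.congr_of_eventuallyEq e)
  have h4 := congrArg (fun A : V × Y →L[ℝ] Y' => A X) h3
  simp only [add_apply, ContinuousLinearMap.comp_apply, ContinuousLinearMap.flip_apply,
    ContinuousLinearMap.prod_apply, ContinuousLinearMap.coe_fst', zero_apply,
    Function.comp_apply, zero_add, ContinuousLinearMap.comp_zero] at h4
  rw [add_comm, h4, add_comm]

/-- A fibred map which intertwines the splittings transforms the Christoffel symbols
`splitChristoffel l C + paraCTensor (splitJ l) Υ` into `splitChristoffel l' C'`. -/

lemma fderiv_splitChristoffel (hψ : ContDiffAt ℝ ∞ ψ z.1) (hG : ContDiffAt ℝ ∞ G z)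
    (hl : DifferentiableAt ℝ l z) (hl' : DifferentiableAt ℝ l' (ψ z.1, G z))
    (h : ∀ᶠ w in 𝓝 z, IntertwinesLifts l l' ψ G w)
    {C C' : V →L[ℝ] V →L[ℝ] V} {Υ : V × Y →L[ℝ] ℝ}
    (hC : ∀ x x', fderiv ℝ ψ z.1 (C x x' + (2 * Υ (x, l z x)) • x' + (2 * Υ (x', l z x')) • x) =
      fderiv ℝ (fderiv ℝ ψ) z.1 x x' + C' (fderiv ℝ ψ z.1 x) (fderiv ℝ ψ z.1 x'))
    (hG2 : ∀ p p' : Y, fderiv ℝ (fderiv ℝ G) z (0, p) (0, p') =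
      (2 * Υ (0, p)) • fderiv ℝ G z (0, p') + (2 * Υ (0, p')) • fderiv ℝ G z (0, p))
    (X X' : V × Y) :
    fderiv ℝ (fun z : V × Y => (ψ z.1, G z)) z
        ((splitChristoffel l C z + paraCTensor (splitJ (l z)) Υ) X X') =
      fderiv ℝ (fderiv ℝ (fun z : V × Y => (ψ z.1, G z))) z X X' +
        splitChristoffel l' C' (ψ z.1, G z)
          (fderiv ℝ (fun z : V × Y => (ψ z.1, G z)) z X)
          (fderiv ℝ (fun z : V × Y => (ψ z.1, G z)) z X') := by
  have dψ : DifferentiableAt ℝ ψ z.1 := hψ.differentiableAt (by simp)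
  have dG : DifferentiableAt ℝ G z := hG.differentiableAt (by simp)
  have hI := h.self_of_nhds
  have D := fderiv_intertwines hψ hG hl hl' h
  have hsymm : ∀ X X', fderiv ℝ (fderiv ℝ G) z X X' = fderiv ℝ (fderiv ℝ G) z X' X :=
    (hG.isSymmSndFDerivAt (by simp; norm_cast))
  rw [fderiv_fderiv_fibred hψ hG]
  simp only [fderiv_fibred dψ dG, add_apply, splitChristoffel_apply, paraCTensor_splitJ]
  obtain ⟨x, a⟩ := X
  obtain ⟨x', a'⟩ := X'
  obtain ⟨p, rfl⟩ : ∃ p, a = l z x + p := ⟨a - l z x, by abel⟩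
  obtain ⟨p', rfl⟩ : ∃ p', a' = l z x' + p' := ⟨a' - l z x', by abel⟩
  have s : ∀ x p, ((x, l z x + p) : V × Y) = (x, l z x) + (0, p) := by intro x p; simp
  have hC' := hC x x'
  ext1
  · simp only [Prod.fst_add, Prod.smul_fst, smul_zero, add_zero, add_sub_cancel_left]
    rw [← hC']
    congr 1
    abel
  · simp only [Prod.snd_add, add_sub_cancel_left]
    have D1 := D (x, l z x + p) x'
    have D2 := D (0, p') x
    have hx' : fderiv ℝ G z (x', l z x' + p') = l' (ψ z.1, G z) (fderiv ℝ ψ z.1 x') +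
        fderiv ℝ G z (0, p') := by
      rw [hI x', ← map_add, s]
    have hCl := congrArg (l' (ψ z.1, G z)) hC'
    rw [hI] at hCl
    have hv : ∀ q : Y, ((0, q) : V × Y) = ContinuousLinearMap.inr ℝ V Y q := fun q => rfl
    have hM : fderiv ℝ G z ((C x x', l z (C x x') - fderiv ℝ l z (x, l z x + p) x' -
        fderiv ℝ l z (0, p') x) + ((2 * Υ (x, l z x)) • (x', l z x') +
        (2 * Υ (x', l z x')) • (x, l z x) + (2 * Υ (0, p)) • (0, p') +
          (2 * Υ (0, p')) • (0, p))) =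
        fderiv ℝ G z (C x x' + (2 * Υ (x, l z x)) • x' + (2 * Υ (x', l z x')) • x,
          l z (C x x' + (2 * Υ (x, l z x)) • x' + (2 * Υ (x', l z x')) • x)) -
        fderiv ℝ G z (0, fderiv ℝ l z (x, l z x + p) x') - fderiv ℝ G z (0, fderiv ℝ l z (0, p') x)
        + (2 * Υ (0, p)) • fderiv ℝ G z (0, p') + (2 * Υ (0, p')) • fderiv ℝ G z (0, p) := by
      rw [← (fderiv ℝ G z).map_smul, ← (fderiv ℝ G z).map_smul, ← (fderiv ℝ G z).map_sub,
        ← (fderiv ℝ G z).map_sub, ← (fderiv ℝ G z).map_add, ← (fderiv ℝ G z).map_add]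
      congr 1
      ext1
      · simp [add_assoc]
      · simp; try abel
    have hS : fderiv ℝ (fderiv ℝ G) z (x, l z x + p) (x', l z x' + p') =
        fderiv ℝ (fderiv ℝ G) z (x, l z x + p) (x', l z x') +
        (fderiv ℝ (fderiv ℝ G) z (0, p') (x, l z x) +
          ((2 * Υ (0, p)) • fderiv ℝ G z (0, p') + (2 * Υ (0, p')) • fderiv ℝ G z (0, p))) := by
      rw [← hG2, s x' p', map_add, hsymm (0, p') (x, l z x), s x p]
      simp only [map_add, add_apply]
    simp only [map_zero] at D2
    simp only [zero_apply, map_zero, add_zero] at D2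
    rw [hM, hS, hx', hCl, add_sub_cancel_left, D2, map_add, eq_sub_of_add_eq D1]
    abel

end Naturality

end Splitting

section SplitIdentities

variable {V : Type*} [NormedAddCommGroup V] [NormedSpace ℝ V]
  {Y : Type*} [NormedAddCommGroup Y] [NormedSpace ℝ Y]

lemma hasFDerivAt_splitJ {l : V × Y → V →L[ℝ] Y} {z : V × Y} (hl : DifferentiableAt ℝ l z)
    (X : V × Y) : HasFDerivAt (fun z => splitJ (l z) X)
      (-(ContinuousLinearMap.inr ℝ V Y ∘L ((2 : ℝ) • (fderiv ℝ l z).flip X.1))) z := by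
  have h1 : HasFDerivAt (fun z => l z X.1) ((fderiv ℝ l z).flip X.1) z := by
    have := hl.hasFDerivAt.clm_apply (hasFDerivAt_const X.1 z)
    simpa using this
  have h2 := ((ContinuousLinearMap.inr ℝ V Y).hasFDerivAt.comp z (h1.const_smul (2 : ℝ))).const_sub
    ((-X.1, X.2) : V × Y)
  refine h2.congr_of_eventuallyEq (Eventually.of_forall fun w => ?_)
  simp

lemma splitChristoffel_splitJ {l : V × Y → V →L[ℝ] Y} {z : V × Y} (hl : DifferentiableAt ℝ l z)
    (C : V →L[ℝ] V →L[ℝ] V) (v X : V × Y) :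
    fderiv ℝ (fun z => splitJ (l z) X) z v + splitChristoffel l C z v (splitJ (l z) X) =
      splitJ (l z) (splitChristoffel l C z v X) := by
  rw [(hasFDerivAt_splitJ hl X).fderiv]
  have e : X.2 - (2 : ℝ) • l z X.1 - l z (-X.1) = X.2 - l z X.1 := by
    rw [map_neg]; module
  simp only [splitJ_apply, splitChristoffel_apply, e]
  ext1
  · simp
  · simp
    module

lemma splitChristoffel_torsion {l : V × Y → V →L[ℝ] Y} {z : V × Y} {C : V →L[ℝ] V →L[ℝ] V}
    (hC : ∀ x x', C x x' = C x' x) (X X' : V × Y) :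
    splitChristoffel l C z X X' - splitChristoffel l C z X' X =
      (0, fderiv ℝ l z (X'.1, l z X'.1) X.1 - fderiv ℝ l z (X.1, l z X.1) X'.1) := by
  have e : ∀ X : V × Y, fderiv ℝ l z X = fderiv ℝ l z (X.1, l z X.1) +
      fderiv ℝ l z (0, X.2 - l z X.1) := by
    intro X; rw [← map_add]; simp
  simp only [splitChristoffel_apply]
  rw [e X, e X', hC]
  ext1
  · simp
  · simp
    abel

/-- The pairing of the horizontal and the vertical part of the splitting of `V × V*`. -/
noncomputable def splitMetric (l : V →L[ℝ] V →L[ℝ] ℝ) :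
    V × (V →L[ℝ] ℝ) →L[ℝ] V × (V →L[ℝ] ℝ) →L[ℝ] ℝ :=
  let b := bilinComp (ContinuousLinearMap.id ℝ ℝ) (ContinuousLinearMap.id ℝ (V →L[ℝ] ℝ))
    (ContinuousLinearMap.snd ℝ V (V →L[ℝ] ℝ) - l ∘L ContinuousLinearMap.fst ℝ V (V →L[ℝ] ℝ))
    (ContinuousLinearMap.fst ℝ V (V →L[ℝ] ℝ))
  (1 / 2 : ℝ) • (b + b.flip)

lemma splitMetric_apply (l : V →L[ℝ] V →L[ℝ] ℝ) (X X' : V × (V →L[ℝ] ℝ)) :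
    splitMetric l X X' = 1 / 2 * ((X.2 - l X.1) X'.1 + (X'.2 - l X'.1) X.1) := by
  simp [splitMetric]
  ring

lemma contDiffWithinAt_splitMetric {D : Type*} [NormedAddCommGroup D] [NormedSpace ℝ D]
    {l : D → V →L[ℝ] V →L[ℝ] ℝ} {s : Set D} {d : D}
    (hl : ContDiffWithinAt ℝ ∞ l s d) : ContDiffWithinAt ℝ ∞ (fun d => splitMetric (l d)) s d := by
  unfold splitMetric
  have h := ContDiffWithinAt.bilinComp (s := s) (d := d)
    (A := fun _ => ContinuousLinearMap.id ℝ ℝ)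
    (B := fun _ => ContinuousLinearMap.id ℝ (V →L[ℝ] ℝ))
    (p := fun d => ContinuousLinearMap.snd ℝ V (V →L[ℝ] ℝ) -
      l d ∘L ContinuousLinearMap.fst ℝ V (V →L[ℝ] ℝ))
    (p' := fun _ => ContinuousLinearMap.fst ℝ V (V →L[ℝ] ℝ))
    contDiffWithinAt_const contDiffWithinAt_const
    (contDiffWithinAt_const.sub (hl.clm_comp contDiffWithinAt_const)) contDiffWithinAt_const
  exact (contDiffWithinAt_const (c := (1 / 2 : ℝ))).smul (h.add h.clm_flip)

lemma fderiv_splitMetric {l : V × (V →L[ℝ] ℝ) → V →L[ℝ] V →L[ℝ] ℝ} {z : V × (V →L[ℝ] ℝ)}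
    (hl : DifferentiableAt ℝ l z) (X X' v : V × (V →L[ℝ] ℝ)) :
    fderiv ℝ (fun z => splitMetric (l z) X X') z v =
      -(1 / 2 * (fderiv ℝ l z v X.1 X'.1 + fderiv ℝ l z v X'.1 X.1)) := by
  have h0 : ∀ x x', HasFDerivAt (fun z => l z x x')
      (ContinuousLinearMap.apply ℝ ℝ x' ∘L (fderiv ℝ l z).flip x) z := by
    intro x x'
    have := (hl.hasFDerivAt.clm_apply (hasFDerivAt_const x z)).clm_apply (hasFDerivAt_const x' z)
    simp only [ContinuousLinearMap.comp_zero, zero_add] at this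
    exact this
  have h1 := (((h0 X.1 X'.1).const_sub (X.2 X'.1)).add
    ((h0 X'.1 X.1).const_sub (X'.2 X.1))).const_mul (1 / 2 : ℝ)
  have h2 : (fun z => splitMetric (l z) X X') = fun z => 1 / 2 * (X.2 X'.1 - l z X.1 X'.1 +
      (X'.2 X.1 - l z X'.1 X.1)) := by
    ext z; rw [splitMetric_apply]; simp
  rw [h2]
  refine (congrArg (fun A : V × (V →L[ℝ] ℝ) →L[ℝ] ℝ => A v) h1.fderiv).trans ?_
  simp
  ring

end SplitIdentities

section Tractor

variable {V : Type*} [NormedAddCommGroup V] [NormedSpace ℝ V]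

variable (V) in
/-- An affine chart of the space of rays in `V* × ℝ`: the affine hyperplane `ell = 1`, with the
parametrization `y ↦ base + lin y` by `V*`. -/

structure AffineSlice where
  /-- the linear form -/
  ell : (V →L[ℝ] ℝ) × ℝ →L[ℝ] ℝ
  /-- a point of the hyperplane -/
  base : (V →L[ℝ] ℝ) × ℝ
  /-- the parametrization of the kernel of `ell` -/
  lin : (V →L[ℝ] ℝ) →L[ℝ] (V →L[ℝ] ℝ) × ℝ
  /-- the coordinates of a point of the hyperplane -/
  tau : (V →L[ℝ] ℝ) × ℝ →L[ℝ] (V →L[ℝ] ℝ)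
  ell_lin : ∀ y, ell (lin y) = 0
  ell_base : ell base = 1
  tau_base : tau base = 0
  tau_lin : ∀ y, tau (lin y) = y
  lin_tau : ∀ w, lin (tau w) = w - ell w • base

/-- The parametrization of the hyperplane `ell = 1`. -/
noncomputable def AffineSlice.sect (S : AffineSlice V) (y : V →L[ℝ] ℝ) : (V →L[ℝ] ℝ) × ℝ :=
  S.base + S.lin y

lemma AffineSlice.ell_sect (S : AffineSlice V) (y : V →L[ℝ] ℝ) : S.ell (S.sect y) = 1 := by
  simp [sect, S.ell_base, S.ell_lin]

lemma AffineSlice.tau_sect (S : AffineSlice V) (y : V →L[ℝ] ℝ) : S.tau (S.sect y) = y := by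
  simp [sect, S.tau_base, S.tau_lin]

lemma AffineSlice.sect_tau (S : AffineSlice V) {w : (V →L[ℝ] ℝ) × ℝ} (hw : S.ell w ≠ 0) :
    S.sect ((S.ell w)⁻¹ • S.tau w) = (S.ell w)⁻¹ • w := by
  rw [sect, map_smul, S.lin_tau, smul_sub, smul_smul, inv_mul_cancel₀ hw, one_smul]
  abel

lemma AffineSlice.contDiff_sect (S : AffineSlice V) : ContDiff ℝ ∞ S.sect :=
  contDiff_const.add S.lin.contDiff

variable (V) in
/-- The slice of `V* × ℝ` consisting of the `(ξ, 1)`. -/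
noncomputable def cotangentSlice : AffineSlice V where
  ell := ContinuousLinearMap.snd ℝ _ _
  base := (0, 1)
  lin := ContinuousLinearMap.inl ℝ _ _
  tau := ContinuousLinearMap.fst ℝ _ _
  ell_lin := by simp
  ell_base := by simp
  tau_base := by simp
  tau_lin := by simp
  lin_tau w := by ext1 <;> simp

lemma cotangentSlice_sect (ξ : V →L[ℝ] ℝ) : (cotangentSlice V).sect ξ = (ξ, 1) := by
  simp [AffineSlice.sect, cotangentSlice]

/-- The connection form `(ξ, t) ↦ (ξ ∘ Γ(x) - t P(x), ξ(x))` of the cotractor connection. -/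
noncomputable def tractorForm (Γ : V →L[ℝ] V →L[ℝ] V) (P : V →L[ℝ] V →L[ℝ] ℝ)
    (w : (V →L[ℝ] ℝ) × ℝ) : V →L[ℝ] (V →L[ℝ] ℝ) × ℝ :=
  ContinuousLinearMap.inl ℝ _ _ ∘L (bilinComp w.1 Γ (ContinuousLinearMap.id ℝ V)
    (ContinuousLinearMap.id ℝ V) - w.2 • P) + ContinuousLinearMap.inr ℝ _ _ ∘L w.1

lemma tractorForm_apply (Γ : V →L[ℝ] V →L[ℝ] V) (P : V →L[ℝ] V →L[ℝ] ℝ)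
    (w : (V →L[ℝ] ℝ) × ℝ) (x : V) :
    tractorForm Γ P w x = (w.1 ∘L Γ x - w.2 • P x, w.1 x) := by
  have : bilinComp w.1 Γ (ContinuousLinearMap.id ℝ V) (ContinuousLinearMap.id ℝ V) x =
      w.1 ∘L Γ x := by
    ext y; simp
  simp [tractorForm, this]

lemma tractorForm_smul (Γ : V →L[ℝ] V →L[ℝ] V) (P : V →L[ℝ] V →L[ℝ] ℝ)
    (w : (V →L[ℝ] ℝ) × ℝ) (c : ℝ) (x : V) :
    tractorForm Γ P (c • w) x = c • tractorForm Γ P w x := by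
  simp only [tractorForm_apply]
  ext1
  · simp [smul_sub, smul_smul]
  · simp

lemma contDiffWithinAt_tractorForm {D : Type*} [NormedAddCommGroup D] [NormedSpace ℝ D]
    {Γ : D → V →L[ℝ] V →L[ℝ] V} {P : D → V →L[ℝ] V →L[ℝ] ℝ} {w : D → (V →L[ℝ] ℝ) × ℝ}
    {s : Set D} {d : D} (hΓ : ContDiffWithinAt ℝ ∞ Γ s d) (hP : ContDiffWithinAt ℝ ∞ P s d)
    (hw : ContDiffWithinAt ℝ ∞ w s d) :
    ContDiffWithinAt ℝ ∞ (fun d => tractorForm (Γ d) (P d) (w d)) s d := by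
  have h := ContDiffWithinAt.bilinComp (A := fun d => (w d).1) (B := Γ)
    (p := fun _ => ContinuousLinearMap.id ℝ V) (p' := fun _ => ContinuousLinearMap.id ℝ V)
    hw.fst hΓ contDiffWithinAt_const contDiffWithinAt_const
  exact (contDiffWithinAt_const.clm_comp (h.sub (hw.snd.smul hP))).add
    (contDiffWithinAt_const.clm_comp hw.fst)

/-- The horizontal lift of tangent vectors in the affine chart `S` of the projectivized cotractor
bundle. -/

noncomputable def sliceLift (S : AffineSlice V) (Γ : V → V →L[ℝ] V →L[ℝ] V)
    (P : V → V →L[ℝ] V →L[ℝ] ℝ) (z : V × (V →L[ℝ] ℝ)) : V →L[ℝ] V →L[ℝ] ℝ :=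
  S.tau ∘L tractorForm (Γ z.1) (P z.1) (S.sect z.2) -
    (S.ell ∘L tractorForm (Γ z.1) (P z.1) (S.sect z.2)).smulRight z.2

lemma sliceLift_apply (S : AffineSlice V) (Γ : V → V →L[ℝ] V →L[ℝ] V)
    (P : V → V →L[ℝ] V →L[ℝ] ℝ) (z : V × (V →L[ℝ] ℝ)) (x : V) :
    sliceLift S Γ P z x = S.tau (tractorForm (Γ z.1) (P z.1) (S.sect z.2) x) -
      S.ell (tractorForm (Γ z.1) (P z.1) (S.sect z.2) x) • z.2 := by
  simp [sliceLift]

lemma lin_sliceLift (S : AffineSlice V) (Γ : V → V →L[ℝ] V →L[ℝ] V)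
    (P : V → V →L[ℝ] V →L[ℝ] ℝ) (z : V × (V →L[ℝ] ℝ)) (x : V) :
    S.lin (sliceLift S Γ P z x) = tractorForm (Γ z.1) (P z.1) (S.sect z.2) x -
      S.ell (tractorForm (Γ z.1) (P z.1) (S.sect z.2) x) • S.sect z.2 := by
  rw [sliceLift_apply, map_sub, map_smul, S.lin_tau, AffineSlice.sect, smul_add]
  abel

/-- The connection on the horizontal distribution in the affine chart `S`. -/
noncomputable def sliceConnection (S : AffineSlice V) (Γ : V → V →L[ℝ] V →L[ℝ] V)
    (P : V → V →L[ℝ] V →L[ℝ] ℝ) (z : V × (V →L[ℝ] ℝ)) : V →L[ℝ] V →L[ℝ] V :=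
  Γ z.1 - (S.ell ∘L tractorForm (Γ z.1) (P z.1) (S.sect z.2)).smulRight
      (ContinuousLinearMap.id ℝ V)
    - ((S.ell ∘L tractorForm (Γ z.1) (P z.1) (S.sect z.2)).smulRight
      (ContinuousLinearMap.id ℝ V)).flip

lemma sliceConnection_apply (S : AffineSlice V) (Γ : V → V →L[ℝ] V →L[ℝ] V)
    (P : V → V →L[ℝ] V →L[ℝ] ℝ) (z : V × (V →L[ℝ] ℝ)) (x x' : V) :
    sliceConnection S Γ P z x x' = Γ z.1 x x' -
      S.ell (tractorForm (Γ z.1) (P z.1) (S.sect z.2) x) • x' -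
      S.ell (tractorForm (Γ z.1) (P z.1) (S.sect z.2) x') • x := by
  simp [sliceConnection]

section Smoothness

variable {S : AffineSlice V} {Γ : V → V →L[ℝ] V →L[ℝ] V} {P : V → V →L[ℝ] V →L[ℝ] ℝ}
  {z : V × (V →L[ℝ] ℝ)}

lemma contDiffAt_sliceTractor (hΓ : ContDiffAt ℝ ∞ Γ z.1) (hP : ContDiffAt ℝ ∞ P z.1) :
    ContDiffAt ℝ ∞ (fun z : V × (V →L[ℝ] ℝ) =>
      tractorForm (Γ z.1) (P z.1) (S.sect z.2)) z := by
  have h1 : ContDiffAt ℝ ∞ (fun z : V × (V →L[ℝ] ℝ) => Γ z.1) z := hΓ.comp z contDiffAt_fst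
  have h2 : ContDiffAt ℝ ∞ (fun z : V × (V →L[ℝ] ℝ) => P z.1) z := hP.comp z contDiffAt_fst
  have h3 : ContDiffAt ℝ ∞ (fun z : V × (V →L[ℝ] ℝ) => S.sect z.2) z :=
    S.contDiff_sect.contDiffAt.comp z contDiffAt_snd
  rw [← contDiffWithinAt_univ] at *
  exact contDiffWithinAt_tractorForm h1 h2 h3

lemma contDiffAt_sliceLift (hΓ : ContDiffAt ℝ ∞ Γ z.1) (hP : ContDiffAt ℝ ∞ P z.1) :
    ContDiffAt ℝ ∞ (sliceLift S Γ P) z := by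
  have h := contDiffAt_sliceTractor (S := S) hΓ hP
  exact (contDiffAt_const.clm_comp h).sub
    ((contDiffAt_const.clm_comp h).smulRight contDiffAt_snd)

lemma contDiffAt_sliceConnection (hΓ : ContDiffAt ℝ ∞ Γ z.1) (hP : ContDiffAt ℝ ∞ P z.1) :
    ContDiffAt ℝ ∞ (sliceConnection S Γ P) z := by
  have h := contDiffAt_sliceTractor (S := S) hΓ hP
  have h1 : ContDiffAt ℝ ∞ (fun z : V × (V →L[ℝ] ℝ) => Γ z.1) z := hΓ.comp z contDiffAt_fst
  have h2 : ContDiffAt ℝ ∞ (fun z : V × (V →L[ℝ] ℝ) =>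
      (S.ell ∘L tractorForm (Γ z.1) (P z.1) (S.sect z.2)).smulRight
      (ContinuousLinearMap.id ℝ V)) z :=
    (contDiffAt_const.clm_comp h).smulRight contDiffAt_const
  have h3 : ContDiffAt ℝ ∞ (fun z : V × (V →L[ℝ] ℝ) =>
      ((S.ell ∘L tractorForm (Γ z.1) (P z.1) (S.sect z.2)).smulRight
      (ContinuousLinearMap.id ℝ V)).flip) z := by
    rw [← contDiffWithinAt_univ] at *
    exact h2.clm_flip
  exact (h1.sub h2).sub h3

lemma sliceConnection_symm (hΓ : ∀ x x', Γ z.1 x x' = Γ z.1 x' x) (x x' : V) :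
    sliceConnection S Γ P z x x' = sliceConnection S Γ P z x' x := by
  rw [sliceConnection_apply, sliceConnection_apply, hΓ]
  abel

end Smoothness

section Cotangent

variable {Γ : V → V →L[ℝ] V →L[ℝ] V} {P : V → V →L[ℝ] V →L[ℝ] ℝ}
  {z : V × (V →L[ℝ] ℝ)}

lemma cotangentLift_apply (x : V) : sliceLift (cotangentSlice V) Γ P z x =
    z.2 ∘L Γ z.1 x - P z.1 x - z.2 x • z.2 := by
  rw [sliceLift_apply, cotangentSlice_sect, tractorForm_apply]
  simp [cotangentSlice]

lemma cotangentConnection_apply (x x' : V) : sliceConnection (cotangentSlice V) Γ P z x x' =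
    Γ z.1 x x' - z.2 x • x' - z.2 x' • x := by
  rw [sliceConnection_apply, cotangentSlice_sect, tractorForm_apply, tractorForm_apply]
  simp [cotangentSlice]

lemma fderiv_cotangentLift (hΓ : ContDiffAt ℝ ∞ Γ z.1) (hP : ContDiffAt ℝ ∞ P z.1)
    (q : V →L[ℝ] ℝ) (x : V) :
    fderiv ℝ (sliceLift (cotangentSlice V) Γ P) z (0, q) x =
      q ∘L Γ z.1 x - q x • z.2 - z.2 x • q := by
  have hd : DifferentiableAt ℝ (sliceLift (cotangentSlice V) Γ P) z :=
    (contDiffAt_sliceLift hΓ hP).differentiableAt (by simp)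
  have h1 : HasFDerivAt (fun z => sliceLift (cotangentSlice V) Γ P z x)
      ((fderiv ℝ (sliceLift (cotangentSlice V) Γ P) z).flip x) z := by
    simpa using hd.hasFDerivAt.clm_apply (hasFDerivAt_const x z)
  have hc : HasFDerivAt (fun t : ℝ => (z.1, z.2 + t • q))
      (ContinuousLinearMap.toSpanSingleton ℝ ((0, q) : V × (V →L[ℝ] ℝ))) (0 : ℝ) := by
    have := (hasFDerivAt_const z.1 (0 : ℝ)).prodMk
      (((ContinuousLinearMap.toSpanSingleton ℝ q).hasFDerivAt (x := (0 : ℝ))).const_add z.2)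
    refine this.congr_fderiv ?_
    ext1
    simp
  have h2 : HasFDerivAt ((fun z => sliceLift (cotangentSlice V) Γ P z x) ∘
      fun t : ℝ => (z.1, z.2 + t • q))
      (((fderiv ℝ (sliceLift (cotangentSlice V) Γ P) z).flip x) ∘L
      (ContinuousLinearMap.toSpanSingleton ℝ ((0, q) : V × (V →L[ℝ] ℝ)))) (0 : ℝ) := by
    refine HasFDerivAt.comp (0 : ℝ) ?_ hc
    simpa using h1
  have h3 : HasDerivAt (fun t : ℝ => (z.2 ∘L Γ z.1 x - P z.1 x - z.2 x • z.2) +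
      t • (q ∘L Γ z.1 x - q x • z.2 - z.2 x • q) - (t ^ 2) • (q x • q))
      ((1 : ℝ) • (q ∘L Γ z.1 x - q x • z.2 - z.2 x • q) -
        ((2 : ℕ) * (0 : ℝ) ^ (2 - 1) : ℝ) • (q x • q)) 0 :=
    (((hasDerivAt_id (0 : ℝ)).smul_const (q ∘L Γ z.1 x - q x • z.2 - z.2 x • q)).const_add _).sub
      ((hasDerivAt_pow 2 (0 : ℝ)).smul_const (q x • q))
  have h4 : ((fun z => sliceLift (cotangentSlice V) Γ P z x) ∘
      fun t : ℝ => (z.1, z.2 + t • q)) = (fun t : ℝ => (z.2 ∘L Γ z.1 x - P z.1 x - z.2 x • z.2) +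
      t • (q ∘L Γ z.1 x - q x • z.2 - z.2 x • q) - (t ^ 2) • (q x • q)) := by
    ext t y
    simp only [Function.comp_apply, cotangentLift_apply]
    simp
    ring
  rw [h4] at h2
  have h5 := h2.hasDerivAt.unique h3
  simpa using h5

/-- The split connection of the cotangent slice preserves the split metric. -/
lemma splitChristoffel_splitMetric (hΓ : ContDiffAt ℝ ∞ Γ z.1) (hP : ContDiffAt ℝ ∞ P z.1)
    (v X X' : V × (V →L[ℝ] ℝ)) :
    fderiv ℝ (fun z => splitMetric (sliceLift (cotangentSlice V) Γ P z) X X') z v =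
      splitMetric (sliceLift (cotangentSlice V) Γ P z)
        (splitChristoffel (sliceLift (cotangentSlice V) Γ P)
          (sliceConnection (cotangentSlice V) Γ P z) z v X) X' +
      splitMetric (sliceLift (cotangentSlice V) Γ P z) X
        (splitChristoffel (sliceLift (cotangentSlice V) Γ P)
          (sliceConnection (cotangentSlice V) Γ P z) z v X') := by
  have hd : DifferentiableAt ℝ (sliceLift (cotangentSlice V) Γ P) z :=
    (contDiffAt_sliceLift hΓ hP).differentiableAt (by simp)
  have e : ∀ a b c : V →L[ℝ] ℝ, a - b - c - a = -b - c := fun a b c => by abel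
  rw [fderiv_splitMetric hd, splitMetric_apply, splitMetric_apply]
  simp only [splitChristoffel_apply, e, fderiv_cotangentLift hΓ hP, cotangentConnection_apply]
  simp only [sub_apply, neg_apply, smul_apply, ContinuousLinearMap.comp_apply, map_sub, map_smul,
    smul_eq_mul]
  ring

/-- The transformation of the horizontal lifts under a change of coordinates of the base. -/
lemma intertwinesLifts_cotangent {Γ' : V → V →L[ℝ] V →L[ℝ] V} {P' : V → V →L[ℝ] V →L[ℝ] ℝ}
    {ψ : V → V} {G : V × (V →L[ℝ] ℝ) → V →L[ℝ] ℝ} (hψ : ContDiffAt ℝ ∞ ψ z.1)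
    (hinv : Function.Surjective (fderiv ℝ ψ z.1)) (hGd : DifferentiableAt ℝ G z)
    (hG : ∀ᶠ w in 𝓝 z, ∀ x, G w (fderiv ℝ ψ w.1 x) = w.2 x)
    (hΓ : ∀ x x', fderiv ℝ ψ z.1 (Γ z.1 x x') = fderiv ℝ (fderiv ℝ ψ) z.1 x x' +
      Γ' (ψ z.1) (fderiv ℝ ψ z.1 x) (fderiv ℝ ψ z.1 x'))
    (hP : ∀ x x', P' (ψ z.1) (fderiv ℝ ψ z.1 x) (fderiv ℝ ψ z.1 x') = P z.1 x x') :
    IntertwinesLifts (sliceLift (cotangentSlice V) Γ P) (sliceLift (cotangentSlice V) Γ' P')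
      ψ G z := by
  intro x
  have d1 : DifferentiableAt ℝ (fderiv ℝ ψ) z.1 :=
    (hψ.fderiv_right (m := 1) (by norm_cast)).differentiableAt (by simp)
  have key : ∀ (X : V × (V →L[ℝ] ℝ)) (x' : V), fderiv ℝ G z X (fderiv ℝ ψ z.1 x') +
      G z (fderiv ℝ (fderiv ℝ ψ) z.1 X.1 x') = X.2 x' := by
    intro X x'
    have h1 := hGd.hasFDerivAt.clm_apply (d1.hasFDerivAt.comp z hasFDerivAt_fst |>.clm_apply
      (hasFDerivAt_const x' z))
    have h2 : HasFDerivAt (fun w : V × (V →L[ℝ] ℝ) => w.2 x')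
        (ContinuousLinearMap.apply ℝ ℝ x' ∘L ContinuousLinearMap.snd ℝ V (V →L[ℝ] ℝ)) z :=
      (ContinuousLinearMap.apply ℝ ℝ x').hasFDerivAt.comp z hasFDerivAt_snd
    have h3 := h1.unique (h2.congr_of_eventuallyEq (hG.mono fun w hw => hw x'))
    have h4 := congrArg (fun A : V × (V →L[ℝ] ℝ) →L[ℝ] ℝ => A X) h3
    simp at h4
    rw [add_comm]
    exact h4
  ext y'
  obtain ⟨x', rfl⟩ := hinv y'
  have hG0 := hG.self_of_nhds
  have h1 := key (x, sliceLift (cotangentSlice V) Γ P z x) x'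
  have h2 := congrArg (G z) (hΓ x x')
  rw [hG0, map_add] at h2
  rw [eq_sub_of_add_eq h1]
  simp only [cotangentLift_apply]
  simp [hG0, hP, h2]
  ring

end Cotangent

section Rescaling

variable {Γ : V → V →L[ℝ] V →L[ℝ] V} {P : V → V →L[ℝ] V →L[ℝ] ℝ}
  {z : V × (V →L[ℝ] ℝ)} (S : AffineSlice V)

/-- The coordinates in the affine chart `S` of the ray of `(ξ, 1)`. -/
noncomputable def sliceCoord (z : V × (V →L[ℝ] ℝ)) : V →L[ℝ] ℝ :=
  (S.ell (z.2, 1))⁻¹ • S.tau (z.2, 1)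

variable {S}

lemma sect_sliceCoord (hz : S.ell (z.2, 1) ≠ 0) :
    S.sect (sliceCoord S z) = (S.ell (z.2, 1))⁻¹ • (z.2, 1) :=
  S.sect_tau hz

lemma contDiffAt_sliceCoord (hz : S.ell (z.2, 1) ≠ 0) : ContDiffAt ℝ ∞ (sliceCoord S) z := by
  have h : ContDiffAt ℝ ∞ (fun z : V × (V →L[ℝ] ℝ) => (z.2, (1 : ℝ))) z :=
    contDiffAt_snd.prodMk contDiffAt_const
  exact ((S.ell.contDiff.contDiffAt.comp z h).inv hz).smul (S.tau.contDiff.contDiffAt.comp z h)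

lemma hasFDerivAt_ell (z : V × (V →L[ℝ] ℝ)) :
    HasFDerivAt (fun z : V × (V →L[ℝ] ℝ) => S.ell (z.2, 1))
      (S.ell ∘L ContinuousLinearMap.inl ℝ _ ℝ ∘L ContinuousLinearMap.snd ℝ V _) z := by
  refine S.ell.hasFDerivAt.comp z ?_
  exact (hasFDerivAt_snd.prodMk (hasFDerivAt_const _ _)).congr_fderiv (by ext1 <;> ext <;> simp)

lemma fderiv_sliceCoord (hz : S.ell (z.2, 1) ≠ 0) (X : V × (V →L[ℝ] ℝ)) :
    fderiv ℝ (sliceCoord S) z X = (S.ell (z.2, 1))⁻¹ • S.tau (X.2, 0) -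
      ((S.ell (z.2, 1))⁻¹ ^ 2 * S.ell (X.2, 0)) • S.tau (z.2, 1) := by
  have h1 : HasFDerivAt (fun z : V × (V →L[ℝ] ℝ) => S.tau (z.2, 1))
      (S.tau ∘L ContinuousLinearMap.inl ℝ _ ℝ ∘L ContinuousLinearMap.snd ℝ V _) z := by
    refine S.tau.hasFDerivAt.comp z ?_
    exact (hasFDerivAt_snd.prodMk (hasFDerivAt_const _ _)).congr_fderiv
      (by ext1 <;> ext <;> simp)
  have h2 := ((hasDerivAt_inv hz).comp_hasFDerivAt z (hasFDerivAt_ell z)).smul h1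
  have h3 := congrArg (fun A : V × (V →L[ℝ] ℝ) →L[ℝ] (V →L[ℝ] ℝ) => A X) h2.fderiv
  refine h3.trans ?_
  simp [neg_smul, sub_eq_add_neg]

lemma fderiv_fderiv_sliceCoord (hz : S.ell (z.2, 1) ≠ 0) (p p' : V →L[ℝ] ℝ) :
    fderiv ℝ (fderiv ℝ (sliceCoord S)) z (0, p) (0, p') =
      -((S.ell (z.2, 1))⁻¹ * S.ell (p, 0)) • fderiv ℝ (sliceCoord S) z (0, p') -
      ((S.ell (z.2, 1))⁻¹ * S.ell (p', 0)) • fderiv ℝ (sliceCoord S) z (0, p) := by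
  have hd : DifferentiableAt ℝ (fderiv ℝ (sliceCoord S)) z :=
    ((contDiffAt_sliceCoord hz).fderiv_right (m := 1) (by norm_cast)).differentiableAt (by simp)
  have h0 : HasFDerivAt (fun w => fderiv ℝ (sliceCoord S) w (0, p'))
      ((fderiv ℝ (fderiv ℝ (sliceCoord S)) z).flip (0, p')) z := by
    simpa using hd.hasFDerivAt.clm_apply (hasFDerivAt_const ((0, p') : V × (V →L[ℝ] ℝ)) z)
  have e : (fun w => fderiv ℝ (sliceCoord S) w (0, p')) =ᶠ[𝓝 z] fun w =>
      (S.ell (w.2, 1))⁻¹ • S.tau (p', 0) - ((S.ell (w.2, 1))⁻¹ * S.ell (p', 0)) •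
        sliceCoord S w := by
    have hc : ContinuousAt (fun z : V × (V →L[ℝ] ℝ) => S.ell (z.2, 1)) z :=
      (hasFDerivAt_ell z).continuousAt
    filter_upwards [hc.eventually_ne hz] with w hw
    rw [fderiv_sliceCoord hw, sliceCoord, smul_smul]
    congr 2
    ring
  have h1 := (hasDerivAt_inv hz).comp_hasFDerivAt z (hasFDerivAt_ell z)
  have h2 := (h1.smul_const (S.tau (p', 0))).sub ((h1.mul_const (S.ell (p', 0))).smul
    ((contDiffAt_sliceCoord hz).differentiableAt (by simp)).hasFDerivAt)
  have h3 := h0.unique (h2.congr_of_eventuallyEq e)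
  have h4 := congrArg (fun A : V × (V →L[ℝ] ℝ) →L[ℝ] (V →L[ℝ] ℝ) => A (0, p)) h3
  simp only [ContinuousLinearMap.flip_apply] at h4
  rw [h4, fderiv_sliceCoord hz (0, p'), fderiv_sliceCoord hz (0, p), sliceCoord]
  simp [fderiv_sliceCoord hz (0, p)]
  module

lemma intertwinesLifts_sliceCoord (hz : S.ell (z.2, 1) ≠ 0) :
    IntertwinesLifts (sliceLift (cotangentSlice V) Γ P) (sliceLift S Γ P) id (sliceCoord S) z := by
  intro x
  rw [fderiv_id, fderiv_sliceCoord hz, cotangentLift_apply, sliceLift_apply]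
  simp only [ContinuousLinearMap.id_apply, id, sect_sliceCoord hz, tractorForm_smul]
  have e : ((z.2 ∘L Γ z.1 x - P z.1 x - z.2 x • z.2, 0) : (V →L[ℝ] ℝ) × ℝ) =
      tractorForm (Γ z.1) (P z.1) (z.2, 1) x - z.2 x • (z.2, 1) := by
    rw [tractorForm_apply]; ext1 <;> simp
  rw [e]
  simp only [map_sub, map_smul, sliceCoord, smul_smul, smul_eq_mul]
  have e2 : (S.ell (z.2, 1))⁻¹ ^ 2 * (S.ell (tractorForm (Γ z.1) (P z.1) (z.2, 1) x) -
      z.2 x * S.ell (z.2, 1)) = (S.ell (z.2, 1))⁻¹ * S.ell (tractorForm (Γ z.1) (P z.1)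
      (z.2, 1) x) * (S.ell (z.2, 1))⁻¹ - (S.ell (z.2, 1))⁻¹ * z.2 x := by
    field_simp
  rw [e2]
  module

/-- The one-form `dm / 2m` for `m = 1 / ell(ξ, 1)`. -/
noncomputable def rescalingForm (S : AffineSlice V) (z : V × (V →L[ℝ] ℝ)) :
    V × (V →L[ℝ] ℝ) →L[ℝ] ℝ :=
  (-(1 / 2 * (S.ell (z.2, 1))⁻¹)) •
    (S.ell ∘L ContinuousLinearMap.inl ℝ _ ℝ ∘L ContinuousLinearMap.snd ℝ V _)

lemma rescalingForm_apply (X : V × (V →L[ℝ] ℝ)) :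
    rescalingForm S z X = -(1 / 2 * (S.ell (z.2, 1))⁻¹) * S.ell (X.2, 0) := by
  simp [rescalingForm]

lemma fderiv_splitChristoffel_sliceCoord (hz : S.ell (z.2, 1) ≠ 0)
    (hΓ : ContDiffAt ℝ ∞ Γ z.1) (hP : ContDiffAt ℝ ∞ P z.1) (X X' : V × (V →L[ℝ] ℝ)) :
    fderiv ℝ (fun z : V × (V →L[ℝ] ℝ) => (z.1, sliceCoord S z)) z
        ((splitChristoffel (sliceLift (cotangentSlice V) Γ P)
            (sliceConnection (cotangentSlice V) Γ P z) z +
          paraCTensor (splitJ (sliceLift (cotangentSlice V) Γ P z)) (rescalingForm S z)) X X') =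
      fderiv ℝ (fderiv ℝ (fun z : V × (V →L[ℝ] ℝ) => (z.1, sliceCoord S z))) z X X' +
        splitChristoffel (sliceLift S Γ P) (sliceConnection S Γ P (z.1, sliceCoord S z))
          (z.1, sliceCoord S z)
          (fderiv ℝ (fun z : V × (V →L[ℝ] ℝ) => (z.1, sliceCoord S z)) z X)
          (fderiv ℝ (fun z : V × (V →L[ℝ] ℝ) => (z.1, sliceCoord S z)) z X') := by
  have hc : ContinuousAt (fun z : V × (V →L[ℝ] ℝ) => S.ell (z.2, 1)) z :=
    (hasFDerivAt_ell z).continuousAt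
  refine fderiv_splitChristoffel (ψ := id) contDiffAt_id (contDiffAt_sliceCoord hz)
    ((contDiffAt_sliceLift hΓ hP).differentiableAt (by simp))
    ((contDiffAt_sliceLift (z := (z.1, sliceCoord S z)) hΓ hP).differentiableAt (by simp))
    ((hc.eventually_ne hz).mono fun w hw => intertwinesLifts_sliceCoord hw) ?_ ?_ X X'
  · intro x x'
    have e : ∀ x, 2 * rescalingForm S z (x, sliceLift (cotangentSlice V) Γ P z x) =
        z.2 x - S.ell (tractorForm (Γ z.1) (P z.1) (S.sect (sliceCoord S z)) x) := by
      intro x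
      have e : ((z.2 ∘L Γ z.1 x - P z.1 x - z.2 x • z.2, 0) : (V →L[ℝ] ℝ) × ℝ) =
          tractorForm (Γ z.1) (P z.1) (z.2, 1) x - z.2 x • (z.2, 1) := by
        rw [tractorForm_apply]; ext1 <;> simp
      rw [rescalingForm_apply, cotangentLift_apply, e, sect_sliceCoord hz, tractorForm_smul]
      simp only [map_sub, map_smul, smul_eq_mul]
      field_simp
      ring
    have e2 : fderiv ℝ (fderiv ℝ (id : V → V)) = 0 := by
      have : fderiv ℝ (id : V → V) = fun _ => ContinuousLinearMap.id ℝ V := by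
        ext1 x; exact fderiv_id
      rw [this]
      ext1 x
      simp
    rw [e, e, e2, cotangentConnection_apply, sliceConnection_apply, fderiv_id]
    simp
    module
  · intro p p'
    rw [fderiv_fderiv_sliceCoord hz, rescalingForm_apply, rescalingForm_apply]
    module

lemma fderiv_paraCTensor_of_comm {Z Z' : Type*} [NormedAddCommGroup Z] [NormedSpace ℝ Z]
    [NormedAddCommGroup Z'] [NormedSpace ℝ Z'] {A : Z →L[ℝ] Z'} {J : Z →L[ℝ] Z}
    {J' : Z' →L[ℝ] Z'} (h : ∀ X, A (J X) = J' (A X)) (Υ : Z' →L[ℝ] ℝ) (X X' : Z) :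
    A (paraCTensor J (Υ ∘L A) X X') = paraCTensor J' Υ (A X) (A X') := by
  simp [paraCTensor_apply, h]

end Rescaling

end Tractor

section RescaledMetric

/-- The symmetric product of two linear forms. -/
noncomputable def symForm {Z : Type*} [NormedAddCommGroup Z] [NormedSpace ℝ Z] (a b : Z →L[ℝ] ℝ) :
    Z →L[ℝ] Z →L[ℝ] ℝ :=
  (1 / 2 : ℝ) • (a.smulRight b + b.smulRight a)

lemma symForm_apply {Z : Type*} [NormedAddCommGroup Z] [NormedSpace ℝ Z] (a b : Z →L[ℝ] ℝ)
    (X X' : Z) : symForm a b X X' = 1 / 2 * (a X * b X' + b X * a X') := by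
  simp [symForm]
  ring

lemma contDiffWithinAt_symForm {D Z : Type*} [NormedAddCommGroup D] [NormedSpace ℝ D]
    [NormedAddCommGroup Z] [NormedSpace ℝ Z] {a b : D → Z →L[ℝ] ℝ} {s : Set D} {d : D}
    (ha : ContDiffWithinAt ℝ ∞ a s d) (hb : ContDiffWithinAt ℝ ∞ b s d) :
    ContDiffWithinAt ℝ ∞ (fun d => symForm (a d) (b d)) s d :=
  ContDiffWithinAt.const_smul (1 / 2 : ℝ) ((ha.smulRight hb).add (hb.smulRight ha))

variable {V : Type*} [NormedAddCommGroup V] [NormedSpace ℝ V]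

/-- The vertical part of a tangent vector, as an element of `V* × ℝ`. -/
noncomputable def sliceVert (S : AffineSlice V) (l : V →L[ℝ] V →L[ℝ] ℝ) :
    V × (V →L[ℝ] ℝ) →L[ℝ] (V →L[ℝ] ℝ) × ℝ :=
  S.lin ∘L (ContinuousLinearMap.snd ℝ V (V →L[ℝ] ℝ) - l ∘L ContinuousLinearMap.fst ℝ V _)

lemma sliceVert_apply (S : AffineSlice V) (l : V →L[ℝ] V →L[ℝ] ℝ) (X : V × (V →L[ℝ] ℝ)) :
    sliceVert S l X = S.lin (X.2 - l X.1) := by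
  simp [sliceVert]

/-- The bilinear form `T g + (dT² - θ²) / (4 T)` in the affine chart `S`, for `T = f t`; here `δ`
is the derivative of `f`, `A` the cotractor connection form and `l` the horizontal lift. -/

noncomputable def sliceMetric (S : AffineSlice V) (A : V →L[ℝ] (V →L[ℝ] ℝ) × ℝ)
    (l : V →L[ℝ] V →L[ℝ] ℝ) (f : ℝ) (δ : V × (V →L[ℝ] ℝ) →L[ℝ] ℝ) (y : V →L[ℝ] ℝ) :
    V × (V →L[ℝ] ℝ) →L[ℝ] V × (V →L[ℝ] ℝ) →L[ℝ] ℝ :=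
  let β := sliceVert S l
  let βt := ContinuousLinearMap.snd ℝ _ ℝ ∘L β
  let hor := (ContinuousLinearMap.inl ℝ V (V →L[ℝ] ℝ) + ContinuousLinearMap.inr ℝ V _ ∘L l) ∘L
    ContinuousLinearMap.fst ℝ V (V →L[ℝ] ℝ)
  let δH := δ ∘L hor
  let δV := δ - δ ∘L hor
  let τH := ContinuousLinearMap.snd ℝ _ ℝ ∘L S.lin ∘L l ∘L ContinuousLinearMap.fst ℝ V (V →L[ℝ] ℝ)
  let b := bilinComp (ContinuousLinearMap.id ℝ ℝ) (ContinuousLinearMap.id ℝ (V →L[ℝ] ℝ))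
    (ContinuousLinearMap.fst ℝ _ ℝ ∘L β) (ContinuousLinearMap.fst ℝ V (V →L[ℝ] ℝ))
  f • ((1 / 2 : ℝ) • (b + b.flip) -
      symForm βt (S.ell ∘L A ∘L ContinuousLinearMap.fst ℝ V (V →L[ℝ] ℝ))) +
    symForm βt δH + symForm δV τH + ((S.sect y).2 * f⁻¹) • symForm δV δH

lemma sliceMetric_apply (S : AffineSlice V) (A : V →L[ℝ] (V →L[ℝ] ℝ) × ℝ)
    (l : V →L[ℝ] V →L[ℝ] ℝ) (f : ℝ) (δ : V × (V →L[ℝ] ℝ) →L[ℝ] ℝ) (y : V →L[ℝ] ℝ)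
    (X X' : V × (V →L[ℝ] ℝ)) :
    sliceMetric S A l f δ y X X' =
      f / 2 * ((sliceVert S l X).1 X'.1 + (sliceVert S l X').1 X.1 -
        (sliceVert S l X).2 * S.ell (A X'.1) - (sliceVert S l X').2 * S.ell (A X.1)) +
      1 / 2 * ((sliceVert S l X).2 * δ (X'.1, l X'.1) + (sliceVert S l X').2 * δ (X.1, l X.1)) +
      1 / 2 * ((δ X - δ (X.1, l X.1)) * (S.lin (l X'.1)).2 +
        (δ X' - δ (X'.1, l X'.1)) * (S.lin (l X.1)).2) +
      1 / 2 * ((S.sect y).2 * f⁻¹) * ((δ X - δ (X.1, l X.1)) * δ (X'.1, l X'.1) +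
        (δ X' - δ (X'.1, l X'.1)) * δ (X.1, l X.1)) := by
  have e : ∀ x, δ (x, l x) = δ (x, 0) + δ (0, l x) := by
    intro x; rw [← map_add]; simp
  simp [sliceMetric, symForm_apply, e]
  ring

lemma contDiffWithinAt_sliceMetric {D : Type*} [NormedAddCommGroup D] [NormedSpace ℝ D]
    (S : AffineSlice V) {A : D → V →L[ℝ] (V →L[ℝ] ℝ) × ℝ} {l : D → V →L[ℝ] V →L[ℝ] ℝ} {f : D → ℝ}
    {δ : D → V × (V →L[ℝ] ℝ) →L[ℝ] ℝ} {y : D → V →L[ℝ] ℝ} {s : Set D} {d : D}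
    (hA : ContDiffWithinAt ℝ ∞ A s d) (hl : ContDiffWithinAt ℝ ∞ l s d)
    (hf : ContDiffWithinAt ℝ ∞ f s d) (hf0 : f d ≠ 0) (hδ : ContDiffWithinAt ℝ ∞ δ s d)
    (hy : ContDiffWithinAt ℝ ∞ y s d) :
    ContDiffWithinAt ℝ ∞ (fun d => sliceMetric S (A d) (l d) (f d) (δ d) (y d)) s d := by
  have hβ : ContDiffWithinAt ℝ ∞ (fun d => sliceVert S (l d)) s d :=
    contDiffWithinAt_const.clm_comp (contDiffWithinAt_const.sub
      (hl.clm_comp contDiffWithinAt_const))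
  have hβt : ContDiffWithinAt ℝ ∞ (fun d => ContinuousLinearMap.snd ℝ (V →L[ℝ] ℝ) ℝ ∘L
      sliceVert S (l d)) s d := contDiffWithinAt_const.clm_comp hβ
  have hhor : ContDiffWithinAt ℝ ∞ (fun d => (ContinuousLinearMap.inl ℝ V (V →L[ℝ] ℝ) +
      ContinuousLinearMap.inr ℝ V _ ∘L l d) ∘L ContinuousLinearMap.fst ℝ V (V →L[ℝ] ℝ)) s d :=
    (contDiffWithinAt_const.add (contDiffWithinAt_const.clm_comp hl)).clm_comp
      contDiffWithinAt_const
  have hδH := hδ.clm_comp hhor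
  have hτ : ContDiffWithinAt ℝ ∞ (fun d => ContinuousLinearMap.snd ℝ (V →L[ℝ] ℝ) ℝ ∘L S.lin ∘L
      l d ∘L ContinuousLinearMap.fst ℝ V (V →L[ℝ] ℝ)) s d :=
    contDiffWithinAt_const.clm_comp (contDiffWithinAt_const.clm_comp
      (hl.clm_comp contDiffWithinAt_const))
  have he : ContDiffWithinAt ℝ ∞ (fun d => S.ell ∘L A d ∘L
      ContinuousLinearMap.fst ℝ V (V →L[ℝ] ℝ)) s d :=
    contDiffWithinAt_const.clm_comp (hA.clm_comp contDiffWithinAt_const)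
  have hb := ContDiffWithinAt.bilinComp (s := s) (d := d)
    (A := fun _ => ContinuousLinearMap.id ℝ ℝ)
    (B := fun _ => ContinuousLinearMap.id ℝ (V →L[ℝ] ℝ))
    (p := fun d => ContinuousLinearMap.fst ℝ (V →L[ℝ] ℝ) ℝ ∘L sliceVert S (l d))
    (p' := fun _ => ContinuousLinearMap.fst ℝ V (V →L[ℝ] ℝ))
    contDiffWithinAt_const contDiffWithinAt_const
    (contDiffWithinAt_const.clm_comp hβ) contDiffWithinAt_const
  have hm : ContDiffWithinAt ℝ ∞ (fun d => (S.sect (y d)).2) s d :=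
    (S.contDiff_sect.contDiffAt.comp_contDiffWithinAt d hy).snd
  exact (((hf.smul ((ContDiffWithinAt.const_smul (1 / 2 : ℝ) (hb.add hb.clm_flip)).sub
    (contDiffWithinAt_symForm hβt he))).add (contDiffWithinAt_symForm hβt hδH)).add
    (contDiffWithinAt_symForm (hδ.sub hδH) hτ)).add
    ((hm.mul (hf.inv hf0)).smul (contDiffWithinAt_symForm (hδ.sub hδH) hδH))

variable {Γ : V → V →L[ℝ] V →L[ℝ] V} {P : V → V →L[ℝ] V →L[ℝ] ℝ}
  {z : V × (V →L[ℝ] ℝ)} {S : AffineSlice V}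

/-- The linear form `dT = f dt + t df` in the affine chart `S`. -/
noncomputable def sliceDT (S : AffineSlice V) (f : ℝ) (δ : V × (V →L[ℝ] ℝ) →L[ℝ] ℝ)
    (y : V →L[ℝ] ℝ) : V × (V →L[ℝ] ℝ) →L[ℝ] ℝ :=
  f • (ContinuousLinearMap.snd ℝ _ ℝ ∘L S.lin ∘L ContinuousLinearMap.snd ℝ V (V →L[ℝ] ℝ)) +
    (S.sect y).2 • δ

lemma sliceDT_apply (f : ℝ) (δ : V × (V →L[ℝ] ℝ) →L[ℝ] ℝ) (y : V →L[ℝ] ℝ)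
    (X : V × (V →L[ℝ] ℝ)) :
    sliceDT S f δ y X = f * (S.lin X.2).2 + (S.sect y).2 * δ X := by
  simp [sliceDT]

lemma sliceVert_fderiv (hz : S.ell (z.2, 1) ≠ 0) (X : V × (V →L[ℝ] ℝ)) :
    sliceVert S (sliceLift S Γ P (z.1, sliceCoord S z))
        (X.1, fderiv ℝ (sliceCoord S) z X) =
      (S.ell (z.2, 1))⁻¹ • (X.2 - sliceLift (cotangentSlice V) Γ P z X.1, 0) -
      ((S.ell (z.2, 1))⁻¹ ^ 2 * S.ell (X.2 - sliceLift (cotangentSlice V) Γ P z X.1, 0)) •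
        (z.2, 1) := by
  have h := intertwinesLifts_sliceCoord (Γ := Γ) (P := P) hz X.1
  simp only [fderiv_id, ContinuousLinearMap.id_apply, id] at h
  rw [sliceVert_apply, h, ← map_sub, fderiv_sliceCoord hz]
  simp only [map_sub, map_smul, S.lin_tau, smul_sub, smul_smul, Prod.snd_sub]
  have : (S.ell (z.2, 1))⁻¹ ^ 2 * S.ell (X.2 - sliceLift (cotangentSlice V) Γ P z X.1, 0) *
      S.ell (z.2, 1) = (S.ell (z.2, 1))⁻¹ *
        S.ell (X.2 - sliceLift (cotangentSlice V) Γ P z X.1, 0) := by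
    field_simp
  rw [this]
  abel

lemma sliceMetric_fderiv (hz : S.ell (z.2, 1) ≠ 0) {f : ℝ} (hf : f ≠ 0)
    (δ : V × (V →L[ℝ] ℝ) →L[ℝ] ℝ) (X X' : V × (V →L[ℝ] ℝ)) :
    let Z := fun X : V × (V →L[ℝ] ℝ) => (X.1, fderiv ℝ (sliceCoord S) z X)
    let l := sliceLift S Γ P (z.1, sliceCoord S z)
    let τ := f * (S.ell (z.2, 1))⁻¹
    let dT := sliceDT S f δ (sliceCoord S z)
    sliceMetric S (tractorForm (Γ z.1) (P z.1) (S.sect (sliceCoord S z))) l f δ (sliceCoord S z)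
        (Z X) (Z X') =
      τ * splitMetric (sliceLift (cotangentSlice V) Γ P z) X X' + (4 * τ)⁻¹ *
        (dT (Z X) * dT (Z X') - dT (splitJ l (Z X)) * dT (splitJ l (Z X'))) := by
  intro Z l τ dT
  have hsec : (S.sect (sliceCoord S z)) = (S.ell (z.2, 1))⁻¹ • (z.2, 1) := sect_sliceCoord hz
  have hs2 : (S.sect (sliceCoord S z)).2 = (S.ell (z.2, 1))⁻¹ := by rw [hsec]; simp
  have hv := fun X : V × (V →L[ℝ] ℝ) => sliceVert_fderiv (Γ := Γ) (P := P) (S := S) hz X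
  have hl : ∀ x, (S.lin (l x)).2 = (S.ell (z.2, 1))⁻¹ * z.2 x - S.ell (tractorForm (Γ z.1) (P z.1)
      (S.sect (sliceCoord S z)) x) * (S.ell (z.2, 1))⁻¹ := by
    intro x
    rw [lin_sliceLift]
    simp only [hsec, tractorForm_apply]
    simp
  have hlin : ∀ Y : V × (V →L[ℝ] ℝ), (S.lin Y.2).2 = (sliceVert S l Y).2 + (S.lin (l Y.1)).2 := by
    intro Y
    rw [sliceVert_apply, map_sub]; simp
  have hdT : ∀ Y : V × (V →L[ℝ] ℝ), dT Y = f * (sliceVert S l Y).2 + f * (S.lin (l Y.1)).2 +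
      (S.ell (z.2, 1))⁻¹ * δ Y := by
    intro Y
    rw [sliceDT_apply, hlin, hsec]
    simp
    ring
  have hθ : ∀ Y : V × (V →L[ℝ] ℝ), dT (splitJ l Y) = f * (sliceVert S l Y).2 -
      f * (S.lin (l Y.1)).2 + (S.ell (z.2, 1))⁻¹ * (δ Y - 2 * δ (Y.1, l Y.1)) := by
    intro Y
    have e1 : (splitJ l Y) = Y - (2 : ℝ) • (Y.1, l Y.1) := by
      rw [splitJ_apply]; ext1 <;> simp; module
    rw [e1, map_sub, map_smul, hdT, hdT (Y.1, l Y.1)]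
    have e2 : sliceVert S l (Y.1, l Y.1) = 0 := by simp [sliceVert_apply]
    rw [e2]
    simp
    ring
  rw [sliceMetric_apply, hdT, hdT, hθ, hθ, splitMetric_apply, hs2]
  simp only [Z, l, hv]
  change ∀ x, (S.lin (sliceLift S Γ P (z.1, sliceCoord S z) x)).2 = _ at hl
  simp only [hl]
  simp only [Prod.fst_sub, Prod.snd_sub, Prod.smul_fst, Prod.smul_snd, sub_apply, smul_apply,
    smul_eq_mul, mul_zero, mul_one, zero_sub, τ]
  field_simp
  ring

end RescaledMetric

section Calculus

variable {E : Type*} [NormedAddCommGroup E] [NormedSpace ℝ E]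
  {H : Type*} [TopologicalSpace H] {I : ModelWithCorners ℝ E H}
  {M : Type*} [TopologicalSpace M] [ChartedSpace H M] [IsManifold I ∞ M]
  {Z : Type*} [NormedAddCommGroup Z] [NormedSpace ℝ Z] {L : E ≃L[ℝ] Z}

lemma coordRange_eq_univ [I.Boundaryless] : coordRange I L = univ := by
  simp [coordRange, I.range_eq_univ]

lemma coordTarget_mem_nhds [I.Boundaryless] {x₀ P : M} (hP : P ∈ (chartAt H x₀).source) :
    coordTarget I L x₀ ∈ 𝓝 (coordMap I L x₀ P) := by
  have := coordTarget_mem_nhdsWithin (I := I) (L := L) hP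
  rwa [coordRange_eq_univ, nhdsWithin_univ] at this

lemma continuousAt_coordInv [I.Boundaryless] {x₀ P : M} (hP : P ∈ (chartAt H x₀).source) :
    ContinuousAt (coordInv I L x₀) (coordMap I L x₀ P) := by
  have := (contMDiffWithinAt_coordInv (I := I) (L := L)
    (coordMap_mem_coordTarget hP)).continuousWithinAt
  rwa [coordRange_eq_univ, continuousWithinAt_univ] at this

lemma tendsto_coordInv [I.Boundaryless] {x₀ P : M} (hP : P ∈ (chartAt H x₀).source) :
    Tendsto (coordInv I L x₀) (𝓝 (coordMap I L x₀ P)) (𝓝 P) := by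
  have := (continuousAt_coordInv (I := I) (L := L) hP).tendsto
  rwa [coordInv_coordMap hP] at this

lemma contMDiffAt_coordInv [I.Boundaryless] {x₀ P : M} (hP : P ∈ (chartAt H x₀).source) :
    ContMDiffAt 𝓘(ℝ, Z) I ∞ (coordInv I L x₀) (coordMap I L x₀ P) := by
  have := contMDiffWithinAt_coordInv (I := I) (L := L) (coordMap_mem_coordTarget hP)
  rwa [coordRange_eq_univ, contMDiffWithinAt_univ] at this

lemma differentiableAt_vectorField [I.Boundaryless] {x₀ P : M} (hP : P ∈ (chartAt H x₀).source)
    {Y : ∀ p : M, TangentSpace I p}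
    (hY : MDifferentiableAt I (I.prod 𝓘(ℝ, E)) (fun p => TotalSpace.mk' E p (Y p)) P) :
    DifferentiableAt ℝ ((fun p => coordDeriv I L x₀ p (Y p)) ∘ coordInv I L x₀)
      (coordMap I L x₀ P) := by
  have := MDifferentiableAt.comp_coordInv (L := L) hP
    ((mdifferentiableAt_vectorField_iff (L := L) hP Y).1 hY)
  rwa [coordRange_eq_univ, differentiableWithinAt_univ] at this

lemma coordDeriv_localCov [I.Boundaryless] {x₀ P : M} (hP : P ∈ (chartAt H x₀).source)
    (Γ : Z →L[ℝ] Z →L[ℝ] Z) (Y : ∀ p : M, TangentSpace I p) (v : TangentSpace I P) :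
    coordDeriv I L x₀ P (localCov I L x₀ Γ Y P v) =
      fderiv ℝ ((fun p => coordDeriv I L x₀ p (Y p)) ∘ coordInv I L x₀) (coordMap I L x₀ P)
        (coordDeriv I L x₀ P v) + Γ (coordDeriv I L x₀ P v) (coordDeriv I L x₀ P (Y P)) := by
  simp only [localCov, ContinuousLinearMap.comp_apply, coordDeriv_coordLift hP, add_apply,
    ContinuousLinearMap.flip_apply, coordRange_eq_univ, fderivWithin_univ]

lemma mfderiv_eq_fderiv_comp [I.Boundaryless] {F : Type*} [NormedAddCommGroup F] [NormedSpace ℝ F]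
    {f : M → F} {x₀ P : M} (hP : P ∈ (chartAt H x₀).source)
    (hf : MDifferentiableAt I 𝓘(ℝ, F) f P) {g : Z → F}
    (hg : ∀ᶠ z in 𝓝 (coordMap I L x₀ P), f (coordInv I L x₀ z) = g z) (v : TangentSpace I P) :
    mvfderiv I f P v = fderiv ℝ g (coordMap I L x₀ P) (coordDeriv I L x₀ P v) := by
  rw [mfderiv_eq_fderivWithin_comp (L := L) hP hf, coordRange_eq_univ, fderivWithin_univ]
  have h : (f ∘ coordInv I L x₀) =ᶠ[𝓝 (coordMap I L x₀ P)] g := hg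
  rw [h.fderiv_eq]

lemma coordDeriv_injective {x₀ P : M} (hP : P ∈ (chartAt H x₀).source) :
    Function.Injective (coordDeriv I L x₀ P) :=
  Function.LeftInverse.injective (coordLift_coordDeriv hP)

lemma coordDeriv_inverse {x₀ P : M} (hP : P ∈ (chartAt H x₀).source) :
    (coordDeriv I L x₀ P).inverse = coordLift I L x₀ P :=
  ContinuousLinearMap.inverse_eq (by ext z; simp [coordDeriv_coordLift hP])
    (by ext z; exact coordLift_coordDeriv hP z)

/-- The Lie bracket in coordinates. -/
lemma coordDeriv_mlieBracket [I.Boundaryless] [CompleteSpace E] {x₀ P : M}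
    (hP : P ∈ (chartAt H x₀).source) {X Y : ∀ p : M, TangentSpace I p}
    (hX : MDifferentiableAt I (I.prod 𝓘(ℝ, E)) (fun p => TotalSpace.mk' E p (X p)) P)
    (hY : MDifferentiableAt I (I.prod 𝓘(ℝ, E)) (fun p => TotalSpace.mk' E p (Y p)) P) :
    coordDeriv I L x₀ P (VectorField.mlieBracket I X Y P) =
      fderiv ℝ ((fun p => coordDeriv I L x₀ p (Y p)) ∘ coordInv I L x₀) (coordMap I L x₀ P)
        (coordDeriv I L x₀ P (X P)) -
      fderiv ℝ ((fun p => coordDeriv I L x₀ p (X p)) ∘ coordInv I L x₀) (coordMap I L x₀ P)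
        (coordDeriv I L x₀ P (Y P)) := by
  have hZ : CompleteSpace Z := (completeSpace_congr (e := L.toEquiv) L.isUniformEmbedding).1 ‹_›
  have hM : IsManifold I (minSmoothness ℝ 2) M := by
    rw [minSmoothness_of_isRCLikeNormedField]
    exact IsManifold.of_le (n := ∞) (by norm_cast)
  let V : (∀ p : M, TangentSpace I p) → ∀ z : Z, TangentSpace 𝓘(ℝ, Z) z :=
    fun Y z => coordDeriv I L x₀ (coordInv I L x₀ z) (Y (coordInv I L x₀ z))
  have hmf : ∀ {Q : M}, Q ∈ (chartAt H x₀).source → ∀ w : TangentSpace 𝓘(ℝ, Z) (coordMap I L x₀ Q),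
      (mfderiv I 𝓘(ℝ, Z) (coordMap I L x₀) Q).inverse w = coordLift I L x₀ Q w := by
    intro Q hQ w
    have e : (mfderiv I 𝓘(ℝ, Z) (coordMap I L x₀) Q).inverse = coordLift I L x₀ Q := by
      rw [mfderiv_coordMap hQ]
      exact coordDeriv_inverse (Z := Z) (L := L) hQ
    exact DFunLike.congr_fun e (show Z from w)
  have hpull : ∀ Y : ∀ p : M, TangentSpace I p, VectorField.mpullback I 𝓘(ℝ, Z)
      (coordMap I L x₀) (V Y) =ᶠ[𝓝 P] Y := by
    intro Y
    filter_upwards [eventually_mem_source hP] with Q hQ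
    rw [VectorField.mpullback_apply, hmf hQ]
    refine (congrArg (coordLift I L x₀ Q) (coordField_coordMap hQ Y)).trans ?_
    exact coordLift_coordDeriv hQ _
  have hd : ∀ {Y : ∀ p : M, TangentSpace I p},
      MDifferentiableAt I (I.prod 𝓘(ℝ, E)) (fun p => TotalSpace.mk' E p (Y p)) P →
      MDifferentiableAt 𝓘(ℝ, Z) (𝓘(ℝ, Z).prod 𝓘(ℝ, Z))
        (fun z => TotalSpace.mk' Z z (V Y z)) (coordMap I L x₀ P) := by
    intro Y hY
    have h := (differentiableAt_vectorField (L := L) hP hY).mdifferentiableAt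
    refine (mdifferentiableAt_totalSpace _ _).2 ⟨mdifferentiableAt_id, ?_⟩
    refine h.congr_of_eventuallyEq (Eventually.of_forall fun z => ?_)
    simp [V]
  have h := VectorField.mpullback_mlieBracket (I := I) (n := ∞) (hd hX) (hd hY)
    (contMDiffAt_coordMap hP) (by rw [minSmoothness_of_isRCLikeNormedField]; norm_cast)
  rw [(hpull X).mlieBracket_vectorField_eq (hpull Y), VectorField.mpullback_apply, hmf hP] at h
  rw [← h, ← VectorField.mlieBracketWithin_univ, VectorField.mlieBracketWithin_eq_lieBracketWithin]
  refine (coordDeriv_coordLift (Z := Z) (L := L) hP _).trans ?_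
  rw [VectorField.lieBracketWithin_univ, ← coordField_coordMap hP X, ← coordField_coordMap hP Y]
  rfl

lemma localCov_torsion [I.Boundaryless] [CompleteSpace E] {x₀ P : M}
    (hP : P ∈ (chartAt H x₀).source) {X Y : ∀ p : M, TangentSpace I p}
    (hX : MDifferentiableAt I (I.prod 𝓘(ℝ, E)) (fun p => TotalSpace.mk' E p (X p)) P)
    (hY : MDifferentiableAt I (I.prod 𝓘(ℝ, E)) (fun p => TotalSpace.mk' E p (Y p)) P)
    (Γ : Z →L[ℝ] Z →L[ℝ] Z) :
    coordDeriv I L x₀ P (localCov I L x₀ Γ Y P (X P) - localCov I L x₀ Γ X P (Y P) -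
        VectorField.mlieBracket I X Y P) =
      Γ (coordDeriv I L x₀ P (X P)) (coordDeriv I L x₀ P (Y P)) -
        Γ (coordDeriv I L x₀ P (Y P)) (coordDeriv I L x₀ P (X P)) := by
  rw [map_sub, map_sub, coordDeriv_localCov hP, coordDeriv_localCov hP,
    coordDeriv_mlieBracket hP hX hY]
  abel

/-- A bilinear form whose coordinate expression is preserved by the Christoffel symbols `Γ`. -/
lemma mvfderiv_bilinear_localCov [I.Boundaryless] {x₀ P : M} (hP : P ∈ (chartAt H x₀).source)
    {b : ∀ p : M, TangentSpace I p →L[ℝ] TangentSpace I p →L[ℝ] ℝ}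
    {β : Z → Z →L[ℝ] Z →L[ℝ] ℝ} (hβ : DifferentiableAt ℝ β (coordMap I L x₀ P))
    (hb : ∀ p ∈ (chartAt H x₀).source, ∀ v w, b p v w =
      β (coordMap I L x₀ p) (coordDeriv I L x₀ p v) (coordDeriv I L x₀ p w))
    {Γ : Z →L[ℝ] Z →L[ℝ] Z}
    (hΓ : ∀ v X X', fderiv ℝ (fun z => β z X X') (coordMap I L x₀ P) v =
      β (coordMap I L x₀ P) (Γ v X) X' + β (coordMap I L x₀ P) X (Γ v X'))
    {X Y : ∀ p : M, TangentSpace I p}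
    (hX : MDifferentiableAt I (I.prod 𝓘(ℝ, E)) (fun p => TotalSpace.mk' E p (X p)) P)
    (hY : MDifferentiableAt I (I.prod 𝓘(ℝ, E)) (fun p => TotalSpace.mk' E p (Y p)) P)
    (v : TangentSpace I P) :
    mvfderiv I (fun q => b q (X q) (Y q)) P v =
      b P (localCov I L x₀ Γ X P v) (Y P) + b P (X P) (localCov I L x₀ Γ Y P v) := by
  set z₀ := coordMap I L x₀ P with hz₀
  have dX := differentiableAt_vectorField (L := L) hP hX
  have dY := differentiableAt_vectorField (L := L) hP hY
  set Xh := (fun p => coordDeriv I L x₀ p (X p)) ∘ coordInv I L x₀ with hXh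
  set Yh := (fun p => coordDeriv I L x₀ p (Y p)) ∘ coordInv I L x₀ with hYh
  have e : ∀ᶠ z in 𝓝 z₀, (fun q => b q (X q) (Y q)) (coordInv I L x₀ z) = β z (Xh z) (Yh z) := by
    filter_upwards [coordTarget_mem_nhds (L := L) hP] with z hz
    have := hb _ (coordInv_mem_source hz) (X (coordInv I L x₀ z)) (Y (coordInv I L x₀ z))
    rw [coordMap_coordInv hz] at this
    exact this
  have hβXY := (hβ.hasFDerivAt.clm_apply dX.hasFDerivAt).clm_apply dY.hasFDerivAt
  have hd : MDifferentiableAt I 𝓘(ℝ, ℝ) (fun q => b q (X q) (Y q)) P := by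
    have h1 : MDifferentiableAt I 𝓘(ℝ, ℝ) ((fun z => β z (Xh z) (Yh z)) ∘ coordMap I L x₀) P :=
      (hβXY.differentiableAt.mdifferentiableAt).comp P
        ((contMDiffAt_coordMap hP).mdifferentiableAt (by simp))
    refine h1.congr_of_eventuallyEq ?_
    filter_upwards [eventually_mem_source hP] with Q hQ
    have e1 : Xh (coordMap I L x₀ Q) = _ := coordField_coordMap hQ X
    have e2 : Yh (coordMap I L x₀ Q) = _ := coordField_coordMap hQ Y
    rw [Function.comp_apply, e1, e2]
    exact hb Q hQ _ _
  rw [mfderiv_eq_fderiv_comp hP hd e, hb P hP, hb P hP, coordDeriv_localCov hP,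
    coordDeriv_localCov hP]
  have e1 : Xh z₀ = coordDeriv I L x₀ P (X P) := coordField_coordMap hP X
  have e2 : Yh z₀ = coordDeriv I L x₀ P (Y P) := coordField_coordMap hP Y
  have h0 : ∀ v X X', fderiv ℝ (fun z => β z X X') z₀ v = fderiv ℝ β z₀ v X X' := by
    intro v X X'
    have := (hβ.hasFDerivAt.clm_apply (hasFDerivAt_const X z₀)).clm_apply (hasFDerivAt_const X' z₀)
    rw [this.fderiv]
    simp
  rw [hβXY.fderiv, ← hz₀, ← e1, ← e2, ← hXh, ← hYh]
  have h1 := hΓ (coordDeriv I L x₀ P v) (Xh z₀) (Yh z₀)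
  rw [h0] at h1
  simp only [add_apply, ContinuousLinearMap.comp_apply, ContinuousLinearMap.flip_apply, h1,
    map_add]
  ring

/-- An endomorphism whose coordinate expression is preserved by the Christoffel symbols `Γ`. -/
lemma localCov_endomorphism [I.Boundaryless] {x₀ P : M} (hP : P ∈ (chartAt H x₀).source)
    {J : ∀ p : M, TangentSpace I p →L[ℝ] TangentSpace I p}
    {j : Z → Z →L[ℝ] Z} (hj : DifferentiableAt ℝ j (coordMap I L x₀ P))
    (hJ : ∀ p ∈ (chartAt H x₀).source, ∀ v, coordDeriv I L x₀ p (J p v) =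
      j (coordMap I L x₀ p) (coordDeriv I L x₀ p v))
    {Γ : Z →L[ℝ] Z →L[ℝ] Z}
    (hΓ : ∀ v X, fderiv ℝ (fun z => j z X) (coordMap I L x₀ P) v +
      Γ v (j (coordMap I L x₀ P) X) = j (coordMap I L x₀ P) (Γ v X))
    {X : ∀ p : M, TangentSpace I p}
    (hX : MDifferentiableAt I (I.prod 𝓘(ℝ, E)) (fun p => TotalSpace.mk' E p (X p)) P)
    (v : TangentSpace I P) :
    localCov I L x₀ Γ (fun q => J q (X q)) P v = J P (localCov I L x₀ Γ X P v) := by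
  set z₀ := coordMap I L x₀ P with hz₀
  have dX := differentiableAt_vectorField (L := L) hP hX
  apply coordDeriv_injective (L := L) hP
  rw [hJ P hP, coordDeriv_localCov hP, coordDeriv_localCov hP, hJ P hP]
  set Xh := (fun p => coordDeriv I L x₀ p (X p)) ∘ coordInv I L x₀ with hXh
  have e : (fun p => coordDeriv I L x₀ p (J p (X p))) ∘ coordInv I L x₀ =ᶠ[𝓝 z₀]
      fun z => j z (Xh z) := by
    filter_upwards [coordTarget_mem_nhds (L := L) hP] with z hz
    have := hJ _ (coordInv_mem_source hz) (X (coordInv I L x₀ z))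
    rw [coordMap_coordInv hz] at this
    exact this
  have e1 : Xh z₀ = coordDeriv I L x₀ P (X P) := coordField_coordMap hP X
  have h0 : ∀ v X, fderiv ℝ (fun z => j z X) z₀ v = fderiv ℝ j z₀ v X := by
    intro v X
    have := hj.hasFDerivAt.clm_apply (hasFDerivAt_const X z₀)
    rw [this.fderiv]
    simp
  rw [← hz₀, e.fderiv_eq, (hj.hasFDerivAt.clm_apply dX.hasFDerivAt).fderiv, ← e1, map_add]
  have h1 := hΓ (coordDeriv I L x₀ P v) (Xh z₀)
  rw [h0] at h1
  simp only [add_apply, ContinuousLinearMap.comp_apply, ContinuousLinearMap.flip_apply]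
  rw [← h1]
  abel

lemma contMDiffCovariantDerivative_of_localCov {D : AffineConnection I M}
    (h : ∀ P : M, ∃ Γ : Z → Z →L[ℝ] Z →L[ℝ] Z, ∃ L : E ≃L[ℝ] Z,
      ContDiffWithinAt ℝ ∞ Γ (coordRange I L) (coordMap I L P P) ∧
      ∀ Y, IsSmoothVectorField I Y → ∀ᶠ p in 𝓝 P, D Y p = localCov I L P (Γ (coordMap I L P p)) Y p) :
    D.ContMDiffCovariantDerivative ∞ := by
  refine ⟨⟨fun {Y} hY P _ => ?_⟩⟩
  have hY' : IsSmoothVectorField I Y := contMDiffOn_univ.1 (by simpa using hY)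
  obtain ⟨Γ, L, hΓ, h1⟩ := h P
  refine ContMDiffAt.contMDiffWithinAt ?_
  refine (contMDiffAt_localCov (L := L) (mem_chart_source H P) hΓ hY').congr_of_eventuallyEq ?_
  filter_upwards [h1 Y hY'] with p hp
  exact congrArg _ hp

end Calculus

section Curvature

variable {V : Type*} [NormedAddCommGroup V] [NormedSpace ℝ V]

/-- The curvature of the Christoffel symbols `Γ` on a vector space. -/
noncomputable def flatCurvature (Γ : V → V →L[ℝ] V →L[ℝ] V) (u x y z : V) : V :=
  fderiv ℝ Γ u x y z - fderiv ℝ Γ u y x z + Γ u x (Γ u y z) - Γ u y (Γ u x z)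

lemma flatCurvature_transform {Γ Γ' : V → V →L[ℝ] V →L[ℝ] V} {ψ : V → V} {u : V}
    (hψ : ContDiffAt ℝ ∞ ψ u) (hΓ : DifferentiableAt ℝ Γ u) (hΓ' : DifferentiableAt ℝ Γ' (ψ u))
    (h : ∀ᶠ w in 𝓝 u, ∀ x y, fderiv ℝ ψ w (Γ w x y) = fderiv ℝ (fderiv ℝ ψ) w x y +
      Γ' (ψ w) (fderiv ℝ ψ w x) (fderiv ℝ ψ w y)) (x y z : V) :
    fderiv ℝ ψ u (flatCurvature Γ u x y z) =
      flatCurvature Γ' (ψ u) (fderiv ℝ ψ u x) (fderiv ℝ ψ u y) (fderiv ℝ ψ u z) := by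
  have dψ : DifferentiableAt ℝ ψ u := hψ.differentiableAt (by simp)
  have c1 : ContDiffAt ℝ ∞ (fderiv ℝ ψ) u := hψ.fderiv_right (by simp)
  have d1 : DifferentiableAt ℝ (fderiv ℝ ψ) u := c1.differentiableAt (by simp)
  have d2 : DifferentiableAt ℝ (fderiv ℝ (fderiv ℝ ψ)) u :=
    (c1.fderiv_right (m := 1) (by norm_cast)).differentiableAt (by simp)
  have sym2 : ∀ x y, fderiv ℝ (fderiv ℝ ψ) u x y = fderiv ℝ (fderiv ℝ ψ) u y x :=
    hψ.isSymmSndFDerivAt (by simp; norm_cast)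
  have sym3 : ∀ x y, fderiv ℝ (fderiv ℝ (fderiv ℝ ψ)) u x y =
      fderiv ℝ (fderiv ℝ (fderiv ℝ ψ)) u y x :=
    c1.isSymmSndFDerivAt (by simp; norm_cast)
  have key : ∀ x y z, fderiv ℝ (fderiv ℝ ψ) u x (Γ u y z) + fderiv ℝ ψ u (fderiv ℝ Γ u x y z) =
      fderiv ℝ (fderiv ℝ (fderiv ℝ ψ)) u x y z +
      (fderiv ℝ Γ' (ψ u) (fderiv ℝ ψ u x) (fderiv ℝ ψ u y) (fderiv ℝ ψ u z) +
      Γ' (ψ u) (fderiv ℝ (fderiv ℝ ψ) u x y) (fderiv ℝ ψ u z) +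
      Γ' (ψ u) (fderiv ℝ ψ u y) (fderiv ℝ (fderiv ℝ ψ) u x z)) := by
    intro x y z
    have f1 := d1.hasFDerivAt.clm_apply ((hΓ.hasFDerivAt.clm_apply (hasFDerivAt_const y u)).clm_apply
      (hasFDerivAt_const z u))
    have f2 := (d2.hasFDerivAt.clm_apply (hasFDerivAt_const y u)).clm_apply (hasFDerivAt_const z u)
    have f3 := ((hΓ'.hasFDerivAt.comp u dψ.hasFDerivAt).clm_apply
      (d1.hasFDerivAt.clm_apply (hasFDerivAt_const y u))).clm_apply
      (d1.hasFDerivAt.clm_apply (hasFDerivAt_const z u))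
    have f4 := f1.unique ((f2.add f3).congr_of_eventuallyEq (h.mono fun w hw => hw y z))
    have f5 := congrArg (fun A : V →L[ℝ] V => A x) f4
    simp at f5
    rw [add_comm, f5]
    abel
  have h0 := h.self_of_nhds
  unfold flatCurvature
  have k1 := key x y z
  have k2 := key y x z
  rw [sym3 y x, sym2 y x] at k2
  simp only [map_add, map_sub]
  rw [h0 x (Γ u y z), h0 y (Γ u x z), h0 y z, h0 x z, eq_sub_of_add_eq' k1, eq_sub_of_add_eq' k2]
  simp only [map_add]
  abel

end Curvature

section Base

variable {n : ℕ} {N : Type*} [TopologicalSpace N] [ChartedSpace 𝕍 n N]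
  [IsManifold (𝓡 n) ∞ N]

variable (n) in
/-- The identity of the model space. -/
noncomputable abbrev idEquiv : 𝕍 n ≃L[ℝ] 𝕍 n :=
  ContinuousLinearEquiv.refl ℝ _

/-- The Christoffel symbols of `D` in the chart at `x₀`, as a bilinear map. -/
noncomputable def chartGamma (D : AffineConnection (𝓡 n) N) (x₀ : N)
    (u : 𝕍 n) :
    𝕍 n →L[ℝ] 𝕍 n →L[ℝ] 𝕍 n :=
  ∑ i, ∑ j, ∑ k, christoffel D x₀ i j k u • (EuclideanSpace.proj i).smulRight
    ((EuclideanSpace.proj j).smulRight (EuclideanSpace.single k (1 : ℝ)))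

/-- The projective Schouten tensor of `D` in the chart at `x₀`, as a bilinear form. -/
noncomputable def chartSchouten (D : AffineConnection (𝓡 n) N) (x₀ : N)
    (u : 𝕍 n) :
    𝕍 n →L[ℝ] 𝕍 n →L[ℝ] ℝ :=
  ∑ i, ∑ j, schouten D x₀ i j u • (EuclideanSpace.proj i).smulRight (EuclideanSpace.proj j)

lemma chartGamma_apply (D : AffineConnection (𝓡 n) N) (x₀ : N) (u v w : 𝕍 n) :
    chartGamma D x₀ u v w = ∑ i, ∑ j, ∑ k, (christoffel D x₀ i j k u * (v i * w j)) •
      EuclideanSpace.single k (1 : ℝ) := by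
  simp [chartGamma, smul_smul, mul_assoc]

lemma chartGamma_single (D : AffineConnection (𝓡 n) N) (x₀ : N) (u : 𝕍 n)
    (i j k : Fin n) : chartGamma D x₀ u (EuclideanSpace.single i 1) (EuclideanSpace.single j 1) k =
      christoffel D x₀ i j k u := by
  rw [chartGamma_apply]
  simp [Finset.sum_apply, Pi.single_apply]

lemma chartSchouten_apply (D : AffineConnection (𝓡 n) N) (x₀ : N)
    (u v w : 𝕍 n) :
    chartSchouten D x₀ u v w = ∑ i, ∑ j, schouten D x₀ i j u * (v i * w j) := by
  simp [chartSchouten, sum_apply]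

lemma coordField_eq_coordLift (x₀ : N) (i : Fin n) (y : N) :
    coordField x₀ i y = coordLift (𝓡 n) (idEquiv n) x₀ y (EuclideanSpace.single i 1) := rfl

lemma eq_sum_single (v : 𝕍 n) :
    v = ∑ i, v i • EuclideanSpace.single i (1 : ℝ) := by
  ext k
  simp [Finset.sum_apply, Pi.single_apply]

lemma contMDiffAt_coordField {x₀ P : N}
    (hP : P ∈ (chartAt 𝕍 n x₀).source) (j : Fin n) :
    ContMDiffAt (𝓡 n) ((𝓡 n).prod 𝓘(ℝ, 𝕍 n)) ∞
      (fun p => TotalSpace.mk' 𝕍 n p (coordField x₀ j p)) P := by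
  rw [contMDiffAt_vectorField_iff (L := idEquiv n) hP]
  refine (contMDiffAt_const (c := EuclideanSpace.single j (1 : ℝ))).congr_of_eventuallyEq ?_
  filter_upwards [eventually_mem_source hP] with Q hQ
  rw [coordField_eq_coordLift, coordDeriv_coordLift hQ]

lemma christoffel_eq (D : AffineConnection (𝓡 n) N) {x₀ P : N}
    (hP : P ∈ (chartAt 𝕍 n x₀).source) (i j k : Fin n) :
    christoffel D x₀ i j k (coordMap (𝓡 n) (idEquiv n) x₀ P) =
      coordDeriv (𝓡 n) (idEquiv n) x₀ P (D (coordField x₀ j) P (coordField x₀ i P)) k := by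
  have e : (extChartAt (𝓡 n) x₀).symm (coordMap (𝓡 n) (idEquiv n) x₀ P) = P :=
    coordInv_coordMap (L := idEquiv n) hP
  unfold christoffel
  rw [e]
  have h1 : MDifferentiableAt (𝓡 n) 𝓘(ℝ, 𝕍 n)
      (coordMap (𝓡 n) (idEquiv n) x₀) P :=
    (contMDiffAt_coordMap hP).mdifferentiableAt (by simp)
  have h2 : MDifferentiableAt 𝓘(ℝ, 𝕍 n) 𝓘(ℝ, ℝ)
      (EuclideanSpace.proj k : 𝕍 n →L[ℝ] ℝ) (coordMap (𝓡 n) (idEquiv n) x₀ P) :=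
    (EuclideanSpace.proj k : 𝕍 n →L[ℝ] ℝ).differentiableAt.mdifferentiableAt
  have h3 := mfderiv_comp P h2 h1
  rw [mfderiv_coordMap hP, mfderiv_eq_fderiv, ContinuousLinearMap.fderiv] at h3
  unfold mvfderiv
  refine (DFunLike.congr_fun h3 _).trans ?_
  rfl

lemma isCovariantDerivativeOn_localCov {x₀ : N}
    (Γ : N → 𝕍 n →L[ℝ] 𝕍 n →L[ℝ]
      𝕍 n) :
    IsCovariantDerivativeOn (I := 𝓡 n) 𝕍 n
      (fun Y P => localCov (𝓡 n) (idEquiv n) x₀ (Γ P) Y P)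
      (chartAt 𝕍 n x₀).source where
  add hσ hσ' hx := localCov_add hx _ hσ hσ'
  leibniz hσ hg hx := localCov_leibniz hx _ hσ hg

/-- A connection is given by its Christoffel symbols. -/
lemma connection_eq_localCov (D : AffineConnection (𝓡 n) N) {x₀ P : N}
    (hP : P ∈ (chartAt 𝕍 n x₀).source)
    {Y : ∀ p : N, TangentSpace (𝓡 n) p}
    (hY : MDifferentiableAt (𝓡 n) ((𝓡 n).prod 𝓘(ℝ, 𝕍 n))
      (fun p => TotalSpace.mk' 𝕍 n p (Y p)) P) :
    D Y P = localCov (𝓡 n) (idEquiv n) x₀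
      (chartGamma D x₀ (coordMap (𝓡 n) (idEquiv n) x₀ P)) Y P := by
  have h1 := isCovariantDerivativeOn_localCov (x₀ := x₀)
    (fun P : N => chartGamma D x₀ (coordMap (𝓡 n) (idEquiv n) x₀ P))
  have h2 := D.isCovariantDerivativeOn (s := (chartAt 𝕍 n x₀).source)
  have hd : ∀ {Y : ∀ p : N, TangentSpace (𝓡 n) p}, MDifferentiableAt (𝓡 n)
      ((𝓡 n).prod 𝓘(ℝ, 𝕍 n))
      (fun p => TotalSpace.mk' 𝕍 n p (Y p)) P →
      h2.difference h1 P (Y P) = D Y P - localCov (𝓡 n) (idEquiv n) x₀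
      (chartGamma D x₀ (coordMap (𝓡 n) (idEquiv n) x₀ P)) Y P :=
    fun hY => IsCovariantDerivativeOn.difference_apply h2 h1 hP hY
  have hc : ∀ j, h2.difference h1 P (coordField x₀ j P) = 0 := by
    intro j
    rw [hd ((contMDiffAt_coordField hP j).mdifferentiableAt (by simp)), sub_eq_zero]
    refine ContinuousLinearMap.ext fun v => ?_
    apply coordDeriv_injective (L := idEquiv n) hP
    rw [coordDeriv_localCov hP]
    have e : (fun p => coordDeriv (𝓡 n) (idEquiv n) x₀ p (coordField x₀ j p)) ∘
        coordInv (𝓡 n) (idEquiv n) x₀ =ᶠ[𝓝 (coordMap (𝓡 n) (idEquiv n) x₀ P)]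
        fun _ => EuclideanSpace.single j (1 : ℝ) := by
      filter_upwards [coordTarget_mem_nhds (L := idEquiv n) hP] with z hz
      simp only [Function.comp_apply, coordField_eq_coordLift]
      rw [coordDeriv_coordLift (coordInv_mem_source hz)]
    rw [e.fderiv_eq, fderiv_const_apply]
    simp only [zero_apply, zero_add]
    rw [coordField_eq_coordLift x₀ j P, coordDeriv_coordLift hP]
    obtain ⟨w, rfl⟩ : ∃ w, v = coordLift (𝓡 n) (idEquiv n) x₀ P w :=
      ⟨_, (coordLift_coordDeriv (L := idEquiv n) hP v).symm⟩
    rw [coordDeriv_coordLift hP]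
    conv_lhs => rw [eq_sum_single w]
    conv_rhs => rw [eq_sum_single w]
    simp only [map_sum, map_smul, sum_apply, smul_apply]
    refine Finset.sum_congr rfl fun i _ => ?_
    congr 1
    ext k
    rw [chartGamma_single, christoffel_eq D hP]
    rfl
  rw [← sub_eq_zero, ← hd hY]
  have e : Y P = ∑ j, (coordDeriv (𝓡 n) (idEquiv n) x₀ P (Y P)) j • coordField x₀ j P := by
    apply coordDeriv_injective (L := idEquiv n) hP
    conv_lhs => rw [eq_sum_single (coordDeriv (𝓡 n) (idEquiv n) x₀ P (Y P))]
    simp only [map_sum, map_smul, coordField_eq_coordLift, coordDeriv_coordLift hP]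
  rw [e, map_sum]
  simp only [map_smul, hc, smul_zero, Finset.sum_const_zero]

lemma exists_smooth_extension [T2Space N] {x₀ P : N}
    (hP : P ∈ (chartAt 𝕍 n x₀).source) (j : Fin n) :
    ∃ Y : ∀ p : N, TangentSpace (𝓡 n) p, IsSmoothVectorField (𝓡 n) Y ∧
      ∀ᶠ p in 𝓝 P, Y p = coordField x₀ j p := by
  obtain ⟨ρ, -, hρ⟩ := (SmoothBumpFunction.nhds_basis_tsupport (I := 𝓡 n) P).mem_iff.1
    ((chartAt 𝕍 n x₀).open_source.mem_nhds hP)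
  refine ⟨(ρ : N → ℝ) • coordField x₀ j, fun p => ?_, ?_⟩
  · by_cases hp : p ∈ tsupport ρ
    · exact ContMDiffAt.smul_section (ρ.contMDiff p) (contMDiffAt_coordField (hρ hp) j)
    · have h0 : ContMDiffAt (𝓡 n) ((𝓡 n).prod 𝓘(ℝ, 𝕍 n)) ∞
          (fun p => TotalSpace.mk' 𝕍 n p
            (0 : TangentSpace (𝓡 n) p)) p := contMDiff_zeroSection ℝ _ p
      refine h0.congr_of_eventuallyEq ?_
      have : ∀ᶠ q in 𝓝 p, q ∉ tsupport ρ := (isClosed_tsupport ρ).isOpen_compl.mem_nhds hp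
      filter_upwards [this] with q hq
      have : ρ q = 0 := image_eq_zero_of_notMem_tsupport hq
      simp [this]
  · filter_upwards [ρ.eventuallyEq_one] with p hp
    simp [hp]

lemma contDiffAt_christoffel [T2Space N] {D : AffineConnection (𝓡 n) N}
    (hD : D.ContMDiffCovariantDerivative ∞) {x₀ P : N}
    (hP : P ∈ (chartAt 𝕍 n x₀).source) (i j k : Fin n) :
    ContDiffAt ℝ ∞ (christoffel D x₀ i j k) (coordMap (𝓡 n) (idEquiv n) x₀ P) := by
  obtain ⟨Y, hY, hYj⟩ := exists_smooth_extension hP j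
  have h1 : ContMDiffAt (𝓡 n) ((𝓡 n).prod 𝓘(ℝ, 𝕍 n →L[ℝ]
      𝕍 n)) ∞
      (fun p => TotalSpace.mk' (𝕍 n →L[ℝ] 𝕍 n) p
        (D Y p)) P := by
    have := hD.contMDiff.contMDiff (σ := Y) (contMDiffOn_univ.2 (by simpa [IsSmoothVectorField] using hY))
    exact (this P (mem_univ P)).contMDiffAt univ_mem
  rw [contMDiffAt_endomorphism_iff (L := idEquiv n) hP] at h1
  have h2 := ContMDiffAt.comp_coordInv (L := idEquiv n) hP h1
  rw [coordRange_eq_univ, contDiffWithinAt_univ] at h2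
  have h3 := (EuclideanSpace.proj k : 𝕍 n →L[ℝ] ℝ).contDiff.contDiffAt.comp _
    (h2.clm_apply (contDiffAt_const (c := EuclideanSpace.single i (1 : ℝ))))
  refine h3.congr_of_eventuallyEq ?_
  have h4 : ∀ᶠ p in 𝓝 P, D Y p = D (coordField x₀ j) p := by
    filter_upwards [hYj.eventually_nhds, eventually_mem_source hP] with p hp hp'
    exact D.isCovariantDerivativeOnUniv.congr_of_eventuallyEq
      ((hY p).mdifferentiableAt (by simp))
      ((contMDiffAt_coordField hp' j).mdifferentiableAt (by simp)) univ_mem hp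
  filter_upwards [coordTarget_mem_nhds (L := idEquiv n) hP,
    (tendsto_coordInv (L := idEquiv n) hP).eventually h4] with z hz hz'
  have h5 := christoffel_eq D (coordInv_mem_source hz) i j k
  rw [coordMap_coordInv hz] at h5
  rw [h5, ← hz']
  rfl

lemma contDiffAt_chartGamma [T2Space N] {D : AffineConnection (𝓡 n) N}
    (hD : D.ContMDiffCovariantDerivative ∞) {x₀ P : N}
    (hP : P ∈ (chartAt 𝕍 n x₀).source) :
    ContDiffAt ℝ ∞ (chartGamma D x₀) (coordMap (𝓡 n) (idEquiv n) x₀ P) := by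
  unfold chartGamma
  refine ContDiffAt.sum fun i _ => ContDiffAt.sum fun j _ => ContDiffAt.sum fun k _ => ?_
  exact (contDiffAt_christoffel hD hP i j k).smul contDiffAt_const

lemma chartGamma_symm {D : AffineConnection (𝓡 n) N} (hD : D.torsion = 0) {x₀ P : N}
    (hP : P ∈ (chartAt 𝕍 n x₀).source) (v w : 𝕍 n) :
    chartGamma D x₀ (coordMap (𝓡 n) (idEquiv n) x₀ P) v w =
      chartGamma D x₀ (coordMap (𝓡 n) (idEquiv n) x₀ P) w v := by
  have h1 : ∀ i j, chartGamma D x₀ (coordMap (𝓡 n) (idEquiv n) x₀ P)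
      (EuclideanSpace.single i 1) (EuclideanSpace.single j 1) =
      chartGamma D x₀ (coordMap (𝓡 n) (idEquiv n) x₀ P)
      (EuclideanSpace.single j 1) (EuclideanSpace.single i 1) := by
    intro i j
    have hi := (contMDiffAt_coordField hP i).mdifferentiableAt (by simp)
    have hj := (contMDiffAt_coordField hP j).mdifferentiableAt (by simp)
    have h2 := D.torsion_eq_zero_iff.1 hD hi hj
    have h3 := localCov_torsion (L := idEquiv n) hP hi hj
      (chartGamma D x₀ (coordMap (𝓡 n) (idEquiv n) x₀ P))
    rw [← connection_eq_localCov D hP hi, ← connection_eq_localCov D hP hj, h2, sub_self,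
      map_zero, coordField_eq_coordLift, coordField_eq_coordLift, coordDeriv_coordLift hP,
      coordDeriv_coordLift hP] at h3
    exact (sub_eq_zero.1 h3.symm)
  rw [eq_sum_single v, eq_sum_single w]
  simp only [map_sum, map_smul, sum_apply, smul_apply]
  simp only [Finset.smul_sum]
  rw [Finset.sum_comm]
  refine Finset.sum_congr rfl fun i _ => Finset.sum_congr rfl fun j _ => ?_
  rw [h1, smul_comm]

/-- The change of coordinates of `N`. -/
noncomputable def baseChange (x₀ x₁ : N) (u : 𝕍 n) :
    𝕍 n :=
  coordMap (𝓡 n) (idEquiv n) x₁ (coordInv (𝓡 n) (idEquiv n) x₀ u)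

lemma contDiffAt_baseChange {x₀ x₁ P : N}
    (hP : P ∈ (chartAt 𝕍 n x₀).source)
    (hP' : P ∈ (chartAt 𝕍 n x₁).source) :
    ContDiffAt ℝ ∞ (baseChange x₀ x₁) (coordMap (𝓡 n) (idEquiv n) x₀ P) := by
  have h := ContMDiffAt.comp_coordInv (L := idEquiv n) hP
    (contMDiffAt_coordMap (I := 𝓡 n) (L := idEquiv n) hP')
  rwa [coordRange_eq_univ, contDiffWithinAt_univ] at h

lemma baseChange_coordMap {x₀ P : N} (x₁ : N)
    (hP : P ∈ (chartAt 𝕍 n x₀).source) :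
    baseChange x₀ x₁ (coordMap (𝓡 n) (idEquiv n) x₀ P) = coordMap (𝓡 n) (idEquiv n) x₁ P := by
  rw [baseChange, coordInv_coordMap hP]

lemma fderiv_baseChange {x₀ x₁ P : N}
    (hP : P ∈ (chartAt 𝕍 n x₀).source)
    (hP' : P ∈ (chartAt 𝕍 n x₁).source) (v : TangentSpace (𝓡 n) P) :
    fderiv ℝ (baseChange x₀ x₁) (coordMap (𝓡 n) (idEquiv n) x₀ P)
      (coordDeriv (𝓡 n) (idEquiv n) x₀ P v) = coordDeriv (𝓡 n) (idEquiv n) x₁ P v := by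
  have h := coordDeriv_mfderiv_of_eventuallyEq (I := 𝓡 n) (I' := 𝓡 n) (L := idEquiv n)
    (L' := idEquiv n) (G := id) (F := baseChange x₀ x₁) hP hP' mdifferentiableAt_id
    (Eventually.of_forall fun z => rfl) v
  rw [mfderiv_id] at h
  exact h.symm

lemma chartGamma_transform (D : AffineConnection (𝓡 n) N) {x₀ x₁ P : N}
    (hP : P ∈ (chartAt 𝕍 n x₀).source)
    (hP' : P ∈ (chartAt 𝕍 n x₁).source)
    (v w : 𝕍 n) :
    let u := coordMap (𝓡 n) (idEquiv n) x₀ P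
    fderiv ℝ (baseChange x₀ x₁) u (chartGamma D x₀ u v w) =
      fderiv ℝ (fderiv ℝ (baseChange x₀ x₁)) u v w +
      chartGamma D x₁ (baseChange x₀ x₁ u) (fderiv ℝ (baseChange x₀ x₁) u v)
        (fderiv ℝ (baseChange x₀ x₁) u w) := by
  intro u
  set Y : ∀ p : N, TangentSpace (𝓡 n) p := fun p => coordLift (𝓡 n) (idEquiv n) x₀ p w with hYdef
  have hY : ContMDiffAt (𝓡 n) ((𝓡 n).prod 𝓘(ℝ, 𝕍 n)) ∞
      (fun p => TotalSpace.mk' 𝕍 n p (Y p)) P := by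
    rw [contMDiffAt_vectorField_iff (L := idEquiv n) hP]
    refine (contMDiffAt_const (c := w)).congr_of_eventuallyEq ?_
    filter_upwards [eventually_mem_source hP] with Q hQ
    exact coordDeriv_coordLift hQ w
  have hYd := hY.mdifferentiableAt (n := ∞) (by simp)
  have hD0 := connection_eq_localCov D hP hYd
  have hD1 := connection_eq_localCov D hP' hYd
  set V := coordLift (𝓡 n) (idEquiv n) x₀ P v with hV
  have e0 : coordDeriv (𝓡 n) (idEquiv n) x₀ P (D Y P V) = chartGamma D x₀ u v w := by
    rw [hD0, coordDeriv_localCov hP]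
    have e : (fun p => coordDeriv (𝓡 n) (idEquiv n) x₀ p (Y p)) ∘
        coordInv (𝓡 n) (idEquiv n) x₀ =ᶠ[𝓝 (coordMap (𝓡 n) (idEquiv n) x₀ P)] fun _ => w := by
      filter_upwards [coordTarget_mem_nhds (L := idEquiv n) hP] with z hz
      simp only [Function.comp_apply, hYdef]
      rw [coordDeriv_coordLift (coordInv_mem_source hz)]
    rw [e.fderiv_eq, fderiv_const_apply, zero_apply, zero_add, hV, coordDeriv_coordLift hP,
      coordDeriv_coordLift hP]
  set Yh := (fun p => coordDeriv (𝓡 n) (idEquiv n) x₁ p (Y p)) ∘ coordInv (𝓡 n) (idEquiv n) x₁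
    with hYh
  have hψ := contDiffAt_baseChange hP hP'
  have d1 : DifferentiableAt ℝ (fderiv ℝ (baseChange x₀ x₁)) u :=
    (hψ.fderiv_right (m := 1) (by norm_cast)).differentiableAt (by simp)
  have dψ : DifferentiableAt ℝ (baseChange x₀ x₁) u := hψ.differentiableAt (by simp)
  have e1 : (fun z => fderiv ℝ (baseChange x₀ x₁) z w) =ᶠ[𝓝 u] Yh ∘ baseChange x₀ x₁ := by
    filter_upwards [coordTarget_mem_nhds (L := idEquiv n) hP,
      (tendsto_coordInv (L := idEquiv n) hP).eventually (eventually_mem_source hP')] with z hz hz'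
    have h := fderiv_baseChange (coordInv_mem_source hz) hz'
      (coordLift (𝓡 n) (idEquiv n) x₀ _ w)
    rw [coordDeriv_coordLift (coordInv_mem_source hz), coordMap_coordInv hz] at h
    rw [h]
    simp only [hYh, Function.comp_apply, baseChange]
    rw [coordInv_coordMap hz']
  have dYh : DifferentiableAt ℝ Yh (baseChange x₀ x₁ u) := by
    rw [baseChange_coordMap x₁ hP]
    exact differentiableAt_vectorField hP' hYd
  have e2 : fderiv ℝ (fderiv ℝ (baseChange x₀ x₁)) u v w =
      fderiv ℝ Yh (baseChange x₀ x₁ u) (fderiv ℝ (baseChange x₀ x₁) u v) := by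
    have h1 := d1.hasFDerivAt.clm_apply (hasFDerivAt_const w u)
    have h2 := (dYh.hasFDerivAt.comp u dψ.hasFDerivAt).congr_of_eventuallyEq e1
    have h3 := DFunLike.congr_fun (h1.unique h2) v
    simpa using h3
  have h4 := fderiv_baseChange hP hP' (D Y P V)
  rw [e0] at h4
  have h5 : fderiv ℝ (baseChange x₀ x₁) u v = coordDeriv (𝓡 n) (idEquiv n) x₁ P V := by
    rw [← fderiv_baseChange hP hP', hV, coordDeriv_coordLift hP]
  have h6 : fderiv ℝ (baseChange x₀ x₁) u w = coordDeriv (𝓡 n) (idEquiv n) x₁ P (Y P) := by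
    rw [← fderiv_baseChange hP hP', hYdef, coordDeriv_coordLift hP]
  rw [h4, e2, h5, h6, baseChange_coordMap x₁ hP, hD1, coordDeriv_localCov hP']

lemma fderiv_chartGamma_single [T2Space N] {D : AffineConnection (𝓡 n) N}
    (hD : D.ContMDiffCovariantDerivative ∞) {x₀ P : N}
    (hP : P ∈ (chartAt 𝕍 n x₀).source) (i j k l : Fin n) :
    partialDeriv i (christoffel D x₀ j l k) (coordMap (𝓡 n) (idEquiv n) x₀ P) =
      fderiv ℝ (chartGamma D x₀) (coordMap (𝓡 n) (idEquiv n) x₀ P) (EuclideanSpace.single i 1)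
        (EuclideanSpace.single j 1) (EuclideanSpace.single l 1) k := by
  have h0 := ((contDiffAt_chartGamma hD hP).differentiableAt (by simp)).hasFDerivAt
  have h1 := (h0.clm_apply (hasFDerivAt_const (EuclideanSpace.single j (1 : ℝ)) _)).clm_apply
    (hasFDerivAt_const (EuclideanSpace.single l (1 : ℝ)) _)
  have h2 := (EuclideanSpace.proj k : 𝕍 n →L[ℝ] ℝ).hasFDerivAt.comp _ h1
  have h3 : christoffel D x₀ j l k = (EuclideanSpace.proj k : 𝕍 n →L[ℝ] ℝ) ∘
      fun u => chartGamma D x₀ u (EuclideanSpace.single j 1) (EuclideanSpace.single l 1) := by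
    ext u
    exact (chartGamma_single D x₀ u j l k).symm
  rw [partialDeriv, h3, h2.fderiv]
  simp

lemma curvature_eq [T2Space N] {D : AffineConnection (𝓡 n) N}
    (hD : D.ContMDiffCovariantDerivative ∞) {x₀ P : N}
    (hP : P ∈ (chartAt 𝕍 n x₀).source) (i j k l : Fin n) :
    curvature D x₀ i j k l (coordMap (𝓡 n) (idEquiv n) x₀ P) =
      flatCurvature (chartGamma D x₀) (coordMap (𝓡 n) (idEquiv n) x₀ P)
        (EuclideanSpace.single i 1) (EuclideanSpace.single j 1) (EuclideanSpace.single l 1) k := by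
  have h : ∀ (u w : 𝕍 n) i, chartGamma D x₀ u (EuclideanSpace.single i 1) w k =
      ∑ m, christoffel D x₀ i m k u * w m := by
    intro u w i
    conv_lhs => rw [eq_sum_single w]
    simp only [map_sum, map_smul]
    rw [WithLp.ofLp_sum, Finset.sum_apply]
    refine Finset.sum_congr rfl fun m _ => ?_
    rw [PiLp.smul_apply, chartGamma_single, smul_eq_mul, mul_comm]
  unfold curvature flatCurvature
  rw [fderiv_chartGamma_single hD hP, fderiv_chartGamma_single hD hP]
  simp only [PiLp.add_apply, PiLp.sub_apply, h, chartGamma_single, Finset.sum_sub_distrib]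
  ring

/-- The Ricci tensor of the Christoffel symbols `Γ`. -/
noncomputable def flatRicci
    (Γ : 𝕍 n → 𝕍 n →L[ℝ]
      𝕍 n →L[ℝ] 𝕍 n)
    (u y z : 𝕍 n) : ℝ :=
  ∑ k, flatCurvature Γ u (EuclideanSpace.single k 1) y z k

lemma flatRicci_eq_sum
    (Γ : 𝕍 n → 𝕍 n →L[ℝ]
      𝕍 n →L[ℝ] 𝕍 n)
    (u y z : 𝕍 n) :
    flatRicci Γ u y z = ∑ i, ∑ j, flatRicci Γ u (EuclideanSpace.single i 1)
      (EuclideanSpace.single j 1) * (y i * z j) := by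
  have hy : ∀ x, flatCurvature Γ u x y z =
      ∑ i, ∑ j, (y i * z j) • flatCurvature Γ u x (EuclideanSpace.single i 1)
        (EuclideanSpace.single j 1) := by
    intro x
    conv_lhs => rw [eq_sum_single y, eq_sum_single z]
    simp only [flatCurvature, map_sum, map_smul, sum_apply, smul_apply, smul_add, smul_sub,
      Finset.sum_add_distrib, Finset.sum_sub_distrib, Finset.smul_sum, smul_smul]
    have e : ∀ f : Fin n → Fin n → 𝕍 n,
        ∑ j, ∑ i, (z j * y i) • f i j = ∑ i, ∑ j, (y i * z j) • f i j := by
      intro f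
      rw [Finset.sum_comm]
      simp only [mul_comm]
    simp only [e]
  simp only [flatRicci, hy, WithLp.ofLp_sum, Finset.sum_apply, PiLp.smul_apply, smul_eq_mul,
    Finset.sum_mul]
  rw [Finset.sum_comm]
  refine Finset.sum_congr rfl fun i _ => ?_
  rw [Finset.sum_comm]
  exact Finset.sum_congr rfl fun i _ => Finset.sum_congr rfl fun i _ => mul_comm _ _

lemma sum_apply_single_eq_trace (A : 𝕍 n →ₗ[ℝ] 𝕍 n) :
    ∑ k, A (EuclideanSpace.single k 1) k = LinearMap.trace ℝ _ A := by
  rw [LinearMap.trace_eq_matrix_trace ℝ (EuclideanSpace.basisFun (Fin n) ℝ).toBasis, Matrix.trace]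
  refine Finset.sum_congr rfl fun k _ => ?_
  simp [LinearMap.toMatrix_apply]

/-- The endomorphism `x ↦ R(x, y) z`. -/
noncomputable def flatCurvatureMap
    (Γ : 𝕍 n → 𝕍 n →L[ℝ]
      𝕍 n →L[ℝ] 𝕍 n)
    (u y z : 𝕍 n) : 𝕍 n →ₗ[ℝ] 𝕍 n where
  toFun x := flatCurvature Γ u x y z
  map_add' x x' := by
    simp only [flatCurvature, map_add, add_apply]
    abel
  map_smul' c x := by
    simp [flatCurvature, smul_sub, smul_add]

lemma ricci_eq [T2Space N] {D : AffineConnection (𝓡 n) N}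
    (hD : D.ContMDiffCovariantDerivative ∞) {x₀ P : N}
    (hP : P ∈ (chartAt 𝕍 n x₀).source) (j l : Fin n) :
    ricci D x₀ j l (coordMap (𝓡 n) (idEquiv n) x₀ P) =
      flatRicci (chartGamma D x₀) (coordMap (𝓡 n) (idEquiv n) x₀ P)
        (EuclideanSpace.single j 1) (EuclideanSpace.single l 1) :=
  Finset.sum_congr rfl fun _ _ => curvature_eq hD hP _ _ _ _

lemma chartSchouten_eq [T2Space N] {D : AffineConnection (𝓡 n) N}
    (hD : D.ContMDiffCovariantDerivative ∞) {x₀ P : N}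
    (hP : P ∈ (chartAt 𝕍 n x₀).source) (y z : 𝕍 n) :
    let u := coordMap (𝓡 n) (idEquiv n) x₀ P
    chartSchouten D x₀ u y z = (n * flatRicci (chartGamma D x₀) u y z +
      flatRicci (chartGamma D x₀) u z y) / ((n : ℝ) ^ 2 - 1) := by
  intro u
  rw [chartSchouten_apply, flatRicci_eq_sum _ u y z, flatRicci_eq_sum _ u z y]
  simp only [schouten, u, ricci_eq hD hP, div_mul_eq_mul_div, ← Finset.sum_div, add_mul,
    Finset.sum_add_distrib, Finset.mul_sum]
  congr 2
  · simp only [mul_assoc]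
  · rw [Finset.sum_comm]
    simp only [mul_comm]

/-- The Schouten tensor is a tensor. -/
lemma chartSchouten_transform [T2Space N] {D : AffineConnection (𝓡 n) N}
    (hD : D.ContMDiffCovariantDerivative ∞) {x₀ x₁ P : N}
    (hP : P ∈ (chartAt 𝕍 n x₀).source)
    (hP' : P ∈ (chartAt 𝕍 n x₁).source)
    (y z : 𝕍 n) :
    let u := coordMap (𝓡 n) (idEquiv n) x₀ P
    chartSchouten D x₁ (baseChange x₀ x₁ u) (fderiv ℝ (baseChange x₀ x₁) u y)
      (fderiv ℝ (baseChange x₀ x₁) u z) = chartSchouten D x₀ u y z := by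
  intro u
  have hu' := baseChange_coordMap x₁ hP
  have hcurv : ∀ x y z, fderiv ℝ (baseChange x₀ x₁) u (flatCurvature (chartGamma D x₀) u x y z) =
      flatCurvature (chartGamma D x₁) (baseChange x₀ x₁ u) (fderiv ℝ (baseChange x₀ x₁) u x)
        (fderiv ℝ (baseChange x₀ x₁) u y) (fderiv ℝ (baseChange x₀ x₁) u z) := by
    refine flatCurvature_transform (contDiffAt_baseChange hP hP')
      ((contDiffAt_chartGamma hD hP).differentiableAt (by simp)) ?_ ?_
    · rw [hu']
      exact (contDiffAt_chartGamma hD hP').differentiableAt (by simp)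
    · filter_upwards [coordTarget_mem_nhds (L := idEquiv n) hP,
        (tendsto_coordInv (L := idEquiv n) hP).eventually (eventually_mem_source hP')]
        with w hw hw' x y
      have := chartGamma_transform D (coordInv_mem_source hw) hw' x y
      rwa [coordMap_coordInv hw] at this
  have hinv : ∃ B : 𝕍 n ≃ₗ[ℝ] 𝕍 n,
      ∀ x, B x = fderiv ℝ (baseChange x₀ x₁) u x := by
    refine ⟨LinearEquiv.ofInjectiveEndo (fderiv ℝ (baseChange x₀ x₁) u).toLinearMap ?_,
      fun x => rfl⟩
    intro a b hab
    have ha := fderiv_baseChange hP hP' (coordLift (𝓡 n) (idEquiv n) x₀ P a)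
    have hb := fderiv_baseChange hP hP' (coordLift (𝓡 n) (idEquiv n) x₀ P b)
    rw [coordDeriv_coordLift hP] at ha hb
    have : coordDeriv (𝓡 n) (idEquiv n) x₁ P (coordLift (𝓡 n) (idEquiv n) x₀ P a) =
      coordDeriv (𝓡 n) (idEquiv n) x₁ P (coordLift (𝓡 n) (idEquiv n) x₀ P b) := by
      rw [← ha, ← hb]
      exact hab
    have := coordDeriv_injective hP' this
    have := congrArg (coordDeriv (𝓡 n) (idEquiv n) x₀ P) this
    rwa [coordDeriv_coordLift hP, coordDeriv_coordLift hP] at this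
  obtain ⟨B, hB⟩ := hinv
  have hric : ∀ y z, flatRicci (chartGamma D x₁) (baseChange x₀ x₁ u)
      (fderiv ℝ (baseChange x₀ x₁) u y) (fderiv ℝ (baseChange x₀ x₁) u z) =
      flatRicci (chartGamma D x₀) u y z := by
    intro y z
    have h1 := LinearMap.trace_conj' (flatCurvatureMap (chartGamma D x₀) u y z) B
    have h2 : B.conj (flatCurvatureMap (chartGamma D x₀) u y z) =
        flatCurvatureMap (chartGamma D x₁) (baseChange x₀ x₁ u)
          (fderiv ℝ (baseChange x₀ x₁) u y) (fderiv ℝ (baseChange x₀ x₁) u z) := by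
      refine LinearMap.ext fun x => ?_
      obtain ⟨x, rfl⟩ := B.surjective x
      rw [LinearEquiv.conj_apply_apply, B.symm_apply_apply, hB]
      refine (hcurv x y z).trans ?_
      rw [hB]
      rfl
    rw [h2, ← sum_apply_single_eq_trace, ← sum_apply_single_eq_trace] at h1
    exact h1
  have e1 := chartSchouten_eq hD hP' (fderiv ℝ (baseChange x₀ x₁) u y)
    (fderiv ℝ (baseChange x₀ x₁) u z)
  rw [← hu'] at e1
  rw [e1, hric, hric]
  exact (chartSchouten_eq hD hP y z).symm

lemma contDiffAt_chartSchouten [T2Space N] {D : AffineConnection (𝓡 n) N}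
    (hD : D.ContMDiffCovariantDerivative ∞) {x₀ P : N}
    (hP : P ∈ (chartAt 𝕍 n x₀).source) :
    ContDiffAt ℝ ∞ (chartSchouten D x₀) (coordMap (𝓡 n) (idEquiv n) x₀ P) := by
  have h1 : ∀ i j, ContDiffAt ℝ ∞ (ricci D x₀ i j) (coordMap (𝓡 n) (idEquiv n) x₀ P) := by
    intro i j
    unfold ricci curvature partialDeriv
    refine ContDiffAt.sum fun k _ => ?_
    have h (i j k) := contDiffAt_christoffel hD hP i j k
    have h' (i j k l) : ContDiffAt ℝ ∞ (fun u => fderiv ℝ (christoffel D x₀ i j k) u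
        (EuclideanSpace.single l (1 : ℝ))) (coordMap (𝓡 n) (idEquiv n) x₀ P) :=
      ((h i j k).fderiv_right (m := ∞) (by simp)).clm_apply contDiffAt_const
    refine ((h' _ _ _ _).sub (h' _ _ _ _)).add (ContDiffAt.sum fun m _ => ?_)
    exact ((h _ _ _).mul (h _ _ _)).sub ((h _ _ _).mul (h _ _ _))
  unfold chartSchouten schouten
  refine ContDiffAt.sum fun i _ => ContDiffAt.sum fun j _ => ?_
  exact (((contDiffAt_const.mul (h1 i j)).add (h1 j i)).div_const _).smul contDiffAt_const

end Base

section CotangentCharts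

variable {n : ℕ} {N : Type*} [TopologicalSpace N] [ChartedSpace 𝕍 n N]
  [IsManifold (𝓡 n) ∞ N]

variable (n) in
/-- The dual of the model space. -/
abbrev DualSpace : Type := 𝕍 n →L[ℝ] ℝ

variable (n) in
/-- The identity of the model space of the cotangent bundle. -/
noncomputable abbrev cotEquiv : (𝕍 n × DualSpace n) ≃L[ℝ]
    (𝕍 n × DualSpace n) :=
  ContinuousLinearEquiv.refl ℝ _

/-- The coordinates `(x, ξ)` of the cotangent bundle. -/
noncomputable abbrev cotCoord (x₀ : N) (p : CotangentBundle n N) :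
    𝕍 n × DualSpace n :=
  coordMap (cotangentModel n) (cotEquiv n) (⟨x₀, 0⟩ : CotangentBundle n N) p

/-- The point with coordinates `(x, ξ)`. -/
noncomputable abbrev cotInv (x₀ : N) (z : 𝕍 n × DualSpace n) :
    CotangentBundle n N :=
  coordInv (cotangentModel n) (cotEquiv n) (⟨x₀, 0⟩ : CotangentBundle n N) z

/-- The components of a tangent vector of the cotangent bundle. -/
noncomputable abbrev cotDeriv (x₀ : N) (p : CotangentBundle n N) :
    TangentSpace (cotangentModel n) p →L[ℝ] 𝕍 n × DualSpace n :=
  coordDeriv (cotangentModel n) (cotEquiv n) (⟨x₀, 0⟩ : CotangentBundle n N) p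

/-- The tangent vector of the cotangent bundle with given components. -/
noncomputable abbrev cotVec (x₀ : N) (p : CotangentBundle n N) :
    𝕍 n × DualSpace n →L[ℝ] TangentSpace (cotangentModel n) p :=
  coordLift (cotangentModel n) (cotEquiv n) (⟨x₀, 0⟩ : CotangentBundle n N) p

lemma mem_cotSource {x₀ : N} {p : CotangentBundle n N} :
    p ∈ (chartAt (ModelProd 𝕍 n (DualSpace n))
      (⟨x₀, 0⟩ : CotangentBundle n N)).source ↔
    p.proj ∈ (chartAt 𝕍 n x₀).source := by
  rw [FiberBundle.chartedSpace_chartAt]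
  simp only [mfld_simps]
  exact ⟨fun h => h.1.1, fun h => ⟨⟨h, mem_univ _⟩, h⟩⟩

lemma cotCoord_eq (x₀ : N) (p : CotangentBundle n N)
    (_ : p.proj ∈ (chartAt 𝕍 n x₀).source) :
    cotCoord x₀ p = (coordMap (𝓡 n) (idEquiv n) x₀ p.proj,
      p.2 ∘L coordLift (𝓡 n) (idEquiv n) x₀ p.proj) := by
  unfold cotCoord coordMap
  rw [FiberBundle.extChartAt]
  refine Prod.ext rfl ?_
  refine ContinuousLinearMap.ext fun v => ?_
  simp [hom_trivializationAt_apply, ContinuousLinearMap.inCoordinates]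
  rfl

lemma cotCoord_self (p : CotangentBundle n N) :
    coordMap (cotangentModel n) (cotEquiv n) p = cotCoord p.proj := rfl

lemma localCov_self (p : CotangentBundle n N) :
    localCov (cotangentModel n) (cotEquiv n) p =
      localCov (cotangentModel n) (cotEquiv n) (⟨p.proj, 0⟩ : CotangentBundle n N) := rfl

lemma proj_mem_of_mem_cotTarget {x₀ : N} {z : 𝕍 n × DualSpace n}
    (hz : z ∈ coordTarget (cotangentModel n) (cotEquiv n) (⟨x₀, 0⟩ : CotangentBundle n N)) :
    (cotInv x₀ z).proj ∈ (chartAt 𝕍 n x₀).source :=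
  mem_cotSource.1 (coordInv_mem_source hz)

lemma momentum_eq {x₀ : N} {p : CotangentBundle n N}
    (hp : p.proj ∈ (chartAt 𝕍 n x₀).source) (i : Fin n) :
    momentum x₀ i p = (cotCoord x₀ p).2 (EuclideanSpace.single i 1) := by
  rw [cotCoord_eq x₀ p hp]
  rfl

lemma position_eq {x₀ : N} {p : CotangentBundle n N}
    (hp : p.proj ∈ (chartAt 𝕍 n x₀).source) (i : Fin n) :
    position x₀ i p = (cotCoord x₀ p).1 i := by
  rw [cotCoord_eq x₀ p hp]
  rfl

lemma mvfderiv_linear_cotCoord {x₀ : N} {p : CotangentBundle n N}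
    (hp : p.proj ∈ (chartAt 𝕍 n x₀).source)
    {f : CotangentBundle n N → ℝ} {A : 𝕍 n × DualSpace n → ℝ}
    (hA : ContDiffAt ℝ ∞ A (cotCoord x₀ p))
    (hf : ∀ p : CotangentBundle n N, p.proj ∈ (chartAt 𝕍 n x₀).source →
      f p = A (cotCoord x₀ p)) (v : TangentSpace (cotangentModel n) p) :
    mvfderiv (cotangentModel n) f p v = fderiv ℝ A (cotCoord x₀ p) (cotDeriv x₀ p v) := by
  have hp' := mem_cotSource.2 hp
  have hev : ∀ᶠ q in 𝓝 p, f q = A (cotCoord x₀ q) := by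
    filter_upwards [eventually_mem_source hp'] with q hq
    exact hf q (mem_cotSource.1 hq)
  refine mfderiv_eq_fderiv_comp hp' ?_ ?_ v
  · refine (contMDiffAt_of_comp_coordMap (I := cotangentModel n) (L := cotEquiv n) (g := A)
      hp' hA.contDiffWithinAt hev).mdifferentiableAt (by simp)
  · filter_upwards [coordTarget_mem_nhds hp'] with z hz
    rw [hf _ (proj_mem_of_mem_cotTarget hz), cotCoord, coordMap_coordInv hz]

lemma dPosition_apply {x₀ : N} {p : CotangentBundle n N}
    (hp : p.proj ∈ (chartAt 𝕍 n x₀).source) (i : Fin n)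
    (v : TangentSpace (cotangentModel n) p) :
    dPosition x₀ i p v = (cotDeriv x₀ p v).1 i := by
  have h := mvfderiv_linear_cotCoord hp (f := position x₀ i)
    (A := (EuclideanSpace.proj i : 𝕍 n →L[ℝ] ℝ) ∘L
      ContinuousLinearMap.fst ℝ _ (DualSpace n)) (ContinuousLinearMap.contDiff _).contDiffAt
    (fun p hp => position_eq hp i) v
  rw [ContinuousLinearMap.fderiv] at h
  exact h

lemma dMomentum_apply {x₀ : N} {p : CotangentBundle n N}
    (hp : p.proj ∈ (chartAt 𝕍 n x₀).source) (i : Fin n)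
    (v : TangentSpace (cotangentModel n) p) :
    dMomentum x₀ i p v = (cotDeriv x₀ p v).2 (EuclideanSpace.single i 1) := by
  have h := mvfderiv_linear_cotCoord hp (f := momentum x₀ i)
    (A := ContinuousLinearMap.apply ℝ ℝ (EuclideanSpace.single i (1 : ℝ)) ∘L
      ContinuousLinearMap.snd ℝ 𝕍 n (DualSpace n))
    (ContinuousLinearMap.contDiff _).contDiffAt
    (fun p hp => momentum_eq hp i) v
  rw [ContinuousLinearMap.fderiv] at h
  exact h

/-- The horizontal lift of a connection on the cotangent bundle. -/
noncomputable def cotLift (D : AffineConnection (𝓡 n) N) (x₀ : N)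
    (z : 𝕍 n × DualSpace n) :
    𝕍 n →L[ℝ] DualSpace n :=
  sliceLift (cotangentSlice _) (chartGamma D x₀) (chartSchouten D x₀) z

lemma apply_eq_sum (b : DualSpace n) (x : 𝕍 n) :
    b x = ∑ j, b (EuclideanSpace.single j 1) * x j := by
  conv_lhs => rw [eq_sum_single x]
  simp [mul_comm]

lemma cotLift_single (D : AffineConnection (𝓡 n) N) (x₀ : N)
    (z : 𝕍 n × DualSpace n) (x : 𝕍 n) (j : Fin n) :
    cotLift D x₀ z x (EuclideanSpace.single j 1) =
      ∑ i, (∑ k, christoffel D x₀ i j k z.1 * z.2 (EuclideanSpace.single k 1) -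
        z.2 (EuclideanSpace.single i 1) * z.2 (EuclideanSpace.single j 1) -
          schouten D x₀ i j z.1) * x i := by
  rw [cotLift, cotangentLift_apply]
  simp only [sub_apply, ContinuousLinearMap.comp_apply, smul_apply, smul_eq_mul, sub_mul,
    Finset.sum_sub_distrib]
  have h1 : z.2 (chartGamma D x₀ z.1 x (EuclideanSpace.single j 1)) =
      ∑ i, (∑ k, christoffel D x₀ i j k z.1 * z.2 (EuclideanSpace.single k 1)) * x i := by
    rw [chartGamma_apply]
    simp only [map_sum, map_smul, smul_eq_mul, PiLp.single_apply, Finset.sum_mul]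
    refine Finset.sum_congr rfl fun i _ => ?_
    rw [Finset.sum_eq_single j]
    · refine Finset.sum_congr rfl fun k _ => ?_
      simp
      ring
    · intro b _ hb
      simp [hb]
    · simp
  have h2 : chartSchouten D x₀ z.1 x (EuclideanSpace.single j 1) =
      ∑ i, schouten D x₀ i j z.1 * x i := by
    rw [chartSchouten_apply]
    simp [PiLp.single_apply]
  have h3 : z.2 x * z.2 (EuclideanSpace.single j 1) =
      ∑ i, z.2 (EuclideanSpace.single i 1) * z.2 (EuclideanSpace.single j 1) * x i := by
    rw [apply_eq_sum z.2 x, Finset.sum_mul]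
    exact Finset.sum_congr rfl fun i _ => by ring
  rw [h1, h2, h3]
  ring

lemma sum_symmPart_mul (S : Fin n → Fin n → ℝ) (x y : Fin n → ℝ) :
    ∑ j, (∑ i, (S i j + S j i) / 2 * x i) * y j + ∑ j, (∑ i, (S i j + S j i) / 2 * y i) * x j =
      ∑ j, (∑ i, S i j * x i) * y j + ∑ j, (∑ i, S i j * y i) * x j := by
  simp only [Finset.sum_mul, ← Finset.sum_add_distrib]
  have h : ∑ j, ∑ i, (S i j - S j i) * (x i * y j + y i * x j) = 0 := by
    have h1 : ∑ j, ∑ i, (S i j - S j i) * (x i * y j + y i * x j) =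
        -∑ j, ∑ i, (S i j - S j i) * (x i * y j + y i * x j) := by
      conv_lhs => rw [Finset.sum_comm]
      simp only [← Finset.sum_neg_distrib]
      exact Finset.sum_congr rfl fun i _ => Finset.sum_congr rfl fun j _ => by ring
    linarith
  rw [← sub_eq_zero, ← neg_eq_zero, ← mul_eq_zero_iff_left (two_ne_zero (α := ℝ)), ← h]
  simp only [← Finset.sum_sub_distrib, ← Finset.sum_neg_distrib, Finset.mul_sum]
  exact Finset.sum_congr rfl fun i _ => Finset.sum_congr rfl fun j _ => by ring

lemma neutralMetricIn_apply (D : AffineConnection (𝓡 n) N) {x₀ : N} {p : CotangentBundle n N}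
    (hp : p.proj ∈ (chartAt 𝕍 n x₀).source)
    (v w : TangentSpace (cotangentModel n) p) :
    neutralMetricIn D x₀ p v w = splitMetric (cotLift D x₀ (cotCoord x₀ p))
      (cotDeriv x₀ p v) (cotDeriv x₀ p w) := by
  have hu : (cotCoord x₀ p).1 = extChartAt (𝓡 n) x₀ p.proj := by
    rw [cotCoord_eq x₀ p hp]; rfl
  unfold neutralMetricIn symProd
  simp only [sum_apply, smul_apply, add_apply, ContinuousLinearMap.smulRight_apply, smul_eq_mul,
    sub_apply, dPosition_apply hp, dMomentum_apply hp, momentum_eq hp, ← hu]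
  rw [splitMetric_apply, apply_eq_sum (_ - _) (cotDeriv x₀ p w).1,
    apply_eq_sum (_ - _) (cotDeriv x₀ p v).1]
  simp only [sub_apply, cotLift_single, ← Finset.mul_sum, Finset.sum_add_distrib]
  congr 1
  set X := (cotDeriv x₀ p v)
  set Y := (cotDeriv x₀ p w)
  have h := sum_symmPart_mul (fun i j => schouten D x₀ i j (cotCoord x₀ p).1) X.1 Y.1
  have e1 : ∀ a : Fin n → ℝ, ∀ j, ∑ i, (∑ k, christoffel D x₀ i j k (cotCoord x₀ p).1 *
        (cotCoord x₀ p).2 (EuclideanSpace.single k 1) -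
        (cotCoord x₀ p).2 (EuclideanSpace.single i 1) *
          (cotCoord x₀ p).2 (EuclideanSpace.single j 1) -
          (schouten D x₀ i j (cotCoord x₀ p).1 + schouten D x₀ j i (cotCoord x₀ p).1) / 2) * a i =
      ∑ i, (∑ k, christoffel D x₀ i j k (cotCoord x₀ p).1 *
        (cotCoord x₀ p).2 (EuclideanSpace.single k 1) -
        (cotCoord x₀ p).2 (EuclideanSpace.single i 1) *
          (cotCoord x₀ p).2 (EuclideanSpace.single j 1)) * a i -
      ∑ i, (schouten D x₀ i j (cotCoord x₀ p).1 + schouten D x₀ j i (cotCoord x₀ p).1) / 2 *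
        a i := by
    intro a j
    rw [← Finset.sum_sub_distrib]
    exact Finset.sum_congr rfl fun i _ => by ring
  have e2 : ∀ a : Fin n → ℝ, ∀ j, ∑ i, (∑ k, christoffel D x₀ i j k (cotCoord x₀ p).1 *
        (cotCoord x₀ p).2 (EuclideanSpace.single k 1) -
        (cotCoord x₀ p).2 (EuclideanSpace.single i 1) *
          (cotCoord x₀ p).2 (EuclideanSpace.single j 1) -
          schouten D x₀ i j (cotCoord x₀ p).1) * a i =
      ∑ i, (∑ k, christoffel D x₀ i j k (cotCoord x₀ p).1 *
        (cotCoord x₀ p).2 (EuclideanSpace.single k 1) -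
        (cotCoord x₀ p).2 (EuclideanSpace.single i 1) *
          (cotCoord x₀ p).2 (EuclideanSpace.single j 1)) * a i -
      ∑ i, schouten D x₀ i j (cotCoord x₀ p).1 * a i := by
    intro a j
    rw [← Finset.sum_sub_distrib]
    exact Finset.sum_congr rfl fun i _ => by ring
  simp only [e1, e2, mul_comm (X.1.ofLp _) (_ - _)]
  simp only [sub_mul, Finset.sum_sub_distrib] at h ⊢
  linarith

lemma neutralFormIn_apply (D : AffineConnection (𝓡 n) N) (hD : D.torsion = 0) {x₀ : N}
    {p : CotangentBundle n N}
    (hp : p.proj ∈ (chartAt 𝕍 n x₀).source)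
    (v w : TangentSpace (cotangentModel n) p) :
    neutralFormIn D x₀ p v w = splitMetric (cotLift D x₀ (cotCoord x₀ p))
      (splitJ (cotLift D x₀ (cotCoord x₀ p)) (cotDeriv x₀ p v)) (cotDeriv x₀ p w) := by
  have hu : (cotCoord x₀ p).1 = extChartAt (𝓡 n) x₀ p.proj := by
    rw [cotCoord_eq x₀ p hp]; rfl
  have hs := chartGamma_symm hD hp (cotDeriv x₀ p v).1 (cotDeriv x₀ p w).1
  have hu' : (cotCoord x₀ p).1 = coordMap (𝓡 n) (idEquiv n) x₀ p.proj := hu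
  rw [← hu'] at hs
  unfold neutralFormIn wedgeProd
  simp only [sum_apply, smul_apply, add_apply, ContinuousLinearMap.smulRight_apply, smul_eq_mul,
    sub_apply, dPosition_apply hp, dMomentum_apply hp, ← hu]
  rw [splitMetric_apply, splitJ_apply]
  set X := (cotDeriv x₀ p v)
  set Y := (cotDeriv x₀ p w)
  simp only [sub_apply, smul_apply, map_neg, neg_apply, smul_eq_mul]
  have h1 : cotLift D x₀ (cotCoord x₀ p) X.1 Y.1 - cotLift D x₀ (cotCoord x₀ p) Y.1 X.1 =
      chartSchouten D x₀ (cotCoord x₀ p).1 Y.1 X.1 -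
        chartSchouten D x₀ (cotCoord x₀ p).1 X.1 Y.1 := by
    simp only [cotLift, cotangentLift_apply, sub_apply, ContinuousLinearMap.comp_apply, smul_apply,
      smul_eq_mul, hs]
    ring
  have h2 : ∑ i, ∑ j, (schouten D x₀ i j (cotCoord x₀ p).1 - schouten D x₀ j i (cotCoord x₀ p).1) /
      2 * (1 / 2 * (X.1 i * Y.1 j - X.1 j * Y.1 i)) =
      1 / 2 * (chartSchouten D x₀ (cotCoord x₀ p).1 X.1 Y.1 -
        chartSchouten D x₀ (cotCoord x₀ p).1 Y.1 X.1) := by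
    rw [chartSchouten_apply, chartSchouten_apply]
    have h3 : ∑ i, ∑ j, schouten D x₀ i j (cotCoord x₀ p).1 * (Y.1 i * X.1 j) =
      ∑ i, ∑ j, schouten D x₀ j i (cotCoord x₀ p).1 * (Y.1 j * X.1 i) := Finset.sum_comm
    have h4 : ∑ i, ∑ j, schouten D x₀ i j (cotCoord x₀ p).1 * (X.1 i * Y.1 j) =
      ∑ i, ∑ j, schouten D x₀ j i (cotCoord x₀ p).1 * (X.1 j * Y.1 i) := Finset.sum_comm
    have h5 : ∑ i, ∑ j, (schouten D x₀ i j (cotCoord x₀ p).1 -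
        schouten D x₀ j i (cotCoord x₀ p).1) / 2 * (1 / 2 * (X.1 i * Y.1 j - X.1 j * Y.1 i)) =
        1 / 4 * (∑ i, ∑ j, schouten D x₀ i j (cotCoord x₀ p).1 * (X.1 i * Y.1 j) -
          ∑ i, ∑ j, schouten D x₀ i j (cotCoord x₀ p).1 * (Y.1 i * X.1 j) -
          ∑ i, ∑ j, schouten D x₀ j i (cotCoord x₀ p).1 * (Y.1 j * X.1 i) +
          ∑ i, ∑ j, schouten D x₀ j i (cotCoord x₀ p).1 * (X.1 j * Y.1 i)) := by
      simp only [← Finset.sum_sub_distrib, ← Finset.sum_add_distrib, Finset.mul_sum]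
      exact Finset.sum_congr rfl fun i _ => Finset.sum_congr rfl fun j _ => by ring
    rw [h5, ← h3, ← h4]
    ring
  have h6 : ∑ i, 1 / 2 * (X.2 (EuclideanSpace.single i 1) * Y.1 i -
      X.1 i * Y.2 (EuclideanSpace.single i 1)) = 1 / 2 * (X.2 Y.1 - Y.2 X.1) := by
    rw [apply_eq_sum X.2, apply_eq_sum Y.2, ← Finset.mul_sum, Finset.sum_sub_distrib]
    simp only [mul_comm]
  rw [h6, h2]
  linarith

end CotangentCharts

section CotangentChange

variable {n : ℕ} {N : Type*} [TopologicalSpace N] [ChartedSpace 𝕍 n N]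
  [IsManifold (𝓡 n) ∞ N]

/-- The fibre component of a change of coordinates of the cotangent bundle. -/
noncomputable def fibreChange (x₀ x₁ : N) (z : 𝕍 n × DualSpace n) :
    DualSpace n :=
  (cotCoord x₁ (cotInv x₀ z)).2

lemma cotCoord_cotInv {x₀ x₁ : N} {z : 𝕍 n × DualSpace n}
    (hz : z ∈ coordTarget (cotangentModel n) (cotEquiv n) (⟨x₀, 0⟩ : CotangentBundle n N))
    (hz' : (cotInv x₀ z).proj ∈ (chartAt 𝕍 n x₁).source) :
    cotCoord x₁ (cotInv x₀ z) = (baseChange x₀ x₁ z.1, fibreChange x₀ x₁ z) := by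
  refine Prod.ext ?_ rfl
  rw [cotCoord_eq x₁ _ hz', baseChange]
  have h := cotCoord_eq x₀ _ (proj_mem_of_mem_cotTarget hz)
  rw [cotCoord, coordMap_coordInv hz] at h
  have h1 : z.1 = _ := congrArg Prod.fst h
  conv_rhs => rw [h1]
  rw [coordInv_coordMap (proj_mem_of_mem_cotTarget hz)]

lemma fibreChange_apply {x₀ x₁ : N} {z : 𝕍 n × DualSpace n}
    (hz : z ∈ coordTarget (cotangentModel n) (cotEquiv n) (⟨x₀, 0⟩ : CotangentBundle n N))
    (hz' : (cotInv x₀ z).proj ∈ (chartAt 𝕍 n x₁).source)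
    (x : 𝕍 n) :
    fibreChange x₀ x₁ z (fderiv ℝ (baseChange x₀ x₁) z.1 x) = z.2 x := by
  have h0 := proj_mem_of_mem_cotTarget hz
  have h := cotCoord_eq x₀ _ h0
  rw [cotCoord, coordMap_coordInv hz] at h
  have h1 : z.1 = _ := congrArg Prod.fst h
  have h2 : z.2 = _ := congrArg Prod.snd h
  rw [fibreChange, cotCoord_eq x₁ _ hz', h1]
  have e : x = coordDeriv (𝓡 n) (idEquiv n) x₀ (cotInv x₀ z).proj
      (coordLift (𝓡 n) (idEquiv n) x₀ (cotInv x₀ z).proj x) := (coordDeriv_coordLift h0 x).symm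
  conv_lhs => rw [e]
  rw [fderiv_baseChange h0 hz', ContinuousLinearMap.comp_apply, coordLift_coordDeriv hz']
  exact (DFunLike.congr_fun h2 x).symm

variable {x₀ x₁ : N} {p : CotangentBundle n N}
  (hp : p.proj ∈ (chartAt 𝕍 n x₀).source)
  (hp' : p.proj ∈ (chartAt 𝕍 n x₁).source)

include hp in
lemma cotCoord_fst : (cotCoord x₀ p).1 = coordMap (𝓡 n) (idEquiv n) x₀ p.proj := by
  rw [cotCoord_eq x₀ p hp]

include hp hp'

lemma eventually_mem_cotTarget : ∀ᶠ z in 𝓝 (cotCoord x₀ p),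
    z ∈ coordTarget (cotangentModel n) (cotEquiv n) (⟨x₀, 0⟩ : CotangentBundle n N) ∧
    (cotInv x₀ z).proj ∈ (chartAt 𝕍 n x₁).source := by
  have hp0 := mem_cotSource.2 hp
  filter_upwards [coordTarget_mem_nhds hp0, (tendsto_coordInv hp0).eventually
    (eventually_mem_source (mem_cotSource.2 hp'))] with z hz hz'
  exact ⟨hz, mem_cotSource.1 hz'⟩

lemma contDiffAt_fibreChange : ContDiffAt ℝ ∞ (fibreChange x₀ x₁) (cotCoord x₀ p) := by
  have h := ContMDiffAt.comp_coordInv (L := cotEquiv n) (mem_cotSource.2 hp)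
    (contMDiffAt_coordMap (I := cotangentModel n) (L := cotEquiv n) (mem_cotSource.2 hp'))
  rw [coordRange_eq_univ, contDiffWithinAt_univ] at h
  exact contDiffAt_snd.comp _ h

lemma contDiffAt_baseChange_fst : ContDiffAt ℝ ∞ (baseChange x₀ x₁) (cotCoord x₀ p).1 := by
  rw [cotCoord_fst hp]
  exact contDiffAt_baseChange hp hp'

lemma surjective_fderiv_baseChange :
    Function.Surjective (fderiv ℝ (baseChange x₀ x₁) (cotCoord x₀ p).1) := by
  intro y
  rw [cotCoord_fst hp]
  refine ⟨coordDeriv (𝓡 n) (idEquiv n) x₀ p.proj (coordLift (𝓡 n) (idEquiv n) x₁ p.proj y), ?_⟩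
  rw [fderiv_baseChange hp hp', coordDeriv_coordLift hp']

lemma eventually_fibreChange_apply : ∀ᶠ w in 𝓝 (cotCoord x₀ p), ∀ x,
    fibreChange x₀ x₁ w (fderiv ℝ (baseChange x₀ x₁) w.1 x) = w.2 x := by
  filter_upwards [eventually_mem_cotTarget hp hp'] with w hw x
  exact fibreChange_apply hw.1 hw.2 x

lemma eventually_fderiv_fibreChange : ∀ᶠ w in 𝓝 (cotCoord x₀ p), ∀ q x,
    fderiv ℝ (fibreChange x₀ x₁) w (0, q) (fderiv ℝ (baseChange x₀ x₁) w.1 x) = q x := by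
  have h1 : ∀ᶠ w in 𝓝 (cotCoord x₀ p), ContDiffAt ℝ ∞ (fibreChange x₀ x₁) w ∧
      ContDiffAt ℝ ∞ (baseChange x₀ x₁) w.1 := by
    filter_upwards [eventually_mem_cotTarget hp hp'] with w hw
    have h := contDiffAt_fibreChange (proj_mem_of_mem_cotTarget hw.1) hw.2
    have h' := contDiffAt_baseChange_fst (proj_mem_of_mem_cotTarget hw.1) hw.2
    rw [cotCoord, coordMap_coordInv hw.1] at h h'
    exact ⟨h, h'⟩
  filter_upwards [h1, (eventually_fibreChange_apply hp hp').eventually_nhds] with w hw hw' q x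
  have d1 : DifferentiableAt ℝ (fibreChange x₀ x₁) w := hw.1.differentiableAt (by simp)
  have d2 : DifferentiableAt ℝ (fderiv ℝ (baseChange x₀ x₁)) w.1 :=
    (hw.2.fderiv_right (m := 1) (by norm_cast)).differentiableAt (by simp)
  have f1 := d1.hasFDerivAt.clm_apply
    ((d2.hasFDerivAt.comp w hasFDerivAt_fst).clm_apply (hasFDerivAt_const x w))
  have f2 : HasFDerivAt (fun w : 𝕍 n × DualSpace n => w.2 x)
      (ContinuousLinearMap.apply ℝ ℝ x ∘L ContinuousLinearMap.snd ℝ _ (DualSpace n)) w :=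
    (ContinuousLinearMap.apply ℝ ℝ x ∘L
      ContinuousLinearMap.snd ℝ 𝕍 n (DualSpace n)).hasFDerivAt
  have f3 := f1.unique (f2.congr_of_eventuallyEq (hw'.mono fun w hw => hw x))
  have f4 := DFunLike.congr_fun f3 (0, q)
  simpa using f4

lemma fderiv_fderiv_fibreChange (q q' : DualSpace n) :
    fderiv ℝ (fderiv ℝ (fibreChange x₀ x₁)) (cotCoord x₀ p) (0, q) (0, q') = 0 := by
  have c1 := contDiffAt_fibreChange hp hp'
  have c2 := contDiffAt_baseChange_fst hp hp'
  have d1 : DifferentiableAt ℝ (fderiv ℝ (fibreChange x₀ x₁)) (cotCoord x₀ p) :=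
    (c1.fderiv_right (m := 1) (by norm_cast)).differentiableAt (by simp)
  have d2 : DifferentiableAt ℝ (fderiv ℝ (baseChange x₀ x₁)) (cotCoord x₀ p).1 :=
    (c2.fderiv_right (m := 1) (by norm_cast)).differentiableAt (by simp)
  refine ContinuousLinearMap.ext fun y => ?_
  obtain ⟨x, rfl⟩ := surjective_fderiv_baseChange hp hp' y
  have f1 := (d1.hasFDerivAt.clm_apply (hasFDerivAt_const ((0 : 𝕍 n), q') _)
    ).clm_apply ((d2.hasFDerivAt.comp (cotCoord x₀ p) hasFDerivAt_fst).clm_apply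
      (hasFDerivAt_const x _))
  have f3 := f1.unique ((hasFDerivAt_const (q' x) _).congr_of_eventuallyEq
    ((eventually_fderiv_fibreChange hp hp').mono fun w hw => hw q' x))
  have f4 := DFunLike.congr_fun f3 (0, q)
  simpa using f4

/-- The change of coordinates in `T*N`. -/
lemma cotDeriv_change (v : TangentSpace (cotangentModel n) p) :
    cotDeriv x₁ p v = fderiv ℝ (fun z : 𝕍 n × DualSpace n =>
      (baseChange x₀ x₁ z.1, fibreChange x₀ x₁ z)) (cotCoord x₀ p) (cotDeriv x₀ p v) := by
  have h := coordDeriv_mfderiv_of_eventuallyEq (I := cotangentModel n) (I' := cotangentModel n)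
    (L := cotEquiv n) (L' := cotEquiv n) (G := id) (mem_cotSource.2 hp) (mem_cotSource.2 hp')
    mdifferentiableAt_id (F := fun z : 𝕍 n × DualSpace n =>
      (baseChange x₀ x₁ z.1, fibreChange x₀ x₁ z)) ?_ v
  · rwa [mfderiv_id] at h
  · filter_upwards [eventually_mem_cotTarget hp hp'] with w hw
    exact cotCoord_cotInv hw.1 hw.2

lemma cotCoord_change : cotCoord x₁ p = (baseChange x₀ x₁ (cotCoord x₀ p).1,
    fibreChange x₀ x₁ (cotCoord x₀ p)) := by
  have h : cotInv x₀ (cotCoord x₀ p) = p := coordInv_coordMap (mem_cotSource.2 hp)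
  have h2 := (eventually_mem_cotTarget hp hp').self_of_nhds
  have h1 := cotCoord_cotInv h2.1 h2.2
  rwa [h] at h1

variable [T2Space N] {D : AffineConnection (𝓡 n) N} (hD : IsSmoothTorsionFree D)

omit hp' in
include hD in
lemma contDiffAt_cotLift : ContDiffAt ℝ ∞ (cotLift D x₀) (cotCoord x₀ p) := by
  refine contDiffAt_sliceLift ?_ ?_
  · rw [cotCoord_fst hp]
    exact contDiffAt_chartGamma hD.1 hp
  · rw [cotCoord_fst hp]
    exact contDiffAt_chartSchouten hD.1 hp

include hD

lemma intertwinesLifts_cotLift : IntertwinesLifts (cotLift D x₀) (cotLift D x₁)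
    (baseChange x₀ x₁) (fibreChange x₀ x₁) (cotCoord x₀ p) := by
  refine intertwinesLifts_cotangent (contDiffAt_baseChange_fst hp hp')
    (surjective_fderiv_baseChange hp hp')
    ((contDiffAt_fibreChange hp hp').differentiableAt (by simp))
    (eventually_fibreChange_apply hp hp') ?_ ?_
  · rw [cotCoord_fst hp]
    exact chartGamma_transform D hp hp'
  · rw [cotCoord_fst hp]
    exact chartSchouten_transform hD.1 hp hp'

lemma eventually_intertwinesLifts_cotLift : ∀ᶠ z in 𝓝 (cotCoord x₀ p),
    IntertwinesLifts (cotLift D x₀) (cotLift D x₁) (baseChange x₀ x₁) (fibreChange x₀ x₁) z := by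
  filter_upwards [eventually_mem_cotTarget hp hp'] with w hw
  have h := intertwinesLifts_cotLift (proj_mem_of_mem_cotTarget hw.1) hw.2 hD
  rwa [cotCoord, coordMap_coordInv hw.1] at h

lemma splitMetric_change (v w : TangentSpace (cotangentModel n) p) :
    splitMetric (cotLift D x₁ (cotCoord x₁ p)) (cotDeriv x₁ p v) (cotDeriv x₁ p w) =
      splitMetric (cotLift D x₀ (cotCoord x₀ p)) (cotDeriv x₀ p v) (cotDeriv x₀ p w) := by
  have hψ := (contDiffAt_baseChange_fst hp hp').differentiableAt (n := ∞) (by simp)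
  have hG := (contDiffAt_fibreChange hp hp').differentiableAt (n := ∞) (by simp)
  have hi := intertwinesLifts_cotLift hp hp' hD
  have hv := (eventually_fderiv_fibreChange hp hp').self_of_nhds
  have key : ∀ X x, (fderiv ℝ (fibreChange x₀ x₁) (cotCoord x₀ p) X -
      cotLift D x₁ (cotCoord x₁ p) (fderiv ℝ (baseChange x₀ x₁) (cotCoord x₀ p).1 X.1))
      (fderiv ℝ (baseChange x₀ x₁) (cotCoord x₀ p).1 x) =
      (X.2 - cotLift D x₀ (cotCoord x₀ p) X.1) x := by
    intro X x
    rw [cotCoord_change hp hp', hi X.1, ← map_sub]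
    rw [show X - (X.1, cotLift D x₀ (cotCoord x₀ p) X.1) =
      (0, X.2 - cotLift D x₀ (cotCoord x₀ p) X.1) from Prod.ext (sub_self _) rfl, hv]
  rw [splitMetric_apply, splitMetric_apply, cotDeriv_change hp hp' v, cotDeriv_change hp hp' w,
    fderiv_fibred hψ hG, fderiv_fibred hψ hG]
  simp only [key]

lemma splitJ_change (X : 𝕍 n × DualSpace n) :
    cotDeriv x₁ p (cotVec x₀ p (splitJ (cotLift D x₀ (cotCoord x₀ p)) X)) =
      splitJ (cotLift D x₁ (cotCoord x₁ p)) (cotDeriv x₁ p (cotVec x₀ p X)) := by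
  have hψ := (contDiffAt_baseChange_fst hp hp').differentiableAt (n := ∞) (by simp)
  have hG := (contDiffAt_fibreChange hp hp').differentiableAt (n := ∞) (by simp)
  have hi := intertwinesLifts_cotLift hp hp' hD
  rw [cotDeriv_change hp hp', cotDeriv_change hp hp',
    coordDeriv_coordLift (mem_cotSource.2 hp), coordDeriv_coordLift (mem_cotSource.2 hp),
    fderiv_splitJ_of_intertwines hψ hG hi, cotCoord_change hp hp']

end CotangentChange

section CotangentStructures

variable {n : ℕ} {N : Type*} [TopologicalSpace N] [ChartedSpace 𝕍 n N]
  [IsManifold (𝓡 n) ∞ N]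

/-- The para-complex structure `J` on `T*N`. -/
noncomputable def neutralJ (D : AffineConnection (𝓡 n) N) (p : CotangentBundle n N) :
    TangentSpace (cotangentModel n) p →L[ℝ] TangentSpace (cotangentModel n) p :=
  cotVec p.proj p ∘L splitJ (cotLift D p.proj (cotCoord p.proj p)) ∘L cotDeriv p.proj p

/-- The Christoffel symbols of the canonical connection of `T*N`. -/
noncomputable def cotGamma (D : AffineConnection (𝓡 n) N) (x₀ : N)
    (z : 𝕍 n × DualSpace n) :
    𝕍 n × DualSpace n →L[ℝ] 𝕍 n × DualSpace n →L[ℝ]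
      𝕍 n × DualSpace n :=
  splitChristoffel (cotLift D x₀) (sliceConnection (cotangentSlice _) (chartGamma D x₀)
    (chartSchouten D x₀) z) z

/-- The canonical connection of `T*N`: it preserves `g` and `J` and has minimal torsion. -/
noncomputable def neutralConnection (D : AffineConnection (𝓡 n) N) :
    AffineConnection (cotangentModel n) (CotangentBundle n N) :=
  connectionOfChristoffel (I := cotangentModel n) (fun _ => cotEquiv n)
    (fun p => cotGamma D p.proj)

lemma neutralConnection_eq (D : AffineConnection (𝓡 n) N)
    (Y : ∀ p : CotangentBundle n N, TangentSpace (cotangentModel n) p) (p : CotangentBundle n N) :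
    neutralConnection D Y p = localCov (cotangentModel n) (cotEquiv n)
      (⟨p.proj, 0⟩ : CotangentBundle n N) (cotGamma D p.proj (cotCoord p.proj p)) Y p := by
  have e : neutralConnection D Y p = localCov (cotangentModel n) (cotEquiv n) p
    (cotGamma D p.proj (coordMap (cotangentModel n) (cotEquiv n) p p)) Y p := rfl
  rw [e, localCov_self, cotCoord_self]

variable [T2Space N] {D : AffineConnection (𝓡 n) N} (hD : IsSmoothTorsionFree D)
  {x₀ : N} {p : CotangentBundle n N}
  (hp : p.proj ∈ (chartAt 𝕍 n x₀).source)

include hp hD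

lemma cotDeriv_neutralJ (v : TangentSpace (cotangentModel n) p) :
    cotDeriv x₀ p (neutralJ D p v) =
      splitJ (cotLift D x₀ (cotCoord x₀ p)) (cotDeriv x₀ p v) := by
  have h := splitJ_change (mem_chart_source _ p.proj) hp hD (cotDeriv p.proj p v)
  have h2 : cotVec p.proj p (cotDeriv p.proj p v) = v :=
    coordLift_coordDeriv (mem_cotSource.2 (mem_chart_source _ p.proj)) v
  rw [h2] at h
  exact h

lemma neutralMetric_apply (v w : TangentSpace (cotangentModel n) p) :
    neutralMetric D p v w = splitMetric (cotLift D x₀ (cotCoord x₀ p))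
      (cotDeriv x₀ p v) (cotDeriv x₀ p w) := by
  rw [neutralMetric, neutralMetricIn_apply D (mem_chart_source _ p.proj)]
  exact (splitMetric_change (mem_chart_source _ p.proj) hp hD v w).symm

lemma contDiffAt_cotGamma : ContDiffAt ℝ ∞ (cotGamma D x₀) (cotCoord x₀ p) := by
  refine contDiffAt_splitChristoffel (contDiffAt_cotLift hp hD) (contDiffAt_sliceConnection ?_ ?_)
  · rw [cotCoord_fst hp]
    exact contDiffAt_chartGamma hD.1 hp
  · rw [cotCoord_fst hp]
    exact contDiffAt_chartSchouten hD.1 hp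

lemma neutralConnection_apply {Y : ∀ p : CotangentBundle n N, TangentSpace (cotangentModel n) p}
    (hY : MDifferentiableAt (cotangentModel n) ((cotangentModel n).prod
      𝓘(ℝ, 𝕍 n × DualSpace n))
      (fun p => TotalSpace.mk' (𝕍 n × DualSpace n) p (Y p)) p) :
    neutralConnection D Y p = localCov (cotangentModel n) (cotEquiv n)
      (⟨x₀, 0⟩ : CotangentBundle n N) (cotGamma D x₀ (cotCoord x₀ p)) Y p := by
  have hp0 : p.proj ∈ (chartAt 𝕍 n p.proj).source := mem_chart_source _ _
  refine ContinuousLinearMap.ext fun v => ?_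
  have key := mfderiv_localCov (I := cotangentModel n) (I' := cotangentModel n)
    (L := cotEquiv n) (L' := cotEquiv n) (G := id) (mem_cotSource.2 hp0) (mem_cotSource.2 hp)
    contMDiffAt_id (F := fun z : 𝕍 n × DualSpace n =>
      (baseChange p.proj x₀ z.1, fibreChange p.proj x₀ z))
    (Γ := cotGamma D p.proj (cotCoord p.proj p)) (Γ' := cotGamma D x₀ (cotCoord x₀ p))
    (Y := Y) (Y' := Y) ?_ ?_ ?_ hY hY ?_ v
  · rw [mfderiv_id] at key
    exact (DFunLike.congr_fun (neutralConnection_eq D Y p) v).trans key.symm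
  · filter_upwards [eventually_mem_cotTarget hp0 hp] with w hw
    exact cotCoord_cotInv hw.1 hw.2
  · exact ((contDiffAt_baseChange_fst hp0 hp).comp _ contDiffAt_fst).prodMk
      (contDiffAt_fibreChange hp0 hp)
  · intro X X'
    have h := fderiv_splitChristoffel (contDiffAt_baseChange_fst hp0 hp)
      (contDiffAt_fibreChange hp0 hp) ((contDiffAt_cotLift hp0 hD).differentiableAt (by simp))
      (l' := cotLift D x₀) ?_ (eventually_intertwinesLifts_cotLift hp0 hp hD)
      (C := sliceConnection (cotangentSlice _) (chartGamma D p.proj)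
        (chartSchouten D p.proj) (cotCoord p.proj p))
      (C' := sliceConnection (cotangentSlice _) (chartGamma D x₀)
        (chartSchouten D x₀) (cotCoord x₀ p)) (Υ := 0) ?_ ?_ X X'
    · have h0 : ∀ X, paraCTensor (splitJ (cotLift D p.proj (cotCoord p.proj p))) 0 X X' = 0 := by
        intro X
        rw [paraCTensor_apply]
        simp
      rw [add_apply, add_apply, h0, add_zero] at h
      refine h.trans ?_
      rw [← cotCoord_change hp0 hp]
      rfl
    · rw [← cotCoord_change hp0 hp]
      exact (contDiffAt_cotLift hp hD).differentiableAt (by simp)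
    · intro x x'
      simp only [zero_apply, mul_zero, zero_smul, add_zero]
      rw [cotangentConnection_apply, cotangentConnection_apply, map_sub, map_sub, map_smul,
        map_smul, cotCoord_fst hp0, chartGamma_transform D hp0 hp, cotCoord_change hp0 hp]
      simp only
      have hf := (eventually_fibreChange_apply hp0 hp).self_of_nhds
      rw [← cotCoord_fst hp0, hf, hf]
      abel
    · intro q q'
      rw [fderiv_fderiv_fibreChange hp0 hp]
      simp
  · refine Eventually.of_forall fun q => ?_
    rw [mfderiv_id]
    rfl

end CotangentStructures

lemma eq_smul_nijenhuis_of_torsion {W : Type*} [AddCommGroup W] [Module ℝ W] (J : W →ₗ[ℝ] W)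
    (hJ : ∀ w, J (J w) = w) {a b c d b₁ b₂ b₃ b₄ τ : W} (hτ : J τ = τ)
    (h₁ : a - b - b₁ = τ) (h₂ : J c - J d - b₂ = τ) (h₃ : c - J b - b₃ = -τ)
    (h₄ : J a - d - b₄ = -τ) :
    τ = (-(1 / 4) : ℝ) • (b₁ + b₂ - J b₃ - J b₄) := by
  rw [sub_eq_iff_eq_add, ← sub_eq_iff_eq_add'] at h₁ h₂ h₃ h₄
  rw [← h₁, ← h₂, ← h₃, ← h₄]
  simp only [map_sub, map_neg, hJ, hτ]
  module

/-- The torsion of the canonical connection of a split manifold. -/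
noncomputable def splitTorsion {V Y : Type*} [NormedAddCommGroup V] [NormedSpace ℝ V]
    [NormedAddCommGroup Y] [NormedSpace ℝ Y] (l : V × Y → V →L[ℝ] Y) (z : V × Y) (x y : V) : Y :=
  fderiv ℝ l z (y, l z y) x - fderiv ℝ l z (x, l z x) y

section SplitTorsion

variable {V Y : Type*} [NormedAddCommGroup V] [NormedSpace ℝ V]
    [NormedAddCommGroup Y] [NormedSpace ℝ Y] (l : V × Y → V →L[ℝ] Y) (z : V × Y) (x y : V)

lemma splitTorsion_neg_left : splitTorsion l z (-x) y = -splitTorsion l z x y := by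
  rw [splitTorsion, splitTorsion, map_neg (l z),
    show (-x, -l z x) = -(x, l z x) from rfl]
  simp only [map_neg, neg_apply]
  abel

lemma splitTorsion_neg_right : splitTorsion l z x (-y) = -splitTorsion l z x y := by
  rw [splitTorsion, splitTorsion, map_neg (l z),
    show (-y, -l z y) = -(y, l z y) from rfl]
  simp only [map_neg, neg_apply]
  abel

end SplitTorsion

section CotangentGeometry

variable {n : ℕ} {N : Type*} [TopologicalSpace N] [ChartedSpace 𝕍 n N]
  [IsManifold (𝓡 n) ∞ N] [T2Space N] {D : AffineConnection (𝓡 n) N} (hD : IsSmoothTorsionFree D)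

include hD

lemma neutralForm_eq (p : CotangentBundle n N) (v w : TangentSpace (cotangentModel n) p) :
    neutralForm D p v w = neutralMetric D p (neutralJ D p v) w := by
  have hp := mem_chart_source 𝕍 n p.proj
  rw [neutralForm, neutralFormIn_apply D hD.2 hp, neutralMetric_apply hD hp,
    cotDeriv_neutralJ hD hp]

lemma isSmoothBilinearForm_neutralMetric :
    IsSmoothBilinearForm (cotangentModel n) (neutralMetric D) := by
  intro p
  have hp := mem_chart_source 𝕍 n p.proj
  have hp' := mem_cotSource.2 hp
  rw [contMDiffAt_bilinearForm_iff (L := cotEquiv n) hp']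
  refine contMDiffAt_of_comp_coordMap (L := cotEquiv n) hp'
    (g := fun z => splitMetric (cotLift D p.proj z))
    (contDiffWithinAt_splitMetric (contDiffAt_cotLift hp hD).contDiffWithinAt) ?_
  filter_upwards [eventually_mem_source hp'] with q hq
  refine ContinuousLinearMap.ext fun v => ContinuousLinearMap.ext fun w => ?_
  rw [pullBilinear_apply, neutralMetric_apply hD (mem_cotSource.1 hq), cotDeriv,
    coordDeriv_coordLift hq, coordDeriv_coordLift hq]

lemma isSmoothEndomorphism_neutralJ :
    IsSmoothEndomorphism (cotangentModel n) (neutralJ D) := by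
  intro p
  have hp := mem_chart_source 𝕍 n p.proj
  have hp' := mem_cotSource.2 hp
  rw [contMDiffAt_endomorphism_iff (L := cotEquiv n) hp']
  refine contMDiffAt_of_comp_coordMap (L := cotEquiv n) hp'
    (g := fun z => splitJ (cotLift D p.proj z))
    (contDiffAt_splitJ (contDiffAt_cotLift hp hD).contDiffWithinAt) ?_
  filter_upwards [eventually_mem_source hp'] with q hq
  refine ContinuousLinearMap.ext fun v => ?_
  have h := cotDeriv_neutralJ hD (mem_cotSource.1 hq) (cotVec p.proj q v)
  rw [cotDeriv, coordDeriv_coordLift hq] at h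
  exact h

lemma neutralMetric_nondegenerate {p : CotangentBundle n N}
    {v : TangentSpace (cotangentModel n) p} (hv : ∀ w, neutralMetric D p v w = 0) : v = 0 := by
  have hp := mem_chart_source 𝕍 n p.proj
  have hp' := mem_cotSource.2 hp
  set l := cotLift D p.proj (cotCoord p.proj p)
  set X := cotDeriv p.proj p v with hX
  have h : ∀ Y, splitMetric l X Y = 0 := by
    intro Y
    have h := hv (cotVec p.proj p Y)
    rwa [neutralMetric_apply hD hp, cotDeriv, coordDeriv_coordLift hp'] at h
  have h1 : X.1 = 0 := by
    refine (SeparatingDual.eq_zero_iff_forall_dual_eq_zero (R := ℝ) X.1).2 fun q => ?_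
    have := h (0, q)
    rw [splitMetric_apply] at this
    simpa using this
  have h2 : X.2 = 0 := by
    refine ContinuousLinearMap.ext fun x => ?_
    have := h (x, l x)
    rw [splitMetric_apply] at this
    simpa [h1] using this
  apply coordDeriv_injective (L := cotEquiv n) hp'
  rw [map_zero]
  exact Prod.ext h1 h2

lemma isParaHermitian_neutral :
    IsParaHermitian (cotangentModel n) (neutralMetric D) (neutralJ D) where
  smooth_metric := isSmoothBilinearForm_neutralMetric hD
  smooth_J := isSmoothEndomorphism_neutralJ hD
  symm p v w := by
    have hp := mem_chart_source 𝕍 n p.proj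
    rw [neutralMetric_apply hD hp, neutralMetric_apply hD hp, splitMetric_apply,
      splitMetric_apply, add_comm]
  nondegenerate p v hv := neutralMetric_nondegenerate hD hv
  sq p v := by
    have hp := mem_chart_source 𝕍 n p.proj
    apply coordDeriv_injective (L := cotEquiv n) (mem_cotSource.2 hp)
    rw [cotDeriv_neutralJ hD hp, cotDeriv_neutralJ hD hp, splitJ_apply, splitJ_apply]
    refine Prod.ext (neg_neg _) ?_
    simp
  compatible p v w := by
    have hp := mem_chart_source 𝕍 n p.proj
    rw [neutralMetric_apply hD hp, neutralMetric_apply hD hp, cotDeriv_neutralJ hD hp,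
      cotDeriv_neutralJ hD hp, splitMetric_apply, splitMetric_apply, splitJ_apply, splitJ_apply]
    simp
    ring

lemma neutralJ_smooth {X : ∀ p : CotangentBundle n N, TangentSpace (cotangentModel n) p}
    (hX : IsSmoothVectorField (cotangentModel n) X) :
    IsSmoothVectorField (cotangentModel n) (fun p => neutralJ D p (X p)) := by
  intro p
  have hp' := mem_chart_source (ModelProd 𝕍 n (DualSpace n)) p
  have h1 := (contMDiffAt_endomorphism_iff (L := cotEquiv n) hp' _).1
    (isSmoothEndomorphism_neutralJ hD p)
  have h2 := (contMDiffAt_vectorField_iff (L := cotEquiv n) hp' _).1 (hX p)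
  rw [contMDiffAt_vectorField_iff (L := cotEquiv n) hp']
  refine (h1.clm_apply h2).congr_of_eventuallyEq ?_
  filter_upwards [eventually_mem_source hp'] with q hq
  simp only [ContinuousLinearMap.comp_apply]
  rw [coordLift_coordDeriv hq]

lemma neutralConnection_smooth : (neutralConnection D).ContMDiffCovariantDerivative ∞ := by
  refine contMDiffCovariantDerivative_of_localCov
    (Z := 𝕍 n × DualSpace n) fun p => ?_
  have hp := mem_chart_source 𝕍 n p.proj
  refine ⟨cotGamma D p.proj, cotEquiv n, (contDiffAt_cotGamma hD hp).contDiffWithinAt,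
    fun Y hY => ?_⟩
  filter_upwards [eventually_mem_source (mem_cotSource.2 hp)] with q hq
  exact neutralConnection_apply hD (mem_cotSource.1 hq) ((hY q).mdifferentiableAt (by simp))

lemma neutralConnection_torsion
    {X Y : ∀ p : CotangentBundle n N, TangentSpace (cotangentModel n) p}
    (hX : IsSmoothVectorField (cotangentModel n) X) (hY : IsSmoothVectorField (cotangentModel n) Y)
    (p : CotangentBundle n N) {x y : 𝕍 n}
    (hx : (cotDeriv p.proj p (X p)).1 = x) (hy : (cotDeriv p.proj p (Y p)).1 = y) :
    neutralConnection D Y p (X p) - neutralConnection D X p (Y p) -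
      VectorField.mlieBracket (cotangentModel n) X Y p =
      cotVec p.proj p (0, splitTorsion (cotLift D p.proj) (cotCoord p.proj p) x y) := by
  subst hx hy
  have hp := mem_chart_source 𝕍 n p.proj
  have hp' := mem_cotSource.2 hp
  have hXd := (hX p).mdifferentiableAt (n := ∞) (by simp)
  have hYd := (hY p).mdifferentiableAt (n := ∞) (by simp)
  apply coordDeriv_injective (L := cotEquiv n) hp'
  rw [neutralConnection_apply hD hp hXd, neutralConnection_apply hD hp hYd,
    localCov_torsion hp' hXd hYd, coordDeriv_coordLift hp']
  refine splitChristoffel_torsion (sliceConnection_symm ?_) _ _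
  rw [cotCoord_fst hp]
  exact chartGamma_symm hD.2 hp

lemma cotGamma_splitJ {x₀ : N} {p : CotangentBundle n N}
    (hp : p.proj ∈ (chartAt 𝕍 n x₀).source)
    (v X : 𝕍 n × DualSpace n) :
    fderiv ℝ (fun z => splitJ (cotLift D x₀ z) X) (cotCoord x₀ p) v +
      cotGamma D x₀ (cotCoord x₀ p) v (splitJ (cotLift D x₀ (cotCoord x₀ p)) X) =
      splitJ (cotLift D x₀ (cotCoord x₀ p)) (cotGamma D x₀ (cotCoord x₀ p) v X) :=
  splitChristoffel_splitJ ((contDiffAt_cotLift hp hD).differentiableAt (by simp)) _ v X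

lemma cotGamma_splitMetric {x₀ : N} {p : CotangentBundle n N}
    (hp : p.proj ∈ (chartAt 𝕍 n x₀).source)
    (v X X' : 𝕍 n × DualSpace n) :
    fderiv ℝ (fun z => splitMetric (cotLift D x₀ z) X X') (cotCoord x₀ p) v =
      splitMetric (cotLift D x₀ (cotCoord x₀ p)) (cotGamma D x₀ (cotCoord x₀ p) v X) X' +
        splitMetric (cotLift D x₀ (cotCoord x₀ p)) X (cotGamma D x₀ (cotCoord x₀ p) v X') := by
  refine splitChristoffel_splitMetric ?_ ?_ v X X'
  · rw [cotCoord_fst hp]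
    exact contDiffAt_chartGamma hD.1 hp
  · rw [cotCoord_fst hp]
    exact contDiffAt_chartSchouten hD.1 hp

lemma neutralConnection_parallel
    {X : ∀ p : CotangentBundle n N, TangentSpace (cotangentModel n) p}
    (hX : IsSmoothVectorField (cotangentModel n) X) (p : CotangentBundle n N)
    (v : TangentSpace (cotangentModel n) p) :
    neutralConnection D (fun q => neutralJ D q (X q)) p v =
      neutralJ D p (neutralConnection D X p v) := by
  have hp := mem_chart_source 𝕍 n p.proj
  have hp' := mem_cotSource.2 hp
  have hXd := (hX p).mdifferentiableAt (n := ∞) (by simp)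
  have hl := contDiffAt_cotLift hp hD
  have hJX := (neutralJ_smooth hD hX p).mdifferentiableAt (n := ∞) (by simp)
  have e1 := neutralConnection_apply (Y := X) hD hp hXd
  have e2 := neutralConnection_apply (Y := fun q => neutralJ D q (X q)) hD hp hJX
  have hj : DifferentiableAt ℝ (fun z => splitJ (cotLift D p.proj z)) (cotCoord p.proj p) :=
    ((contDiffAt_splitJ hl.contDiffWithinAt (s := univ)).contDiffAt
      univ_mem).differentiableAt (by simp)
  have h := localCov_endomorphism (I := cotangentModel n) (L := cotEquiv n) (J := neutralJ D)
    (Γ := cotGamma D p.proj (cotCoord p.proj p)) hp' hj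
    (fun q hq v => cotDeriv_neutralJ hD (mem_cotSource.1 hq) v) (cotGamma_splitJ hD hp)
    (X := X) hXd v
  rw [DFunLike.congr_fun e2 v, DFunLike.congr_fun e1 v, ← h]

set_option maxHeartbeats 1000000 in
lemma neutralConnection_minimal
    {X Y : ∀ p : CotangentBundle n N, TangentSpace (cotangentModel n) p}
    (hX : IsSmoothVectorField (cotangentModel n) X) (hY : IsSmoothVectorField (cotangentModel n) Y)
    (p : CotangentBundle n N) :
    neutralConnection D Y p (X p) - neutralConnection D X p (Y p) -
      VectorField.mlieBracket (cotangentModel n) X Y p =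
      (-(1 / 4) : ℝ) • nijenhuis (cotangentModel n) (neutralJ D) X Y p := by
  have hp := mem_chart_source 𝕍 n p.proj
  have hJX := neutralJ_smooth hD hX
  have hJY := neutralJ_smooth hD hY
  obtain ⟨x, hx⟩ : ∃ x, (cotDeriv p.proj p (X p)).1 = x := ⟨_, rfl⟩
  obtain ⟨y, hy⟩ : ∃ y, (cotDeriv p.proj p (Y p)).1 = y := ⟨_, rfl⟩
  have hx' : (cotDeriv p.proj p (neutralJ D p (X p))).1 = -x := by
    rw [cotDeriv_neutralJ hD hp, splitJ_apply, hx]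
  have hy' : (cotDeriv p.proj p (neutralJ D p (Y p))).1 = -y := by
    rw [cotDeriv_neutralJ hD hp, splitJ_apply, hy]
  have t1 := neutralConnection_torsion hD hX hY p hx hy
  have t2 := neutralConnection_torsion hD hJX hJY p hx' hy'
  have t3 := neutralConnection_torsion hD hJX hY p hx' hy
  have t4 := neutralConnection_torsion hD hX hJY p hx hy'
  rw [neutralConnection_parallel hD hX, neutralConnection_parallel hD hY, splitTorsion_neg_left,
    splitTorsion_neg_right, neg_neg] at t2
  rw [neutralConnection_parallel hD hX, splitTorsion_neg_left] at t3
  rw [neutralConnection_parallel hD hY, splitTorsion_neg_right] at t4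
  obtain ⟨τ, hτ⟩ : ∃ τ, cotVec p.proj p
    (0, splitTorsion (cotLift D p.proj) (cotCoord p.proj p) x y) = τ := ⟨_, rfl⟩
  have s3 : cotVec p.proj p
      (0, -splitTorsion (cotLift D p.proj) (cotCoord p.proj p) x y) = -τ := by
    rw [← hτ, ← map_neg, Prod.neg_mk, neg_zero]
  have Jτ : neutralJ D p τ = τ := by
    apply coordDeriv_injective (L := cotEquiv n) (mem_cotSource.2 hp)
    rw [cotDeriv_neutralJ hD hp, ← hτ, cotDeriv, coordDeriv_coordLift (mem_cotSource.2 hp),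
      splitJ_apply]
    simp
  have JJ := (isParaHermitian_neutral hD).sq p
  rw [s3] at t3 t4
  rw [hτ] at t1 t2
  rw [t1]
  exact eq_smul_nijenhuis_of_torsion (neutralJ D p).toLinearMap JJ Jτ t1 t2 t3 t4

lemma neutralConnection_metric
    {X Y : ∀ p : CotangentBundle n N, TangentSpace (cotangentModel n) p}
    (hX : IsSmoothVectorField (cotangentModel n) X) (hY : IsSmoothVectorField (cotangentModel n) Y)
    (p : CotangentBundle n N) (v : TangentSpace (cotangentModel n) p) :
    mvfderiv (cotangentModel n) (fun q => neutralMetric D q (X q) (Y q)) p v =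
      neutralMetric D p (neutralConnection D X p v) (Y p) +
        neutralMetric D p (X p) (neutralConnection D Y p v) := by
  have hp := mem_chart_source 𝕍 n p.proj
  have hp' := mem_cotSource.2 hp
  have hXd := (hX p).mdifferentiableAt (n := ∞) (by simp)
  have hYd := (hY p).mdifferentiableAt (n := ∞) (by simp)
  have hl := contDiffAt_cotLift hp hD
  rw [neutralConnection_apply hD hp hXd, neutralConnection_apply hD hp hYd]
  have hβ : DifferentiableAt ℝ (fun z => splitMetric (cotLift D p.proj z)) (cotCoord p.proj p) :=
    ((contDiffWithinAt_splitMetric hl.contDiffWithinAt (s := univ)).contDiffAt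
      univ_mem).differentiableAt (by simp)
  have h := mvfderiv_bilinear_localCov (I := cotangentModel n) (L := cotEquiv n)
    (b := neutralMetric D) (Γ := cotGamma D p.proj (cotCoord p.proj p)) hp' hβ
    (fun q hq v w => neutralMetric_apply hD (mem_cotSource.1 hq) v w)
    (cotGamma_splitMetric hD hp) (X := X) (Y := Y) hXd hYd v
  exact h

lemma isAdmissibleConnection_neutral :
    IsAdmissibleConnection (cotangentModel n) (neutralMetric D) (neutralJ D)
      (neutralConnection D) where
  smooth := neutralConnection_smooth hD
  metric _ _ hX hY p v := neutralConnection_metric hD hX hY p v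
  parallel _ hX p v := neutralConnection_parallel hD hX p v
  minimal := ⟨-(1 / 4), fun _ _ hX hY p => neutralConnection_minimal hD hX hY p⟩

end CotangentGeometry

section FibreNorms

variable (n : ℕ) (N : Type*) [TopologicalSpace N] [ChartedSpace 𝕍 n N]
  [IsManifold (𝓡 n) ∞ N]

/-- A smooth positive definite function on `T*N`, homogeneous of degree `2` on the fibres. -/
class FibreNorm where
  /-- the function -/
  sq : CotangentBundle n N → ℝ
  smooth : ContMDiff (cotangentModel n) 𝓘(ℝ, ℝ) ∞ sq
  homogeneous : ∀ (p : CotangentBundle n N) (c : ℝ), sq ⟨p.proj, c • p.2⟩ = c ^ 2 * sq p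
  pos : ∀ p : CotangentBundle n N, p.2 ≠ 0 → 0 < sq p

variable {n N}

lemma eq_zero_of_momentum {x₀ : N} {p : CotangentBundle n N}
    (hp : p.proj ∈ (chartAt 𝕍 n x₀).source)
    (h : ∀ i, momentum x₀ i p = 0) : p.2 = 0 := by
  have h1 : (cotCoord x₀ p).2 = 0 := by
    refine ContinuousLinearMap.ext fun x => ?_
    rw [apply_eq_sum]
    simp [← momentum_eq hp, h]
  rw [cotCoord_eq x₀ p hp] at h1
  refine ContinuousLinearMap.ext fun v => ?_
  have h2 := DFunLike.congr_fun h1 (coordDeriv (𝓡 n) (idEquiv n) x₀ p.proj v)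
  simp only [ContinuousLinearMap.comp_apply] at h2
  rwa [coordLift_coordDeriv hp] at h2

lemma contMDiffAt_momentum {x₀ : N} {p : CotangentBundle n N}
    (hp : p.proj ∈ (chartAt 𝕍 n x₀).source) (i : Fin n) :
    ContMDiffAt (cotangentModel n) 𝓘(ℝ, ℝ) ∞ (momentum x₀ i) p := by
  refine contMDiffAt_of_comp_coordMap (L := cotEquiv n) (mem_cotSource.2 hp)
    (g := fun z => z.2 (EuclideanSpace.single i 1)) ?_ ?_
  · exact (contDiff_snd.clm_apply contDiff_const).contDiffAt.contDiffWithinAt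
  · filter_upwards [eventually_mem_source (mem_cotSource.2 hp)] with q hq
    exact momentum_eq (mem_cotSource.1 hq) i

lemma momentum_smul (x₀ : N) (i : Fin n) (p : CotangentBundle n N) (c : ℝ) :
    momentum x₀ i ⟨p.proj, c • p.2⟩ = c * momentum x₀ i p := rfl

lemma exists_fibreNorm [T2Space N] [SecondCountableTopology N] : Nonempty (FibreNorm n N) := by
  have : LocallyCompactSpace N := Manifold.locallyCompact_of_finiteDimensional (𝓡 n)
  obtain ⟨ρ, hρ⟩ := SmoothPartitionOfUnity.exists_isSubordinate_chartAt_source (𝓡 n) N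
  let f : N → CotangentBundle n N → ℝ := fun i p => ρ i p.proj * ∑ j, momentum i j p ^ 2
  have hf : ∀ i, ContMDiff (cotangentModel n) 𝓘(ℝ, ℝ) ∞ (f i) := by
    intro i p
    have hproj : ContMDiffAt (cotangentModel n) (𝓡 n) ∞
      (fun p : CotangentBundle n N => p.proj) p := Bundle.contMDiffAt_proj _
    by_cases hp : p.proj ∈ tsupport (ρ i)
    · have h1 : ContMDiffAt (cotangentModel n) 𝓘(ℝ, ℝ) ∞
        (fun p : CotangentBundle n N => ρ i p.proj) p :=
        ((ρ i).contMDiff p.proj).comp p hproj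
      refine h1.mul (contMDiffAt_finsetSum fun j _ => ?_)
      exact (contMDiffAt_momentum (hρ i hp) j).pow 2
    · have : ∀ᶠ q : CotangentBundle n N in 𝓝 p, q.proj ∉ tsupport (ρ i) :=
        hproj.continuousAt.eventually ((isClosed_tsupport _).isOpen_compl.mem_nhds hp)
      refine (contMDiffAt_const (c := (0 : ℝ))).congr_of_eventuallyEq ?_
      filter_upwards [this] with q hq
      simp [f, image_eq_zero_of_notMem_tsupport hq]
  have hlf : LocallyFinite fun i => Function.support (f i) := by
    refine (ρ.locallyFinite.preimage_continuous
      (g := fun p : CotangentBundle n N => p.proj) (Bundle.contMDiff_proj (n := ∞)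
        (IB := 𝓡 n) _).continuous).subset fun i p hp => ?_
    exact left_ne_zero_of_mul hp
  refine ⟨⟨fun p => ∑ᶠ i, f i p, contMDiff_finsum hf hlf, fun p c => ?_, fun p hp => ?_⟩⟩
  · rw [← smul_eq_mul, smul_finsum]
    refine finsum_congr fun i => ?_
    simp only [f, momentum_smul, smul_eq_mul, mul_pow, ← Finset.mul_sum]
    ring
  · obtain ⟨i, hi⟩ := ρ.exists_pos_of_mem (mem_univ p.proj)
    have h0 : ∀ i, 0 ≤ f i p := fun i =>
      mul_nonneg (ρ.nonneg i _) (Finset.sum_nonneg fun j _ => sq_nonneg _)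
    have hfin : (Function.support fun i => f i p).Finite := hlf.point_finite p
    refine finsum_pos h0 ⟨i, mul_pos hi ?_⟩ hfin
    have hs : p.proj ∈ (chartAt 𝕍 n i).source :=
      hρ i (subset_tsupport _ hi.ne')
    by_contra hneg
    apply hp
    refine eq_zero_of_momentum hs fun j => ?_
    have h1 := (Finset.sum_eq_zero_iff_of_nonneg (fun j _ => sq_nonneg (momentum i j p))).1
      (le_antisymm (not_lt.1 hneg) (Finset.sum_nonneg fun j _ => sq_nonneg _)) j
      (Finset.mem_univ j)
    exact pow_eq_zero_iff (two_ne_zero) |>.1 h1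

lemma FibreNorm.sq_zero (F : FibreNorm n N) (x : N) : F.sq ⟨x, 0⟩ = 0 := by
  have h := F.homogeneous ⟨x, 0⟩ 0
  simpa using h

lemma FibreNorm.nonneg (F : FibreNorm n N) (p : CotangentBundle n N) : 0 ≤ F.sq p := by
  by_cases hp : p.2 = 0
  · obtain ⟨x, ξ⟩ := p
    simp only at hp
    rw [hp, F.sq_zero]
  · exact (F.pos p hp).le

lemma FibreNorm.eq_zero_iff (F : FibreNorm n N) {p : CotangentBundle n N} :
    F.sq p = 0 ↔ p.2 = 0 := by
  refine ⟨fun h => by_contra fun hp => (F.pos p hp).ne' h, fun hp => ?_⟩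
  obtain ⟨x, ξ⟩ := p
  simp only at hp
  rw [hp, F.sq_zero]

end FibreNorms

section CotangentTopology

variable {n : ℕ} {N : Type*} [TopologicalSpace N] [ChartedSpace 𝕍 n N]
  [IsManifold (𝓡 n) ∞ N]

lemma continuous_cotProj : Continuous (fun p : CotangentBundle n N => p.proj) :=
  FiberBundle.continuous_proj _ _

lemma isOpen_cotSource (x₀ : N) :
    IsOpen {p : CotangentBundle n N |
      p.proj ∈ (chartAt 𝕍 n x₀).source} :=
  (chartAt 𝕍 n x₀).open_source.preimage continuous_cotProj

lemma cotCoord_injOn (x₀ : N) {p q : CotangentBundle n N}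
    (hp : p.proj ∈ (chartAt 𝕍 n x₀).source)
    (hq : q.proj ∈ (chartAt 𝕍 n x₀).source)
    (h : cotCoord x₀ p = cotCoord x₀ q) : p = q := by
  rw [← coordInv_coordMap (I := cotangentModel n) (L := cotEquiv n) (mem_cotSource.2 hp),
    ← coordInv_coordMap (I := cotangentModel n) (L := cotEquiv n) (mem_cotSource.2 hq)]
  exact congrArg _ h

lemma t2Space_cotangentBundle [T2Space N] : T2Space (CotangentBundle n N) := by
  refine t2_iff_nhds.2 fun {p q} hpq => ?_
  have h1 : p.proj = q.proj := tendsto_nhds_unique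
    (continuous_cotProj.continuousAt.mono_left inf_le_left : Tendsto _ (𝓝 p ⊓ 𝓝 q) _)
    (continuous_cotProj.continuousAt.mono_left inf_le_right)
  have hp := mem_chart_source 𝕍 n p.proj
  have hq : q.proj ∈ (chartAt 𝕍 n p.proj).source := h1 ▸ hp
  exact cotCoord_injOn p.proj hp hq (tendsto_nhds_unique
    ((continuousAt_coordMap (mem_cotSource.2 hp)).mono_left inf_le_left :
      Tendsto _ (𝓝 p ⊓ 𝓝 q) _)
    ((continuousAt_coordMap (mem_cotSource.2 hq)).mono_left inf_le_right))

lemma secondCountable_cotangentBundle [SecondCountableTopology N] :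
    SecondCountableTopology (CotangentBundle n N) := by
  obtain ⟨s, hs, hsU⟩ := TopologicalSpace.countable_cover_nhds
    (fun x : N => (chartAt 𝕍 n x).open_source.mem_nhds
      (mem_chart_source 𝕍 n x))
  have : ProperSpace (DualSpace n) := FiniteDimensional.proper ℝ _
  have : SecondCountableTopology (ModelProd 𝕍 n (DualSpace n)) :=
    inferInstanceAs (SecondCountableTopology (𝕍 n × DualSpace n))
  refine ChartedSpace.secondCountable_of_countable_cover
    (ModelProd 𝕍 n (DualSpace n))
    (s := (fun x => (⟨x, 0⟩ : CotangentBundle n N)) '' s) ?_ (hs.image _)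
  refine eq_univ_of_forall fun p => ?_
  have h : p.proj ∈ ⋃ x ∈ s, (chartAt 𝕍 n x).source := hsU ▸ mem_univ _
  obtain ⟨x, hx, hpx⟩ := mem_iUnion₂.1 h
  exact mem_iUnion₂.2 ⟨_, mem_image_of_mem _ hx, mem_cotSource.2 hpx⟩

/-- Scalar multiplication on the fibres of `T*N`. -/
noncomputable def cotScale (c : ℝ) (p : CotangentBundle n N) : CotangentBundle n N :=
  ⟨p.proj, c • p.2⟩

lemma cotCoord_cotScale {x₀ : N} {p : CotangentBundle n N}
    (hp : p.proj ∈ (chartAt 𝕍 n x₀).source) (c : ℝ) :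
    cotCoord x₀ (cotScale c p) = ((cotCoord x₀ p).1, c • (cotCoord x₀ p).2) := by
  rw [cotCoord_eq x₀ p hp, cotCoord_eq x₀ (cotScale c p) hp]
  rfl

lemma cotScale_one (p : CotangentBundle n N) : cotScale 1 p = p := by
  simp [cotScale]

lemma cotScale_cotScale (c d : ℝ) (p : CotangentBundle n N) :
    cotScale c (cotScale d p) = cotScale (c * d) p :=
  TotalSpace.ext rfl (heq_of_eq (smul_smul c d p.2))

lemma continuousAt_cotScale (a : ℝ × CotangentBundle n N) :
    ContinuousAt (fun a : ℝ × CotangentBundle n N => cotScale a.1 a.2) a := by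
  obtain ⟨c, p⟩ := a
  have hp := mem_chart_source 𝕍 n p.proj
  have h1 : ∀ᶠ a : ℝ × CotangentBundle n N in 𝓝 (c, p), cotScale a.1 a.2 =
      cotInv p.proj ((cotCoord p.proj a.2).1, a.1 • (cotCoord p.proj a.2).2) := by
    have h2 : ∀ᶠ a : ℝ × CotangentBundle n N in 𝓝 (c, p),
        a.2.proj ∈ (chartAt 𝕍 n p.proj).source :=
      (continuousAt_snd (p := (c, p))).eventually
        ((isOpen_cotSource p.proj).mem_nhds (x := p) hp)
    filter_upwards [h2] with a ha
    rw [← cotCoord_cotScale ha]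
    exact (coordInv_coordMap (I := cotangentModel n) (L := cotEquiv n)
      (mem_cotSource.2 (show (cotScale a.1 a.2).proj ∈ _ from ha))).symm
  refine ContinuousAt.congr ?_ (h1.mono fun _ h => h.symm)
  have hc : ContinuousAt (fun a : ℝ × CotangentBundle n N => cotCoord p.proj a.2) (c, p) :=
    ContinuousAt.comp (f := Prod.snd) (g := cotCoord p.proj)
      (continuousAt_coordMap (mem_cotSource.2 hp)) continuousAt_snd
  refine ContinuousAt.comp (g := cotInv p.proj)
    (f := fun a : ℝ × CotangentBundle n N =>
      ((cotCoord p.proj a.2).1, a.1 • (cotCoord p.proj a.2).2)) ?_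
    (hc.fst.prodMk (continuousAt_fst.smul hc.snd))
  rw [← cotCoord_cotScale hp]
  exact continuousAt_coordInv (I := cotangentModel n) (L := cotEquiv n)
    (mem_cotSource.2 (show (cotScale c p).proj ∈ _ from hp))

end CotangentTopology

section LinearCoordinates

/-- A nonzero functional is the first coordinate of some linear coordinate system. -/
lemma exists_equiv_coord_zero {Z : Type*} [NormedAddCommGroup Z] [NormedSpace ℝ Z]
    [FiniteDimensional ℝ Z] {m : ℕ} [NeZero m] (hm : Module.finrank ℝ Z = m) (φ : Z →L[ℝ] ℝ)
    {v : Z} (hv : φ v = 1) :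
    ∃ L : Z ≃L[ℝ] 𝕍 m, ∀ z, L z 0 = φ z := by
  let g₁ : ℝ →L[ℝ] Z := (ContinuousLinearMap.id ℝ ℝ).smulRight v
  let g₂ : ℝ →L[ℝ] 𝕍 m :=
    (ContinuousLinearMap.id ℝ ℝ).smulRight (EuclideanSpace.single 0 1)
  let φ' : 𝕍 m →L[ℝ] ℝ := EuclideanSpace.proj 0
  have h1 : Function.RightInverse g₁ φ := fun t => by simp [g₁, hv]
  have h2 : Function.RightInverse g₂ φ' := fun t => by simp [g₂, φ']
  let e1 := ContinuousLinearEquiv.equivOfRightInverse φ _ h1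
  let e2 := ContinuousLinearEquiv.equivOfRightInverse φ' _ h2
  have f1 := e1.toLinearEquiv.finrank_eq
  have f2 := e2.toLinearEquiv.finrank_eq
  rw [Module.finrank_prod] at f1 f2
  rw [finrank_euclideanSpace_fin] at f2
  have e3 := ContinuousLinearEquiv.ofFinrankEq (𝕜 := ℝ) (E := φ.ker) (F := φ'.ker) (by omega)
  refine ⟨e1.trans (((ContinuousLinearEquiv.refl ℝ ℝ).prodCongr e3).trans e2.symm), fun z => ?_⟩
  set L := e1.trans (((ContinuousLinearEquiv.refl ℝ ℝ).prodCongr e3).trans e2.symm)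
  change φ' (L z) = φ z
  have h3 : (e2 (L z)).1 = (e1 z).1 := by
    simp [L]
  exact h3

/-- The kernel of a nonzero functional is a coordinate space. -/
lemma exists_kernel_coordinates {Z : Type*} [NormedAddCommGroup Z] [NormedSpace ℝ Z]
    [FiniteDimensional ℝ Z] {m : ℕ} (hm : Module.finrank ℝ Z = m + 1) (φ : Z →L[ℝ] ℝ)
    {v : Z} (hv : φ v = 1) :
    ∃ (A : 𝕍 m →L[ℝ] Z) (B : Z →L[ℝ] 𝕍 m),
      (∀ x, B (A x) = x) ∧ (∀ x, φ (A x) = 0) ∧ ∀ z, φ z = 0 → A (B z) = z := by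
  let g : ℝ →L[ℝ] Z := (ContinuousLinearMap.id ℝ ℝ).smulRight v
  have h1 : Function.RightInverse g φ := fun t => by simp [g, hv]
  let e1 := ContinuousLinearEquiv.equivOfRightInverse φ _ h1
  have f1 := e1.toLinearEquiv.finrank_eq
  rw [Module.finrank_prod, Module.finrank_self] at f1
  have e3 := ContinuousLinearEquiv.ofFinrankEq (𝕜 := ℝ) (E := φ.ker)
    (F := 𝕍 m) (by rw [finrank_euclideanSpace_fin]; omega)
  refine ⟨φ.ker.subtypeL ∘L (e3.symm : _ →L[ℝ] φ.ker),
    (e3 : φ.ker →L[ℝ] _) ∘L ContinuousLinearMap.snd ℝ ℝ φ.ker ∘L (e1 : Z →L[ℝ] ℝ × φ.ker),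
    fun x => ?_, fun x => (e3.symm x).2, fun z hz => ?_⟩
  · have h2 : (e1 (e3.symm x : Z)).2 = e3.symm x := by
      apply Subtype.ext
      rw [ContinuousLinearEquiv.snd_equivOfRightInverse, show φ (e3.symm x : Z) = 0 from
        (e3.symm x).2, map_zero, sub_zero]
    change e3 (e1 (e3.symm x : Z)).2 = x
    rw [h2, e3.apply_symm_apply]
  · change ((e3.symm (e3 (e1 z).2) : φ.ker) : Z) = z
    rw [e3.symm_apply_apply, ContinuousLinearEquiv.snd_equivOfRightInverse, hz, map_zero, sub_zero]

end LinearCoordinates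

section RaySlices

variable {n : ℕ}

/-- The choice of an affine slice of the space of rays: an index `k`, a sign and a slope. -/
structure RayIndex (n : ℕ) where
  /-- the index of the distinguished coordinate -/
  k : Fin n
  /-- the sign of the distinguished coordinate -/
  sgn : ℝ
  sgn_mul_sgn : sgn * sgn = 1
  /-- the slope of the slice -/
  slope : ℝ

variable (n) in
/-- The coordinate covector `dxᵏ`. -/
noncomputable abbrev coordCovector (k : Fin n) : DualSpace n :=
  (EuclideanSpace.proj k : 𝕍 n →L[ℝ] ℝ)

/-- The evaluation at the `k`-th basis vector. -/
noncomputable abbrev evalAt (k : Fin n) : DualSpace n →L[ℝ] ℝ :=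
  ContinuousLinearMap.apply ℝ ℝ (EuclideanSpace.single k (1 : ℝ))

lemma coordCovector_single (k : Fin n) : coordCovector n k (EuclideanSpace.single k 1) = 1 := by
  simp

/-- The slice `± ξ_k + c t = 1`. -/
noncomputable def raySlice (a : RayIndex n) : AffineSlice 𝕍 n where
  ell := a.sgn • (evalAt a.k ∘L ContinuousLinearMap.fst ℝ _ ℝ) +
    a.slope • ContinuousLinearMap.snd ℝ _ ℝ
  base := (a.sgn • coordCovector n a.k, 0)
  lin := (ContinuousLinearMap.id ℝ _ - (evalAt a.k).smulRight
    ((1 + a.sgn * a.slope) • coordCovector n a.k)).prod (evalAt a.k)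
  tau := ContinuousLinearMap.fst ℝ _ ℝ -
    (evalAt a.k ∘L ContinuousLinearMap.fst ℝ _ ℝ - ContinuousLinearMap.snd ℝ _ ℝ).smulRight
      (coordCovector n a.k)
  ell_lin y := by
    have h := a.sgn_mul_sgn
    simp
    linear_combination (-a.slope * y (EuclideanSpace.single a.k 1)) * h
  ell_base := by
    have h := a.sgn_mul_sgn
    simpa using h
  tau_base := by
    ext i
    simp
  tau_lin y := by
    ext x
    simp
    ring
  lin_tau w := by
    have h := a.sgn_mul_sgn
    refine Prod.ext ?_ ?_
    · ext x
      simp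
      linear_combination (w.1 (EuclideanSpace.single a.k 1) * x a.k) * h
    · simp

lemma raySlice_ell (a : RayIndex n) (w : DualSpace n × ℝ) :
    (raySlice a).ell w = a.sgn * w.1 (EuclideanSpace.single a.k 1) + a.slope * w.2 := by
  simp [raySlice]

lemma raySlice_tau (a : RayIndex n) (w : DualSpace n × ℝ) :
    (raySlice a).tau w (EuclideanSpace.single a.k 1) = w.2 := by
  simp [raySlice]

lemma raySlice_lin (a : RayIndex n) (y : DualSpace n) :
    ((raySlice a).lin y).2 = y (EuclideanSpace.single a.k 1) := by
  simp [raySlice]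

lemma raySlice_sect (a : RayIndex n) (y : DualSpace n) :
    ((raySlice a).sect y).2 = y (EuclideanSpace.single a.k 1) := by
  simp [raySlice, AffineSlice.sect]

/-- The coordinates of a ray in the affine slice. -/
noncomputable def rayCoord {V : Type*} [NormedAddCommGroup V] [NormedSpace ℝ V]
    (S : AffineSlice V) (w : (V →L[ℝ] ℝ) × ℝ) : V →L[ℝ] ℝ :=
  (S.ell w)⁻¹ • S.tau w

lemma rayCoord_smul {V : Type*} [NormedAddCommGroup V] [NormedSpace ℝ V]
    (S : AffineSlice V) (w : (V →L[ℝ] ℝ) × ℝ) {c : ℝ} (hc : c ≠ 0) :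
    rayCoord S (c • w) = rayCoord S w := by
  simp only [rayCoord, map_smul, smul_eq_mul, mul_inv, smul_smul]
  congr 1
  field_simp

lemma rayCoord_sect {V : Type*} [NormedAddCommGroup V] [NormedSpace ℝ V]
    (S : AffineSlice V) (y : V →L[ℝ] ℝ) : rayCoord S (S.sect y) = y := by
  rw [rayCoord, S.ell_sect, S.tau_sect, inv_one, one_smul]

lemma contDiffAt_rayCoord {V : Type*} [NormedAddCommGroup V] [NormedSpace ℝ V]
    (S : AffineSlice V) {w : (V →L[ℝ] ℝ) × ℝ} (hw : S.ell w ≠ 0) :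
    ContDiffAt ℝ ∞ (rayCoord S) w :=
  (S.ell.contDiff.contDiffAt.inv hw).smul S.tau.contDiff.contDiffAt

lemma finrank_cotModel : Module.finrank ℝ (𝕍 n × DualSpace n) = 2 * n := by
  have h : Module.finrank ℝ (DualSpace n) = n := by
    rw [(LinearMap.toContinuousLinearMap (𝕜 := ℝ) (E := 𝕍 n)
      (F' := ℝ)).symm.finrank_eq, Module.finrank_linearMap]
    simp
  rw [Module.finrank_prod, h, finrank_euclideanSpace_fin]
  ring

lemma exists_halfEquiv [NeZero n] (k : Fin n) :
    ∃ L : (𝕍 n × DualSpace n) ≃L[ℝ] 𝕍 (2 * n),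
      ∀ z, L z 0 = z.2 (EuclideanSpace.single k 1) :=
  exists_equiv_coord_zero finrank_cotModel
    (evalAt k ∘L ContinuousLinearMap.snd ℝ 𝕍 n (DualSpace n))
    (v := (0, coordCovector n k)) (coordCovector_single k)

/-- Linear coordinates on the model space, the first of which is `y(e_k)`. -/
noncomputable def halfEquiv [NeZero n] (k : Fin n) :
    𝕍 (2 * n) ≃L[ℝ] (𝕍 n × DualSpace n) :=
  (exists_halfEquiv k).choose.symm

lemma halfEquiv_symm_zero [NeZero n] (k : Fin n) (z : 𝕍 n × DualSpace n) :
    (halfEquiv k).symm z 0 = z.2 (EuclideanSpace.single k 1) :=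
  (exists_halfEquiv k).choose_spec z

lemma halfEquiv_snd [NeZero n] (k : Fin n) (x : 𝕍 (2 * n)) :
    (halfEquiv k x).2 (EuclideanSpace.single k 1) = x 0 := by
  rw [← halfEquiv_symm_zero, ContinuousLinearEquiv.symm_apply_apply]

lemma exists_boundaryCoordinates [NeZero n] (k : Fin n) :
    ∃ (A : 𝕍 (2 * n - 1) →L[ℝ] 𝕍 n × DualSpace n)
      (B : 𝕍 n × DualSpace n →L[ℝ] 𝕍 (2 * n - 1)),
      (∀ x, B (A x) = x) ∧ (∀ x, (A x).2 (EuclideanSpace.single k 1) = 0) ∧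
        ∀ z, z.2 (EuclideanSpace.single k 1) = 0 → A (B z) = z :=
  exists_kernel_coordinates (finrank_cotModel.trans (by have := NeZero.pos n; omega))
    (evalAt k ∘L ContinuousLinearMap.snd ℝ 𝕍 n (DualSpace n))
    (v := (0, coordCovector n k)) (coordCovector_single k)

/-- The parametrization of the boundary hyperplane `y(e_k) = 0`. -/
noncomputable def boundaryIncl [NeZero n] (k : Fin n) :
    𝕍 (2 * n - 1) →L[ℝ] 𝕍 n × DualSpace n :=
  (exists_boundaryCoordinates k).choose

/-- A projection onto the boundary hyperplane `y(e_k) = 0`. -/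
noncomputable def boundaryProj [NeZero n] (k : Fin n) :
    𝕍 n × DualSpace n →L[ℝ] 𝕍 (2 * n - 1) :=
  (exists_boundaryCoordinates k).choose_spec.choose

lemma boundaryProj_boundaryIncl [NeZero n] (k : Fin n) (x : 𝕍 (2 * n - 1)) :
    boundaryProj k (boundaryIncl k x) = x :=
  (exists_boundaryCoordinates k).choose_spec.choose_spec.1 x

lemma boundaryIncl_apply_single [NeZero n] (k : Fin n) (x : 𝕍 (2 * n - 1)) :
    (boundaryIncl k x).2 (EuclideanSpace.single k 1) = 0 :=
  (exists_boundaryCoordinates k).choose_spec.choose_spec.2.1 x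

lemma boundaryIncl_boundaryProj [NeZero n] (k : Fin n)
    {z : 𝕍 n × DualSpace n} (hz : z.2 (EuclideanSpace.single k 1) = 0) :
    boundaryIncl k (boundaryProj k z) = z :=
  (exists_boundaryCoordinates k).choose_spec.choose_spec.2.2 z hz

end RaySlices

section Pairs

variable {n : ℕ} {N : Type*} [TopologicalSpace N] [ChartedSpace 𝕍 n N]
  [IsManifold (𝓡 n) ∞ N]

/-- The coordinate domain in `ℝⁿ × (ℝⁿ)*` over the chart at `x₀`. -/
def chartCylinder (x₀ : N) : Set (𝕍 n × DualSpace n) :=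
  {z | z.1 ∈ (extChartAt (𝓡 n) x₀).target}

lemma mem_cotTarget {x₀ : N} {z : 𝕍 n × DualSpace n} :
    z ∈ coordTarget (cotangentModel n) (cotEquiv n) (⟨x₀, 0⟩ : CotangentBundle n N) ↔
      z ∈ chartCylinder x₀ := by
  change z ∈ (extChartAt (cotangentModel n) (⟨x₀, 0⟩ : CotangentBundle n N)).target ↔ _
  rw [FiberBundle.extChartAt_target]
  have h1 : z.1 ∈ (extChartAt (𝓡 n) x₀).target →
      (extChartAt (𝓡 n) x₀).symm z.1 ∈ (chartAt 𝕍 n x₀).source := fun h => by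
    simpa using (extChartAt (𝓡 n) x₀).map_target h
  change (z.1 ∈ (extChartAt (𝓡 n) x₀).target ∧ _) ∧ _ ↔ z.1 ∈ (extChartAt (𝓡 n) x₀).target
  constructor
  · exact fun h => h.1.1
  · intro h
    exact ⟨⟨h, h1 h, mem_univ _⟩, mem_univ _⟩

lemma isOpen_chartCylinder (x₀ : N) : IsOpen (chartCylinder (n := n) x₀) :=
  IsOpen.preimage (f := Prod.fst) continuous_fst (isOpen_extChartAt_target (I := 𝓡 n) x₀)

lemma cotCoord_cotInv_self {x₀ : N} {z : 𝕍 n × DualSpace n}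
    (hz : z ∈ chartCylinder x₀) : cotCoord x₀ (cotInv x₀ z) = z :=
  coordMap_coordInv (mem_cotTarget.2 hz)

lemma cotInv_proj_mem {x₀ : N} {z : 𝕍 n × DualSpace n}
    (hz : z ∈ chartCylinder x₀) :
    (cotInv x₀ z).proj ∈ (chartAt 𝕍 n x₀).source :=
  proj_mem_of_mem_cotTarget (mem_cotTarget.2 hz)

lemma cotInv_cotCoord {x₀ : N} {p : CotangentBundle n N}
    (hp : p.proj ∈ (chartAt 𝕍 n x₀).source) :
    cotInv x₀ (cotCoord x₀ p) = p :=
  coordInv_coordMap (mem_cotSource.2 hp)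

lemma cotCoord_mem {x₀ : N} {p : CotangentBundle n N}
    (hp : p.proj ∈ (chartAt 𝕍 n x₀).source) :
    cotCoord x₀ p ∈ chartCylinder x₀ :=
  mem_cotTarget.1 (coordMap_mem_coordTarget (mem_cotSource.2 hp))

lemma cotScale_cotInv {x₀ : N} {z : 𝕍 n × DualSpace n}
    (hz : z ∈ chartCylinder x₀) (c : ℝ) :
    cotScale c (cotInv x₀ z) = cotInv x₀ (z.1, c • z.2) := by
  refine cotCoord_injOn x₀ (cotInv_proj_mem hz) (cotInv_proj_mem (z := (z.1, c • z.2)) hz) ?_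
  rw [cotCoord_cotScale (cotInv_proj_mem hz), cotCoord_cotInv_self hz,
    cotCoord_cotInv_self (z := (z.1, c • z.2)) hz]

lemma continuousAt_cotInv {x₀ : N} {z : 𝕍 n × DualSpace n}
    (hz : z ∈ chartCylinder x₀) : ContinuousAt (cotInv x₀) z := by
  have h := continuousAt_coordInv (I := cotangentModel n) (L := cotEquiv n)
    (mem_cotSource.2 (cotInv_proj_mem hz))
  rwa [show coordMap (cotangentModel n) (cotEquiv n) (⟨x₀, 0⟩ : CotangentBundle n N)
    (cotInv x₀ z) = z from cotCoord_cotInv_self hz] at h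

lemma contMDiffAt_cotInv {x₀ : N} {z : 𝕍 n × DualSpace n}
    (hz : z ∈ chartCylinder x₀) : ContMDiffAt 𝓘(ℝ, 𝕍 n × DualSpace n)
      (cotangentModel n) ∞ (cotInv x₀) z := by
  have h := contMDiffAt_coordInv (I := cotangentModel n) (L := cotEquiv n)
    (mem_cotSource.2 (cotInv_proj_mem hz))
  rwa [show coordMap (cotangentModel n) (cotEquiv n) (⟨x₀, 0⟩ : CotangentBundle n N)
    (cotInv x₀ z) = z from cotCoord_cotInv_self hz] at h

/-- The homogeneous coordinates `(ξ, t)` of a pair. -/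
noncomputable abbrev pairFibre (x₀ : N) (P : CotangentBundle n N × ℝ) : DualSpace n × ℝ :=
  ((cotCoord x₀ P.1).2, P.2)

/-- The coordinates of the ray through a pair `(p, t)`. -/
noncomputable def pairCoord (x₀ : N) (a : RayIndex n) (P : CotangentBundle n N × ℝ) :
    𝕍 n × DualSpace n :=
  ((cotCoord x₀ P.1).1, rayCoord (raySlice a) (pairFibre x₀ P))

/-- The domain of `pairCoord`. -/
def pairSource (x₀ : N) (a : RayIndex n) : Set (CotangentBundle n N × ℝ) :=
  {P | P.1.proj ∈ (chartAt 𝕍 n x₀).source ∧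
    0 < (raySlice a).ell (pairFibre x₀ P)}

/-- A point of the ray with given coordinates. -/
noncomputable def pairInv (x₀ : N) (a : RayIndex n)
    (z : 𝕍 n × DualSpace n) : CotangentBundle n N × ℝ :=
  (cotInv x₀ (z.1, ((raySlice a).sect z.2).1), ((raySlice a).sect z.2).2)

/-- Scalar multiplication of pairs. -/
noncomputable def pairScale (c : ℝ) (P : CotangentBundle n N × ℝ) : CotangentBundle n N × ℝ :=
  (cotScale c P.1, c * P.2)

lemma pairFibre_pairScale {x₀ : N} {P : CotangentBundle n N × ℝ}
    (hP : P.1.proj ∈ (chartAt 𝕍 n x₀).source) (c : ℝ) :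
    pairFibre x₀ (pairScale c P) = c • pairFibre x₀ P := by
  simp only [pairFibre, pairScale, cotCoord_cotScale hP]
  rfl

lemma pairCoord_pairScale {x₀ : N} {a : RayIndex n} {P : CotangentBundle n N × ℝ}
    (hP : P.1.proj ∈ (chartAt 𝕍 n x₀).source) {c : ℝ} (hc : c ≠ 0) :
    pairCoord x₀ a (pairScale c P) = pairCoord x₀ a P := by
  rw [pairCoord, pairFibre_pairScale hP, rayCoord_smul _ _ hc, pairCoord]
  simp only [pairScale, cotCoord_cotScale hP]

lemma pairScale_mem_pairSource {x₀ : N} {a : RayIndex n} {P : CotangentBundle n N × ℝ} {c : ℝ}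
    (hc : 0 < c) : pairScale c P ∈ pairSource x₀ a ↔ P ∈ pairSource x₀ a := by
  refine and_congr_right fun hP => ?_
  rw [pairFibre_pairScale (P := P) hP, map_smul, smul_eq_mul, mul_pos_iff_of_pos_left hc]

lemma pairScale_pairScale (c d : ℝ) (P : CotangentBundle n N × ℝ) :
    pairScale c (pairScale d P) = pairScale (c * d) P :=
  Prod.ext (cotScale_cotScale c d P.1) (mul_assoc c d P.2).symm

lemma pairScale_one (P : CotangentBundle n N × ℝ) : pairScale 1 P = P :=
  Prod.ext (cotScale_one P.1) (one_mul P.2)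

lemma pairFibre_pairInv {x₀ : N} {a : RayIndex n}
    {z : 𝕍 n × DualSpace n} (hz : z ∈ chartCylinder x₀) :
    pairFibre x₀ (pairInv x₀ a z) = (raySlice a).sect z.2 := by
  rw [pairFibre, pairInv,
    cotCoord_cotInv_self (z := (z.1, ((raySlice a).sect z.2).1)) hz]

lemma pairInv_mem_pairSource {x₀ : N} {a : RayIndex n}
    {z : 𝕍 n × DualSpace n} (hz : z ∈ chartCylinder x₀) :
    pairInv x₀ a z ∈ pairSource x₀ a := by
  refine ⟨cotInv_proj_mem (z := (z.1, ((raySlice a).sect z.2).1)) hz, ?_⟩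
  rw [pairFibre_pairInv hz, AffineSlice.ell_sect]
  exact one_pos

lemma pairCoord_pairInv {x₀ : N} {a : RayIndex n}
    {z : 𝕍 n × DualSpace n} (hz : z ∈ chartCylinder x₀) :
    pairCoord x₀ a (pairInv x₀ a z) = z := by
  rw [pairCoord, pairFibre_pairInv hz, rayCoord_sect, pairInv,
    cotCoord_cotInv_self (z := (z.1, ((raySlice a).sect z.2).1)) hz]

lemma pairCoord_mem {x₀ : N} {a : RayIndex n} {P : CotangentBundle n N × ℝ}
    (hP : P ∈ pairSource x₀ a) : pairCoord x₀ a P ∈ chartCylinder x₀ :=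
  cotCoord_mem hP.1

lemma pairInv_pairCoord {x₀ : N} {a : RayIndex n} {P : CotangentBundle n N × ℝ}
    (hP : P ∈ pairSource x₀ a) :
    pairInv x₀ a (pairCoord x₀ a P) = pairScale ((raySlice a).ell (pairFibre x₀ P))⁻¹ P := by
  have h1 : (raySlice a).sect (pairCoord x₀ a P).2 =
      ((raySlice a).ell (pairFibre x₀ P))⁻¹ • pairFibre x₀ P :=
    AffineSlice.sect_tau _ hP.2.ne'
  rw [pairInv, h1]
  refine Prod.ext ?_ rfl
  simp only [pairCoord, pairScale]
  have h2 := cotScale_cotInv (cotCoord_mem hP.1) ((raySlice a).ell (pairFibre x₀ P))⁻¹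
  rw [cotInv_cotCoord hP.1] at h2
  rw [h2]
  rfl

lemma pairCoord_single {x₀ : N} {a : RayIndex n} (P : CotangentBundle n N × ℝ) :
    (pairCoord x₀ a P).2 (EuclideanSpace.single a.k 1) =
      ((raySlice a).ell (pairFibre x₀ P))⁻¹ * P.2 := by
  rw [pairCoord, rayCoord, smul_apply, raySlice_tau, smul_eq_mul]

lemma pairInv_snd {x₀ : N} {a : RayIndex n} (z : 𝕍 n × DualSpace n) :
    (pairInv x₀ a z).2 = z.2 (EuclideanSpace.single a.k 1) :=
  raySlice_sect a z.2

lemma continuousAt_pairFibre {x₀ : N} {P : CotangentBundle n N × ℝ}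
    (hP : P.1.proj ∈ (chartAt 𝕍 n x₀).source) :
    ContinuousAt (pairFibre x₀) P := by
  have h : ContinuousAt (fun P : CotangentBundle n N × ℝ => cotCoord x₀ P.1) P :=
    ContinuousAt.comp (f := Prod.fst) (g := cotCoord x₀)
      (continuousAt_coordMap (mem_cotSource.2 hP)) continuousAt_fst
  exact h.snd.prodMk continuousAt_snd

lemma isOpen_pairSource (x₀ : N) (a : RayIndex n) : IsOpen (pairSource x₀ a) := by
  refine isOpen_iff_mem_nhds.2 fun P hP => ?_
  have h1 : ∀ᶠ Q : CotangentBundle n N × ℝ in 𝓝 P,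
      Q.1.proj ∈ (chartAt 𝕍 n x₀).source :=
    (continuousAt_fst (p := P)).eventually ((isOpen_cotSource x₀).mem_nhds (x := P.1) hP.1)
  have h2 : ∀ᶠ Q : CotangentBundle n N × ℝ in 𝓝 P, 0 < (raySlice a).ell (pairFibre x₀ Q) :=
    ((raySlice a).ell.continuous.continuousAt.comp (continuousAt_pairFibre hP.1)).eventually
      (lt_mem_nhds hP.2)
  filter_upwards [h1, h2] with Q hQ hQ' using ⟨hQ, hQ'⟩

lemma continuousAt_pairCoord {x₀ : N} {a : RayIndex n} {P : CotangentBundle n N × ℝ}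
    (hP : P ∈ pairSource x₀ a) : ContinuousAt (pairCoord x₀ a) P := by
  have h : ContinuousAt (fun P : CotangentBundle n N × ℝ => cotCoord x₀ P.1) P :=
    ContinuousAt.comp (f := Prod.fst) (g := cotCoord x₀)
      (continuousAt_coordMap (mem_cotSource.2 hP.1)) continuousAt_fst
  exact h.fst.prodMk ((contDiffAt_rayCoord _ hP.2.ne').continuousAt.comp
    (continuousAt_pairFibre hP.1))

lemma continuousAt_pairInv {x₀ : N} {a : RayIndex n}
    {z : 𝕍 n × DualSpace n} (hz : z ∈ chartCylinder x₀) :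
    ContinuousAt (pairInv x₀ a) z := by
  have h : Continuous fun z : 𝕍 n × DualSpace n => (raySlice a).sect z.2 :=
    (raySlice a).contDiff_sect.continuous.comp continuous_snd
  refine ContinuousAt.prodMk ?_ h.snd.continuousAt
  exact ContinuousAt.comp (g := cotInv x₀)
    (f := fun z : 𝕍 n × DualSpace n => (z.1, ((raySlice a).sect z.2).1))
    (continuousAt_cotInv (z := (z.1, ((raySlice a).sect z.2).1)) hz)
    (continuous_fst.prodMk h.fst).continuousAt

lemma contDiffAt_pairCoord_pairInv {x₀ x₁ : N} {a a' : RayIndex n}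
    {z : 𝕍 n × DualSpace n} (hz : z ∈ chartCylinder x₀)
    (hz' : pairInv x₀ a z ∈ pairSource x₁ a') :
    ContDiffAt ℝ ∞ (fun z => pairCoord x₁ a' (pairInv x₀ a z)) z := by
  have h1 : ContDiffAt ℝ ∞ (cotCoord x₁ ∘ cotInv x₀) (z.1, ((raySlice a).sect z.2).1) := by
    rw [← contMDiffAt_iff_contDiffAt]
    exact ContMDiffAt.comp (g := cotCoord x₁) _
      (contMDiffAt_coordMap (mem_cotSource.2 hz'.1))
      (contMDiffAt_cotInv (z := (z.1, ((raySlice a).sect z.2).1)) hz)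
  have h : ContDiffAt ℝ ∞ (fun z : 𝕍 n × DualSpace n =>
      (raySlice a).sect z.2) z := ((raySlice a).contDiff_sect.comp contDiff_snd).contDiffAt
  have h2 := ContDiffAt.comp (f := fun z : 𝕍 n × DualSpace n =>
    (z.1, ((raySlice a).sect z.2).1)) z h1 (contDiffAt_fst.prodMk h.fst)
  exact h2.fst.prodMk (ContDiffAt.comp (g := rayCoord (raySlice a'))
    (f := fun z => pairFibre x₁ (pairInv x₀ a z)) z
    (contDiffAt_rayCoord _ hz'.2.ne') (h2.snd.prodMk h.snd))

/-- Every nonzero pair lies in the domain of some `pairCoord`, of slope `0` if `t = 0`. -/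
lemma exists_rayIndex [NeZero n] (P : CotangentBundle n N × ℝ) (hP : P.2 = 0 → P.1.2 ≠ 0)
    (h0 : 0 ≤ P.2) : ∃ a : RayIndex n,
      0 < (raySlice a).ell (pairFibre P.1.proj P) ∧ (P.2 = 0 → a.slope = 0) := by
  rcases h0.eq_or_lt with h | h
  · obtain ⟨k, hk⟩ : ∃ k, momentum P.1.proj k P.1 ≠ 0 := by
      by_contra! hc
      exact hP h.symm (eq_zero_of_momentum (mem_chart_source _ P.1.proj) hc)
    rw [momentum_eq (mem_chart_source _ P.1.proj)] at hk
    rcases lt_or_gt_of_ne hk with hk | hk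
    · refine ⟨⟨k, -1, by norm_num, 0⟩, ?_, fun _ => rfl⟩
      simpa [raySlice_ell] using hk
    · refine ⟨⟨k, 1, by norm_num, 0⟩, ?_, fun _ => rfl⟩
      simpa [raySlice_ell] using hk
  · refine ⟨⟨0, 1, by norm_num,
      (|(cotCoord P.1.proj P.1).2 (EuclideanSpace.single 0 1)| + 1) / P.2⟩, ?_,
      fun h' => absurd h' h.ne'⟩
    rw [raySlice_ell]
    simp only
    rw [div_mul_cancel₀ _ h.ne', one_mul]
    linarith [neg_abs_le ((cotCoord P.1.proj P.1).2 (EuclideanSpace.single 0 1))]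

open Classical in
/-- An index adapted to a nonzero pair. -/
noncomputable def rayIndex [NeZero n] (P : CotangentBundle n N × ℝ) : RayIndex n :=
  if h : ∃ a : RayIndex n, 0 < (raySlice a).ell (pairFibre P.1.proj P) ∧ (P.2 = 0 → a.slope = 0)
  then h.choose else ⟨0, 1, by norm_num, 0⟩

lemma rayIndex_spec [NeZero n] {P : CotangentBundle n N × ℝ} (hP : P.2 = 0 → P.1.2 ≠ 0)
    (h0 : 0 ≤ P.2) : 0 < (raySlice (rayIndex P)).ell (pairFibre P.1.proj P) ∧
      (P.2 = 0 → (rayIndex P).slope = 0) := by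
  have h := exists_rayIndex P hP h0
  rw [rayIndex, dif_pos h]
  exact h.choose_spec

lemma mem_pairSource_rayIndex [NeZero n] {P : CotangentBundle n N × ℝ}
    (hP : P.2 = 0 → P.1.2 ≠ 0) (h0 : 0 ≤ P.2) : P ∈ pairSource P.1.proj (rayIndex P) :=
  ⟨mem_chart_source _ _, (rayIndex_spec hP h0).1⟩

end Pairs

section Normalization

variable {n : ℕ} {N : Type*} [TopologicalSpace N] [ChartedSpace 𝕍 n N]
  [IsManifold (𝓡 n) ∞ N] (F : FibreNorm n N)

/-- The function `F(p) + t²`. -/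
noncomputable def pairSq (P : CotangentBundle n N × ℝ) : ℝ := F.sq P.1 + P.2 ^ 2

lemma pairSq_pairScale (c : ℝ) (P : CotangentBundle n N × ℝ) :
    pairSq F (pairScale c P) = c ^ 2 * pairSq F P := by
  simp only [pairSq, pairScale, cotScale, F.homogeneous]
  ring

lemma continuous_pairSq : Continuous (pairSq F) :=
  (F.smooth.continuous.comp continuous_fst).add (continuous_snd.pow 2)

lemma pairSq_pos_of_mem {x₀ : N} {a : RayIndex n} {P : CotangentBundle n N × ℝ}
    (hP : P ∈ pairSource x₀ a) : 0 < pairSq F P := by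
  by_contra h
  have h1 := F.nonneg P.1
  have h2 := sq_nonneg P.2
  have h3 : F.sq P.1 = 0 := by simp only [pairSq, not_lt] at h; linarith
  have h4 : P.2 = 0 := by
    refine pow_eq_zero_iff two_ne_zero |>.1 ?_
    simp only [pairSq, not_lt] at h; linarith
  have h5 : (cotCoord x₀ P.1).2 = 0 := by
    rw [cotCoord_eq x₀ P.1 hP.1, F.eq_zero_iff.1 h3]
    exact ContinuousLinearMap.zero_comp _
  have h6 := hP.2
  rw [pairFibre, h5, h4] at h6
  exact h6.ne' (map_zero (raySlice a).ell)

/-- The compactification of `T*N`: the pairs `(p, t)` with `F(p) + t² = 1` and `t ≥ 0`. -/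
def CompactifiedCotangent : Type _ :=
  {P : CotangentBundle n N × ℝ // pairSq F P = 1 ∧ 0 ≤ P.2}

instance : TopologicalSpace (CompactifiedCotangent F) :=
  inferInstanceAs (TopologicalSpace {P : CotangentBundle n N × ℝ // pairSq F P = 1 ∧ 0 ≤ P.2})

variable {F}

/-- The pair underlying a point of the compactification. -/
def CompactifiedCotangent.pair (P : CompactifiedCotangent F) : CotangentBundle n N × ℝ := P.1

lemma CompactifiedCotangent.pair_injective :
    Function.Injective (CompactifiedCotangent.pair (F := F)) := Subtype.val_injective

lemma CompactifiedCotangent.continuous_pair :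
    Continuous (CompactifiedCotangent.pair (F := F)) := continuous_subtype_val

lemma CompactifiedCotangent.pairSq_pair (P : CompactifiedCotangent F) : pairSq F P.pair = 1 := P.2.1

lemma CompactifiedCotangent.nonneg (P : CompactifiedCotangent F) : 0 ≤ P.pair.2 := P.2.2

lemma CompactifiedCotangent.ne_zero (P : CompactifiedCotangent F) (h : P.pair.2 = 0) :
    P.pair.1.2 ≠ 0 := by
  intro h'
  have h1 := P.pairSq_pair
  rw [pairSq, F.eq_zero_iff.2 h', h] at h1
  norm_num at h1

/-- The point of the compactification given by a normalized pair. -/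
def CompactifiedCotangent.ofPair (P : CotangentBundle n N × ℝ) (h : pairSq F P = 1 ∧ 0 ≤ P.2) :
    CompactifiedCotangent F := ⟨P, h⟩

lemma CompactifiedCotangent.isEmbedding_pair :
    Topology.IsEmbedding (CompactifiedCotangent.pair (F := F)) := Topology.IsEmbedding.subtypeVal

variable (F) in
open Classical in
/-- The point of the compactification on the ray through a pair. -/
noncomputable def rayPoint (P : CotangentBundle n N × ℝ) : CompactifiedCotangent F :=
  if h : 0 < pairSq F P ∧ 0 ≤ P.2 then
    .ofPair (pairScale (√(pairSq F P))⁻¹ P) ⟨by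
      rw [pairSq_pairScale, inv_pow, Real.sq_sqrt h.1.le, inv_mul_cancel₀ h.1.ne'],
      mul_nonneg (inv_nonneg.2 (Real.sqrt_nonneg _)) h.2⟩
  else .ofPair (⟨P.1.proj, 0⟩, 1) (by simp [pairSq, F.sq_zero])

lemma pair_rayPoint {P : CotangentBundle n N × ℝ} (h : 0 < pairSq F P) (h' : 0 ≤ P.2) :
    (rayPoint F P).pair = pairScale (√(pairSq F P))⁻¹ P := by
  rw [rayPoint, dif_pos ⟨h, h'⟩]
  rfl

lemma rayPoint_pair (P : CompactifiedCotangent F) : rayPoint F P.pair = P := by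
  refine CompactifiedCotangent.pair_injective ?_
  rw [pair_rayPoint (P.pairSq_pair ▸ one_pos) P.nonneg, P.pairSq_pair, Real.sqrt_one, inv_one,
    pairScale_one]

lemma rayPoint_pairScale {P : CotangentBundle n N × ℝ} (h : 0 < pairSq F P) (h' : 0 ≤ P.2)
    {c : ℝ} (hc : 0 < c) : rayPoint F (pairScale c P) = rayPoint F P := by
  refine CompactifiedCotangent.pair_injective ?_
  have h1 : 0 < pairSq F (pairScale c P) := by rw [pairSq_pairScale]; positivity
  rw [pair_rayPoint h1 (mul_nonneg hc.le h'), pair_rayPoint h h', pairScale_pairScale,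
    pairSq_pairScale, Real.sqrt_mul (sq_nonneg c), Real.sqrt_sq hc.le]
  congr 1
  field_simp

lemma continuousAt_pairScale (a : ℝ × (CotangentBundle n N × ℝ)) :
    ContinuousAt (fun a : ℝ × (CotangentBundle n N × ℝ) => pairScale a.1 a.2) a := by
  refine ContinuousAt.prodMk ?_ (continuousAt_fst.mul continuousAt_snd.snd)
  exact ContinuousAt.comp (g := fun a : ℝ × CotangentBundle n N => cotScale a.1 a.2)
    (f := fun a : ℝ × (CotangentBundle n N × ℝ) => (a.1, a.2.1)) (continuousAt_cotScale _)
    (continuousAt_fst.prodMk continuousAt_snd.fst)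

lemma continuousWithinAt_rayPoint {P : CotangentBundle n N × ℝ} (h : 0 < pairSq F P) (h' : 0 ≤ P.2) :
    ContinuousWithinAt (rayPoint F) {P | 0 ≤ P.2} P := by
  rw [ContinuousWithinAt, CompactifiedCotangent.isEmbedding_pair.tendsto_nhds_iff]
  have h1 : ContinuousAt (fun P => pairScale (√(pairSq F P))⁻¹ P) P :=
    ContinuousAt.comp (g := fun a : ℝ × (CotangentBundle n N × ℝ) => pairScale a.1 a.2)
      (f := fun P => ((√(pairSq F P))⁻¹, P)) (continuousAt_pairScale _)
      (((continuous_pairSq F).sqrt.continuousAt.inv₀ (Real.sqrt_pos.2 h).ne').prodMk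
        continuousAt_id)
  refine ContinuousWithinAt.congr_of_eventuallyEq (f := fun P => pairScale (√(pairSq F P))⁻¹ P)
    h1.continuousWithinAt ?_ (pair_rayPoint h h')
  filter_upwards [self_mem_nhdsWithin, nhdsWithin_le_nhds
    ((continuous_pairSq F).continuousAt.eventually (lt_mem_nhds h))] with Q hQ hQ'
  exact pair_rayPoint hQ' hQ

lemma t2Space_compactifiedCotangent [T2Space N] : T2Space (CompactifiedCotangent F) := by
  have : T2Space (CotangentBundle n N) := t2Space_cotangentBundle
  exact inferInstanceAs (T2Space {P : CotangentBundle n N × ℝ // pairSq F P = 1 ∧ 0 ≤ P.2})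

lemma secondCountable_compactifiedCotangent [SecondCountableTopology N] :
    SecondCountableTopology (CompactifiedCotangent F) := by
  have : SecondCountableTopology (CotangentBundle n N) := secondCountable_cotangentBundle
  have : SecondCountableTopology (CotangentBundle n N × ℝ) := inferInstance
  exact TopologicalSpace.Subtype.secondCountableTopology _

end Normalization

section CompactChart

variable {n : ℕ} [NeZero n] {N : Type*} [TopologicalSpace N]
  [ChartedSpace 𝕍 n N] [IsManifold (𝓡 n) ∞ N] (F : FibreNorm n N)

omit [NeZero n] in
variable {F} in
lemma pairCoord_pair_nonneg {x₀ : N} {a : RayIndex n} {P : CompactifiedCotangent F}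
    (hP : P.pair ∈ pairSource x₀ a) :
    0 ≤ (pairCoord x₀ a P.pair).2 (EuclideanSpace.single a.k 1) := by
  rw [pairCoord_single]
  exact mul_nonneg (inv_nonneg.2 hP.2.le) P.nonneg

lemma halfSpace_right_inv {k : Fin n} {z : 𝕍 n × DualSpace n}
    (hz : 0 ≤ z.2 (EuclideanSpace.single k 1)) :
    𝓗 n ((𝓗 n).symm ((halfEquiv k).symm z)) = (halfEquiv k).symm z := by
  refine (𝓗 n).right_inv ?_
  rw [range_modelWithCornersEuclideanHalfSpace]
  change 0 ≤ (halfEquiv k).symm z 0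
  rwa [halfEquiv_symm_zero]

lemma halfSpace_nonneg (k : Fin n) (u : EuclideanHalfSpace (2 * n)) :
    0 ≤ (halfEquiv k (𝓗 n u)).2 (EuclideanSpace.single k 1) := by
  rw [halfEquiv_snd]
  exact u.2

lemma pairInv_halfSpace_nonneg (x₀ : N) (a : RayIndex n) (u : EuclideanHalfSpace (2 * n)) :
    0 ≤ (pairInv x₀ a (halfEquiv a.k (𝓗 n u))).2 := by
  rw [pairInv_snd]
  exact halfSpace_nonneg a.k u

/-- The chart of the compactification given by an affine slice of the space of rays. -/
noncomputable def compactChart (x₀ : N) (a : RayIndex n) :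
    OpenPartialHomeomorph (CompactifiedCotangent F) (EuclideanHalfSpace (2 * n)) where
  toFun P := (𝓗 n).symm ((halfEquiv a.k).symm (pairCoord x₀ a P.pair))
  invFun u := rayPoint F (pairInv x₀ a (halfEquiv a.k (𝓗 n u)))
  source := CompactifiedCotangent.pair ⁻¹' pairSource x₀ a
  target := {u | halfEquiv a.k (𝓗 n u) ∈ chartCylinder x₀}
  map_source' P hP := by
    change halfEquiv a.k (𝓗 n _) ∈ chartCylinder x₀
    rw [halfSpace_right_inv (pairCoord_pair_nonneg hP), ContinuousLinearEquiv.apply_symm_apply]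
    exact pairCoord_mem hP
  map_target' u hu := by
    have h1 := pairInv_mem_pairSource (a := a) hu
    have h2 := pairSq_pos_of_mem F h1
    change (rayPoint F _).pair ∈ pairSource x₀ a
    rw [pair_rayPoint h2 (pairInv_halfSpace_nonneg x₀ a u),
      pairScale_mem_pairSource (inv_pos.2 (Real.sqrt_pos.2 h2))]
    exact h1
  left_inv' P hP := by
    rw [halfSpace_right_inv (pairCoord_pair_nonneg hP), ContinuousLinearEquiv.apply_symm_apply,
      pairInv_pairCoord hP, rayPoint_pairScale (P.pairSq_pair ▸ one_pos) P.nonneg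
        (inv_pos.2 hP.2), rayPoint_pair]
  right_inv' u hu := by
    have h1 := pairInv_mem_pairSource (a := a) hu
    have h2 := pairSq_pos_of_mem F h1
    rw [pair_rayPoint h2 (pairInv_halfSpace_nonneg x₀ a u),
      pairCoord_pairScale h1.1 (inv_pos.2 (Real.sqrt_pos.2 h2)).ne', pairCoord_pairInv hu,
      ContinuousLinearEquiv.symm_apply_apply, ModelWithCorners.left_inv]
  open_source := (isOpen_pairSource x₀ a).preimage CompactifiedCotangent.continuous_pair
  open_target := (isOpen_chartCylinder x₀).preimage
    ((halfEquiv a.k).continuous.comp (𝓗 n).continuous)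
  continuousOn_toFun P hP := by
    refine ContinuousAt.continuousWithinAt ?_
    refine ((𝓗 n).continuous_symm.comp (halfEquiv a.k).symm.continuous).continuousAt.comp ?_
    exact (continuousAt_pairCoord hP).comp CompactifiedCotangent.continuous_pair.continuousAt
  continuousOn_invFun u hu := by
    refine ContinuousAt.continuousWithinAt ?_
    rw [← continuousWithinAt_univ]
    refine ContinuousWithinAt.comp (g := rayPoint F) (t := {P | 0 ≤ P.2})
      (f := fun u : EuclideanHalfSpace (2 * n) =>
        pairInv x₀ a (halfEquiv a.k (𝓗 n u))) ?_ ?_ ?_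
    · exact continuousWithinAt_rayPoint (pairSq_pos_of_mem F (pairInv_mem_pairSource (a := a) hu))
        (pairInv_halfSpace_nonneg x₀ a u)
    · exact (ContinuousAt.comp (g := pairInv x₀ a)
        (f := fun u : EuclideanHalfSpace (2 * n) => halfEquiv a.k (𝓗 n u))
        (continuousAt_pairInv hu)
        ((halfEquiv a.k).continuous.comp (𝓗 n).continuous).continuousAt).continuousWithinAt
    · exact fun u _ => pairInv_halfSpace_nonneg x₀ a u

variable {F}

lemma compactChart_apply {x₀ : N} {a : RayIndex n} {P : CompactifiedCotangent F}
    (hP : P.pair ∈ pairSource x₀ a) :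
    halfEquiv a.k (𝓗 n (compactChart F x₀ a P)) = pairCoord x₀ a P.pair := by
  change halfEquiv a.k (𝓗 n ((𝓗 n).symm
    ((halfEquiv a.k).symm (pairCoord x₀ a P.pair)))) = _
  rw [halfSpace_right_inv (pairCoord_pair_nonneg hP), ContinuousLinearEquiv.apply_symm_apply]

noncomputable instance : ChartedSpace (EuclideanHalfSpace (2 * n)) (CompactifiedCotangent F) where
  atlas := {e | ∃ x₀ a, e = compactChart F x₀ a}
  chartAt P := compactChart F P.pair.1.proj (rayIndex P.pair)
  mem_chart_source P := mem_pairSource_rayIndex P.ne_zero P.nonneg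
  chart_mem_atlas _ := ⟨_, _, rfl⟩

instance : IsManifold 𝓗 n ∞ (CompactifiedCotangent F) := by
  refine isManifold_of_contDiffOn _ _ _ ?_
  rintro _ _ ⟨x₀, a, rfl⟩ ⟨x₁, a', rfl⟩ v ⟨hv, hv'⟩
  rw [range_modelWithCornersEuclideanHalfSpace] at hv'
  obtain ⟨u, rfl⟩ : v ∈ range 𝓗 n := by
    rw [range_modelWithCornersEuclideanHalfSpace]; exact hv'
  rw [mem_preimage, ModelWithCorners.left_inv] at hv
  obtain ⟨hu, hu'⟩ := hv
  have hu1 : halfEquiv a.k (𝓗 n u) ∈ chartCylinder x₀ := hu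
  have h1 := pairInv_mem_pairSource (a := a) hu1
  have h2 : pairInv x₀ a (halfEquiv a.k (𝓗 n u)) ∈ pairSource x₁ a' := by
    have h3 : (rayPoint F (pairInv x₀ a (halfEquiv a.k (𝓗 n u)))).pair ∈
      pairSource x₁ a' := hu'
    have h4 := pairSq_pos_of_mem F h1
    rwa [pair_rayPoint h4 (pairInv_halfSpace_nonneg x₀ a u),
      pairScale_mem_pairSource (inv_pos.2 (Real.sqrt_pos.2 h4))] at h3
  have h5 := (halfEquiv a'.k).symm.contDiff.contDiffAt.comp _
    ((contDiffAt_pairCoord_pairInv hu1 h2).comp (𝓗 n u)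
      (halfEquiv a.k).contDiff.contDiffAt)
  refine h5.contDiffWithinAt.congr_of_mem ?_ ?_
  · rintro v ⟨hv, hv'⟩
    obtain ⟨w, rfl⟩ := hv'
    rw [mem_preimage, ModelWithCorners.left_inv] at hv
    have hw : halfEquiv a.k (𝓗 n w) ∈ chartCylinder x₀ := hv.1
    have hw1 := pairInv_mem_pairSource (a := a) hw
    have hw2 := pairSq_pos_of_mem F hw1
    have hw3 : (rayPoint F (pairInv x₀ a (halfEquiv a.k (𝓗 n w)))).pair ∈
      pairSource x₁ a' := hv.2
    have hw4 := compactChart_apply hw3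
    simp only [Function.comp_apply, ModelWithCorners.left_inv]
    change 𝓗 n (compactChart F x₁ a' (rayPoint F (pairInv x₀ a
      (halfEquiv a.k (𝓗 n w))))) = _
    rw [ContinuousLinearEquiv.eq_symm_apply, hw4,
      pair_rayPoint hw2 (pairInv_halfSpace_nonneg x₀ a w)]
    rw [pair_rayPoint hw2 (pairInv_halfSpace_nonneg x₀ a w),
      pairScale_mem_pairSource (inv_pos.2 (Real.sqrt_pos.2 hw2))] at hw3
    exact pairCoord_pairScale hw3.1 (inv_pos.2 (Real.sqrt_pos.2 hw2)).ne'
  · exact ⟨by rw [mem_preimage, ModelWithCorners.left_inv]; exact ⟨hu, hu'⟩, mem_range_self u⟩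

variable (F) in
/-- Coordinates of the compactification. -/
noncomputable abbrev compCoord (P₀ P : CompactifiedCotangent F) :
    𝕍 n × DualSpace n :=
  coordMap 𝓗 n (halfEquiv (rayIndex P₀.pair).k) P₀ P

lemma mem_compSource {P₀ P : CompactifiedCotangent F} :
    P ∈ (chartAt (EuclideanHalfSpace (2 * n)) P₀).source ↔
      P.pair ∈ pairSource P₀.pair.1.proj (rayIndex P₀.pair) := Iff.rfl

lemma compCoord_eq {P₀ P : CompactifiedCotangent F}
    (hP : P.pair ∈ pairSource P₀.pair.1.proj (rayIndex P₀.pair)) :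
    compCoord F P₀ P = pairCoord P₀.pair.1.proj (rayIndex P₀.pair) P.pair :=
  compactChart_apply hP

lemma isInteriorPoint_compactified {P : CompactifiedCotangent F} :
    (𝓗 n).IsInteriorPoint P ↔ 0 < P.pair.2 := by
  have h1 := mem_pairSource_rayIndex P.ne_zero P.nonneg
  have h2 : extChartAt 𝓗 n P P =
      (halfEquiv (rayIndex P.pair).k).symm (compCoord F P P) := by
    rw [compCoord, coordMap, ContinuousLinearEquiv.symm_apply_apply]
  rw [ModelWithCorners.IsInteriorPoint, interior_range_modelWithCornersEuclideanHalfSpace, h2]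
  change 0 < (halfEquiv (rayIndex P.pair).k).symm (compCoord F P P) 0 ↔ _
  rw [halfEquiv_symm_zero, compCoord_eq h1, pairCoord_single,
    mul_pos_iff_of_pos_left (inv_pos.2 h1.2)]

lemma isBoundaryPoint_compactified {P : CompactifiedCotangent F} :
    (𝓗 n).IsBoundaryPoint P ↔ P.pair.2 = 0 := by
  rw [ModelWithCorners.isBoundaryPoint_iff_not_isInteriorPoint, isInteriorPoint_compactified,
    not_lt]
  exact ⟨fun h => le_antisymm h P.nonneg, fun h => h.le⟩

end CompactChart

section RayChart

variable {n : ℕ} [NeZero n] {N : Type*} [TopologicalSpace N]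
  [ChartedSpace 𝕍 n N] [IsManifold (𝓡 n) ∞ N]

open Classical in
/-- The ray through a covector (an arbitrary ray over the same point for the zero covector). -/
noncomputable def rayProj (p : CotangentBundle n N) : RayCotangent n N :=
  if h : p.2 ≠ 0 then rayOf p h else rayOf ⟨p.proj, coordCovector n 0⟩ fun h => by
    have h1 := DFunLike.congr_fun h (EuclideanSpace.single (0 : Fin n) (1 : ℝ))
    have h2 := coordCovector_single (n := n) 0
    exact one_ne_zero (h2.symm.trans h1)

lemma rayProj_eq (p : CotangentBundle n N) (hp : p.2 ≠ 0) : rayProj p = rayOf p hp := by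
  rw [rayProj, dif_pos hp]

lemma rayProj_cotScale {p : CotangentBundle n N} (hp : p.2 ≠ 0) {c : ℝ} (hc : 0 < c) :
    rayProj (cotScale c p) = rayProj p := by
  have h : (cotScale c p).2 ≠ 0 := smul_ne_zero hc.ne' hp
  rw [rayProj_eq p hp, rayProj_eq _ h]
  exact (Quotient.sound ⟨c, hc, rfl⟩ : (Quotient.mk (raySetoid n N) ⟨p, hp⟩) = _).symm

variable [F : FibreNorm n N]

lemma pairSq_boundary_pos {p : CotangentBundle n N} (hp : p.2 ≠ 0) : 0 < pairSq F (p, 0) := by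
  simpa [pairSq] using F.pos p hp

lemma isOpen_nonzero : IsOpen {p : CotangentBundle n N | p.2 ≠ 0} := by
  have h : {p : CotangentBundle n N | p.2 ≠ 0} = {p | 0 < F.sq p} := by
    ext p
    refine ⟨F.pos p, fun h hp => ?_⟩
    exact h.ne' (F.eq_zero_iff.2 hp)
  rw [h]
  exact isOpen_lt continuous_const F.smooth.continuous

lemma continuousAt_rayProj {p : CotangentBundle n N} (hp : p.2 ≠ 0) : ContinuousAt rayProj p := by
  have h := (isOpen_nonzero (n := n) (N := N)).isOpenEmbedding_subtypeVal.continuousAt_iff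
    (f := Subtype.val) (g := rayProj) (x := ⟨p, hp⟩)
  refine h.1 (Continuous.continuousAt ?_)
  have h2 : rayProj ∘ (Subtype.val : NonzeroCovector n N → CotangentBundle n N) =
      Quotient.mk (raySetoid n N) := funext fun p => rayProj_eq p.1 p.2
  exact h2 ▸ (continuous_quotient_mk' : Continuous (Quotient.mk (raySetoid n N)))

variable (F) in
/-- The inclusion of the space of rays as the boundary of the compactification. -/
noncomputable def rayBoundary : RayCotangent n N → CompactifiedCotangent F :=
  Quotient.lift (fun p : NonzeroCovector n N => rayPoint F (p.1, 0)) (by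
    rintro ⟨p, hp⟩ ⟨q, hq⟩ ⟨c, hc, rfl⟩
    have h := rayPoint_pairScale (pairSq_boundary_pos hp) le_rfl hc
    rw [pairScale, mul_zero] at h
    exact h.symm)

lemma rayBoundary_rayProj {p : CotangentBundle n N} (hp : p.2 ≠ 0) :
    rayBoundary F (rayProj p) = rayPoint F (p, 0) := by
  rw [rayProj_eq p hp]; rfl

lemma exists_rayProj_eq (b : RayCotangent n N) : ∃ p : CotangentBundle n N, p.2 ≠ 0 ∧
    rayProj p = b := by
  induction b using Quotient.inductionOn with
  | h p => exact ⟨p.1, p.2, rayProj_eq p.1 p.2⟩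

lemma pair_rayBoundary {p : CotangentBundle n N} (hp : p.2 ≠ 0) :
    (rayBoundary F (rayProj p)).pair = pairScale (√(pairSq F (p, 0)))⁻¹ (p, 0) := by
  rw [rayBoundary_rayProj hp, pair_rayPoint (pairSq_boundary_pos hp) le_rfl]

lemma rayBoundary_snd (b : RayCotangent n N) : (rayBoundary F b).pair.2 = 0 := by
  obtain ⟨p, hp, rfl⟩ := exists_rayProj_eq b
  rw [pair_rayBoundary hp, pairScale, mul_zero]

lemma rayProj_rayBoundary (b : RayCotangent n N) : rayProj (rayBoundary F b).pair.1 = b := by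
  obtain ⟨p, hp, rfl⟩ := exists_rayProj_eq b
  rw [pair_rayBoundary hp]
  exact rayProj_cotScale hp (inv_pos.2 (Real.sqrt_pos.2 (pairSq_boundary_pos hp)))

lemma rayBoundary_rayProj_pair {P : CompactifiedCotangent F} (hP : P.pair.2 = 0) :
    rayBoundary F (rayProj P.pair.1) = P := by
  rw [rayBoundary_rayProj (P.ne_zero hP), ← hP]
  exact rayPoint_pair P

lemma range_rayBoundary : range (rayBoundary F) = {P : CompactifiedCotangent F | P.pair.2 = 0} :=
  Subset.antisymm (range_subset_iff.2 rayBoundary_snd)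
    fun _ hP => ⟨_, rayBoundary_rayProj_pair hP⟩

lemma continuous_rayBoundary : Continuous (rayBoundary F) := by
  suffices h : Continuous fun p : NonzeroCovector n N => rayPoint F (p.1, 0) from
    h.quotient_lift _
  refine continuous_iff_continuousAt.2 fun p => ?_
  rw [← continuousWithinAt_univ]
  exact ContinuousWithinAt.comp (g := rayPoint F) (t := {P | 0 ≤ P.2})
    (f := fun p : NonzeroCovector n N => (p.1, (0 : ℝ)))
    (continuousWithinAt_rayPoint (pairSq_boundary_pos p.2) le_rfl)
    (continuous_subtype_val.prodMk continuous_const).continuousAt.continuousWithinAt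
    (fun _ _ => le_refl (0 : ℝ))

lemma rayBoundary_injective : Function.Injective (rayBoundary F) :=
  fun b b' h => by rw [← rayProj_rayBoundary b, h, rayProj_rayBoundary]

lemma isEmbedding_rayBoundary : Topology.IsEmbedding (rayBoundary F) := by
  refine ⟨Topology.isInducing_iff_nhds.2 fun b => le_antisymm
    (map_le_iff_le_comap.1 continuous_rayBoundary.continuousAt) ?_, rayBoundary_injective⟩
  have h1 : ContinuousAt (fun P : CompactifiedCotangent F => rayProj P.pair.1) (rayBoundary F b) :=
    ContinuousAt.comp (g := rayProj) (f := fun P : CompactifiedCotangent F => P.pair.1)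
      (continuousAt_rayProj ((rayBoundary F b).ne_zero (rayBoundary_snd b)))
      CompactifiedCotangent.continuous_pair.fst.continuousAt
  have h2 := h1.tendsto.comp (tendsto_comap (f := rayBoundary F) (x := 𝓝 (rayBoundary F b)))
  have h3 : ((fun P : CompactifiedCotangent F => rayProj P.pair.1) ∘ rayBoundary F) = id :=
    funext rayProj_rayBoundary
  rw [h3, rayProj_rayBoundary] at h2
  exact h2

lemma pairCoord_boundary {x₀ : N} {a : RayIndex n} {P : CotangentBundle n N × ℝ} (hP : P.2 = 0) :
    boundaryIncl a.k (boundaryProj a.k (pairCoord x₀ a P)) = pairCoord x₀ a P :=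
  boundaryIncl_boundaryProj _ (by rw [pairCoord_single, hP, mul_zero])

lemma pairInv_boundaryIncl (x₀ : N) (a : RayIndex n) (u : 𝕍 (2 * n - 1)) :
    pairInv x₀ a (boundaryIncl a.k u) = ((pairInv x₀ a (boundaryIncl a.k u)).1, 0) :=
  Prod.ext rfl ((pairInv_snd _).trans (boundaryIncl_apply_single _ _))

lemma ne_zero_of_mem_pairSource {x₀ : N} {a : RayIndex n} {p : CotangentBundle n N}
    (hp : (p, (0 : ℝ)) ∈ pairSource x₀ a) : p.2 ≠ 0 := by
  intro h
  have h1 := pairSq_pos_of_mem F hp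
  rw [pairSq, F.eq_zero_iff.2 h] at h1
  norm_num at h1

lemma pairInv_boundaryIncl_ne_zero {x₀ : N} {a : RayIndex n}
    {u : 𝕍 (2 * n - 1)} (hu : boundaryIncl a.k u ∈ chartCylinder x₀) :
    (pairInv x₀ a (boundaryIncl a.k u)).1.2 ≠ 0 := by
  have h := pairInv_mem_pairSource (a := a) hu
  rw [pairInv_boundaryIncl] at h
  exact ne_zero_of_mem_pairSource h

lemma rayBoundary_mem_pairSource {x₀ : N} {a : RayIndex n} {p : CotangentBundle n N}
    (hp : p.2 ≠ 0) : (rayBoundary F (rayProj p)).pair ∈ pairSource x₀ a ↔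
      (p, (0 : ℝ)) ∈ pairSource x₀ a := by
  rw [pair_rayBoundary hp,
    pairScale_mem_pairSource (inv_pos.2 (Real.sqrt_pos.2 (pairSq_boundary_pos hp)))]

lemma pairCoord_rayBoundary {x₀ : N} {a : RayIndex n} {p : CotangentBundle n N}
    (hp : (p, (0 : ℝ)) ∈ pairSource x₀ a) :
    pairCoord x₀ a (rayBoundary F (rayProj p)).pair = pairCoord x₀ a (p, 0) := by
  have h := ne_zero_of_mem_pairSource hp
  rw [pair_rayBoundary h, pairCoord_pairScale hp.1
    (inv_pos.2 (Real.sqrt_pos.2 (pairSq_boundary_pos h))).ne']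

/-- The chart of the space of rays given by an affine slice. -/
noncomputable def rayChart (x₀ : N) (a : RayIndex n) :
    OpenPartialHomeomorph (RayCotangent n N) 𝕍 (2 * n - 1) where
  toFun b := boundaryProj a.k (pairCoord x₀ a (rayBoundary F b).pair)
  invFun u := rayProj (pairInv x₀ a (boundaryIncl a.k u)).1
  source := {b | (rayBoundary F b).pair ∈ pairSource x₀ a}
  target := {u | boundaryIncl a.k u ∈ chartCylinder x₀}
  map_source' b hb := by
    change boundaryIncl a.k (boundaryProj a.k _) ∈ chartCylinder x₀
    rw [pairCoord_boundary (rayBoundary_snd b)]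
    exact pairCoord_mem hb
  map_target' u hu := by
    refine (rayBoundary_mem_pairSource (pairInv_boundaryIncl_ne_zero hu)).2 ?_
    rw [← pairInv_boundaryIncl]
    exact pairInv_mem_pairSource hu
  left_inv' b hb := by
    rw [pairCoord_boundary (rayBoundary_snd b), pairInv_pairCoord hb]
    refine (rayProj_cotScale ((rayBoundary F b).ne_zero (rayBoundary_snd b))
      (inv_pos.2 hb.2)).trans (rayProj_rayBoundary b)
  right_inv' u hu := by
    have h := pairInv_mem_pairSource (a := a) hu
    rw [pairInv_boundaryIncl] at h
    rw [pairCoord_rayBoundary h, ← pairInv_boundaryIncl, pairCoord_pairInv hu,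
      boundaryProj_boundaryIncl]
  open_source := (isOpen_pairSource x₀ a).preimage
    (CompactifiedCotangent.continuous_pair.comp continuous_rayBoundary)
  open_target := (isOpen_chartCylinder x₀).preimage (boundaryIncl a.k).continuous
  continuousOn_toFun b hb := by
    refine ContinuousAt.continuousWithinAt ?_
    exact (boundaryProj a.k).continuous.continuousAt.comp (ContinuousAt.comp
      (g := pairCoord x₀ a) (f := CompactifiedCotangent.pair ∘ rayBoundary F)
      (continuousAt_pairCoord hb) (CompactifiedCotangent.continuous_pair.comp continuous_rayBoundary).continuousAt)
  continuousOn_invFun u hu := by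
    refine ContinuousAt.continuousWithinAt ?_
    exact ContinuousAt.comp (g := rayProj)
      (f := fun u => (pairInv x₀ a (boundaryIncl a.k u)).1)
      (continuousAt_rayProj (pairInv_boundaryIncl_ne_zero hu))
      (ContinuousAt.fst (ContinuousAt.comp (g := pairInv x₀ a) (f := boundaryIncl a.k)
        (continuousAt_pairInv hu) (boundaryIncl a.k).continuous.continuousAt))

noncomputable instance : ChartedSpace 𝕍 (2 * n - 1) (RayCotangent n N) where
  atlas := {e | ∃ x₀ a, e = rayChart x₀ a}
  chartAt b := rayChart (rayBoundary F b).pair.1.proj (rayIndex (rayBoundary F b).pair)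
  mem_chart_source b :=
    mem_pairSource_rayIndex (rayBoundary F b).ne_zero (rayBoundary F b).nonneg
  chart_mem_atlas _ := ⟨_, _, rfl⟩

instance : IsManifold 𝓢 n ∞ (RayCotangent n N) := by
  refine isManifold_of_contDiffOn _ _ _ ?_
  rintro _ _ ⟨x₀, a, rfl⟩ ⟨x₁, a', rfl⟩ u ⟨⟨hu, hu'⟩, -⟩
  have key : ∀ u, boundaryIncl a.k u ∈ chartCylinder x₀ →
      rayProj (pairInv x₀ a (boundaryIncl a.k u)).1 ∈ (rayChart (n := n) x₁ a').source →
      pairInv x₀ a (boundaryIncl a.k u) ∈ pairSource x₁ a' := by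
    intro u hu hu'
    rw [pairInv_boundaryIncl]
    exact (rayBoundary_mem_pairSource (pairInv_boundaryIncl_ne_zero hu)).1 hu'
  have h5 := (boundaryProj a'.k).contDiff.contDiffAt.comp _
    ((contDiffAt_pairCoord_pairInv hu (key u hu hu')).comp u
      (boundaryIncl a.k).contDiff.contDiffAt)
  refine h5.contDiffWithinAt.congr_of_mem ?_ ?_
  · rintro v ⟨⟨hv, hv'⟩, -⟩
    have h := key v hv hv'
    rw [pairInv_boundaryIncl] at h
    change boundaryProj a'.k (pairCoord x₁ a' (rayBoundary F (rayProj
      (pairInv x₀ a (boundaryIncl a.k v)).1)).pair) = _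
    rw [pairCoord_rayBoundary h, ← pairInv_boundaryIncl]
    rfl
  · exact ⟨⟨hu, hu'⟩, u, rfl⟩

/-- Coordinates of the space of rays. -/
noncomputable abbrev rayCoordMap (b b' : RayCotangent n N) : 𝕍 (2 * n - 1) :=
  coordMap 𝓢 n (ContinuousLinearEquiv.refl ℝ _) b b'

lemma rayCoordMap_eq (b b' : RayCotangent n N) : rayCoordMap b b' =
    boundaryProj (rayIndex (rayBoundary F b).pair).k (pairCoord (rayBoundary F b).pair.1.proj
      (rayIndex (rayBoundary F b).pair) (rayBoundary F b').pair) := rfl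

end RayChart

section CoordinateExpressions

variable {E : Type*} [NormedAddCommGroup E] [NormedSpace ℝ E]
  {H : Type*} [TopologicalSpace H] {I : ModelWithCorners ℝ E H}
  {M : Type*} [TopologicalSpace M] [ChartedSpace H M] [IsManifold I ∞ M]
  {Z : Type*} [NormedAddCommGroup Z] [NormedSpace ℝ Z] {L : E ≃L[ℝ] Z}
  {F : Type*} [NormedAddCommGroup F] [NormedSpace ℝ F]
  {E' : Type*} [NormedAddCommGroup E'] [NormedSpace ℝ E']
  {H' : Type*} [TopologicalSpace H'] {I' : ModelWithCorners ℝ E' H'}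
  {M' : Type*} [TopologicalSpace M'] [ChartedSpace H' M'] [IsManifold I' ∞ M']
  {Z' : Type*} [NormedAddCommGroup Z'] [NormedSpace ℝ Z'] {L' : E' ≃L[ℝ] Z'}
  {x₀ P : M} {y₀ : M'} {G : M → M'} {g : Z → Z'}

lemma mvfderiv_of_comp_coordMap (hP : P ∈ (chartAt H x₀).source) {f : M → F} {k : Z → F}
    (hk : DifferentiableAt ℝ k (coordMap I L x₀ P))
    (hf : ∀ᶠ Q in 𝓝 P, f Q = k (coordMap I L x₀ Q)) (v : TangentSpace I P) :
    mvfderiv I f P v = fderiv ℝ k (coordMap I L x₀ P) (coordDeriv I L x₀ P v) := by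
  have h1 : mvfderiv I f P = mvfderiv I (k ∘ coordMap I L x₀) P := by
    have h := (show f =ᶠ[𝓝 P] k ∘ coordMap I L x₀ from hf).mfderiv_eq (I := I) (I' := 𝓘(ℝ, F))
    ext w
    simp only [mvfderiv]
    rw [h]
    rfl
  rw [h1]
  have h2 : MDifferentiableAt I 𝓘(ℝ, Z) (coordMap I L x₀) P :=
    (contMDiffAt_coordMap hP).mdifferentiableAt (by simp)
  have h3 := mfderiv_comp P hk.mdifferentiableAt h2
  have h4 := DFunLike.congr_fun h3 v
  rw [mfderiv_eq_fderiv, mfderiv_coordMap hP] at h4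
  exact h4

lemma contMDiffAt_of_coordMap_eq (hP : P ∈ (chartAt H x₀).source)
    (hGP : G P ∈ (chartAt H' y₀).source) (hG : ContinuousAt G P)
    (hg : ContDiffWithinAt ℝ ∞ g (coordRange I L) (coordMap I L x₀ P))
    (h : ∀ᶠ Q in 𝓝 P, coordMap I' L' y₀ (G Q) = g (coordMap I L x₀ Q)) :
    ContMDiffAt I I' ∞ G P := by
  have h1 : ContMDiffAt I 𝓘(ℝ, Z') ∞ (fun Q => coordMap I' L' y₀ (G Q)) P :=
    contMDiffAt_of_comp_coordMap hP hg h
  have h2 := contMDiffWithinAt_coordInv (I := I') (L := L') (coordMap_mem_coordTarget hGP)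
  have h3 : ContMDiffAt I I' ∞ (fun Q => coordInv I' L' y₀ (coordMap I' L' y₀ (G Q))) P := by
    rw [← contMDiffWithinAt_univ] at h1 ⊢
    exact ContMDiffWithinAt.comp (g := coordInv I' L' y₀) (f := fun Q => coordMap I' L' y₀ (G Q))
      P h2 h1 (fun Q _ => coordMap_mem_coordRange y₀ (G Q))
  refine h3.congr_of_eventuallyEq ?_
  filter_upwards [hG.eventually (eventually_mem_source hGP)] with Q hQ
  exact (coordInv_coordMap hQ).symm

lemma coordDeriv_mfderiv_of_coordMap_eq (hP : P ∈ (chartAt H x₀).source)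
    (hGP : G P ∈ (chartAt H' y₀).source) (hG : MDifferentiableAt I I' G P)
    (hg : DifferentiableAt ℝ g (coordMap I L x₀ P))
    (h : ∀ᶠ Q in 𝓝 P, coordMap I' L' y₀ (G Q) = g (coordMap I L x₀ Q)) (v : TangentSpace I P) :
    coordDeriv I' L' y₀ (G P) (mfderiv I I' G P v) =
      fderiv ℝ g (coordMap I L x₀ P) (coordDeriv I L x₀ P v) := by
  have h1 := mvfderiv_of_comp_coordMap (f := fun Q => coordMap I' L' y₀ (G Q)) hP hg h v
  rw [← h1]
  have h2 : MDifferentiableAt I' 𝓘(ℝ, Z') (coordMap I' L' y₀) (G P) :=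
    (contMDiffAt_coordMap hGP).mdifferentiableAt (by simp)
  have h4 := DFunLike.congr_fun (mfderiv_comp P h2 hG) v
  rw [mfderiv_coordMap hGP] at h4
  exact h4.symm

end CoordinateExpressions

section CompactifiedMaps

variable {n : ℕ} [NeZero n] {N : Type*} [TopologicalSpace N]
  [ChartedSpace 𝕍 n N] [IsManifold (𝓡 n) ∞ N] [F : FibreNorm n N]

/-- The factor `f` with `T = f y_k`. -/
noncomputable def pairWeight (x₀ : N) (a : RayIndex n)
    (z : 𝕍 n × DualSpace n) : ℝ :=
  (√(pairSq F (pairInv x₀ a z)))⁻¹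

lemma pairWeight_pos {x₀ : N} {a : RayIndex n} {z : 𝕍 n × DualSpace n}
    (hz : z ∈ chartCylinder x₀) : 0 < pairWeight x₀ a z :=
  inv_pos.2 (Real.sqrt_pos.2 (pairSq_pos_of_mem F (pairInv_mem_pairSource hz)))

lemma contDiffAt_pairWeight {x₀ : N} {a : RayIndex n}
    {z : 𝕍 n × DualSpace n} (hz : z ∈ chartCylinder x₀) :
    ContDiffAt ℝ ∞ (pairWeight x₀ a) z := by
  have h : ContDiffAt ℝ ∞ (fun z : 𝕍 n × DualSpace n =>
      (raySlice a).sect z.2) z := ((raySlice a).contDiff_sect.comp contDiff_snd).contDiffAt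
  have h1 : ContDiffAt ℝ ∞ (fun z => F.sq (pairInv x₀ a z).1) z := by
    have h2 : ContDiffAt ℝ ∞ (F.sq ∘ cotInv x₀) (z.1, ((raySlice a).sect z.2).1) := by
      rw [← contMDiffAt_iff_contDiffAt]
      exact ContMDiffAt.comp (g := F.sq) _ (F.smooth _)
        (contMDiffAt_cotInv (z := (z.1, ((raySlice a).sect z.2).1)) hz)
    exact ContDiffAt.comp (f := fun z : 𝕍 n × DualSpace n =>
      (z.1, ((raySlice a).sect z.2).1)) z h2 (contDiffAt_fst.prodMk h.fst)
  have h3 := pairSq_pos_of_mem F (pairInv_mem_pairSource (a := a) hz)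
  exact ((h1.add (h.snd.pow 2)).sqrt h3.ne').inv (Real.sqrt_pos.2 h3).ne'

lemma pair_eq_pairScale {x₀ : N} {a : RayIndex n} {P : CompactifiedCotangent F}
    (hP : P.pair ∈ pairSource x₀ a) : P.pair =
      pairScale (pairWeight x₀ a (pairCoord x₀ a P.pair)) (pairInv x₀ a (pairCoord x₀ a P.pair)) := by
  have h1 : 0 < ((raySlice a).ell (pairFibre x₀ P.pair))⁻¹ := inv_pos.2 hP.2
  rw [pairWeight, pairInv_pairCoord hP, pairSq_pairScale, P.pairSq_pair, mul_one,
    Real.sqrt_sq h1.le, inv_inv, pairScale_pairScale, mul_inv_cancel₀ hP.2.ne', pairScale_one]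

variable (F) in
/-- The boundary defining function. -/
noncomputable def definingFunction (P : CompactifiedCotangent F) : ℝ := P.pair.2

variable (F) in
/-- The projection of the compactification. -/
def compactProj (P : CompactifiedCotangent F) : N := P.pair.1.proj

variable (F) in
/-- The inclusion of `T*N` in its compactification. -/
noncomputable def interiorIncl (p : CotangentBundle n N) : CompactifiedCotangent F :=
  rayPoint F (p, 1)

lemma definingFunction_eq {x₀ : N} {a : RayIndex n} {P : CompactifiedCotangent F}
    (hP : P.pair ∈ pairSource x₀ a) : definingFunction F P =
      pairWeight x₀ a (pairCoord x₀ a P.pair) *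
        (pairCoord x₀ a P.pair).2 (EuclideanSpace.single a.k 1) := by
  conv_lhs => rw [definingFunction, pair_eq_pairScale hP]
  rw [pairScale, pairInv_snd]

lemma eventually_definingFunction_eq {P₀ P : CompactifiedCotangent F}
    (hP : P ∈ (chartAt (EuclideanHalfSpace (2 * n)) P₀).source) : ∀ᶠ Q in 𝓝 P,
      definingFunction F Q = pairWeight P₀.pair.1.proj (rayIndex P₀.pair) (compCoord F P₀ Q) *
        (compCoord F P₀ Q).2 (EuclideanSpace.single (rayIndex P₀.pair).k 1) := by
  filter_upwards [eventually_mem_source hP] with Q hQ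
  rw [compCoord_eq hQ]
  exact definingFunction_eq hQ

lemma compCoord_mem_cylinder {P₀ P : CompactifiedCotangent F}
    (hP : P ∈ (chartAt (EuclideanHalfSpace (2 * n)) P₀).source) :
    compCoord F P₀ P ∈ chartCylinder P₀.pair.1.proj := by
  rw [compCoord_eq hP]
  exact pairCoord_mem hP

lemma contMDiff_definingFunction : ContMDiff 𝓗 n 𝓘(ℝ, ℝ) ∞ (definingFunction F) := by
  intro P
  have hP := mem_chart_source (EuclideanHalfSpace (2 * n)) P
  refine contMDiffAt_of_comp_coordMap (L := halfEquiv (rayIndex P.pair).k)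
    (g := fun z => pairWeight P.pair.1.proj (rayIndex P.pair) z *
      z.2 (EuclideanSpace.single (rayIndex P.pair).k 1)) hP ?_ (eventually_definingFunction_eq hP)
  exact ((contDiffAt_pairWeight (compCoord_mem_cylinder hP)).mul
    (contDiffAt_snd.clm_apply contDiffAt_const)).contDiffWithinAt

lemma mvfderiv_definingFunction {P₀ P : CompactifiedCotangent F}
    (hP : P ∈ (chartAt (EuclideanHalfSpace (2 * n)) P₀).source)
    (v : TangentSpace 𝓗 n P) : mvfderiv 𝓗 n (definingFunction F) P v =
      sliceDT (raySlice (rayIndex P₀.pair))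
        (pairWeight P₀.pair.1.proj (rayIndex P₀.pair) (compCoord F P₀ P))
        (fderiv ℝ (pairWeight P₀.pair.1.proj (rayIndex P₀.pair)) (compCoord F P₀ P))
        (compCoord F P₀ P).2
        (coordDeriv 𝓗 n (halfEquiv (rayIndex P₀.pair).k) P₀ P v) := by
  have hf := (contDiffAt_pairWeight (a := rayIndex P₀.pair) (compCoord_mem_cylinder hP)).differentiableAt
    (by simp)
  have hl := ((evalAt (rayIndex P₀.pair).k) ∘L
    ContinuousLinearMap.snd ℝ 𝕍 n (DualSpace n)).hasFDerivAt
      (x := compCoord F P₀ P)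
  have h := hf.hasFDerivAt.mul hl
  rw [mvfderiv_of_comp_coordMap hP h.differentiableAt (eventually_definingFunction_eq hP),
    h.fderiv, sliceDT_apply, raySlice_lin, raySlice_sect]
  simp

lemma isBoundaryDefining_definingFunction :
    IsBoundaryDefining 𝓗 n (definingFunction F) where
  smooth := contMDiff_definingFunction
  zero_iff P := isBoundaryPoint_compactified.symm
  deriv_ne_zero P hP h := by
    have hP0 : P.pair.2 = 0 := isBoundaryPoint_compactified.1 hP
    have hs := mem_chart_source (EuclideanHalfSpace (2 * n)) P
    have h1 := mvfderiv_definingFunction hs (coordLift 𝓗 n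
      (halfEquiv (rayIndex P.pair).k) P P (0, coordCovector n (rayIndex P.pair).k))
    rw [h, coordDeriv_coordLift hs, sliceDT_apply, raySlice_lin, raySlice_sect, compCoord_eq hs,
      pairCoord_single, hP0, coordCovector_single] at h1
    have h2 := pairWeight_pos (a := rayIndex P.pair) (pairCoord_mem hs)
    simp at h1
    exact h2.ne h1

lemma contMDiff_compactProj : ContMDiff 𝓗 n (𝓡 n) ∞ (compactProj F) := by
  intro P
  have hP := mem_chart_source (EuclideanHalfSpace (2 * n)) P
  refine contMDiffAt_of_coordMap_eq (L := halfEquiv (rayIndex P.pair).k) (L' := idEquiv n)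
    (g := Prod.fst) (x₀ := P) (y₀ := P.pair.1.proj) hP
    (mem_chart_source 𝕍 n P.pair.1.proj) ?_
    contDiffAt_fst.contDiffWithinAt ?_
  · exact (continuous_cotProj.comp CompactifiedCotangent.continuous_pair.fst).continuousAt
  · filter_upwards [eventually_mem_source hP] with Q hQ
    have h := compCoord_eq hQ
    rw [compCoord] at h
    rw [h, pairCoord, cotCoord_fst (mem_compSource.1 hQ).1]
    rfl

lemma pairSq_interior_pos (p : CotangentBundle n N) {t : ℝ} (ht : t ≠ 0) :
    0 < pairSq F (p, t) :=
  add_pos_of_nonneg_of_pos (F.nonneg p) (by positivity)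

lemma pair_interiorIncl (p : CotangentBundle n N) :
    (interiorIncl F p).pair = pairScale (√(pairSq F (p, 1)))⁻¹ (p, 1) :=
  pair_rayPoint (pairSq_interior_pos p one_ne_zero) zero_le_one

lemma definingFunction_interiorIncl_pos (p : CotangentBundle n N) :
    0 < definingFunction F (interiorIncl F p) := by
  rw [definingFunction, pair_interiorIncl, pairScale, mul_one]
  exact inv_pos.2 (Real.sqrt_pos.2 (pairSq_interior_pos p one_ne_zero))

lemma compactProj_interiorIncl (p : CotangentBundle n N) :
    compactProj F (interiorIncl F p) = p.proj := by
  rw [compactProj, pair_interiorIncl]; rfl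

variable (F) in
/-- The inverse of `interiorIncl`. -/
noncomputable def interiorInv (P : CompactifiedCotangent F) : CotangentBundle n N :=
  cotScale P.pair.2⁻¹ P.pair.1

lemma interiorInv_interiorIncl (p : CotangentBundle n N) :
    interiorInv F (interiorIncl F p) = p := by
  have h := Real.sqrt_pos.2 (pairSq_interior_pos (F := F) p one_ne_zero)
  rw [interiorInv, pair_interiorIncl]
  simp only [pairScale, mul_one, inv_inv]
  rw [cotScale_cotScale, mul_inv_cancel₀ h.ne', cotScale_one]

lemma interiorIncl_interiorInv {P : CompactifiedCotangent F} (hP : 0 < P.pair.2) :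
    interiorIncl F (interiorInv F P) = P := by
  have h := rayPoint_pairScale (P.pairSq_pair ▸ one_pos) P.nonneg (inv_pos.2 hP)
  rw [rayPoint_pair] at h
  rw [pairScale, inv_mul_cancel₀ hP.ne'] at h
  exact h

lemma continuous_interiorIncl : Continuous (interiorIncl F) := by
  refine continuous_iff_continuousAt.2 fun p => ?_
  rw [← continuousWithinAt_univ]
  exact ContinuousWithinAt.comp (g := rayPoint F) (t := {P | 0 ≤ P.2})
    (f := fun p : CotangentBundle n N => (p, (1 : ℝ)))
    (continuousWithinAt_rayPoint (pairSq_interior_pos p one_ne_zero) zero_le_one)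
    (Continuous.prodMk continuous_id continuous_const).continuousAt.continuousWithinAt
    (fun _ _ => zero_le_one (α := ℝ))

lemma continuousAt_interiorInv {P : CompactifiedCotangent F} (hP : 0 < P.pair.2) :
    ContinuousAt (interiorInv F) P :=
  ContinuousAt.comp (g := fun a : ℝ × CotangentBundle n N => cotScale a.1 a.2)
    (f := fun P : CompactifiedCotangent F => (P.pair.2⁻¹, P.pair.1)) (continuousAt_cotScale _)
    ((CompactifiedCotangent.continuous_pair.snd.continuousAt.inv₀ hP.ne').prodMk
      CompactifiedCotangent.continuous_pair.fst.continuousAt)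

lemma interiorIncl_mem_pairSource {x₀ : N} {a : RayIndex n} {p : CotangentBundle n N} :
    (interiorIncl F p).pair ∈ pairSource x₀ a ↔ (p, (1 : ℝ)) ∈ pairSource x₀ a := by
  rw [pair_interiorIncl, pairScale_mem_pairSource
    (inv_pos.2 (Real.sqrt_pos.2 (pairSq_interior_pos p one_ne_zero)))]

lemma pairCoord_interiorIncl {x₀ : N} {a : RayIndex n} {p : CotangentBundle n N}
    (hp : (p, (1 : ℝ)) ∈ pairSource x₀ a) : pairCoord x₀ a (interiorIncl F p).pair =
      ((cotCoord x₀ p).1, sliceCoord (raySlice a) (cotCoord x₀ p)) := by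
  rw [pair_interiorIncl, pairCoord_pairScale hp.1
    (inv_pos.2 (Real.sqrt_pos.2 (pairSq_interior_pos p one_ne_zero))).ne']
  rfl

lemma compCoord_interiorIncl {P₀ : CompactifiedCotangent F} {p : CotangentBundle n N}
    (hp : interiorIncl F p ∈ (chartAt (EuclideanHalfSpace (2 * n)) P₀).source) :
    compCoord F P₀ (interiorIncl F p) = ((cotCoord P₀.pair.1.proj p).1,
      sliceCoord (raySlice (rayIndex P₀.pair)) (cotCoord P₀.pair.1.proj p)) := by
  rw [compCoord_eq hp]
  exact pairCoord_interiorIncl (interiorIncl_mem_pairSource.1 hp)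

lemma contMDiff_interiorIncl :
    ContMDiff (cotangentModel n) 𝓗 n ∞ (interiorIncl F) := by
  intro p
  have hs := mem_chart_source (EuclideanHalfSpace (2 * n)) (interiorIncl F p)
  have hp := interiorIncl_mem_pairSource.1 (mem_compSource.1 hs)
  refine contMDiffAt_of_coordMap_eq (L := cotEquiv n)
    (L' := halfEquiv (rayIndex (interiorIncl F p).pair).k)
    (x₀ := (⟨(interiorIncl F p).pair.1.proj, 0⟩ : CotangentBundle n N)) (y₀ := interiorIncl F p)
    (g := fun z => (z.1, sliceCoord (raySlice (rayIndex (interiorIncl F p).pair)) z))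
    (mem_cotSource.2 hp.1) hs continuous_interiorIncl.continuousAt
    (contDiffAt_fst.prodMk (contDiffAt_sliceCoord hp.2.ne')).contDiffWithinAt ?_
  filter_upwards [continuous_interiorIncl.continuousAt.eventually (eventually_mem_source hs)]
    with q hq
  exact compCoord_interiorIncl hq

lemma contMDiffAt_interiorInv {P : CompactifiedCotangent F} (hP : 0 < P.pair.2) :
    ContMDiffAt 𝓗 n (cotangentModel n) ∞ (interiorInv F) P := by
  have hs := mem_chart_source (EuclideanHalfSpace (2 * n)) P
  set S := raySlice (rayIndex P.pair) with hS
  have hsect : ContDiffAt ℝ ∞ (fun z : 𝕍 n × DualSpace n => S.sect z.2)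
    (compCoord F P P) := (S.contDiff_sect.comp contDiff_snd).contDiffAt
  have h0 : (S.sect (compCoord F P P).2).2 ≠ 0 := by
    rw [hS, raySlice_sect, compCoord_eq hs, pairCoord_single]
    exact mul_ne_zero (inv_pos.2 (mem_compSource.1 hs).2).ne' hP.ne'
  refine contMDiffAt_of_coordMap_eq (L' := cotEquiv n) (L := halfEquiv (rayIndex P.pair).k)
    (y₀ := (⟨P.pair.1.proj, 0⟩ : CotangentBundle n N)) (x₀ := P)
    (g := fun z => (z.1, (S.sect z.2).2⁻¹ • (S.sect z.2).1))
    hs (mem_cotSource.2 (mem_compSource.1 hs).1) (continuousAt_interiorInv hP)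
    (contDiffAt_fst.prodMk ((hsect.snd.inv h0).smul hsect.fst)).contDiffWithinAt ?_
  have h1 : ∀ᶠ Q : CompactifiedCotangent F in 𝓝 P, 0 < Q.pair.2 :=
    CompactifiedCotangent.continuous_pair.snd.continuousAt.eventually (lt_mem_nhds hP)
  filter_upwards [eventually_mem_source hs, h1] with Q hQ hQ'
  have h2 := compCoord_eq hQ
  have hQ2 := mem_compSource.1 hQ
  have h3 : S.sect (pairCoord P.pair.1.proj (rayIndex P.pair) Q.pair).2 = _ :=
    AffineSlice.sect_tau _ hQ2.2.ne'
  rw [compCoord] at h2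
  rw [h2, h3]
  change cotCoord P.pair.1.proj (cotScale _ _) = _
  rw [cotCoord_cotScale hQ2.1]
  refine Prod.ext rfl ?_
  simp only [Prod.smul_snd, Prod.smul_fst, pairFibre, smul_smul, smul_eq_mul]
  congr 1
  have h4 := hQ2.2.ne'
  simp only [pairFibre, ← hS] at h4
  rw [mul_inv, inv_inv, mul_right_comm, mul_inv_cancel₀ h4, one_mul]

lemma isInteriorInclusion_interiorIncl :
    IsInteriorInclusion (cotangentModel n) 𝓗 n (interiorIncl F) where
  isLocalDiffeomorph p := ⟨
    { toFun := interiorIncl F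
      invFun := interiorInv F
      source := univ
      target := {P | 0 < P.pair.2}
      map_source' := fun p _ => definingFunction_interiorIncl_pos p
      map_target' := fun _ _ => mem_univ _
      left_inv' := fun p _ => interiorInv_interiorIncl p
      right_inv' := fun _ hP => interiorIncl_interiorInv hP
      open_source := isOpen_univ
      open_target := isOpen_lt continuous_const CompactifiedCotangent.continuous_pair.snd
      contMDiffOn_toFun := contMDiff_interiorIncl.contMDiffOn
      contMDiffOn_invFun := fun _ hP => (contMDiffAt_interiorInv hP).contMDiffWithinAt },
    mem_univ p, fun _ _ => rfl⟩
  injective p q h := by rw [← interiorInv_interiorIncl (F := F) p, h, interiorInv_interiorIncl]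
  range_eq := by
    refine Subset.antisymm (range_subset_iff.2 fun p =>
      isInteriorPoint_compactified.2 (definingFunction_interiorIncl_pos p)) fun P hP => ?_
    exact ⟨_, interiorIncl_interiorInv (isInteriorPoint_compactified.1 hP)⟩

end CompactifiedMaps

section Properness

variable {n : ℕ} [NeZero n] {N : Type*} [TopologicalSpace N] [T2Space N]
  [ChartedSpace 𝕍 n N] [IsManifold (𝓡 n) ∞ N] [F : FibreNorm n N]

/-- Locally uniform coercivity of the fibre norm. -/
lemma exists_fibreNorm_lower_bound (x₀ : N) : ∃ r m : ℝ, 0 < r ∧ 0 < m ∧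
    ∀ u ∈ Metric.closedBall (extChartAt (𝓡 n) x₀ x₀) r, ∀ ξ : DualSpace n,
      (u, ξ) ∈ chartCylinder x₀ ∧ m * ‖ξ‖ ^ 2 ≤ F.sq (cotInv x₀ (u, ξ)) := by
  have : ProperSpace (DualSpace n) := FiniteDimensional.proper ℝ _
  obtain ⟨r, hr, hball⟩ := Metric.nhds_basis_closedBall.mem_iff.1
    (extChartAt_target_mem_nhds (I := 𝓡 n) x₀)
  have hcyl : ∀ u ∈ Metric.closedBall (extChartAt (𝓡 n) x₀ x₀) r, ∀ ξ : DualSpace n,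
      (u, ξ) ∈ chartCylinder x₀ := fun u hu ξ => hball hu
  let K : Set (𝕍 n × DualSpace n) :=
    Metric.closedBall (extChartAt (𝓡 n) x₀ x₀) r ×ˢ Metric.sphere 0 1
  have hK : IsCompact K := (isCompact_closedBall _ _).prod (isCompact_sphere _ _)
  have hcont : ContinuousOn (fun z => F.sq (cotInv x₀ z)) K := fun z hz =>
    (F.smooth.continuous.continuousAt.comp
      (continuousAt_cotInv (hcyl z.1 hz.1 z.2))).continuousWithinAt
  have hpos : ∀ z ∈ K, 0 < F.sq (cotInv x₀ z) := by
    intro z hz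
    refine F.pos _ fun h0 => ?_
    have h1 := cotCoord_cotInv_self (hcyl z.1 hz.1 z.2)
    rw [cotCoord_eq x₀ _ (cotInv_proj_mem (hcyl z.1 hz.1 z.2)), h0] at h1
    have h2 : z.2 = 0 := by
      rw [← congrArg Prod.snd h1]
      exact ContinuousLinearMap.zero_comp _
    have h3 := hz.2
    simp [h2] at h3
  obtain ⟨m, hm, hmK⟩ : ∃ m, 0 < m ∧ ∀ z ∈ K, m ≤ F.sq (cotInv x₀ z) := by
    rcases K.eq_empty_or_nonempty with h | h
    · exact ⟨1, one_pos, by simp [h]⟩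
    · obtain ⟨z, hz, hmin⟩ := hK.exists_isMinOn h hcont
      exact ⟨_, hpos z hz, fun w hw => hmin hw⟩
  refine ⟨r, m, hr, hm, fun u hu ξ => ⟨hcyl u hu ξ, ?_⟩⟩
  rcases eq_or_ne ξ 0 with rfl | hξ
  · simpa using F.nonneg _
  · have hn : ‖ξ‖ ≠ 0 := norm_ne_zero_iff.2 hξ
    have h1 := hmK (u, ‖ξ‖⁻¹ • ξ) ⟨hu, by simp [norm_smul, hn]⟩
    have h2 := cotScale_cotInv (hcyl u hu (‖ξ‖⁻¹ • ξ)) ‖ξ‖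
    simp only [smul_smul, mul_inv_cancel₀ hn, one_smul] at h2
    rw [← h2, cotScale, F.homogeneous, mul_comm]
    exact mul_le_mul_of_nonneg_left h1 (sq_nonneg _)

lemma isClosedEmbedding_pair :
    Topology.IsClosedEmbedding (CompactifiedCotangent.pair (F := F)) := by
  refine ⟨CompactifiedCotangent.isEmbedding_pair, ?_⟩
  have h : range (CompactifiedCotangent.pair (F := F)) = {P | pairSq F P = 1 ∧ 0 ≤ P.2} :=
    Subtype.range_coe
  rw [h]
  exact (isClosed_eq (continuous_pairSq F) continuous_const).inter
    (isClosed_le continuous_const continuous_snd)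

lemma isProperMap_compactProj : IsProperMap (compactProj F) := by
  refine isProperMap_iff_ultrafilter_of_t2.2 ⟨contMDiff_compactProj.continuous, fun 𝒰 x₀ h𝒰 => ?_⟩
  have : ProperSpace (DualSpace n) := FiniteDimensional.proper ℝ _
  obtain ⟨r, m, hr, hm, hF⟩ := exists_fibreNorm_lower_bound (F := F) x₀
  let K : Set ((𝕍 n × DualSpace n) × ℝ) :=
    (Metric.closedBall (extChartAt (𝓡 n) x₀ x₀) r ×ˢ Metric.closedBall 0 (√m)⁻¹) ×ˢ Icc 0 1
  have hK : IsCompact K := ((isCompact_closedBall _ _).prod (isCompact_closedBall _ _)).prod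
    isCompact_Icc
  let G : (𝕍 n × DualSpace n) × ℝ → CotangentBundle n N × ℝ :=
    fun w => (cotInv x₀ w.1, w.2)
  have hG : ContinuousOn G K := fun w hw => by
    refine ContinuousAt.continuousWithinAt (ContinuousAt.prodMk ?_ continuousAt_snd)
    exact ContinuousAt.comp (g := cotInv x₀) (f := Prod.fst)
      (continuousAt_cotInv (hF _ hw.1.1 _).1) continuousAt_fst
  have hC := isClosedEmbedding_pair.isCompact_preimage (hK.image_of_continuousOn hG) (f := CompactifiedCotangent.pair (F := F))
  suffices hmem : CompactifiedCotangent.pair (F := F) ⁻¹' (G '' K) ∈ 𝒰 by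
    obtain ⟨P, -, hP⟩ := hC.ultrafilter_le_nhds 𝒰 (le_principal_iff.2 hmem)
    exact ⟨P, hP⟩
  have h1 : ∀ᶠ x in 𝓝 x₀, x ∈ (chartAt 𝕍 n x₀).source ∧
      extChartAt (𝓡 n) x₀ x ∈ Metric.closedBall (extChartAt (𝓡 n) x₀ x₀) r := by
    filter_upwards [chart_source_mem_nhds 𝕍 n x₀,
      (continuousAt_extChartAt (I := 𝓡 n) x₀).eventually (Metric.closedBall_mem_nhds _ hr)]
      with x hx hx' using ⟨hx, hx'⟩
  filter_upwards [h𝒰.eventually h1] with P hP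
  obtain ⟨hP1, hP2⟩ := hP
  have hP3 : P.pair.1.proj ∈ (chartAt 𝕍 n x₀).source := hP1
  have hu : (cotCoord x₀ P.pair.1).1 = extChartAt (𝓡 n) x₀ P.pair.1.proj := by
    rw [cotCoord_fst hP3]; rfl
  have hP4 : (cotCoord x₀ P.pair.1).1 ∈ Metric.closedBall (extChartAt (𝓡 n) x₀ x₀) r := hu ▸ hP2
  have h3 := (hF _ hP4 (cotCoord x₀ P.pair.1).2).2
  rw [Prod.mk.eta, cotInv_cotCoord hP3] at h3
  have h4 := P.pairSq_pair
  rw [pairSq] at h4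
  have h5 := F.nonneg P.pair.1
  refine ⟨(cotCoord x₀ P.pair.1, P.pair.2), ⟨⟨hP4, ?_⟩, P.nonneg, ?_⟩, ?_⟩
  · rw [mem_closedBall_zero_iff]
    refine (Real.le_sqrt (norm_nonneg _) (inv_nonneg.2 hm.le)).2 ?_ |>.trans_eq
      (Real.sqrt_inv m)
    rw [← one_div, le_div_iff₀ hm]
    nlinarith [sq_nonneg P.pair.2]
  · change P.pair.2 ≤ 1
    nlinarith [sq_nonneg (P.pair.2 - 1)]
  · exact Prod.ext (cotInv_cotCoord hP3) rfl

end Properness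

section BoundaryMaps

variable {n : ℕ} [NeZero n] {N : Type*} [TopologicalSpace N]
  [ChartedSpace 𝕍 n N] [IsManifold (𝓡 n) ∞ N] [F : FibreNorm n N]

lemma rayBoundary_mem_source {b b' : RayCotangent n N} :
    rayBoundary F b' ∈ (chartAt (EuclideanHalfSpace (2 * n)) (rayBoundary F b)).source ↔
      b' ∈ (chartAt 𝕍 (2 * n - 1) b).source := Iff.rfl

lemma compCoord_rayBoundary {b b' : RayCotangent n N}
    (hb : b' ∈ (chartAt 𝕍 (2 * n - 1) b).source) :
    compCoord F (rayBoundary F b) (rayBoundary F b') =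
      boundaryIncl (rayIndex (rayBoundary F b).pair).k (rayCoordMap b b') := by
  rw [compCoord_eq (rayBoundary_mem_source.2 hb), rayCoordMap_eq,
    pairCoord_boundary (rayBoundary_snd b')]

lemma contMDiff_rayBoundary :
    ContMDiff 𝓢 n 𝓗 n ∞ (rayBoundary F) := by
  intro b
  have hs := mem_chart_source 𝕍 (2 * n - 1) b
  refine contMDiffAt_of_coordMap_eq (L := ContinuousLinearEquiv.refl ℝ _)
    (L' := halfEquiv (rayIndex (rayBoundary F b).pair).k) hs (rayBoundary_mem_source.2 hs)
    continuous_rayBoundary.continuousAt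
    (boundaryIncl (rayIndex (rayBoundary F b).pair).k).contDiff.contDiffAt.contDiffWithinAt ?_
  filter_upwards [eventually_mem_source hs] with b' hb'
  exact compCoord_rayBoundary hb'

lemma coordDeriv_mfderiv_rayBoundary {b b' : RayCotangent n N}
    (hb : b' ∈ (chartAt 𝕍 (2 * n - 1) b).source)
    (v : TangentSpace 𝓢 n b') :
    coordDeriv 𝓗 n (halfEquiv (rayIndex (rayBoundary F b).pair).k) (rayBoundary F b)
        (rayBoundary F b') (mfderiv 𝓢 n 𝓗 n (rayBoundary F) b' v) =
      boundaryIncl (rayIndex (rayBoundary F b).pair).k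
        (coordDeriv 𝓢 n (ContinuousLinearEquiv.refl ℝ _) b b' v) := by
  have h := coordDeriv_mfderiv_of_coordMap_eq (L := ContinuousLinearEquiv.refl ℝ _)
    (L' := halfEquiv (rayIndex (rayBoundary F b).pair).k) hb (rayBoundary_mem_source.2 hb)
    ((contMDiff_rayBoundary b').mdifferentiableAt (by simp))
    (boundaryIncl (rayIndex (rayBoundary F b).pair).k).differentiableAt
    ((eventually_mem_source hb).mono fun c hc => compCoord_rayBoundary hc) v
  rw [h, ContinuousLinearMap.fderiv]

lemma isBoundaryIdentification_rayBoundary :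
    IsBoundaryIdentification (2 * n - 1) 𝓗 n (interiorIncl F) (rayBoundary F) where
  smooth := contMDiff_rayBoundary
  isEmbedding := isEmbedding_rayBoundary
  immersion b v w h := by
    have hs := mem_chart_source 𝕍 (2 * n - 1) b
    have h1 := coordDeriv_mfderiv_rayBoundary hs v
    rw [h, coordDeriv_mfderiv_rayBoundary hs w] at h1
    have h2 := congrArg (boundaryProj (rayIndex (rayBoundary F b).pair).k) h1
    rw [boundaryProj_boundaryIncl, boundaryProj_boundaryIncl] at h2
    rw [← coordLift_coordDeriv (I := 𝓡 (2 * n - 1)) (L := ContinuousLinearEquiv.refl ℝ _) hs v,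
      ← h2, coordLift_coordDeriv hs]
  range_eq := by
    rw [range_rayBoundary]
    ext P
    exact isBoundaryPoint_compactified.symm
  tendsto p hp := by
    rw [← rayProj_eq p hp, rayBoundary_rayProj hp]
    have h1 : Tendsto (fun s : ℝ => (p, s⁻¹)) atTop (𝓝[{P | 0 ≤ P.2}] (p, (0 : ℝ))) := by
      refine tendsto_nhdsWithin_iff.2 ⟨tendsto_const_nhds.prodMk_nhds tendsto_inv_atTop_zero, ?_⟩
      filter_upwards [eventually_gt_atTop 0] with s hs using (inv_pos.2 hs).le
    refine ((continuousWithinAt_rayPoint (pairSq_boundary_pos hp) le_rfl).tendsto.comp h1).congr' ?_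
    filter_upwards [eventually_gt_atTop 0] with s hs
    have h2 := rayPoint_pairScale (F := F) (P := (p, s⁻¹))
      (pairSq_interior_pos p (inv_pos.2 hs).ne') (inv_pos.2 hs).le hs
    rw [pairScale, mul_inv_cancel₀ hs.ne'] at h2
    exact h2.symm

lemma hasFDerivAt_rayCoord {V : Type*} [NormedAddCommGroup V] [NormedSpace ℝ V]
    (S : AffineSlice V) {w : (V →L[ℝ] ℝ) × ℝ} (hw : S.ell w ≠ 0) (w' : (V →L[ℝ] ℝ) × ℝ) :
    fderiv ℝ (rayCoord S) w w' = (S.ell w)⁻¹ • (S.tau w' - S.ell w' • rayCoord S w) := by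
  have h1 := (hasDerivAt_inv hw).comp_hasFDerivAt w S.ell.hasFDerivAt
  have h2 := h1.smul (S.tau.hasFDerivAt (x := w))
  have h3 : fderiv ℝ (rayCoord S) w = _ := h2.fderiv
  rw [h3, rayCoord]
  simp
  module

lemma rayBoundary_rayProj_mem {b : RayCotangent n N} {p : CotangentBundle n N} (hp : p.2 ≠ 0) :
    rayProj p ∈ (chartAt 𝕍 (2 * n - 1) b).source ↔
      (p, (0 : ℝ)) ∈ pairSource (rayBoundary F b).pair.1.proj
        (rayIndex (rayBoundary F b).pair) :=
  rayBoundary_mem_pairSource hp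

lemma rayCoordMap_rayProj {b : RayCotangent n N} {p : CotangentBundle n N}
    (hp : (p, (0 : ℝ)) ∈ pairSource (rayBoundary F b).pair.1.proj
      (rayIndex (rayBoundary F b).pair)) :
    rayCoordMap b (rayProj p) = boundaryProj (rayIndex (rayBoundary F b).pair).k
      (pairCoord (rayBoundary F b).pair.1.proj (rayIndex (rayBoundary F b).pair) (p, 0)) := by
  rw [rayCoordMap_eq, pairCoord_rayBoundary hp]

/-- The derivative of `(x, ξ) ↦ (x, [ξ : 0])`. -/
noncomputable def rayDeriv (S : AffineSlice 𝕍 n)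
    (z X : 𝕍 n × DualSpace n) : 𝕍 n × DualSpace n :=
  (X.1, (S.ell (z.2, 0))⁻¹ • (S.tau (X.2, 0) - S.ell (X.2, 0) • rayCoord S (z.2, 0)))

lemma contDiffAt_rayMap (S : AffineSlice 𝕍 n)
    {z : 𝕍 n × DualSpace n} (hz : S.ell (z.2, 0) ≠ 0) :
    ContDiffAt ℝ ∞ (fun z : 𝕍 n × DualSpace n =>
      (z.1, rayCoord S (z.2, 0))) z :=
  contDiffAt_fst.prodMk (ContDiffAt.comp (g := rayCoord S)
    (f := fun z : 𝕍 n × DualSpace n => (z.2, (0 : ℝ))) z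
    (contDiffAt_rayCoord S hz) (contDiffAt_snd.prodMk contDiffAt_const))

lemma fderiv_rayMap (S : AffineSlice 𝕍 n)
    {z : 𝕍 n × DualSpace n} (hz : S.ell (z.2, 0) ≠ 0)
    (X : 𝕍 n × DualSpace n) :
    fderiv ℝ (fun z : 𝕍 n × DualSpace n =>
      (z.1, rayCoord S (z.2, 0))) z X = rayDeriv S z X := by
  have h1 : HasFDerivAt (rayCoord S) (fderiv ℝ (rayCoord S) (z.2, 0)) (z.2, 0) :=
    ((contDiffAt_rayCoord S hz).differentiableAt (by simp)).hasFDerivAt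
  have h2 := HasFDerivAt.comp z (f := fun z : 𝕍 n × DualSpace n =>
    (z.2, (0 : ℝ))) h1 (hasFDerivAt_snd.prodMk (hasFDerivAt_const (0 : ℝ) z))
  have h3 : HasFDerivAt (fun z : 𝕍 n × DualSpace n =>
      (z.1, rayCoord S (z.2, 0))) _ z := hasFDerivAt_fst.prodMk h2
  rw [h3.fderiv, rayDeriv, ← hasFDerivAt_rayCoord S hz]
  rfl

lemma contMDiffAt_rayProj {p : CotangentBundle n N} (hp : p.2 ≠ 0) :
    ContMDiffAt (cotangentModel n) 𝓢 n ∞ rayProj p := by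
  have hs := mem_chart_source 𝕍 (2 * n - 1) (rayProj p)
  have hp' := (rayBoundary_rayProj_mem hp).1 hs
  refine contMDiffAt_of_coordMap_eq (L := cotEquiv n) (L' := ContinuousLinearEquiv.refl ℝ _)
    (x₀ := (⟨(rayBoundary F (rayProj p)).pair.1.proj, 0⟩ : CotangentBundle n N))
    (y₀ := rayProj p) (mem_cotSource.2 hp'.1) hs (continuousAt_rayProj hp)
    (g := fun z => boundaryProj (rayIndex (rayBoundary F (rayProj p)).pair).k
      (z.1, rayCoord (raySlice (rayIndex (rayBoundary F (rayProj p)).pair)) (z.2, 0))) ?_ ?_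
  · exact ((boundaryProj _).contDiff.contDiffAt.comp _
      (contDiffAt_rayMap _ hp'.2.ne')).contDiffWithinAt
  · have h : ∀ᶠ q : CotangentBundle n N in 𝓝 p, (q, (0 : ℝ)) ∈ pairSource
      (rayBoundary F (rayProj p)).pair.1.proj (rayIndex (rayBoundary F (rayProj p)).pair) :=
      (Continuous.prodMk continuous_id continuous_const).continuousAt.eventually
        ((isOpen_pairSource _ _).mem_nhds hp')
    filter_upwards [h] with q hq
    exact rayCoordMap_rayProj hq

lemma coordDeriv_mfderiv_rayProj {b : RayCotangent n N} {p : CotangentBundle n N} (hp : p.2 ≠ 0)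
    (hb : rayProj p ∈ (chartAt 𝕍 (2 * n - 1) b).source)
    (v : TangentSpace (cotangentModel n) p) :
    coordDeriv 𝓢 n (ContinuousLinearEquiv.refl ℝ _) b (rayProj p)
        (mfderiv (cotangentModel n) 𝓢 n rayProj p v) =
      boundaryProj (rayIndex (rayBoundary F b).pair).k
        (rayDeriv (raySlice (rayIndex (rayBoundary F b).pair))
          (cotCoord (rayBoundary F b).pair.1.proj p)
          (cotDeriv (rayBoundary F b).pair.1.proj p v)) := by
  have hp' := (rayBoundary_rayProj_mem hp).1 hb
  have h1 := contDiffAt_rayMap (raySlice (rayIndex (rayBoundary F b).pair))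
    (z := cotCoord (rayBoundary F b).pair.1.proj p) hp'.2.ne'
  have h2 := (boundaryProj (rayIndex (rayBoundary F b).pair).k).hasFDerivAt.comp _
    (h1.differentiableAt (by simp)).hasFDerivAt
  have h : ∀ᶠ q : CotangentBundle n N in 𝓝 p, (q, (0 : ℝ)) ∈ pairSource
      (rayBoundary F b).pair.1.proj (rayIndex (rayBoundary F b).pair) :=
    (Continuous.prodMk continuous_id continuous_const).continuousAt.eventually
      ((isOpen_pairSource _ _).mem_nhds hp')
  have h3 := coordDeriv_mfderiv_of_coordMap_eq (I := cotangentModel n) (I' := 𝓡 (2 * n - 1))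
    (L := cotEquiv n) (L' := ContinuousLinearEquiv.refl ℝ _)
    (x₀ := (⟨(rayBoundary F b).pair.1.proj, 0⟩ : CotangentBundle n N)) (y₀ := b)
    (mem_cotSource.2 hp'.1) hb
    ((contMDiffAt_rayProj hp).mdifferentiableAt (by simp)) h2.differentiableAt
    (h.mono fun q hq => rayCoordMap_rayProj hq) v
  rw [h3, h2.fderiv, ContinuousLinearMap.comp_apply, fderiv_rayMap _ hp'.2.ne']

lemma isRayProjection_rayProj : IsRayProjection (n := n) (N := N) (2 * n - 1) rayProj where
  eq_rayOf p hp := rayProj_eq p hp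
  smooth p hp := (contMDiffAt_rayProj hp).contMDiffWithinAt
  submersion p hp w := by
    have hs := mem_chart_source 𝕍 (2 * n - 1) (rayProj p)
    have hp' := (rayBoundary_rayProj_mem hp).1 hs
    set x₀ := (rayBoundary F (rayProj p)).pair.1.proj
    set a := rayIndex (rayBoundary F (rayProj p)).pair
    set S := raySlice a
    set X := boundaryIncl a.k (coordDeriv 𝓢 n (ContinuousLinearEquiv.refl ℝ _)
      (rayProj p) (rayProj p) w) with hX
    have hXk : X.2 (EuclideanSpace.single a.k 1) = 0 := boundaryIncl_apply_single _ _
    have hlin : S.lin X.2 = ((S.lin X.2).1, 0) :=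
      Prod.ext rfl ((raySlice_lin a X.2).trans hXk)
    refine ⟨cotVec x₀ p (X.1, S.ell (pairFibre x₀ (p, 0)) • (S.lin X.2).1), ?_⟩
    have h1 := coordDeriv_mfderiv_rayProj hp hs
      (cotVec x₀ p (X.1, S.ell (pairFibre x₀ (p, 0)) • (S.lin X.2).1))
    rw [show cotDeriv x₀ p (cotVec x₀ p (X.1, S.ell (pairFibre x₀ (p, 0)) • (S.lin X.2).1)) = _
      from coordDeriv_coordLift (mem_cotSource.2 hp'.1) _] at h1
    have h2 : ((S.ell (pairFibre x₀ (p, 0)) • (S.lin X.2).1, 0) : DualSpace n × ℝ) =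
        S.ell (pairFibre x₀ (p, 0)) • S.lin X.2 := by
      rw [hlin]; simp
    have h3 : rayDeriv S (cotCoord x₀ p) (X.1, S.ell (pairFibre x₀ (p, 0)) • (S.lin X.2).1) =
        X := by
      refine Prod.ext rfl ?_
      simp only [rayDeriv, h2, map_smul, S.ell_lin, S.tau_lin, smul_zero, zero_smul, sub_zero,
        smul_smul]
      have h4 : S.ell ((cotCoord x₀ p).2, 0) ≠ 0 := hp'.2.ne'
      rw [inv_mul_cancel₀ h4, one_smul]
    rw [h3, hX, boundaryProj_boundaryIncl] at h1
    rw [← coordLift_coordDeriv (I := 𝓡 (2 * n - 1)) (L := ContinuousLinearEquiv.refl ℝ _) hs w,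
      ← h1, coordLift_coordDeriv hs]

end BoundaryMaps

section Density

variable {n : ℕ} [NeZero n] {N : Type*} [TopologicalSpace N]
  [ChartedSpace 𝕍 n N] [IsManifold (𝓡 n) ∞ N] [F : FibreNorm n N]

lemma neBot_nhdsWithin_interior (P : CompactifiedCotangent F) : (𝓝[{Q | 0 < Q.pair.2}] P).NeBot := by
  rw [← mem_closure_iff_nhdsWithin_neBot]
  rcases P.nonneg.eq_or_lt with h | h
  · have h1 := isBoundaryIdentification_rayBoundary (F := F) |>.tendsto P.pair.1 (P.ne_zero h.symm)
    rw [← rayProj_eq, rayBoundary_rayProj_pair h.symm] at h1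
    exact mem_closure_of_tendsto h1 (Eventually.of_forall fun s =>
      definingFunction_interiorIncl_pos _)
  · exact subset_closure h

lemma eq_of_eq_interior {X : Type*} [TopologicalSpace X] [T2Space X]
    {f g : CompactifiedCotangent F → X} {P : CompactifiedCotangent F} (hf : ContinuousAt f P)
    (hg : ContinuousAt g P) (h : ∀ᶠ Q in 𝓝 P, 0 < Q.pair.2 → f Q = g Q) : f P = g P := by
  have := neBot_nhdsWithin_interior P
  have h1 : f =ᶠ[𝓝[{Q | 0 < Q.pair.2}] P] g := by
    filter_upwards [nhdsWithin_le_nhds h, self_mem_nhdsWithin] with Q hQ hQ' using hQ hQ'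
  exact tendsto_nhds_unique ((hf.mono_left nhdsWithin_le_nhds).congr' h1)
    (hg.mono_left nhdsWithin_le_nhds)

lemma endomorphism_eq_of_eq_interior
    {A B : ∀ P : CompactifiedCotangent F,
      TangentSpace 𝓗 n P →L[ℝ] TangentSpace 𝓗 n P}
    {P : CompactifiedCotangent F}
    (hA : ContMDiffAt 𝓗 n ((𝓗 n).prod 𝓘(ℝ, 𝕍 (2 * n) →L[ℝ]
      𝕍 (2 * n))) ∞ (fun p => TotalSpace.mk' (𝕍 (2 * n)
      →L[ℝ] 𝕍 (2 * n)) p (A p)) P)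
    (hB : ContMDiffAt 𝓗 n ((𝓗 n).prod 𝓘(ℝ, 𝕍 (2 * n) →L[ℝ]
      𝕍 (2 * n))) ∞ (fun p => TotalSpace.mk' (𝕍 (2 * n)
      →L[ℝ] 𝕍 (2 * n)) p (B p)) P)
    (h : ∀ᶠ Q in 𝓝 P, 0 < Q.pair.2 → A Q = B Q) : A P = B P := by
  have hs := mem_chart_source (EuclideanHalfSpace (2 * n)) P
  rw [contMDiffAt_endomorphism_iff (L := ContinuousLinearEquiv.refl ℝ _) hs] at hA hB
  have h1 := eq_of_eq_interior hA.continuousAt hB.continuousAt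
    (h.mono fun Q hQ hQ' => by rw [hQ hQ'])
  refine ContinuousLinearMap.ext fun v => ?_
  have h2 := DFunLike.congr_fun h1 (coordDeriv 𝓗 n (ContinuousLinearEquiv.refl ℝ _) P P v)
  simp only [ContinuousLinearMap.comp_apply] at h2
  rw [coordLift_coordDeriv hs] at h2
  rw [← coordLift_coordDeriv (L := ContinuousLinearEquiv.refl ℝ _) hs (A P v), h2,
    coordLift_coordDeriv hs]

lemma bilinearForm_eq_of_eq_interior
    {A B : ∀ P : CompactifiedCotangent F,
      TangentSpace 𝓗 n P →L[ℝ] TangentSpace 𝓗 n P →L[ℝ] ℝ}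
    {P : CompactifiedCotangent F}
    (hA : ContMDiffAt 𝓗 n ((𝓗 n).prod 𝓘(ℝ, 𝕍 (2 * n) →L[ℝ]
      𝕍 (2 * n) →L[ℝ] ℝ)) ∞ (fun p => TotalSpace.mk'
      (𝕍 (2 * n) →L[ℝ] 𝕍 (2 * n) →L[ℝ] ℝ) p (A p)) P)
    (hB : ContMDiffAt 𝓗 n ((𝓗 n).prod 𝓘(ℝ, 𝕍 (2 * n) →L[ℝ]
      𝕍 (2 * n) →L[ℝ] ℝ)) ∞ (fun p => TotalSpace.mk'
      (𝕍 (2 * n) →L[ℝ] 𝕍 (2 * n) →L[ℝ] ℝ) p (B p)) P)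
    (h : ∀ᶠ Q in 𝓝 P, 0 < Q.pair.2 → A Q = B Q) : A P = B P := by
  have hs := mem_chart_source (EuclideanHalfSpace (2 * n)) P
  rw [contMDiffAt_bilinearForm_iff (L := ContinuousLinearEquiv.refl ℝ _) hs] at hA hB
  have h1 := eq_of_eq_interior hA.continuousAt hB.continuousAt
    (h.mono fun Q hQ hQ' => by rw [hQ hQ'])
  refine ContinuousLinearMap.ext fun v => ContinuousLinearMap.ext fun w => ?_
  have h2 := DFunLike.congr_fun (DFunLike.congr_fun h1
    (coordDeriv 𝓗 n (ContinuousLinearEquiv.refl ℝ _) P P v))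
    (coordDeriv 𝓗 n (ContinuousLinearEquiv.refl ℝ _) P P w)
  simp only [pullBilinear_apply] at h2
  rwa [coordLift_coordDeriv hs, coordLift_coordDeriv hs] at h2

lemma surjective_mfderiv_interiorIncl (p : CotangentBundle n N) :
    Function.Surjective (mfderiv (cotangentModel n) 𝓗 n (interiorIncl F) p) :=
  ((isInteriorInclusion_interiorIncl.isLocalDiffeomorph p).mfderivToContinuousLinearEquiv
    (by simp)).surjective

end Density

section LocalFormulas

variable {n : ℕ} [NeZero n] {N : Type*} [TopologicalSpace N] [T2Space N]
  [ChartedSpace 𝕍 n N] [IsManifold (𝓡 n) ∞ N] [F : FibreNorm n N]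

/-- The affine slice of the preferred chart at `P₀`. -/
noncomputable abbrev compSlice (P₀ : CompactifiedCotangent F) :
    AffineSlice 𝕍 n := raySlice (rayIndex P₀.pair)

/-- The base point of the preferred chart at `P₀`. -/
abbrev compBase (P₀ : CompactifiedCotangent F) : N := P₀.pair.1.proj

/-- The factor `f` of the boundary defining function in the preferred chart at `P₀`. -/
noncomputable abbrev compWeight (P₀ : CompactifiedCotangent F) :
    𝕍 n × DualSpace n → ℝ := pairWeight (compBase P₀) (rayIndex P₀.pair)

/-- The components of tangent vectors in the preferred chart at `P₀`. -/
noncomputable abbrev compDeriv (P₀ P : CompactifiedCotangent F) :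
    TangentSpace 𝓗 n P →L[ℝ] 𝕍 n × DualSpace n :=
  coordDeriv 𝓗 n (halfEquiv (rayIndex P₀.pair).k) P₀ P

/-- The tangent vector with given components in the preferred chart at `P₀`. -/
noncomputable abbrev compVec (P₀ P : CompactifiedCotangent F) :
    𝕍 n × DualSpace n →L[ℝ] TangentSpace 𝓗 n P :=
  coordLift 𝓗 n (halfEquiv (rayIndex P₀.pair).k) P₀ P

variable (D : AffineConnection (𝓡 n) N)

/-- The horizontal lift in the preferred chart at `P₀`. -/
noncomputable def compLift (P₀ : CompactifiedCotangent F) :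
    𝕍 n × DualSpace n → 𝕍 n →L[ℝ] DualSpace n :=
  sliceLift (compSlice P₀) (chartGamma D (compBase P₀)) (chartSchouten D (compBase P₀))

/-- The cotractor connection form in the preferred chart at `P₀`. -/
noncomputable def compTractor (P₀ : CompactifiedCotangent F)
    (z : 𝕍 n × DualSpace n) :
    𝕍 n →L[ℝ] DualSpace n × ℝ :=
  tractorForm (chartGamma D (compBase P₀) z.1) (chartSchouten D (compBase P₀) z.1)
    ((compSlice P₀).sect z.2)

/-- The Christoffel symbols of the rescaled connection in the preferred chart at `P₀`. -/
noncomputable def compGamma (P₀ : CompactifiedCotangent F)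
    (z : 𝕍 n × DualSpace n) :
    𝕍 n × DualSpace n →L[ℝ] 𝕍 n × DualSpace n →L[ℝ]
      𝕍 n × DualSpace n :=
  splitChristoffel (compLift D P₀) (sliceConnection (compSlice P₀) (chartGamma D (compBase P₀))
    (chartSchouten D (compBase P₀)) z) z +
  paraCTensor (splitJ (compLift D P₀ z)) ((2 * compWeight P₀ z)⁻¹ • fderiv ℝ (compWeight P₀) z)

/-- The extension of `J` in the preferred chart at `P₀`. -/
noncomputable def localJ (P₀ P : CompactifiedCotangent F) :
    TangentSpace 𝓗 n P →L[ℝ] TangentSpace 𝓗 n P :=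
  compVec P₀ P ∘L splitJ (compLift D P₀ (compCoord F P₀ P)) ∘L compDeriv P₀ P

/-- The extension of the rescaled metric in the preferred chart at `P₀`, in components. -/
noncomputable def compMetric (P₀ : CompactifiedCotangent F)
    (z : 𝕍 n × DualSpace n) :
    𝕍 n × DualSpace n →L[ℝ] 𝕍 n × DualSpace n →L[ℝ] ℝ :=
  sliceMetric (compSlice P₀) (compTractor D P₀ z) (compLift D P₀ z) (compWeight P₀ z)
    (fderiv ℝ (compWeight P₀) z) z.2

/-- The extension of the rescaled metric in the preferred chart at `P₀`. -/
noncomputable def localMetric (P₀ P : CompactifiedCotangent F) :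
    TangentSpace 𝓗 n P →L[ℝ] TangentSpace 𝓗 n P →L[ℝ] ℝ :=
  pullBilinear (compMetric D P₀ (compCoord F P₀ P)) (compDeriv P₀ P)

end LocalFormulas

section LocalSmoothness

variable {n : ℕ} [NeZero n] {N : Type*} [TopologicalSpace N] [T2Space N]
  [ChartedSpace 𝕍 n N] [IsManifold (𝓡 n) ∞ N] [F : FibreNorm n N]
  {D : AffineConnection (𝓡 n) N} {P₀ P : CompactifiedCotangent F}

lemma contDiffAt_compLift {z : 𝕍 n × DualSpace n}
    (h1 : ContDiffAt ℝ ∞ (chartGamma D (compBase P₀)) z.1)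
    (h2 : ContDiffAt ℝ ∞ (chartSchouten D (compBase P₀)) z.1) :
    ContDiffAt ℝ ∞ (compLift D P₀) z := by
  have h3 := contDiffAt_sliceLift (S := compSlice P₀) h1 h2
  exact h3

lemma contDiffAt_compGamma_of {z : 𝕍 n × DualSpace n}
    (hz : z ∈ chartCylinder (compBase P₀))
    (h1 : ContDiffAt ℝ ∞ (chartGamma D (compBase P₀)) z.1)
    (h2 : ContDiffAt ℝ ∞ (chartSchouten D (compBase P₀)) z.1) :
    ContDiffAt ℝ ∞ (compGamma D P₀) z := by
  have h3 := contDiffAt_compLift h1 h2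
  have h4 := contDiffAt_sliceConnection (S := compSlice P₀) h1 h2
  have hf := contDiffAt_pairWeight (F := F) (a := rayIndex P₀.pair) hz
  have hf0 := pairWeight_pos (F := F) (a := rayIndex P₀.pair) hz
  have h5 := contDiffAt_splitChristoffel h3 h4
  have h6 : ContDiffAt ℝ ∞ (fun w => (2 * compWeight P₀ w)⁻¹ • fderiv ℝ (compWeight P₀) w) z :=
    ((contDiffAt_const.mul hf).inv (mul_pos two_pos hf0).ne').smul
    (hf.fderiv_right (m := ∞) (by simp))
  have h7 := (contDiffAt_splitJ h3.contDiffWithinAt).paraCTensor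
    (h6.contDiffWithinAt (s := univ))
  rw [contDiffWithinAt_univ] at h7
  unfold compGamma
  exact ContDiffAt.add h5 h7

variable
  (hP : P ∈ (chartAt (EuclideanHalfSpace (2 * n)) P₀).source) (hD : IsSmoothTorsionFree D)

include hP hD

lemma contDiffAt_compGamma_aux :
    ContDiffAt ℝ ∞ (chartGamma D (compBase P₀)) (compCoord F P₀ P).1 ∧
      ContDiffAt ℝ ∞ (chartSchouten D (compBase P₀)) (compCoord F P₀ P).1 := by
  rw [compCoord_eq hP, pairCoord, cotCoord_fst (mem_compSource.1 hP).1]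
  exact ⟨contDiffAt_chartGamma hD.1 (mem_compSource.1 hP).1,
    contDiffAt_chartSchouten hD.1 (mem_compSource.1 hP).1⟩

lemma contDiffAt_compGamma : ContDiffAt ℝ ∞ (compGamma D P₀) (compCoord F P₀ P) := by
  have h1 := (contDiffAt_compGamma_aux hP hD).1
  have h2 := (contDiffAt_compGamma_aux hP hD).2
  exact contDiffAt_compGamma_of (compCoord_mem_cylinder hP) h1 h2

lemma contDiffAt_compMetric : ContDiffAt ℝ ∞ (compMetric D P₀) (compCoord F P₀ P) := by
  have h1 := contDiffAt_compLift (P₀ := P₀) (contDiffAt_compGamma_aux hP hD).1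
    (contDiffAt_compGamma_aux hP hD).2
  have h2 := contDiffAt_sliceTractor (S := compSlice P₀) (contDiffAt_compGamma_aux hP hD).1
    (contDiffAt_compGamma_aux hP hD).2
  have hf := contDiffAt_pairWeight (F := F) (a := rayIndex P₀.pair) (compCoord_mem_cylinder hP)
  have hf0 := pairWeight_pos (F := F) (a := rayIndex P₀.pair) (compCoord_mem_cylinder hP)
  rw [← contDiffWithinAt_univ]
  exact contDiffWithinAt_sliceMetric _ h2.contDiffWithinAt h1.contDiffWithinAt
    hf.contDiffWithinAt hf0.ne' (hf.fderiv_right (m := ∞) (by simp)).contDiffWithinAt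
    contDiffWithinAt_snd

lemma contMDiffAt_localJ : ContMDiffAt 𝓗 n ((𝓗 n).prod
    𝓘(ℝ, 𝕍 (2 * n) →L[ℝ] 𝕍 (2 * n))) ∞
    (fun p => TotalSpace.mk' (𝕍 (2 * n) →L[ℝ]
      𝕍 (2 * n)) p (localJ D P₀ p)) P := by
  rw [contMDiffAt_endomorphism_iff (L := halfEquiv (rayIndex P₀.pair).k) hP]
  refine contMDiffAt_of_comp_coordMap (L := halfEquiv (rayIndex P₀.pair).k)
    (g := fun z => splitJ (compLift D P₀ z)) hP
    (contDiffAt_splitJ (contDiffAt_compLift (P₀ := P₀) (contDiffAt_compGamma_aux hP hD).1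
    (contDiffAt_compGamma_aux hP hD).2).contDiffWithinAt) ?_
  filter_upwards [eventually_mem_source hP] with Q hQ
  refine ContinuousLinearMap.ext fun X => ?_
  simp only [localJ, ContinuousLinearMap.comp_apply]
  rw [coordDeriv_coordLift hQ, coordDeriv_coordLift hQ]

lemma contMDiffAt_localMetric : ContMDiffAt 𝓗 n ((𝓗 n).prod
    𝓘(ℝ, 𝕍 (2 * n) →L[ℝ] 𝕍 (2 * n) →L[ℝ] ℝ)) ∞
    (fun p => TotalSpace.mk' (𝕍 (2 * n) →L[ℝ]
      𝕍 (2 * n) →L[ℝ] ℝ) p (localMetric D P₀ p)) P := by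
  rw [contMDiffAt_bilinearForm_iff (L := halfEquiv (rayIndex P₀.pair).k) hP]
  refine contMDiffAt_of_comp_coordMap (L := halfEquiv (rayIndex P₀.pair).k)
    (g := compMetric D P₀) hP (contDiffAt_compMetric hP hD).contDiffWithinAt ?_
  filter_upwards [eventually_mem_source hP] with Q hQ
  refine ContinuousLinearMap.ext fun X => ContinuousLinearMap.ext fun Y => ?_
  simp only [localMetric, pullBilinear_apply]
  rw [coordDeriv_coordLift hQ, coordDeriv_coordLift hQ]

end LocalSmoothness

lemma localCov_add_christoffel {E : Type*} [NormedAddCommGroup E] [NormedSpace ℝ E]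
    {H : Type*} [TopologicalSpace H] {I : ModelWithCorners ℝ E H}
    {M : Type*} [TopologicalSpace M] [ChartedSpace H M] [IsManifold I ∞ M]
    {Z : Type*} [NormedAddCommGroup Z] [NormedSpace ℝ Z] {L : E ≃L[ℝ] Z} (x₀ P : M)
    (Γ B : Z →L[ℝ] Z →L[ℝ] Z) (Y : ∀ p : M, TangentSpace I p) (v : TangentSpace I P) :
    localCov I L x₀ (Γ + B) Y P v = localCov I L x₀ Γ Y P v +
      coordLift I L x₀ P (B (coordDeriv I L x₀ P v) (coordDeriv I L x₀ P (Y P))) := by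
  simp only [localCov, ContinuousLinearMap.comp_apply, add_apply, ContinuousLinearMap.flip_apply,
    map_add, add_assoc]

lemma paraCTensor_add {Z : Type*} [NormedAddCommGroup Z] [NormedSpace ℝ Z] (J : Z →L[ℝ] Z)
    (Υ Υ' : Z →L[ℝ] ℝ) : paraCTensor J (Υ + Υ') = paraCTensor J Υ + paraCTensor J Υ' := by
  ext X X'
  simp only [paraCTensor_apply, add_apply, add_smul]
  abel

lemma paraCChange_eq_localCov {E : Type*} [NormedAddCommGroup E] [NormedSpace ℝ E]
    {H : Type*} [TopologicalSpace H] {I : ModelWithCorners ℝ E H}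
    {M : Type*} [TopologicalSpace M] [ChartedSpace H M] [IsManifold I ∞ M]
    {Z : Type*} [NormedAddCommGroup Z] [NormedSpace ℝ Z] {L : E ≃L[ℝ] Z} {x₀ P : M}
    (hP : P ∈ (chartAt H x₀).source) {D : AffineConnection I M}
    {J : ∀ p : M, TangentSpace I p →L[ℝ] TangentSpace I p}
    {Υ : ∀ p : M, TangentSpace I p →L[ℝ] ℝ} {Y : ∀ p : M, TangentSpace I p}
    {Γ : Z →L[ℝ] Z →L[ℝ] Z} {J₀ : Z →L[ℝ] Z} {Υ₀ : Z →L[ℝ] ℝ}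
    (hD : D Y P = localCov I L x₀ Γ Y P)
    (hJ : ∀ u, coordDeriv I L x₀ P (J P u) = J₀ (coordDeriv I L x₀ P u))
    (hΥ : ∀ u, Υ P u = Υ₀ (coordDeriv I L x₀ P u)) (v : TangentSpace I P) :
    paraCChange I J D Υ Y P v = localCov I L x₀ (Γ + paraCTensor J₀ Υ₀) Y P v := by
  simp only [localCov_add_christoffel, paraCTensor_apply, ← hD, paraCChange, ← hJ, ← hΥ, map_add,
    map_smul, coordLift_coordDeriv hP, add_assoc]

lemma fderiv_rescaled_sliceCoord {V : Type*} [NormedAddCommGroup V] [NormedSpace ℝ V]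
    {S : AffineSlice V} {Γ : V → V →L[ℝ] V →L[ℝ] V} {P : V → V →L[ℝ] V →L[ℝ] ℝ}
    {z : V × (V →L[ℝ] ℝ)} (hz : S.ell (z.2, 1) ≠ 0)
    (hΓ : ContDiffAt ℝ ∞ Γ z.1) (hP : ContDiffAt ℝ ∞ P z.1) (δ : V × (V →L[ℝ] ℝ) →L[ℝ] ℝ)
    (X X' : V × (V →L[ℝ] ℝ)) :
    let Ψ := fun z : V × (V →L[ℝ] ℝ) => (z.1, sliceCoord S z)
    fderiv ℝ Ψ z ((splitChristoffel (sliceLift (cotangentSlice V) Γ P)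
            (sliceConnection (cotangentSlice V) Γ P z) z +
          paraCTensor (splitJ (sliceLift (cotangentSlice V) Γ P z))
            (δ ∘L fderiv ℝ Ψ z + rescalingForm S z)) X X') =
      fderiv ℝ (fderiv ℝ Ψ) z X X' +
        (splitChristoffel (sliceLift S Γ P) (sliceConnection S Γ P (Ψ z)) (Ψ z) +
          paraCTensor (splitJ (sliceLift S Γ P (Ψ z))) δ) (fderiv ℝ Ψ z X) (fderiv ℝ Ψ z X') := by
  intro Ψ
  have h1 := fderiv_splitChristoffel_sliceCoord hz hΓ hP X X'
  have h2 := fderiv_paraCTensor_of_comm (A := fderiv ℝ Ψ z)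
    (fderiv_splitJ_of_intertwines (ψ := id) differentiableAt_id
      ((contDiffAt_sliceCoord hz).differentiableAt (by simp))
      (intertwinesLifts_sliceCoord (Γ := Γ) (P := P) hz)) δ X X'
  rw [add_comm (_ ∘L _), paraCTensor_add, ← add_assoc]
  simp only [add_apply, map_add] at h1 h2 ⊢
  rw [← add_assoc]
  exact congrArg₂ (· + ·) h1 h2

section InteriorIdentities

variable {n : ℕ} [NeZero n] {N : Type*} [TopologicalSpace N] [T2Space N]
  [ChartedSpace 𝕍 n N] [IsManifold (𝓡 n) ∞ N] [F : FibreNorm n N]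
  {D : AffineConnection (𝓡 n) N} {P₀ : CompactifiedCotangent F} {p : CotangentBundle n N}

lemma eventually_interiorIncl_mem
    (hp : interiorIncl F p ∈ (chartAt (EuclideanHalfSpace (2 * n)) P₀).source) :
    ∀ᶠ q in 𝓝 p, interiorIncl F q ∈ (chartAt (EuclideanHalfSpace (2 * n)) P₀).source :=
  continuous_interiorIncl.continuousAt.eventually_mem
    ((chartAt (EuclideanHalfSpace (2 * n)) P₀).open_source.mem_nhds hp)

lemma proj_mem_of_interiorIncl_mem
    (hp : interiorIncl F p ∈ (chartAt (EuclideanHalfSpace (2 * n)) P₀).source) :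
    p.proj ∈ (chartAt 𝕍 n (compBase P₀)).source :=
  (interiorIncl_mem_pairSource.1 (mem_compSource.1 hp)).1

lemma ell_ne_zero_of_interiorIncl_mem
    (hp : interiorIncl F p ∈ (chartAt (EuclideanHalfSpace (2 * n)) P₀).source) :
    (compSlice P₀).ell ((cotCoord (compBase P₀) p).2, 1) ≠ 0 :=
  (interiorIncl_mem_pairSource.1 (mem_compSource.1 hp)).2.ne'

lemma differentiableAt_sliceChange {S : AffineSlice 𝕍 n}
    {z : 𝕍 n × DualSpace n} (hz : S.ell (z.2, 1) ≠ 0) :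
    ContDiffAt ℝ ∞ (fun z : 𝕍 n × DualSpace n => (z.1, sliceCoord S z)) z :=
  contDiffAt_fst.prodMk (contDiffAt_sliceCoord hz)

lemma compDeriv_mfderiv_interiorIncl
    (hp : interiorIncl F p ∈ (chartAt (EuclideanHalfSpace (2 * n)) P₀).source)
    (v : TangentSpace (cotangentModel n) p) :
    compDeriv P₀ (interiorIncl F p) (mfderiv (cotangentModel n) 𝓗 n (interiorIncl F) p v) =
      fderiv ℝ (fun z : 𝕍 n × DualSpace n =>
        (z.1, sliceCoord (compSlice P₀) z)) (cotCoord (compBase P₀) p)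
          (cotDeriv (compBase P₀) p v) := by
  have h := coordDeriv_mfderiv_of_coordMap_eq (I := cotangentModel n) (L := cotEquiv n)
    (I' := 𝓡∂ (2 * n)) (L' := halfEquiv (rayIndex P₀.pair).k) (G := interiorIncl F)
    (x₀ := (⟨compBase P₀, 0⟩ : CotangentBundle n N)) (y₀ := P₀)
    (mem_cotSource.2 (proj_mem_of_interiorIncl_mem hp)) hp
    ((contMDiff_interiorIncl p).mdifferentiableAt (by simp))
    ((differentiableAt_sliceChange (ell_ne_zero_of_interiorIncl_mem hp)).differentiableAt (by simp))
    ((eventually_interiorIncl_mem hp).mono fun q hq => compCoord_interiorIncl hq) v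
  exact h

lemma fderiv_sliceChange {S : AffineSlice 𝕍 n}
    {z : 𝕍 n × DualSpace n} (hz : S.ell (z.2, 1) ≠ 0)
    (X : 𝕍 n × DualSpace n) :
    fderiv ℝ (fun z : 𝕍 n × DualSpace n => (z.1, sliceCoord S z)) z X =
      (X.1, fderiv ℝ (sliceCoord S) z X) := by
  have h := (hasFDerivAt_fst (𝕜 := ℝ) (p := z)).prodMk
    ((contDiffAt_sliceCoord hz).differentiableAt (by simp)).hasFDerivAt
  rw [h.fderiv]
  rfl

lemma fderiv_sliceChange_splitJ {S : AffineSlice 𝕍 n} {x₀ : N}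
    {z : 𝕍 n × DualSpace n} (hz : S.ell (z.2, 1) ≠ 0)
    (X : 𝕍 n × DualSpace n) :
    fderiv ℝ (fun z : 𝕍 n × DualSpace n => (z.1, sliceCoord S z)) z
        (splitJ (cotLift D x₀ z) X) =
      splitJ (sliceLift S (chartGamma D x₀) (chartSchouten D x₀) (z.1, sliceCoord S z))
        (fderiv ℝ (fun z : 𝕍 n × DualSpace n => (z.1, sliceCoord S z)) z X) :=
  fderiv_splitJ_of_intertwines (ψ := id) differentiableAt_id
    ((contDiffAt_sliceCoord hz).differentiableAt (by simp)) (intertwinesLifts_sliceCoord hz) X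

lemma localJ_interiorIncl (hD : IsSmoothTorsionFree D)
    (hp : interiorIncl F p ∈ (chartAt (EuclideanHalfSpace (2 * n)) P₀).source)
    (v : TangentSpace (cotangentModel n) p) :
    localJ D P₀ (interiorIncl F p)
        (mfderiv (cotangentModel n) 𝓗 n (interiorIncl F) p v) =
      mfderiv (cotangentModel n) 𝓗 n (interiorIncl F) p (neutralJ D p v) := by
  have h1 := compDeriv_mfderiv_interiorIncl hp (neutralJ D p v)
  rw [cotDeriv_neutralJ hD (proj_mem_of_interiorIncl_mem hp),
    fderiv_sliceChange_splitJ (ell_ne_zero_of_interiorIncl_mem hp),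
    ← compDeriv_mfderiv_interiorIncl hp v] at h1
  rw [localJ]
  simp only [ContinuousLinearMap.comp_apply]
  rw [compLift, compCoord_interiorIncl hp, ← h1]
  exact coordLift_coordDeriv hp _

lemma definingFunction_interiorIncl_eq
    (hp : interiorIncl F p ∈ (chartAt (EuclideanHalfSpace (2 * n)) P₀).source) :
    definingFunction F (interiorIncl F p) = compWeight P₀ (compCoord F P₀ (interiorIncl F p)) *
      ((compSlice P₀).ell ((cotCoord (compBase P₀) p).2, 1))⁻¹ := by
  rw [definingFunction_eq (mem_compSource.1 hp), ← compCoord_eq hp, ← raySlice_sect,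
    compCoord_interiorIncl hp]
  have h := sect_sliceCoord (S := compSlice P₀) (ell_ne_zero_of_interiorIncl_mem hp)
  simp only [h, Prod.smul_snd, smul_eq_mul, mul_one]

set_option maxHeartbeats 400000 in
lemma localMetric_interiorIncl (hD : IsSmoothTorsionFree D)
    (hp : interiorIncl F p ∈ (chartAt (EuclideanHalfSpace (2 * n)) P₀).source)
    (v w : TangentSpace (cotangentModel n) p) :
    let dι := mfderiv (cotangentModel n) 𝓗 n (interiorIncl F) p
    let T := definingFunction F
    let dT := mvfderiv 𝓗 n T (interiorIncl F p)
    localMetric D P₀ (interiorIncl F p) (dι v) (dι w) =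
      T (interiorIncl F p) * neutralMetric D p v w + (4 * T (interiorIncl F p))⁻¹ *
        (dT (dι v) * dT (dι w) - dT (localJ D P₀ (interiorIncl F p) (dι v)) *
          dT (localJ D P₀ (interiorIncl F p) (dι w))) := by
  intro dι T dT
  have hz := ell_ne_zero_of_interiorIncl_mem hp
  have hf := pairWeight_pos (F := F) (a := rayIndex P₀.pair) (compCoord_mem_cylinder hp)
  have h := sliceMetric_fderiv (Γ := chartGamma D (compBase P₀))
    (P := chartSchouten D (compBase P₀)) hz hf.ne'
    (fderiv ℝ (compWeight P₀) (compCoord F P₀ (interiorIncl F p)))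
    (cotDeriv (compBase P₀) p v) (cotDeriv (compBase P₀) p w)
  simp only [← fderiv_sliceChange hz] at h
  rw [← compDeriv_mfderiv_interiorIncl hp v, ← compDeriv_mfderiv_interiorIncl hp w] at h
  have hJ : ∀ u, compDeriv P₀ (interiorIncl F p) (localJ D P₀ (interiorIncl F p) u) =
      splitJ (compLift D P₀ (compCoord F P₀ (interiorIncl F p)))
        (compDeriv P₀ (interiorIncl F p) u) := fun u => by
    simp only [localJ, ContinuousLinearMap.comp_apply]
    exact coordDeriv_coordLift hp _
  simp only [dT, T]
  rw [mvfderiv_definingFunction hp, mvfderiv_definingFunction hp, mvfderiv_definingFunction hp,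
    mvfderiv_definingFunction hp, hJ, hJ, definingFunction_interiorIncl_eq hp, localMetric,
    pullBilinear_apply, neutralMetric_apply hD (proj_mem_of_interiorIncl_mem hp)]
  rw [compMetric, compTractor, cotLift, show compLift D P₀ = sliceLift (compSlice P₀)
    (chartGamma D (compBase P₀)) (chartSchouten D (compBase P₀)) from rfl]
  rw [compCoord_interiorIncl hp] at h ⊢
  convert h

/-- The one-form `dT / (2T)` on the interior in the coordinates of the cotangent bundle. -/
noncomputable def interiorForm (P₀ : CompactifiedCotangent F)
    (z : 𝕍 n × DualSpace n) : 𝕍 n × DualSpace n →L[ℝ] ℝ :=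
  ((2 * compWeight P₀ (z.1, sliceCoord (compSlice P₀) z))⁻¹ •
      fderiv ℝ (compWeight P₀) (z.1, sliceCoord (compSlice P₀) z)) ∘L
    fderiv ℝ (fun z : 𝕍 n × DualSpace n =>
      (z.1, sliceCoord (compSlice P₀) z)) z + rescalingForm (compSlice P₀) z

lemma interiorForm_cotDeriv
    (hp : interiorIncl F p ∈ (chartAt (EuclideanHalfSpace (2 * n)) P₀).source)
    (v : TangentSpace (cotangentModel n) p) :
    ((2 * definingFunction F (interiorIncl F p))⁻¹ •
        mvfderiv (cotangentModel n) (fun q => definingFunction F (interiorIncl F q)) p) v =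
      interiorForm P₀ (cotCoord (compBase P₀) p) (cotDeriv (compBase P₀) p v) := by
  have hz := ell_ne_zero_of_interiorIncl_mem hp
  have hf := (pairWeight_pos (F := F) (a := rayIndex P₀.pair) (compCoord_mem_cylinder hp)).ne'
  have h1 : mvfderiv (cotangentModel n) (fun q => definingFunction F (interiorIncl F q)) p v =
      mvfderiv 𝓗 n (definingFunction F) (interiorIncl F p)
        (mfderiv (cotangentModel n) 𝓗 n (interiorIncl F) p v) :=
    DFunLike.congr_fun (mfderiv_comp p
      ((isBoundaryDefining_definingFunction.smooth (interiorIncl F p)).mdifferentiableAt (by simp))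
      ((contMDiff_interiorIncl p).mdifferentiableAt (by simp))) v
  rw [smul_apply, h1, mvfderiv_definingFunction hp, compDeriv_mfderiv_interiorIncl hp, sliceDT_apply,
    definingFunction_interiorIncl_eq hp, interiorForm]
  have h2 := sect_sliceCoord (S := compSlice P₀) hz
  rw [compCoord_interiorIncl hp] at hf ⊢
  simp only [add_apply, ContinuousLinearMap.comp_apply, smul_apply, smul_eq_mul,
    rescalingForm_apply, h2, fderiv_sliceChange hz, fderiv_sliceCoord hz, raySlice_lin, sub_apply,
    raySlice_tau, Prod.smul_snd, mul_zero, mul_one]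
  field_simp
  ring

lemma paraCChange_neutralConnection (hD : IsSmoothTorsionFree D) {x₀ : N}
    (hb : p.proj ∈ (chartAt 𝕍 n x₀).source)
    {Υ : ∀ p : CotangentBundle n N, TangentSpace (cotangentModel n) p →L[ℝ] ℝ}
    {Υ₀ : 𝕍 n × DualSpace n →L[ℝ] ℝ}
    (hΥ : ∀ u, Υ p u = Υ₀ (cotDeriv x₀ p u))
    {Y : ∀ p : CotangentBundle n N, TangentSpace (cotangentModel n) p}
    (hY : MDifferentiableAt (cotangentModel n) ((cotangentModel n).prod
      𝓘(ℝ, 𝕍 n × DualSpace n))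
      (fun p => TotalSpace.mk' (𝕍 n × DualSpace n) p (Y p)) p)
    (v : TangentSpace (cotangentModel n) p) :
    paraCChange (cotangentModel n) (neutralJ D) (neutralConnection D) Υ Y p v =
      localCov (cotangentModel n) (cotEquiv n) (⟨x₀, 0⟩ : CotangentBundle n N)
        (cotGamma D x₀ (cotCoord x₀ p) + paraCTensor (splitJ (cotLift D x₀ (cotCoord x₀ p))) Υ₀)
        Y p v := by
  have h := paraCChange_eq_localCov (mem_cotSource.2 hb) (neutralConnection_apply hD hb hY)
    (cotDeriv_neutralJ hD hb) hΥ v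
  exact h

lemma fderiv_sliceChange_cotGamma {z : 𝕍 n × DualSpace n}
    (hz : (compSlice P₀).ell (z.2, 1) ≠ 0)
    (hg : ContDiffAt ℝ ∞ (chartGamma D (compBase P₀)) z.1)
    (hs : ContDiffAt ℝ ∞ (chartSchouten D (compBase P₀)) z.1) :
    ChristoffelsCorrespond (fun z : 𝕍 n × DualSpace n =>
        (z.1, sliceCoord (compSlice P₀) z)) z
      (cotGamma D (compBase P₀) z + paraCTensor (splitJ (cotLift D (compBase P₀) z))
        (interiorForm P₀ z)) (compGamma D P₀ (z.1, sliceCoord (compSlice P₀) z)) := by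
  intro X X'
  have h := fderiv_rescaled_sliceCoord hz hg hs
    ((2 * compWeight P₀ (z.1, sliceCoord (compSlice P₀) z))⁻¹ •
      fderiv ℝ (compWeight P₀) (z.1, sliceCoord (compSlice P₀) z)) X X'
  unfold compGamma interiorForm cotGamma
  rw [show cotLift D (compBase P₀) = sliceLift (cotangentSlice _) (chartGamma D (compBase P₀))
    (chartSchouten D (compBase P₀)) from rfl, show compLift D P₀ = sliceLift (compSlice P₀)
    (chartGamma D (compBase P₀)) (chartSchouten D (compBase P₀)) from rfl]
  convert h

lemma isInvertible_mfderiv_interiorIncl (p : CotangentBundle n N) :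
    (mfderiv (cotangentModel n) 𝓗 n (interiorIncl F) p).IsInvertible :=
  ⟨(isInteriorInclusion_interiorIncl.isLocalDiffeomorph p).mfderivToContinuousLinearEquiv
    (by simp), rfl⟩

lemma eventually_compCoord_interiorIncl
    (hp : interiorIncl F p ∈ (chartAt (EuclideanHalfSpace (2 * n)) P₀).source) :
    ∀ᶠ z in 𝓝 (cotCoord (compBase P₀) p), compCoord F P₀ (interiorIncl F (cotInv (compBase P₀) z)) =
      (z.1, sliceCoord (compSlice P₀) z) := by
  have hm := cotCoord_mem (proj_mem_of_interiorIncl_mem hp)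
  have hc := continuousAt_cotInv hm
  have he := eventually_interiorIncl_mem hp
  rw [← cotInv_cotCoord (proj_mem_of_interiorIncl_mem hp)] at he
  filter_upwards [hc.eventually he, (isOpen_chartCylinder (compBase P₀)).mem_nhds hm] with z h1 h2
  rw [compCoord_interiorIncl h1, cotCoord_cotInv_self h2]

lemma localCov_interiorIncl (hD : IsSmoothTorsionFree D)
    (hp : interiorIncl F p ∈ (chartAt (EuclideanHalfSpace (2 * n)) P₀).source)
    {Y : ∀ P : CompactifiedCotangent F, TangentSpace 𝓗 n P}
    (hY : IsSmoothVectorField 𝓗 n Y) (v : TangentSpace (cotangentModel n) p) :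
    localCov 𝓗 n (halfEquiv (rayIndex P₀.pair).k) P₀
        (compGamma D P₀ (compCoord F P₀ (interiorIncl F p))) Y (interiorIncl F p)
        (mfderiv (cotangentModel n) 𝓗 n (interiorIncl F) p v) =
      mfderiv (cotangentModel n) 𝓗 n (interiorIncl F) p
        (paraCChange (cotangentModel n) (neutralJ D) (neutralConnection D)
          (fun q => (2 * definingFunction F (interiorIncl F q))⁻¹ •
            mvfderiv (cotangentModel n) (fun q' => definingFunction F (interiorIncl F q')) q)
          (VectorField.mpullback (cotangentModel n) 𝓗 n (interiorIncl F) Y) p v) := by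
  have hz := ell_ne_zero_of_interiorIncl_mem hp
  have hb := proj_mem_of_interiorIncl_mem hp
  have hg := contDiffAt_chartGamma hD.1 hb
  have hs := contDiffAt_chartSchouten hD.1 hb
  rw [← cotCoord_fst hb] at hg hs
  have hY₀ : IsSmoothVectorField (cotangentModel n)
      (VectorField.mpullback (cotangentModel n) 𝓗 n (interiorIncl F) Y) :=
    ContMDiff.mpullback_vectorField hY contMDiff_interiorIncl isInvertible_mfderiv_interiorIncl
      (by simp)
  have hYY : ∀ q, mfderiv (cotangentModel n) 𝓗 n (interiorIncl F) q
      (VectorField.mpullback (cotangentModel n) 𝓗 n (interiorIncl F) Y q) =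
      Y (interiorIncl F q) := fun q => by
    rw [VectorField.mpullback_apply]
    exact (isInvertible_mfderiv_interiorIncl q).self_apply_inverse _
  have hY₁ := (hY₀ p).mdifferentiableAt (by simp)
  have hΓ := fderiv_sliceChange_cotGamma (D := D) hz hg hs
  have hF := eventually_compCoord_interiorIncl hp
  have hc := paraCChange_neutralConnection hD hb
    (Υ := fun q => (2 * definingFunction F (interiorIncl F q))⁻¹ •
      mvfderiv (cotangentModel n) (fun q' => definingFunction F (interiorIncl F q')) q)
    (Y := VectorField.mpullback (cotangentModel n) 𝓗 n (interiorIncl F) Y)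
    (interiorForm_cotDeriv hp) hY₁ v
  rw [compCoord_interiorIncl hp, hc]
  have hcov := mfderiv_localCov (I := cotangentModel n) (L := cotEquiv n)
    (I' := 𝓡∂ (2 * n)) (L' := halfEquiv (rayIndex P₀.pair).k) (G := interiorIncl F)
    (x₀ := (⟨compBase P₀, 0⟩ : CotangentBundle n N)) (y₀ := P₀)
    (Y := VectorField.mpullback (cotangentModel n) 𝓗 n (interiorIncl F) Y) (Y' := Y)
    (mem_cotSource.2 hb) hp (contMDiff_interiorIncl p) hF (differentiableAt_sliceChange hz) hΓ
    hY₁ ((hY _).mdifferentiableAt (by simp)) (Eventually.of_forall hYY) v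
  rw [hcov]

end InteriorIdentities

lemma connectionOfChristoffel_apply {E : Type*} [NormedAddCommGroup E] [NormedSpace ℝ E]
    {H : Type*} [TopologicalSpace H] {I : ModelWithCorners ℝ E H}
    {M : Type*} [TopologicalSpace M] [ChartedSpace H M] [IsManifold I ∞ M]
    {Z : Type*} [NormedAddCommGroup Z] [NormedSpace ℝ Z] (L : M → (E ≃L[ℝ] Z))
    (Γ : M → Z → Z →L[ℝ] Z →L[ℝ] Z) (Y : ∀ p : M, TangentSpace I p) (P : M) :
    connectionOfChristoffel (I := I) L Γ Y P =
      localCov I (L P) P (Γ P (coordMap I (L P) P P)) Y P :=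
  rfl

section Extension

variable {n : ℕ} [NeZero n] {N : Type*} [TopologicalSpace N] [T2Space N]
  [ChartedSpace 𝕍 n N] [IsManifold (𝓡 n) ∞ N] [F : FibreNorm n N]
  {D : AffineConnection (𝓡 n) N} {P₀ P₁ Q : CompactifiedCotangent F}

lemma localJ_eq_localJ (hD : IsSmoothTorsionFree D)
    (h₀ : Q ∈ (chartAt (EuclideanHalfSpace (2 * n)) P₀).source)
    (h₁ : Q ∈ (chartAt (EuclideanHalfSpace (2 * n)) P₁).source) :
    localJ D P₀ Q = localJ D P₁ Q := by
  refine endomorphism_eq_of_eq_interior (A := localJ D P₀) (B := localJ D P₁)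
    (contMDiffAt_localJ h₀ hD) (contMDiffAt_localJ h₁ hD) ?_
  filter_upwards [eventually_mem_source h₀, eventually_mem_source h₁] with R hR₀ hR₁ hR
  refine ContinuousLinearMap.ext fun v => ?_
  obtain ⟨p, rfl⟩ : ∃ p, interiorIncl F p = R := ⟨_, interiorIncl_interiorInv hR⟩
  obtain ⟨w, rfl⟩ := surjective_mfderiv_interiorIncl p v
  exact (localJ_interiorIncl hD hR₀ w).trans (localJ_interiorIncl hD hR₁ w).symm

lemma localMetric_eq_localMetric (hD : IsSmoothTorsionFree D)
    (h₀ : Q ∈ (chartAt (EuclideanHalfSpace (2 * n)) P₀).source)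
    (h₁ : Q ∈ (chartAt (EuclideanHalfSpace (2 * n)) P₁).source) :
    localMetric D P₀ Q = localMetric D P₁ Q := by
  refine bilinearForm_eq_of_eq_interior (A := localMetric D P₀) (B := localMetric D P₁)
    (contMDiffAt_localMetric h₀ hD) (contMDiffAt_localMetric h₁ hD) ?_
  filter_upwards [eventually_mem_source h₀, eventually_mem_source h₁] with R hR₀ hR₁ hR
  refine ContinuousLinearMap.ext fun v => ContinuousLinearMap.ext fun v' => ?_
  obtain ⟨p, rfl⟩ : ∃ p, interiorIncl F p = R := ⟨_, interiorIncl_interiorInv hR⟩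
  obtain ⟨w, rfl⟩ := surjective_mfderiv_interiorIncl p v
  obtain ⟨w', rfl⟩ := surjective_mfderiv_interiorIncl p v'
  have h1 := localMetric_interiorIncl hD hR₀ w w'
  have h2 := localMetric_interiorIncl hD hR₁ w w'
  rw [localJ_eq_localJ hD hR₀ hR₁] at h1
  exact h1.trans h2.symm

lemma compGamma_eq_compGamma (hD : IsSmoothTorsionFree D)
    (h₀ : Q ∈ (chartAt (EuclideanHalfSpace (2 * n)) P₀).source)
    (h₁ : Q ∈ (chartAt (EuclideanHalfSpace (2 * n)) P₁).source)
    {Y : ∀ P : CompactifiedCotangent F, TangentSpace 𝓗 n P}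
    (hY : IsSmoothVectorField 𝓗 n Y) :
    localCov 𝓗 n (halfEquiv (rayIndex P₀.pair).k) P₀
        (compGamma D P₀ (compCoord F P₀ Q)) Y Q =
      localCov 𝓗 n (halfEquiv (rayIndex P₁.pair).k) P₁
        (compGamma D P₁ (compCoord F P₁ Q)) Y Q := by
  refine endomorphism_eq_of_eq_interior
    (A := fun Q => localCov 𝓗 n (halfEquiv (rayIndex P₀.pair).k) P₀
        (compGamma D P₀ (compCoord F P₀ Q)) Y Q)
    (B := fun Q => localCov 𝓗 n (halfEquiv (rayIndex P₁.pair).k) P₁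
        (compGamma D P₁ (compCoord F P₁ Q)) Y Q)
    (contMDiffAt_localCov h₀ (contDiffAt_compGamma h₀ hD).contDiffWithinAt hY)
    (contMDiffAt_localCov h₁ (contDiffAt_compGamma h₁ hD).contDiffWithinAt hY) ?_
  filter_upwards [eventually_mem_source h₀, eventually_mem_source h₁] with R hR₀ hR₁ hR
  refine ContinuousLinearMap.ext fun v => ?_
  obtain ⟨p, rfl⟩ : ∃ p, interiorIncl F p = R := ⟨_, interiorIncl_interiorInv hR⟩
  obtain ⟨w, rfl⟩ := surjective_mfderiv_interiorIncl p v
  have h2 := localCov_interiorIncl hD hR₀ hY w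
  rw [h2, localCov_interiorIncl hD hR₁ hY w]

variable (F D)

/-- The extension of `J` to the compactification. -/
noncomputable def compactJ (P : CompactifiedCotangent F) :
    TangentSpace 𝓗 n P →L[ℝ] TangentSpace 𝓗 n P :=
  localJ D P P

/-- The extension of the rescaled metric to the compactification. -/
noncomputable def compactMetric (P : CompactifiedCotangent F) :
    TangentSpace 𝓗 n P →L[ℝ] TangentSpace 𝓗 n P →L[ℝ] ℝ :=
  localMetric D P P

/-- The extension of the rescaled connection to the compactification. -/
noncomputable def compactConnection :
    AffineConnection 𝓗 n (CompactifiedCotangent F) :=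
  connectionOfChristoffel (I := 𝓡∂ (2 * n))
    (fun P : CompactifiedCotangent F => halfEquiv (rayIndex P.pair).k) (compGamma D)

variable {F D}

lemma compactConnection_apply (Y : ∀ P : CompactifiedCotangent F, TangentSpace 𝓗 n P)
    (P : CompactifiedCotangent F) : compactConnection F D Y P =
      localCov 𝓗 n (halfEquiv (rayIndex P.pair).k) P (compGamma D P (compCoord F P P)) Y P := by
  rw [compactConnection, connectionOfChristoffel_apply]

variable (hD : IsSmoothTorsionFree D)

include hD

lemma compactJ_eq (h₀ : Q ∈ (chartAt (EuclideanHalfSpace (2 * n)) P₀).source) :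
    compactJ F D Q = localJ D P₀ Q :=
  localJ_eq_localJ hD (mem_chart_source _ _) h₀

lemma compactMetric_eq (h₀ : Q ∈ (chartAt (EuclideanHalfSpace (2 * n)) P₀).source) :
    compactMetric F D Q = localMetric D P₀ Q :=
  localMetric_eq_localMetric hD (mem_chart_source _ _) h₀

lemma isExtensionOfJ_compactJ : IsExtensionOfJ (cotangentModel n) 𝓗 n (neutralJ D)
    (interiorIncl F) (compactJ F D) where
  smooth P := by
    refine (contMDiffAt_localJ (mem_chart_source _ P) hD).congr_of_eventuallyEq ?_
    filter_upwards [eventually_mem_source (mem_chart_source (EuclideanHalfSpace (2 * n)) P)]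
      with Q hQ
    rw [compactJ_eq hD hQ]
  eq_interior p v := localJ_interiorIncl hD (mem_chart_source _ _) v

lemma isRescaledMetric_compactMetric : IsRescaledMetric (cotangentModel n) 𝓗 n
    (neutralMetric D) (interiorIncl F) (definingFunction F) (compactJ F D) (compactMetric F D) where
  smooth P := by
    refine (contMDiffAt_localMetric (mem_chart_source _ P) hD).congr_of_eventuallyEq ?_
    filter_upwards [eventually_mem_source (mem_chart_source (EuclideanHalfSpace (2 * n)) P)]
      with Q hQ
    rw [compactMetric_eq hD hQ]
  eq_interior p v w := by
    have h := localMetric_interiorIncl hD (mem_chart_source _ (interiorIncl F p)) v w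
    simp only [compactMetric, compactJ, thetaForm, ContinuousLinearMap.comp_apply]
    convert h

lemma isParaCProjectiveCompactification : IsParaCProjectiveCompactification (cotangentModel n)
    𝓗 n (neutralMetric D) (neutralJ D) (interiorIncl F) (definingFunction F) where
  paraHermitian := isParaHermitian_neutral hD
  interior := isInteriorInclusion_interiorIncl
  defining := isBoundaryDefining_definingFunction
  extends_connection := by
    refine ⟨neutralConnection D, isAdmissibleConnection_neutral hD, compactConnection F D, ?_,
      fun Y hY p v => ?_⟩
    swap
    · have h := localCov_interiorIncl hD (mem_chart_source _ (interiorIncl F p)) hY v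
      rw [compactConnection_apply, h]
    refine contMDiffCovariantDerivative_of_localCov fun P =>
      ⟨compGamma D P, halfEquiv (rayIndex P.pair).k,
        (contDiffAt_compGamma (mem_chart_source _ P) hD).contDiffWithinAt, fun Y hY => ?_⟩
    filter_upwards [eventually_mem_source (mem_chart_source (EuclideanHalfSpace (2 * n)) P)]
      with Q hQ
    rw [compactConnection_apply, compGamma_eq_compGamma hD (mem_chart_source _ _) hQ hY]

end Extension

/-- The one-form induced on the boundary. -/
local notation:max "ϑ" n:max F:max D:max =>
  boundaryForm (2 * n - 1) (𝓡∂ (2 * n)) (compactJ F D) (definingFunction F) (rayBoundary F)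

section BoundarySlice

variable {n : ℕ} {a : RayIndex n}
  {Γ : 𝕍 n →
    𝕍 n →L[ℝ] 𝕍 n →L[ℝ] 𝕍 n}
  {P : 𝕍 n → 𝕍 n →L[ℝ] 𝕍 n →L[ℝ] ℝ}
  {z : 𝕍 n × DualSpace n}

lemma raySlice_lin_of_eq_zero (ha : a.slope = 0) {y : DualSpace n}
    (hy : y (EuclideanSpace.single a.k 1) = 0) : (raySlice a).lin y = (y, 0) := by
  refine Prod.ext ?_ ((raySlice_lin a y).trans hy)
  ext i
  simp [raySlice, ha, hy]

lemma raySlice_sect_fst (ha : a.slope = 0) {y : DualSpace n}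
    (hy : y (EuclideanSpace.single a.k 1) = 0) :
    ((raySlice a).sect y).1 = a.sgn • coordCovector n a.k + y := by
  rw [AffineSlice.sect, raySlice_lin_of_eq_zero ha hy]
  rfl

lemma sliceLift_single (hz : z.2 (EuclideanSpace.single a.k 1) = 0) (x : 𝕍 n) :
    sliceLift (raySlice a) Γ P z x (EuclideanSpace.single a.k 1) = ((raySlice a).sect z.2).1 x := by
  simp [sliceLift_apply, tractorForm_apply, raySlice_tau, hz]

lemma lin_sliceLift_boundary (hz : z.2 (EuclideanSpace.single a.k 1) = 0)
    {x : 𝕍 n} (hx : ((raySlice a).sect z.2).1 x = 0) :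
    (raySlice a).lin (sliceLift (raySlice a) Γ P z x) =
      (((raySlice a).sect z.2).1 ∘L Γ z.1 x -
        (raySlice a).ell (tractorForm (Γ z.1) (P z.1) ((raySlice a).sect z.2) x) •
          ((raySlice a).sect z.2).1, 0) := by
  rw [lin_sliceLift]
  refine Prod.ext ?_ ?_ <;> simp [tractorForm_apply, raySlice_sect, hz, hx]

lemma sliceLift_boundary_apply (ha : a.slope = 0) (hz : z.2 (EuclideanSpace.single a.k 1) = 0)
    {x x' : 𝕍 n} (hx : ((raySlice a).sect z.2).1 x = 0)
    (hx' : ((raySlice a).sect z.2).1 x' = 0) :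
    sliceLift (raySlice a) Γ P z x x' = ((raySlice a).sect z.2).1 (Γ z.1 x x') := by
  have h1 := raySlice_lin_of_eq_zero ha ((sliceLift_single (Γ := Γ) (P := P) hz x).trans hx)
  rw [lin_sliceLift_boundary hz hx] at h1
  have h2 := congrArg (fun w : DualSpace n × ℝ => w.1 x') h1
  simpa [hx'] using h2.symm

lemma sliceMetric_boundary (ha : a.slope = 0) (hz : z.2 (EuclideanSpace.single a.k 1) = 0) (f : ℝ)
    (δ : 𝕍 n × DualSpace n →L[ℝ] ℝ)
    {X X' : 𝕍 n × DualSpace n}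
    (hX : X.2 (EuclideanSpace.single a.k 1) = 0) (hX' : X'.2 (EuclideanSpace.single a.k 1) = 0)
    (hx : ((raySlice a).sect z.2).1 X.1 = 0) (hx' : ((raySlice a).sect z.2).1 X'.1 = 0) :
    sliceMetric (raySlice a) (tractorForm (Γ z.1) (P z.1) ((raySlice a).sect z.2))
        (sliceLift (raySlice a) Γ P z) f δ z.2 X X' =
      f / 2 * (X.2 X'.1 - ((raySlice a).sect z.2).1 (Γ z.1 X.1 X'.1) +
        (X'.2 X.1 - ((raySlice a).sect z.2).1 (Γ z.1 X'.1 X.1))) := by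
  have h2 : ((raySlice a).sect z.2).2 = 0 := (raySlice_sect a z.2).trans hz
  simp only [sliceMetric_apply, sliceVert_apply, map_sub, lin_sliceLift_boundary hz hx,
    lin_sliceLift_boundary hz hx', raySlice_lin_of_eq_zero ha hX, raySlice_lin_of_eq_zero ha hX',
    Prod.fst_sub, Prod.snd_sub, sub_apply, smul_apply, hx, hx', h2, smul_zero, sub_zero, zero_mul,
    mul_zero, add_zero, ContinuousLinearMap.comp_apply]

end BoundarySlice

section BoundaryFormulas

variable {n : ℕ} [NeZero n] {N : Type*} [TopologicalSpace N] [T2Space N]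
  [ChartedSpace 𝕍 n N] [IsManifold (𝓡 n) ∞ N]

variable [F : FibreNorm n N]

variable (F) in
/-- The affine chart of the cotractors at a boundary point. -/
noncomputable abbrev edgeIndex (b : RayCotangent n N) : RayIndex n :=
  rayIndex (rayBoundary F b).pair

variable (F) in
/-- The components of a tangent vector of the boundary in the chart of the compactification. -/
noncomputable def edgeDeriv (b b' : RayCotangent n N) :
    TangentSpace 𝓢 n b' →L[ℝ] 𝕍 n × DualSpace n :=
  boundaryIncl (edgeIndex F b).k ∘L
    coordDeriv 𝓢 n (ContinuousLinearEquiv.refl ℝ _) b b'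

variable (F) in
/-- The coordinates of a boundary point in the chart of the compactification. -/
noncomputable abbrev edgePoint (b b' : RayCotangent n N) : 𝕍 n × DualSpace n :=
  boundaryIncl (edgeIndex F b).k (rayCoordMap b b')

variable (F) in
/-- The covector on the ray with coordinates `z`, normalized by the chart at `b`. -/
noncomputable def edgeCovector (b : RayCotangent n N)
    (z : 𝕍 n × DualSpace n) : DualSpace n :=
  ((raySlice (edgeIndex F b)).sect z.2).1

lemma edgeIndex_slope (b : RayCotangent n N) : (edgeIndex F b).slope = 0 :=
  (rayIndex_spec ((rayBoundary F b).ne_zero) (rayBoundary F b).nonneg).2 (rayBoundary_snd b)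

lemma edgeDeriv_single (b b' : RayCotangent n N) (v : TangentSpace 𝓢 n b') :
    (edgeDeriv F b b' v).2 (EuclideanSpace.single (edgeIndex F b).k 1) = 0 :=
  boundaryIncl_apply_single _ _

lemma compDeriv_mfderiv_rayBoundary {b b' : RayCotangent n N}
    (hb : b' ∈ (chartAt 𝕍 (2 * n - 1) b).source)
    (v : TangentSpace 𝓢 n b') :
    compDeriv (rayBoundary F b) (rayBoundary F b')
      (mfderiv 𝓢 n 𝓗 n (rayBoundary F) b' v) = edgeDeriv F b b' v :=
  coordDeriv_mfderiv_rayBoundary hb v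

variable {D : AffineConnection (𝓡 n) N} (hD : IsSmoothTorsionFree D)

lemma compDeriv_localJ {P₀ P : CompactifiedCotangent F}
    (hP : P ∈ (chartAt (EuclideanHalfSpace (2 * n)) P₀).source) (v : TangentSpace 𝓗 n P) :
    compDeriv P₀ P (localJ D P₀ P v) =
      splitJ (compLift D P₀ (compCoord F P₀ P)) (compDeriv P₀ P v) := by
  simp only [localJ, ContinuousLinearMap.comp_apply]
  exact coordDeriv_coordLift hP _

include hD

lemma boundaryForm_apply {b b' : RayCotangent n N}
    (hb : b' ∈ (chartAt 𝕍 (2 * n - 1) b).source)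
    (v : TangentSpace 𝓢 n b') :
    ϑ n F D b' v =
      -2 * compWeight (rayBoundary F b) (edgePoint F b b') *
        edgeCovector F b (edgePoint F b b')
          (edgeDeriv F b b' v).1 := by
  have hs := rayBoundary_mem_source.2 hb
  have h1 : ϑ n F D b' v = mvfderiv 𝓗 n (definingFunction F) (rayBoundary F b')
        (localJ D (rayBoundary F b) (rayBoundary F b')
          (mfderiv 𝓢 n 𝓗 n (rayBoundary F) b' v)) := by
    rw [← compactJ_eq hD hs]
    rfl
  rw [h1, mvfderiv_definingFunction hs, sliceDT_apply, compDeriv_localJ hs,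
    compDeriv_mfderiv_rayBoundary hb, compCoord_rayBoundary hb, splitJ_apply, raySlice_sect,
    raySlice_lin, boundaryIncl_apply_single, compLift, edgeCovector]
  simp only [sub_apply, smul_apply, sliceLift_single (boundaryIncl_apply_single _ _),
    edgeDeriv_single, smul_eq_mul, zero_mul, add_zero]
  ring

lemma mem_contactDistribution_iff {b : RayCotangent n N} {v : TangentSpace 𝓢 n b} :
    v ∈ contactDistribution ϑ n F D b ↔
      edgeCovector F b (edgePoint F b b) (edgeDeriv F b b v).1 = 0 := by
  have hb := mem_chart_source 𝕍 (2 * n - 1) b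
  have hf := (pairWeight_pos (F := F) (a := edgeIndex F b)
    (compCoord_mem_cylinder (rayBoundary_mem_source.2 hb))).ne'
  rw [compCoord_rayBoundary hb] at hf
  rw [LinearMap.mem_ker, ContinuousLinearMap.coe_coe, boundaryForm_apply hD hb]
  simp [hf]

lemma boundaryTensor_apply {b : RayCotangent n N} {v w : TangentSpace 𝓢 n b}
    (hv : edgeCovector F b (edgePoint F b b)
      (edgeDeriv F b b v).1 = 0)
    (hw : edgeCovector F b (edgePoint F b b)
      (edgeDeriv F b b w).1 = 0) :
    let z := edgePoint F b b
    let Γ := chartGamma D (compBase (rayBoundary F b)) z.1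
    boundaryTensor (2 * n - 1) 𝓗 n (compactMetric F D) (rayBoundary F) b v w =
      compWeight (rayBoundary F b) z / 2 *
        ((edgeDeriv F b b v).2 (edgeDeriv F b b w).1 -
          edgeCovector F b z (Γ (edgeDeriv F b b v).1 (edgeDeriv F b b w).1) +
        ((edgeDeriv F b b w).2 (edgeDeriv F b b v).1 -
          edgeCovector F b z (Γ (edgeDeriv F b b w).1 (edgeDeriv F b b v).1))) := by
  intro z Γ
  have hb := mem_chart_source 𝕍 (2 * n - 1) b
  have h1 : boundaryTensor (2 * n - 1) 𝓗 n (compactMetric F D) (rayBoundary F) b v w =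
      compMetric D (rayBoundary F b) z (edgeDeriv F b b v) (edgeDeriv F b b w) := by
    rw [← compDeriv_mfderiv_rayBoundary hb, ← compDeriv_mfderiv_rayBoundary hb,
      show z = compCoord F (rayBoundary F b) (rayBoundary F b) from (compCoord_rayBoundary hb).symm]
    rfl
  rw [h1]
  have h2 := sliceMetric_boundary (Γ := chartGamma D (compBase (rayBoundary F b)))
    (P := chartSchouten D (compBase (rayBoundary F b))) (edgeIndex_slope b)
    (z := z) (boundaryIncl_apply_single _ _) (compWeight (rayBoundary F b) z)
    (fderiv ℝ (compWeight (rayBoundary F b)) z) (edgeDeriv_single b b v) (edgeDeriv_single b b w)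
    hv hw
  exact h2

end BoundaryFormulas

section ContactStructure

variable {n : ℕ} [NeZero n] {N : Type*} [TopologicalSpace N] [T2Space N]
  [ChartedSpace 𝕍 n N] [IsManifold (𝓡 n) ∞ N] [F : FibreNorm n N]

variable (F) in
/-- The expression of the boundary form in the chart at `b`. -/
noncomputable def edgeForm (b : RayCotangent n N) (u : 𝕍 (2 * n - 1)) :
    𝕍 (2 * n - 1) →L[ℝ] ℝ :=
  (-2 * compWeight (rayBoundary F b) (boundaryIncl (edgeIndex F b).k u)) •
    (edgeCovector F b (boundaryIncl (edgeIndex F b).k u) ∘L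
      ContinuousLinearMap.fst ℝ _ (DualSpace n) ∘L boundaryIncl (edgeIndex F b).k)

lemma edgeCovector_boundaryIncl (b : RayCotangent n N) (u : 𝕍 (2 * n - 1)) :
    edgeCovector F b (boundaryIncl (edgeIndex F b).k u) =
      (edgeIndex F b).sgn • coordCovector n (edgeIndex F b).k +
        (boundaryIncl (edgeIndex F b).k u).2 :=
  raySlice_sect_fst (edgeIndex_slope b) (boundaryIncl_apply_single _ _)

lemma edgeCovector_single (b : RayCotangent n N) (u : 𝕍 (2 * n - 1)) :
    edgeCovector F b (boundaryIncl (edgeIndex F b).k u)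
      (EuclideanSpace.single (edgeIndex F b).k 1) = (edgeIndex F b).sgn := by
  rw [edgeCovector_boundaryIncl, add_apply, boundaryIncl_apply_single, smul_apply,
    coordCovector_single]
  simp

lemma edgeIndex_sgn_ne_zero (b : RayCotangent n N) : (edgeIndex F b).sgn ≠ 0 := fun h => by
  simpa [h] using (edgeIndex F b).sgn_mul_sgn

lemma edgePoint_mem_chartCylinder (b b' : RayCotangent n N)
    (hb : b' ∈ (chartAt 𝕍 (2 * n - 1) b).source) :
    edgePoint F b b' ∈ chartCylinder (compBase (rayBoundary F b)) := by
  have h := compCoord_mem_cylinder (rayBoundary_mem_source.2 hb)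
  rwa [compCoord_rayBoundary hb] at h

lemma edgeWeight_pos {b b' : RayCotangent n N}
    (hb : b' ∈ (chartAt 𝕍 (2 * n - 1) b).source) :
    0 < compWeight (rayBoundary F b) (edgePoint F b b') :=
  pairWeight_pos (F := F) (a := edgeIndex F b) (edgePoint_mem_chartCylinder b b' hb)

lemma hasFDerivAt_edgeForm {b b' : RayCotangent n N}
    (hb : b' ∈ (chartAt 𝕍 (2 * n - 1) b).source) :
    ContDiffAt ℝ ∞ (edgeForm F b) (rayCoordMap b b') ∧
      ∀ v w, edgeCovector F b (edgePoint F b b') (boundaryIncl (edgeIndex F b).k w).1 = 0 →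
        fderiv ℝ (edgeForm F b) (rayCoordMap b b') v w =
          -2 * compWeight (rayBoundary F b) (edgePoint F b b') *
            (boundaryIncl (edgeIndex F b).k v).2 (boundaryIncl (edgeIndex F b).k w).1 := by
  set β := boundaryIncl (edgeIndex F b).k with hβ
  have hf : ContDiffAt ℝ ∞ (fun u => -2 * compWeight (rayBoundary F b) (β u)) (rayCoordMap b b') :=
    contDiffAt_const.mul (ContDiffAt.comp (g := compWeight (rayBoundary F b)) (f := β)
      (rayCoordMap b b') (contDiffAt_pairWeight (F := F) (a := edgeIndex F b)
        (edgePoint_mem_chartCylinder b b' hb)) β.contDiff.contDiffAt)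
  set K : 𝕍 (2 * n - 1) → 𝕍 (2 * n - 1) →L[ℝ] ℝ :=
    fun u => ((edgeIndex F b).sgn • coordCovector n (edgeIndex F b).k + (β u).2) ∘L
      ContinuousLinearMap.fst ℝ _ (DualSpace n) ∘L β with hK
  have e : edgeForm F b = fun u => (-2 * compWeight (rayBoundary F b) (β u)) • K u := by
    funext u
    rw [edgeForm, edgeCovector_boundaryIncl]
  have hK' : HasFDerivAt K _ (rayCoordMap b b') :=
    HasFDerivAt.clm_comp ((ContinuousLinearMap.snd ℝ _ (DualSpace n) ∘L β).hasFDerivAt.const_add _)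
      (hasFDerivAt_const (ContinuousLinearMap.fst ℝ _ (DualSpace n) ∘L β) (rayCoordMap b b'))
  have hKs : ContDiff ℝ ∞ K := (contDiff_const.add β.contDiff.snd).clm_comp contDiff_const
  refine ⟨?_, fun v w hw => ?_⟩
  · rw [e]
    exact hf.smul hKs.contDiffAt
  · have h := ((hf.differentiableAt (by simp)).hasFDerivAt).smul hK'
    have hw' : K (rayCoordMap b b') w = 0 := by
      rw [← hw, edgeCovector_boundaryIncl]
      rfl
    rw [e]
    erw [h.fderiv]
    simp [hw']
    exact Or.inl rfl

variable {D : AffineConnection (𝓡 n) N} (hD : IsSmoothTorsionFree D)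

include hD

lemma boundaryForm_eq_edgeForm {b b' : RayCotangent n N}
    (hb : b' ∈ (chartAt 𝕍 (2 * n - 1) b).source)
    (v : TangentSpace 𝓢 n b') :
    ϑ n F D b' v =
      edgeForm F b (rayCoordMap b b')
        (coordDeriv 𝓢 n (ContinuousLinearEquiv.refl ℝ _) b b' v) := by
  rw [boundaryForm_apply hD hb]
  rfl

lemma isSmoothOneForm_boundaryForm : IsSmoothOneForm 𝓢 n
    ϑ n F D := by
  intro b
  have hs := mem_chart_source 𝕍 (2 * n - 1) b
  rw [contMDiffAt_oneForm_iff (L := ContinuousLinearEquiv.refl ℝ _) hs]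
  refine contMDiffAt_of_comp_coordMap (L := ContinuousLinearEquiv.refl ℝ _) hs
    (hasFDerivAt_edgeForm (F := F) hs).1.contDiffWithinAt ?_
  filter_upwards [eventually_mem_source hs] with b' hb'
  ext w
  rw [ContinuousLinearMap.comp_apply, boundaryForm_eq_edgeForm hD hb', coordDeriv_coordLift hb']

lemma oneFormInChart_boundaryForm {b : RayCotangent n N} {u : 𝕍 (2 * n - 1)}
    (hu : u ∈ (extChartAt 𝓢 n b).target) :
    oneFormInChart ϑ n F D b u = edgeForm F b u := by
  ext w
  have hs : (extChartAt 𝓢 n b).symm u ∈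
      (chartAt 𝕍 (2 * n - 1) b).source := by
    rw [← extChartAt_source 𝓢 n]
    exact (extChartAt 𝓢 n b).map_target hu
  have h1 : rayCoordMap b ((extChartAt 𝓢 n b).symm u) = u :=
    (extChartAt 𝓢 n b).right_inv hu
  have h2 := DFunLike.congr_fun
    (mfderiv_extChartAt_comp_mfderivWithin_extChartAt_symm (I := 𝓡 (2 * n - 1)) hu) w
  rw [ModelWithCorners.range_eq_univ, mfderivWithin_univ] at h2
  have h3 := mfderiv_coordMap (I := 𝓡 (2 * n - 1)) (L := ContinuousLinearEquiv.refl ℝ _) hs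
  have h4 : coordDeriv 𝓢 n (ContinuousLinearEquiv.refl ℝ _) b
      ((extChartAt 𝓢 n b).symm u)
      (mfderiv 𝓢 n 𝓢 n (extChartAt 𝓢 n b).symm u w) = w := by
    rw [← h3]
    exact h2
  have h5 := boundaryForm_eq_edgeForm hD hs
    (mfderiv 𝓢 n 𝓢 n (extChartAt 𝓢 n b).symm u w)
  rw [h1, h4] at h5
  exact h5

lemma dOneForm_boundaryForm {b : RayCotangent n N} {v w : TangentSpace 𝓢 n b}
    (hv : edgeCovector F b (edgePoint F b b) (edgeDeriv F b b v).1 = 0)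
    (hw : edgeCovector F b (edgePoint F b b) (edgeDeriv F b b w).1 = 0) :
    dOneForm ϑ n F D b v w = -2 * compWeight (rayBoundary F b) (edgePoint F b b) *
        ((edgeDeriv F b b v).2 (edgeDeriv F b b w).1 -
          (edgeDeriv F b b w).2 (edgeDeriv F b b v).1) := by
  have hs := mem_chart_source 𝕍 (2 * n - 1) b
  have h1 : oneFormInChart ϑ n F D b =ᶠ[𝓝 (extChartAt 𝓢 n b b)]
      edgeForm F b := by
    filter_upwards [extChartAt_target_mem_nhds (I := 𝓡 (2 * n - 1)) b] with u hu
    exact oneFormInChart_boundaryForm hD hu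
  have h3 := mfderiv_coordMap (I := 𝓡 (2 * n - 1)) (L := ContinuousLinearEquiv.refl ℝ _) hs
  have h4 : ∀ x, mfderiv 𝓢 n 𝓢 n (extChartAt 𝓢 n b) b x =
    coordDeriv 𝓢 n (ContinuousLinearEquiv.refl ℝ _) b b x := DFunLike.congr_fun h3
  have h5 := (hasFDerivAt_edgeForm (F := F) hs).2
  rw [dOneForm, h1.fderiv_eq]
  simp only [h4]
  have e1 := h5 (coordDeriv 𝓢 n (ContinuousLinearEquiv.refl ℝ _) b b v) _ hw
  have e2 := h5 (coordDeriv 𝓢 n (ContinuousLinearEquiv.refl ℝ _) b b w) _ hv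
  refine (congrArg₂ (· - ·) e1 e2).trans ?_
  rw [mul_sub]
  rfl

end ContactStructure

section ParaCR

variable {n : ℕ} [NeZero n] {N : Type*} [TopologicalSpace N] [T2Space N]
  [ChartedSpace 𝕍 n N] [IsManifold (𝓡 n) ∞ N] [F : FibreNorm n N]
  {b : RayCotangent n N}

lemma edgeDeriv_injective : Function.Injective (edgeDeriv F b b) := fun v w h => by
  have hs := mem_chart_source 𝕍 (2 * n - 1) b
  have h1 := congrArg (boundaryProj (edgeIndex F b).k) h
  simp only [edgeDeriv, ContinuousLinearMap.comp_apply, boundaryProj_boundaryIncl] at h1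
  rw [← coordLift_coordDeriv (L := ContinuousLinearEquiv.refl ℝ _) hs v, h1,
    coordLift_coordDeriv hs]

variable (F b) in
/-- The tangent vector of the boundary with given components. -/
noncomputable def edgeVec :
    𝕍 n × DualSpace n →L[ℝ] TangentSpace 𝓢 n b :=
  coordLift 𝓢 n (ContinuousLinearEquiv.refl ℝ _) b b ∘L boundaryProj (edgeIndex F b).k

lemma edgeDeriv_edgeVec {X : 𝕍 n × DualSpace n}
    (hX : X.2 (EuclideanSpace.single (edgeIndex F b).k 1) = 0) :
    edgeDeriv F b b (edgeVec F b X) = X := by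
  have hs := mem_chart_source 𝕍 (2 * n - 1) b
  simp only [edgeDeriv, edgeVec, ContinuousLinearMap.comp_apply]
  rw [coordDeriv_coordLift hs, boundaryIncl_boundaryProj _ hX]

variable (F) in
/-- The normalized covector on the ray `b`. -/
noncomputable abbrev rayCovector (b : RayCotangent n N) : DualSpace n :=
  edgeCovector F b (edgePoint F b b)

lemma rayCovector_single : rayCovector F b (EuclideanSpace.single (edgeIndex F b).k 1) ≠ 0 :=
  (edgeCovector_single b _).trans_ne (edgeIndex_sgn_ne_zero b)

lemma eq_smul_single_of_forall {k : Fin n} {x : 𝕍 n}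
    (hx : ∀ z : DualSpace n, z (EuclideanSpace.single k 1) = 0 → z x = 0) :
    x = x k • EuclideanSpace.single k 1 := by
  ext i
  rcases eq_or_ne i k with rfl | hi
  · simp
  · have := hx (coordCovector n i) (by simp [coordCovector, hi])
    simpa [coordCovector, hi] using this

variable {D : AffineConnection (𝓡 n) N} (hD : IsSmoothTorsionFree D)

include hD

lemma isContactForm_boundaryForm : IsContactForm
    ϑ n F D where
  smooth := isSmoothOneForm_boundaryForm hD
  ne_zero b h := by
    have h1 : edgeVec F b (EuclideanSpace.single (edgeIndex F b).k 1, 0) ∈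
        contactDistribution ϑ n F D b := by
      rw [LinearMap.mem_ker, h]
      rfl
    rw [mem_contactDistribution_iff hD, edgeDeriv_edgeVec (by simp)] at h1
    exact rayCovector_single h1
  nondegenerate b v hv h := by
    have hv' := (mem_contactDistribution_iff hD).1 hv
    have hf := (edgeWeight_pos (F := F) (mem_chart_source 𝕍 (2 * n - 1) b)).ne'
    have h1 : ∀ X : 𝕍 n × DualSpace n,
        X.2 (EuclideanSpace.single (edgeIndex F b).k 1) = 0 → rayCovector F b X.1 = 0 →
        (edgeDeriv F b b v).2 X.1 = X.2 (edgeDeriv F b b v).1 := fun X hX hX' => by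
      have hw : rayCovector F b (edgeDeriv F b b (edgeVec F b X)).1 = 0 := by
        rwa [edgeDeriv_edgeVec hX]
      have h2 := h (edgeVec F b X) ((mem_contactDistribution_iff hD).2 hw)
      rw [dOneForm_boundaryForm hD hv' hw, edgeDeriv_edgeVec hX] at h2
      simpa [hf, sub_eq_zero] using h2
    have hx : (edgeDeriv F b b v).1 = 0 := by
      have h2 := eq_smul_single_of_forall (k := (edgeIndex F b).k) (x := (edgeDeriv F b b v).1)
        fun z hz => by simpa using (h1 (0, z) hz (map_zero _)).symm
      rw [h2, map_smul, smul_eq_mul, mul_eq_zero] at hv'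
      rw [h2, hv'.resolve_right rayCovector_single, zero_smul]
    apply edgeDeriv_injective (F := F)
    rw [map_zero]
    refine Prod.ext hx (ContinuousLinearMap.ext fun x => ?_)
    set e := EuclideanSpace.single (edgeIndex F b).k (1 : ℝ) with he
    have h3 := h1 (x - (rayCovector F b x / rayCovector F b e) • e, 0) rfl (by
      rw [map_sub, map_smul, smul_eq_mul, div_mul_cancel₀ _ rayCovector_single, sub_self])
    simpa [he, edgeDeriv_single] using h3

lemma contact_chartGamma_symm (v w : 𝕍 n) :
    chartGamma D (compBase (rayBoundary F b)) (edgePoint F b b).1 v w =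
      chartGamma D (compBase (rayBoundary F b)) (edgePoint F b b).1 w v := by
  have hb := mem_chart_source 𝕍 (2 * n - 1) b
  have hP := rayBoundary_mem_source (F := F).2 hb
  rw [show edgePoint F b b = compCoord F (rayBoundary F b) (rayBoundary F b) from
    (compCoord_rayBoundary hb).symm, compCoord_eq hP, pairCoord, cotCoord_fst (mem_compSource.1 hP).1]
  exact chartGamma_symm hD.2 (mem_compSource.1 hP).1 v w

omit hD in
lemma splitJ_compLift_single {v : TangentSpace 𝓢 n b}
    (hv : rayCovector F b (edgeDeriv F b b v).1 = 0) :
    (splitJ (compLift D (rayBoundary F b) (edgePoint F b b)) (edgeDeriv F b b v)).2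
      (EuclideanSpace.single (edgeIndex F b).k 1) = 0 := by
  rw [splitJ_apply, compLift]
  simp only [sub_apply, smul_apply, sliceLift_single (boundaryIncl_apply_single _ _),
    edgeDeriv_single]
  rw [show ((compSlice (rayBoundary F b)).sect (edgePoint F b b).2).1 (edgeDeriv F b b v).1 = 0
    from hv, smul_zero, sub_zero]

/-- The endomorphism induced by `J` on the contact distribution. -/
noncomputable def contactJ (b : RayCotangent n N) :
    contactDistribution ϑ n F D b →ₗ[ℝ]
      contactDistribution ϑ n F D b :=
  (edgeVec F b ∘L splitJ (compLift D (rayBoundary F b) (edgePoint F b b)) ∘L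
    edgeDeriv F b b).toLinearMap.restrict fun v hv => by
      rw [mem_contactDistribution_iff hD] at hv ⊢
      have h := edgeDeriv_edgeVec (splitJ_compLift_single (D := D) hv)
      simp only [ContinuousLinearMap.coe_coe, ContinuousLinearMap.comp_apply]
      rw [h, splitJ_apply, map_neg, hv, neg_zero]

lemma edgeDeriv_contactJ (v : contactDistribution ϑ n F D b) :
    edgeDeriv F b b (contactJ hD b v) =
      splitJ (compLift D (rayBoundary F b) (edgePoint F b b)) (edgeDeriv F b b v) :=
  edgeDeriv_edgeVec (splitJ_compLift_single ((mem_contactDistribution_iff hD).1 v.2))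

lemma contactJ_contactJ (v : contactDistribution ϑ n F D b) :
    contactJ hD b (contactJ hD b v) = v := by
  refine Subtype.ext (edgeDeriv_injective (F := F) ?_)
  rw [edgeDeriv_contactJ, edgeDeriv_contactJ]
  simp [splitJ_apply]

lemma mfderiv_contactJ (v : contactDistribution ϑ n F D b) :
    mfderiv 𝓢 n 𝓗 n (rayBoundary F) b (contactJ hD b v) =
      compactJ F D (rayBoundary F b)
        (mfderiv 𝓢 n 𝓗 n (rayBoundary F) b v) := by
  have hb := mem_chart_source 𝕍 (2 * n - 1) b
  have hP := rayBoundary_mem_source (F := F).2 hb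
  have h1 := compDeriv_localJ (D := D) hP
    (mfderiv 𝓢 n 𝓗 n (rayBoundary F) b v)
  rw [compDeriv_mfderiv_rayBoundary hb, compCoord_rayBoundary hb] at h1
  have h2 := (compDeriv_mfderiv_rayBoundary hb (contactJ hD b v).1).trans
    ((edgeDeriv_contactJ hD v).trans h1.symm)
  have h3 := congrArg (compVec (rayBoundary F b) (rayBoundary F b)) h2
  rw [coordLift_coordDeriv hP, coordLift_coordDeriv hP] at h3
  exact h3

lemma boundaryTensor_symm (v w : contactDistribution ϑ n F D b) :
    boundaryTensor (2 * n - 1) 𝓗 n (compactMetric F D) (rayBoundary F) b v w =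
      boundaryTensor (2 * n - 1) 𝓗 n (compactMetric F D) (rayBoundary F) b w v := by
  rw [boundaryTensor_apply hD ((mem_contactDistribution_iff hD).1 v.2)
    ((mem_contactDistribution_iff hD).1 w.2), boundaryTensor_apply hD
    ((mem_contactDistribution_iff hD).1 w.2) ((mem_contactDistribution_iff hD).1 v.2)]
  ring

lemma boundaryTensor_contactJ (v w : contactDistribution ϑ n F D b) :
    boundaryTensor (2 * n - 1) 𝓗 n (compactMetric F D) (rayBoundary F) b v
        (contactJ hD b w) =
      1 / 4 * dOneForm ϑ n F D b v w := by
  have hv := (mem_contactDistribution_iff hD).1 v.2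
  have hw := (mem_contactDistribution_iff hD).1 w.2
  have hl := sliceLift_boundary_apply (Γ := chartGamma D (compBase (rayBoundary F b)))
    (P := chartSchouten D (compBase (rayBoundary F b))) (z := edgePoint F b b) (edgeIndex_slope b)
    (boundaryIncl_apply_single _ _) hw hv
  rw [boundaryTensor_apply hD hv ((mem_contactDistribution_iff hD).1 (contactJ hD b w).2),
    dOneForm_boundaryForm hD hv hw, edgeDeriv_contactJ, splitJ_apply, compLift]
  simp only [map_neg, neg_apply, sub_apply, smul_apply, hl, smul_eq_mul]
  rw [contact_chartGamma_symm hD (edgeDeriv F b b v).1]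
  change _ / 2 * (_ - -(edgeCovector F b (edgePoint F b b) _) +
    (_ - 2 * edgeCovector F b (edgePoint F b b) _ - -(edgeCovector F b (edgePoint F b b) _))) = _
  ring

omit hD in
lemma dOneForm_swap {m : ℕ} {B : Type*} [TopologicalSpace B]
    [ChartedSpace 𝕍 m B]
    (α : ∀ x : B, TangentSpace (𝓡 m) x →L[ℝ] ℝ) (b : B) (v w : TangentSpace (𝓡 m) b) :
    dOneForm α b v w = -dOneForm α b w v :=
  (neg_sub _ _).symm

lemma boundaryTensor_nondegenerate (v : contactDistribution ϑ n F D b)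
    (h : ∀ w : contactDistribution ϑ n F D b,
      boundaryTensor (2 * n - 1) 𝓗 n (compactMetric F D) (rayBoundary F) b v w = 0) :
    v = 0 := by
  refine Subtype.ext ((isContactForm_boundaryForm hD).nondegenerate b v v.2 fun w hw => ?_)
  have h1 := boundaryTensor_contactJ hD v ⟨w, hw⟩
  rw [h] at h1
  simpa using h1.symm

omit hD in
lemma finrank_ker_of_apply_ne_zero {W : Type*} [AddCommGroup W] [Module ℝ W]
    [FiniteDimensional ℝ W] {f : W →ₗ[ℝ] ℝ} {w : W} (h : f w ≠ 0) :
    Module.finrank ℝ (LinearMap.ker f) = Module.finrank ℝ W - 1 := by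
  have h1 := Module.Dual.finrank_ker_add_one_of_ne_zero (f := f) (by rintro rfl; exact h rfl)
  omega

omit hD in
lemma finrank_dualSpace (n : ℕ) : Module.finrank ℝ (DualSpace n) = n := by
  rw [← (LinearMap.toContinuousLinearMap (𝕜 := ℝ) (E := 𝕍 n)
    (F' := ℝ)).finrank_eq]
  simp

lemma finrank_eigenspace_one : Module.finrank ℝ (Module.End.eigenspace (contactJ (F := F) hD b) 1) =
    n - 1 := by
  have hx : ∀ v ∈ Module.End.eigenspace (contactJ (F := F) hD b) 1,
      (edgeDeriv F b b v).1 = 0 := fun v hv => by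
    have h1 := edgeDeriv_contactJ hD v
    rw [Module.End.mem_eigenspace_iff.1 hv, one_smul, splitJ_apply] at h1
    have h2 : (edgeDeriv F b b v).1 = -(edgeDeriv F b b v).1 := congrArg Prod.fst h1
    have h3 : (2 : ℝ) • (edgeDeriv F b b v).1 = 0 := by
      rw [two_smul]
      nth_rewrite 2 [h2]
      exact add_neg_cancel _
    exact (smul_eq_zero.1 h3).resolve_left two_ne_zero
  let f : Module.End.eigenspace (contactJ (F := F) hD b) 1 →ₗ[ℝ]
      LinearMap.ker (evalAt (edgeIndex F b).k).toLinearMap :=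
    ((LinearMap.snd ℝ _ _ ∘ₗ (edgeDeriv F b b).toLinearMap ∘ₗ Submodule.subtype _) ∘ₗ
      Submodule.subtype _).codRestrict _ fun v => edgeDeriv_single b b _
  have hf : Function.Bijective f := by
    refine ⟨fun v w h => Subtype.ext (Subtype.ext (edgeDeriv_injective (F := F) ?_)), fun z => ?_⟩
    · exact Prod.ext ((hx v v.2).trans (hx w w.2).symm) (congrArg Subtype.val h)
    · have hz : edgeDeriv F b b (edgeVec F b (0, z)) = (0, z.1) := edgeDeriv_edgeVec z.2
      refine ⟨⟨⟨edgeVec F b (0, z), ?_⟩, ?_⟩, Subtype.ext (congrArg Prod.snd hz)⟩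
      · rw [mem_contactDistribution_iff hD, hz, map_zero]
      · rw [Module.End.mem_eigenspace_iff, one_smul]
        refine Subtype.ext (edgeDeriv_injective (F := F) ?_)
        rw [edgeDeriv_contactJ]
        simp [splitJ_apply, hz]
  rw [(LinearEquiv.ofBijective f hf).finrank_eq, finrank_ker_of_apply_ne_zero
    (w := coordCovector n (edgeIndex F b).k) (by simp [coordCovector]), finrank_dualSpace]

lemma finrank_eigenspace_neg_one :
    Module.finrank ℝ (Module.End.eigenspace (contactJ (F := F) hD b) (-1)) = n - 1 := by
  have hx : ∀ v ∈ Module.End.eigenspace (contactJ (F := F) hD b) (-1), (edgeDeriv F b b v).2 =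
      compLift D (rayBoundary F b) (edgePoint F b b) (edgeDeriv F b b v).1 := fun v hv => by
    have h1 := edgeDeriv_contactJ hD v
    rw [Module.End.mem_eigenspace_iff.1 hv, splitJ_apply] at h1
    have h2 := congrArg Prod.snd h1
    simp only [neg_smul, one_smul, Submodule.coe_neg, map_neg, Prod.snd_neg] at h2
    have h3 : (2 : ℝ) • (edgeDeriv F b b v).2 =
        (2 : ℝ) • compLift D (rayBoundary F b) (edgePoint F b b) (edgeDeriv F b b v).1 := by
      rw [two_smul, ← sub_eq_zero, ← sub_eq_zero.2 h2.symm]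
      abel
    exact smul_right_injective _ two_ne_zero h3
  let f : Module.End.eigenspace (contactJ (F := F) hD b) (-1) →ₗ[ℝ]
      LinearMap.ker (rayCovector F b).toLinearMap :=
    ((LinearMap.fst ℝ _ _ ∘ₗ (edgeDeriv F b b).toLinearMap ∘ₗ Submodule.subtype _) ∘ₗ
      Submodule.subtype _).codRestrict _ fun v => (mem_contactDistribution_iff hD).1 v.1.2
  have hf : Function.Bijective f := by
    refine ⟨fun v w h => Subtype.ext (Subtype.ext (edgeDeriv_injective (F := F) ?_)), fun x => ?_⟩
    · have h1 : (edgeDeriv F b b v.1.1).1 = (edgeDeriv F b b w.1.1).1 := congrArg Subtype.val h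
      exact Prod.ext h1 ((hx v v.2).trans ((congrArg _ h1).trans (hx w w.2).symm))
    · have hz : edgeDeriv F b b (edgeVec F b
          (x, compLift D (rayBoundary F b) (edgePoint F b b) x)) =
          (x.1, compLift D (rayBoundary F b) (edgePoint F b b) x) :=
        edgeDeriv_edgeVec ((sliceLift_single (boundaryIncl_apply_single _ _) _).trans x.2)
      refine ⟨⟨⟨edgeVec F b (x, compLift D (rayBoundary F b) (edgePoint F b b) x), ?_⟩, ?_⟩,
        Subtype.ext (congrArg Prod.fst hz)⟩
      · rw [mem_contactDistribution_iff hD, hz]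
        exact x.2
      · rw [Module.End.mem_eigenspace_iff]
        refine Subtype.ext (edgeDeriv_injective (F := F) ?_)
        rw [edgeDeriv_contactJ]
        simp only [hz, splitJ_apply, neg_smul, one_smul, Submodule.coe_neg, map_neg, Prod.neg_mk,
          two_smul, sub_add_cancel_left]
  rw [(LinearEquiv.ofBijective f hf).finrank_eq, finrank_ker_of_apply_ne_zero
    (w := EuclideanSpace.single (edgeIndex F b).k 1) rayCovector_single, finrank_euclideanSpace_fin]

lemma isParaCRStructure_contactJ : IsParaCRStructure ϑ n F D (contactJ hD) (n - 1) where
  sq b v := contactJ_contactJ hD v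
  rank_pos b := finrank_eigenspace_one hD
  rank_neg b := finrank_eigenspace_neg_one hD
  levi b v w := by
    have h1 := boundaryTensor_contactJ hD (contactJ hD b v) (contactJ hD b w)
    have h2 := boundaryTensor_contactJ hD w v
    rw [contactJ_contactJ, boundaryTensor_symm hD, h2, dOneForm_swap _ _ w.1] at h1
    linarith

end ParaCR

section Homogeneous

lemma sum_sum_erase_symm {n : ℕ} (k : Fin n) {G : Fin n → Fin n → ℝ} (hG : ∀ i j, G i j = G j i)
    {Z x x' : Fin n → ℝ} (hx : x k = -∑ A ∈ Finset.univ.erase k, Z A * x A)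
    (hx' : x' k = -∑ A ∈ Finset.univ.erase k, Z A * x' A) :
    ∑ A ∈ Finset.univ.erase k, ((∑ B ∈ Finset.univ.erase k,
        (G A B + G k k * Z A * Z B - 2 * G A k * Z B) * x B) * x' A +
      (∑ B ∈ Finset.univ.erase k, (G A B + G k k * Z A * Z B - 2 * G A k * Z B) * x' B) * x A) =
    ∑ i, ∑ j, G i j * x i * x' j + ∑ i, ∑ j, G i j * x' i * x j := by
  set s := Finset.univ.erase k with hs
  have full : ∀ y y' : Fin n → ℝ, ∑ i, ∑ j, G i j * y i * y' j =
      G k k * y k * y' k + y k * (∑ A ∈ s, G A k * y' A) + y' k * (∑ A ∈ s, G A k * y A) +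
        ∑ A ∈ s, ∑ B ∈ s, G A B * y B * y' A := by
    intro y y'
    rw [← Finset.add_sum_erase _ _ (Finset.mem_univ k),
      ← Finset.add_sum_erase _ _ (Finset.mem_univ k), ← hs]
    rw [show ∑ A ∈ s, ∑ j, G A j * y A * y' j =
      ∑ A ∈ s, (G A k * y A * y' k + ∑ B ∈ s, G A B * y A * y' B) from
      Finset.sum_congr rfl fun A _ => (Finset.add_sum_erase _ _ (Finset.mem_univ k)).symm]
    rw [Finset.sum_add_distrib, Finset.sum_comm (s := s) (t := s), Finset.mul_sum, Finset.mul_sum]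
    have e1 : ∀ B ∈ s, ∑ A ∈ s, G A B * y A * y' B = ∑ A ∈ s, G B A * y A * y' B :=
      fun B _ => Finset.sum_congr rfl fun A _ => by rw [hG]
    rw [Finset.sum_congr rfl e1, Finset.sum_congr rfl fun j _ =>
      (show G k j * y k * y' j = y k * (G j k * y' j) by rw [hG]; ring), Finset.sum_congr rfl
      fun j _ => (show G j k * y j * y' k = y' k * (G j k * y j) by ring)]
    ring
  have half : ∀ y y' : Fin n → ℝ, ∑ A ∈ s, (∑ B ∈ s,
      (G A B + G k k * Z A * Z B - 2 * G A k * Z B) * y B) * y' A =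
      ∑ A ∈ s, ∑ B ∈ s, G A B * y B * y' A +
        G k k * (∑ B ∈ s, Z B * y B) * (∑ A ∈ s, Z A * y' A) -
        2 * (∑ A ∈ s, G A k * y' A) * (∑ B ∈ s, Z B * y B) := by
    intro y y'
    generalize ha : ∑ B ∈ s, Z B * y B = a
    have inner : ∀ A, ∑ B ∈ s, (G A B + G k k * Z A * Z B - 2 * G A k * Z B) * y B =
        ∑ B ∈ s, G A B * y B + (G k k * Z A - 2 * G A k) * a := by
      intro A
      rw [← ha, Finset.mul_sum, ← Finset.sum_add_distrib]
      exact Finset.sum_congr rfl fun B _ => by ring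
    simp only [inner, ← Finset.sum_mul]
    rw [Finset.mul_sum, Finset.mul_sum, Finset.sum_mul, ← Finset.sum_add_distrib,
      ← Finset.sum_sub_distrib]
    exact Finset.sum_congr rfl fun A _ => by ring
  rw [Finset.sum_add_distrib, half, half, full, full, hx, hx']
  ring

end Homogeneous

section ExplicitMetric

variable {n : ℕ} {N : Type*} [TopologicalSpace N]
  [ChartedSpace 𝕍 n N] [IsManifold (𝓡 n) ∞ N]

/-- The symmetrized pairing `(dξ - ξ Γ) ⊙ dx` in the coordinates of `T*N`. -/
noncomputable def cotPairing (D : AffineConnection (𝓡 n) N) (x₀ : N) (p : CotangentBundle n N)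
    (v w : TangentSpace (cotangentModel n) p) : ℝ :=
  let z := cotCoord x₀ p
  let X := cotDeriv x₀ p v
  let X' := cotDeriv x₀ p w
  X.2 X'.1 - z.2 (chartGamma D x₀ z.1 X.1 X'.1) + (X'.2 X.1 - z.2 (chartGamma D x₀ z.1 X'.1 X.1))

variable {x₀ x₁ : N} {p : CotangentBundle n N}
  (hp : p.proj ∈ (chartAt 𝕍 n x₀).source)
  (hp' : p.proj ∈ (chartAt 𝕍 n x₁).source)

section Change

include hp hp'

lemma cotDeriv_fst_change (v : TangentSpace (cotangentModel n) p) : (cotDeriv x₁ p v).1 =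
    fderiv ℝ (baseChange x₀ x₁) (cotCoord x₀ p).1 (cotDeriv x₀ p v).1 := by
  have hψ := (contDiffAt_baseChange_fst hp hp').differentiableAt (n := ∞) (by simp)
  have hG := (contDiffAt_fibreChange hp hp').differentiableAt (n := ∞) (by simp)
  rw [cotDeriv_change hp hp' v, fderiv_fibred hψ hG]

/-- The tautological form does not depend on the chart. -/
lemma cotCoord_snd_cotDeriv (v : TangentSpace (cotangentModel n) p) :
    (cotCoord x₁ p).2 (cotDeriv x₁ p v).1 = (cotCoord x₀ p).2 (cotDeriv x₀ p v).1 := by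
  rw [cotDeriv_fst_change hp hp', cotCoord_change hp hp',
    (eventually_fibreChange_apply hp hp').self_of_nhds]

lemma cotPairing_change [T2Space N] {D : AffineConnection (𝓡 n) N} (hD : IsSmoothTorsionFree D)
    (v w : TangentSpace (cotangentModel n) p) :
    cotPairing D x₁ p v w = cotPairing D x₀ p v w := by
  have h := splitMetric_change hp hp' hD v w
  have hs : ∀ v w : TangentSpace (cotangentModel n) p,
      chartSchouten D x₁ (cotCoord x₁ p).1 (cotDeriv x₁ p v).1 (cotDeriv x₁ p w).1 =
      chartSchouten D x₀ (cotCoord x₀ p).1 (cotDeriv x₀ p v).1 (cotDeriv x₀ p w).1 := by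
    intro v w
    rw [cotDeriv_fst_change hp hp' v, cotDeriv_fst_change hp hp' w,
      show (cotCoord x₁ p).1 = baseChange x₀ x₁ (cotCoord x₀ p).1 by rw [cotCoord_change hp hp'],
      cotCoord_fst hp]
    exact chartSchouten_transform hD.1 hp hp' _ _
  simp only [splitMetric_apply, cotLift, cotangentLift_apply, sub_apply, smul_apply,
    ContinuousLinearMap.comp_apply, hs, cotCoord_snd_cotDeriv hp hp', smul_eq_mul] at h
  simp only [cotPairing]
  linarith

end Change

include hp

lemma contactCovector_apply {k : Fin n} (hk : momentum x₀ k p ≠ 0)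
    (v : TangentSpace (cotangentModel n) p) :
    contactCovector x₀ k p v = (momentum x₀ k p)⁻¹ * (cotCoord x₀ p).2 (cotDeriv x₀ p v).1 := by
  rw [apply_eq_sum, ← Finset.add_sum_erase _ _ (Finset.mem_univ k), ← momentum_eq hp, mul_add,
    inv_mul_cancel_left₀ hk, Finset.mul_sum]
  simp only [contactCovector, add_apply, sum_apply, smul_apply, dPosition_apply hp, smul_eq_mul,
    slope]
  congr 1
  exact Finset.sum_congr rfl fun A _ => by rw [← momentum_eq hp]; ring

lemma mvfderiv_slope {k : Fin n} (hk : momentum x₀ k p ≠ 0) (A : Fin n)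
    (v : TangentSpace (cotangentModel n) p) :
    mvfderiv (cotangentModel n) (slope x₀ k A) p v =
      (cotDeriv x₀ p v).2 (EuclideanSpace.single A 1) / momentum x₀ k p -
        momentum x₀ A p * (cotDeriv x₀ p v).2 (EuclideanSpace.single k 1) /
          momentum x₀ k p ^ 2 := by
  let e : Fin n → 𝕍 n × DualSpace n →L[ℝ] ℝ := fun i =>
    ContinuousLinearMap.apply ℝ ℝ (EuclideanSpace.single i (1 : ℝ)) ∘L
      ContinuousLinearMap.snd ℝ 𝕍 n (DualSpace n)
  have he : e k (cotCoord x₀ p) ≠ 0 := by rwa [momentum_eq hp] at hk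
  have h := mvfderiv_linear_cotCoord hp (f := slope x₀ k A) (A := fun z => e A z / e k z)
    ((e A).contDiff.contDiffAt.div (e k).contDiff.contDiffAt he)
    (fun p hp => by rw [slope, momentum_eq hp, momentum_eq hp]; rfl) v
  have h1 : HasFDerivAt (fun z => e A z / e k z) _ (cotCoord x₀ p) :=
    HasFDerivAt.mul (e A).hasFDerivAt
      ((hasDerivAt_inv he).comp_hasFDerivAt (cotCoord x₀ p) (e k).hasFDerivAt)
  rw [h, h1.fderiv, momentum_eq hp, momentum_eq hp]
  rw [momentum_eq hp] at hk
  simp only [smul_apply, add_apply, smul_eq_mul]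
  change (cotCoord x₀ p).2 (EuclideanSpace.single A 1) *
      (-((cotCoord x₀ p).2 (EuclideanSpace.single k 1) ^ 2)⁻¹ *
        (cotDeriv x₀ p v).2 (EuclideanSpace.single k 1)) +
    ((cotCoord x₀ p).2 (EuclideanSpace.single k 1))⁻¹ *
      (cotDeriv x₀ p v).2 (EuclideanSpace.single A 1) = _
  field_simp
  ring

lemma sum_mvfderiv_slope {k : Fin n} (hk : momentum x₀ k p ≠ 0)
    {v w : TangentSpace (cotangentModel n) p}
    (hw : (cotCoord x₀ p).2 (cotDeriv x₀ p w).1 = 0) :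
    ∑ A ∈ Finset.univ.erase k, mvfderiv (cotangentModel n) (slope x₀ k A) p v *
        dPosition x₀ A p w =
      (momentum x₀ k p)⁻¹ * (cotDeriv x₀ p v).2 (cotDeriv x₀ p w).1 := by
  have h0 : mvfderiv (cotangentModel n) (slope x₀ k k) p v * dPosition x₀ k p w = 0 := by
    rw [mvfderiv_slope hp hk]
    field_simp
    simp
  have h1 := Finset.add_sum_erase Finset.univ (fun A => mvfderiv (cotangentModel n)
    (slope x₀ k A) p v * dPosition x₀ A p w) (Finset.mem_univ k)
  rw [h0, zero_add] at h1
  rw [h1]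
  have h2 : ∀ A, mvfderiv (cotangentModel n) (slope x₀ k A) p v * dPosition x₀ A p w =
      (momentum x₀ k p)⁻¹ * ((cotDeriv x₀ p v).2 (EuclideanSpace.single A 1) *
        (cotDeriv x₀ p w).1 A) -
      (cotDeriv x₀ p v).2 (EuclideanSpace.single k 1) / momentum x₀ k p ^ 2 *
        ((cotCoord x₀ p).2 (EuclideanSpace.single A 1) * (cotDeriv x₀ p w).1 A) := by
    intro A
    rw [mvfderiv_slope hp hk, dPosition_apply hp, momentum_eq hp A]
    ring
  rw [Finset.sum_congr rfl fun A _ => h2 A, Finset.sum_sub_distrib, ← Finset.mul_sum,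
    ← Finset.mul_sum, ← apply_eq_sum, ← apply_eq_sum, hw, mul_zero, sub_zero]

lemma slopeGamma_eq (D : AffineConnection (𝓡 n) N) {k : Fin n} (hk : momentum x₀ k p ≠ 0)
    (i j : Fin n) : slopeGamma D x₀ k i j p = (momentum x₀ k p)⁻¹ *
      (cotCoord x₀ p).2 (chartGamma D x₀ (cotCoord x₀ p).1 (EuclideanSpace.single i 1)
        (EuclideanSpace.single j 1)) := by
  rw [apply_eq_sum, ← Finset.add_sum_erase _ _ (Finset.mem_univ k), ← momentum_eq hp, mul_add,
    inv_mul_cancel_left₀ hk, Finset.mul_sum, slopeGamma, add_comm]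
  have h : extChartAt (𝓡 n) x₀ p.proj = (cotCoord x₀ p).1 := by
    rw [cotCoord_fst hp]
    rfl
  simp only [chartGamma_single, h, slope]
  congr 1
  exact Finset.sum_congr rfl fun A _ => by rw [← momentum_eq hp]; ring

lemma boundaryMetric_apply {D : AffineConnection (𝓡 n) N} (hD : IsSmoothTorsionFree D)
    {k : Fin n} (hk : momentum x₀ k p ≠ 0) {v w : TangentSpace (cotangentModel n) p}
    (hv : (cotCoord x₀ p).2 (cotDeriv x₀ p v).1 = 0)
    (hw : (cotCoord x₀ p).2 (cotDeriv x₀ p w).1 = 0) :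
    boundaryMetric D x₀ k p v w = (2 * momentum x₀ k p)⁻¹ * cotPairing D x₀ p v w := by
  have key : ∀ u : TangentSpace (cotangentModel n) p, (cotCoord x₀ p).2 (cotDeriv x₀ p u).1 = 0 →
      dPosition x₀ k p u = -∑ A ∈ Finset.univ.erase k, slope x₀ k A p * dPosition x₀ A p u := by
    intro u hu
    have h := contactCovector_apply hp hk u
    rw [hu, mul_zero] at h
    simp only [contactCovector, add_apply, sum_apply, smul_apply, smul_eq_mul] at h
    linarith
  have hG : ∀ i j, slopeGamma D x₀ k i j p = slopeGamma D x₀ k j i p := by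
    intro i j
    rw [slopeGamma_eq hp D hk, slopeGamma_eq hp D hk, cotCoord_fst hp, chartGamma_symm hD.2 hp]
  have hΓ : ∀ v w : TangentSpace (cotangentModel n) p, ∑ i, ∑ j, slopeGamma D x₀ k i j p *
      dPosition x₀ i p v * dPosition x₀ j p w = (momentum x₀ k p)⁻¹ * (cotCoord x₀ p).2
        (chartGamma D x₀ (cotCoord x₀ p).1 (cotDeriv x₀ p v).1 (cotDeriv x₀ p w).1) := by
    intro v w
    conv_rhs => rw [eq_sum_single (cotDeriv x₀ p v).1, eq_sum_single (cotDeriv x₀ p w).1]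
    simp only [map_sum, map_smul, sum_apply, smul_apply, smul_eq_mul, Finset.mul_sum]
    rw [Finset.sum_comm]
    refine Finset.sum_congr rfl fun j _ => Finset.sum_congr rfl fun i _ => ?_
    rw [slopeGamma_eq hp D hk, dPosition_apply hp, dPosition_apply hp]
    ring
  have h1 := sum_sum_erase_symm k hG (Z := fun A => slope x₀ k A p)
    (x := fun A => dPosition x₀ A p v) (x' := fun A => dPosition x₀ A p w) (key v hv) (key w hw)
  rw [hΓ, hΓ] at h1
  have h2 := sum_mvfderiv_slope hp hk (v := v) hw
  have h3 := sum_mvfderiv_slope hp hk (v := w) hv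
  have h4 : boundaryMetric D x₀ k p v w = 1 / 2 *
      (∑ A ∈ Finset.univ.erase k, mvfderiv (cotangentModel n) (slope x₀ k A) p v *
        dPosition x₀ A p w + ∑ A ∈ Finset.univ.erase k,
        mvfderiv (cotangentModel n) (slope x₀ k A) p w * dPosition x₀ A p v -
      ∑ A ∈ Finset.univ.erase k, ((∑ B ∈ Finset.univ.erase k, (slopeGamma D x₀ k A B p +
        slopeGamma D x₀ k k k p * slope x₀ k A p * slope x₀ k B p -
        2 * slopeGamma D x₀ k A k p * slope x₀ k B p) * dPosition x₀ B p v) *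
          dPosition x₀ A p w + (∑ B ∈ Finset.univ.erase k, (slopeGamma D x₀ k A B p +
        slopeGamma D x₀ k k k p * slope x₀ k A p * slope x₀ k B p -
        2 * slopeGamma D x₀ k A k p * slope x₀ k B p) * dPosition x₀ B p w) *
          dPosition x₀ A p v)) := by
    rw [← Finset.sum_add_distrib, ← Finset.sum_sub_distrib, Finset.mul_sum, boundaryMetric,
      sum_apply, sum_apply]
    refine Finset.sum_congr rfl fun A _ => ?_
    simp only [symProd, smul_apply, add_apply, ContinuousLinearMap.smulRight_apply, sub_apply,
      sum_apply, smul_eq_mul, bigTheta]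
    ring
  rw [h4, h1, h2, h3, cotPairing, mul_inv]
  ring

end ExplicitMetric

lemma lin_rayDeriv {n : ℕ} (S : AffineSlice 𝕍 n)
    {z X : 𝕍 n × DualSpace n} (hz : S.ell (z.2, 0) ≠ 0) :
    S.lin (rayDeriv S z X).2 =
      (S.ell (z.2, 0))⁻¹ • ((X.2, 0) - (S.ell (X.2, 0) * (S.ell (z.2, 0))⁻¹) • (z.2, 0)) := by
  rw [rayDeriv, map_smul, map_sub, map_smul, S.lin_tau, rayCoord, map_smul, S.lin_tau]
  congr 1
  rw [smul_sub, smul_smul, inv_mul_cancel₀ hz, one_smul, smul_sub, smul_smul]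
  abel

section ExplicitBoundary

variable {n : ℕ} [NeZero n] {N : Type*} [TopologicalSpace N] [T2Space N]
  [ChartedSpace 𝕍 n N] [IsManifold (𝓡 n) ∞ N] [F : FibreNorm n N]
  {p : CotangentBundle n N} (hp : p.2 ≠ 0)

variable (F p) in
/-- The factor relating a covector to the normalized covector on its ray. -/
noncomputable def rayScale : ℝ :=
  (raySlice (edgeIndex F (rayProj p))).ell
    ((cotCoord (compBase (rayBoundary F (rayProj p))) p).2, 0)

include hp

lemma mem_pairSource_rayProj : (p, (0 : ℝ)) ∈ pairSource (compBase (rayBoundary F (rayProj p)))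
    (edgeIndex F (rayProj p)) :=
  (rayBoundary_rayProj_mem hp).1 (mem_chart_source 𝕍 (2 * n - 1) (rayProj p))

lemma rayScale_pos : 0 < rayScale F p := (mem_pairSource_rayProj hp).2

lemma edgePoint_rayProj : edgePoint F (rayProj p) (rayProj p) =
    ((cotCoord (compBase (rayBoundary F (rayProj p))) p).1,
      rayCoord (raySlice (edgeIndex F (rayProj p)))
        ((cotCoord (compBase (rayBoundary F (rayProj p))) p).2, 0)) := by
  rw [edgePoint, rayCoordMap_rayProj (mem_pairSource_rayProj hp)]
  refine boundaryIncl_boundaryProj _ ?_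
  rw [pairCoord_single, mul_zero]

lemma rayCovector_rayProj : rayCovector F (rayProj p) =
    (rayScale F p)⁻¹ • (cotCoord (compBase (rayBoundary F (rayProj p))) p).2 := by
  rw [rayCovector, edgePoint_rayProj hp, edgeCovector, rayCoord,
    AffineSlice.sect_tau _ (rayScale_pos hp).ne']
  rfl

lemma edgeDeriv_mfderiv_rayProj (v : TangentSpace (cotangentModel n) p) :
    edgeDeriv F (rayProj p) (rayProj p) (mfderiv (cotangentModel n) 𝓢 n rayProj p v) =
      rayDeriv (raySlice (edgeIndex F (rayProj p)))
        (cotCoord (compBase (rayBoundary F (rayProj p))) p)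
        (cotDeriv (compBase (rayBoundary F (rayProj p))) p v) := by
  have h := coordDeriv_mfderiv_rayProj (F := F) hp
    (mem_chart_source 𝕍 (2 * n - 1) (rayProj p)) v
  rw [edgeDeriv, ContinuousLinearMap.comp_apply, h]
  refine boundaryIncl_boundaryProj _ ?_
  simp [rayDeriv, rayCoord, raySlice_tau]

lemma edgeDeriv_mfderiv_rayProj_snd (v : TangentSpace (cotangentModel n) p)
    {x : 𝕍 n}
    (hx : (cotCoord (compBase (rayBoundary F (rayProj p))) p).2 x = 0) :
    (edgeDeriv F (rayProj p) (rayProj p)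
      (mfderiv (cotangentModel n) 𝓢 n rayProj p v)).2 x =
      (rayScale F p)⁻¹ * (cotDeriv (compBase (rayBoundary F (rayProj p))) p v).2 x := by
  have h1 := lin_rayDeriv (raySlice (edgeIndex F (rayProj p)))
    (X := cotDeriv (compBase (rayBoundary F (rayProj p))) p v) (rayScale_pos (F := F) hp).ne'
  rw [← edgeDeriv_mfderiv_rayProj hp] at h1
  have h2 := raySlice_lin_of_eq_zero (edgeIndex_slope (F := F) (rayProj p))
    (edgeDeriv_single (F := F) (rayProj p) (rayProj p)
      (mfderiv (cotangentModel n) 𝓢 n rayProj p v))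
  have h3 := congrArg (fun y : DualSpace n × ℝ => y.1 x) (h2.symm.trans h1)
  rw [rayScale]
  simpa [hx] using h3

variable {D : AffineConnection (𝓡 n) N} (hD : IsSmoothTorsionFree D)

include hD

lemma boundaryForm_rayProj_eq_zero_iff {x₀ : N} {k : Fin n}
    (hx₀ : p.proj ∈ (chartAt 𝕍 n x₀).source) (hk : momentum x₀ k p ≠ 0)
    (w : TangentSpace (cotangentModel n) p) :
    ϑ n F D
        (rayProj p) (mfderiv (cotangentModel n) 𝓢 n rayProj p w) = 0 ↔
      contactCovector x₀ k p w = 0 := by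
  have h := mem_contactDistribution_iff (F := F) hD (b := rayProj p)
    (v := mfderiv (cotangentModel n) 𝓢 n rayProj p w)
  rw [LinearMap.mem_ker, ContinuousLinearMap.coe_coe] at h
  rw [h, contactCovector_apply hx₀ hk,
    ← cotCoord_snd_cotDeriv hx₀ (mem_pairSource_rayProj (F := F) hp).1]
  rw [show edgeCovector F (rayProj p) (edgePoint F (rayProj p) (rayProj p)) = _ from
    rayCovector_rayProj hp, edgeDeriv_mfderiv_rayProj hp]
  simp [rayDeriv, hk, (rayScale_pos (F := F) hp).ne']

lemma boundaryTensor_rayProj {x₀ : N} {k : Fin n}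
    (hx₀ : p.proj ∈ (chartAt 𝕍 n x₀).source) (hk : momentum x₀ k p ≠ 0)
    {v w : TangentSpace (cotangentModel n) p}
    (hv : contactCovector x₀ k p v = 0) (hw : contactCovector x₀ k p w = 0) :
    boundaryTensor (2 * n - 1) 𝓗 n (compactMetric F D) (rayBoundary F) (rayProj p)
        (mfderiv (cotangentModel n) 𝓢 n rayProj p v)
        (mfderiv (cotangentModel n) 𝓢 n rayProj p w) =
      compWeight (rayBoundary F (rayProj p)) (edgePoint F (rayProj p) (rayProj p)) *
        (rayScale F p)⁻¹ * momentum x₀ k p * boundaryMetric D x₀ k p v w := by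
  have hy := (mem_pairSource_rayProj (F := F) hp).1
  have key : ∀ u : TangentSpace (cotangentModel n) p, contactCovector x₀ k p u = 0 →
      (cotCoord x₀ p).2 (cotDeriv x₀ p u).1 = 0 ∧
      (cotCoord (compBase (rayBoundary F (rayProj p))) p).2
        (cotDeriv (compBase (rayBoundary F (rayProj p))) p u).1 = 0 ∧
      edgeCovector F (rayProj p) (edgePoint F (rayProj p) (rayProj p))
        (edgeDeriv F (rayProj p) (rayProj p)
          (mfderiv (cotangentModel n) 𝓢 n rayProj p u)).1 = 0 := by
    intro u hu
    have h := mem_contactDistribution_iff (F := F) hD (b := rayProj p)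
      (v := mfderiv (cotangentModel n) 𝓢 n rayProj p u)
    rw [LinearMap.mem_ker, ContinuousLinearMap.coe_coe] at h
    have h1 := h.1 ((boundaryForm_rayProj_eq_zero_iff hp hD hx₀ hk u).2 hu)
    rw [contactCovector_apply hx₀ hk] at hu
    have h2 := (mul_eq_zero.1 hu).resolve_left (inv_ne_zero hk)
    exact ⟨h2, (cotCoord_snd_cotDeriv hx₀ hy u).trans h2, h1⟩
  have hfst : ∀ u : TangentSpace (cotangentModel n) p, (edgeDeriv F (rayProj p) (rayProj p)
      (mfderiv (cotangentModel n) 𝓢 n rayProj p u)).1 =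
      (cotDeriv (compBase (rayBoundary F (rayProj p))) p u).1 := fun u => by
    rw [edgeDeriv_mfderiv_rayProj hp]
    rfl
  rw [boundaryTensor_apply hD (key v hv).2.2 (key w hw).2.2, hfst, hfst,
    edgeDeriv_mfderiv_rayProj_snd hp v (key w hw).2.1,
    edgeDeriv_mfderiv_rayProj_snd hp w (key v hv).2.1,
    boundaryMetric_apply hx₀ hD hk (key v hv).1 (key w hw).1, ← cotPairing_change hx₀ hy hD]
  rw [show edgeCovector F (rayProj p) (edgePoint F (rayProj p) (rayProj p)) = _ from
    rayCovector_rayProj hp]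
  rw [show (edgePoint F (rayProj p) (rayProj p)).1 = _ from
    congrArg Prod.fst (edgePoint_rayProj hp)]
  simp only [cotPairing, smul_apply, smul_eq_mul]
  field_simp

end ExplicitBoundary

end ParaCProjective

theorem theorem3 (n : ℕ) [NeZero n] (hn : 2 ≤ n)
    (N : Type u) [TopologicalSpace N] [T2Space N] [SecondCountableTopology N]
    [ChartedSpace (EuclideanSpace ℝ (Fin n)) N] [IsManifold (𝓡 n) ∞ N]
    (𝔭 : ProjectiveStructure n N) (D : AffineConnection (𝓡 n) N) (hD : D ∈ 𝔭.connections) :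
    -- the manifold with boundary, and the smooth structure on the ray projectivization
    ∃ (Mbar : Type u) (_ : TopologicalSpace Mbar) (_ : T2Space Mbar)
      (_ : SecondCountableTopology Mbar) (_ : ChartedSpace (EuclideanHalfSpace (2 * n)) Mbar)
      (_ : IsManifold (𝓡∂ (2 * n)) ∞ Mbar)
      (_ : ChartedSpace (EuclideanSpace ℝ (Fin (2 * n - 1))) (RayCotangent n N))
      (_ : IsManifold (𝓡 (2 * n - 1)) ∞ (RayCotangent n N))
      (q : CotangentBundle n N → RayCotangent n N)
      (ι : CotangentBundle n N → Mbar) (T : Mbar → ℝ) (pr : Mbar → N)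
      (j : RayCotangent n N → Mbar)
      (J : ∀ p : CotangentBundle n N,
        TangentSpace (cotangentModel n) p →L[ℝ] TangentSpace (cotangentModel n) p)
      (Jbar : ∀ P : Mbar, TangentSpace (𝓡∂ (2 * n)) P →L[ℝ] TangentSpace (𝓡∂ (2 * n)) P)
      (h : ∀ P : Mbar,
        TangentSpace (𝓡∂ (2 * n)) P →L[ℝ] TangentSpace (𝓡∂ (2 * n)) P →L[ℝ] ℝ)
      (φ : ∀ b : RayCotangent n N,
        contactDistribution (boundaryForm (2 * n - 1) (𝓡∂ (2 * n)) Jbar T j) b →ₗ[ℝ]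
          contactDistribution (boundaryForm (2 * n - 1) (𝓡∂ (2 * n)) Jbar T j) b),
      -- the para-c-projective compactification
      (∀ p v w, neutralForm D p v w = neutralMetric D p (J p v) w) ∧
      IsParaCProjectiveCompactification (cotangentModel n) (𝓡∂ (2 * n)) (neutralMetric D) J ι T ∧
      (∀ p, 0 < T (ι p)) ∧
      -- it is fibred over `N` with compact fibres
      ContMDiff (𝓡∂ (2 * n)) (𝓡 n) ∞ pr ∧ IsProperMap pr ∧ (∀ p, pr (ι p) = p.proj) ∧
      -- the boundary is the ray projectivization of the cotangent bundle
      IsRayProjection (2 * n - 1) q ∧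
      IsBoundaryIdentification (2 * n - 1) (𝓡∂ (2 * n)) ι j ∧
      -- `J` and the rescaled metric extend to the boundary
      IsExtensionOfJ (cotangentModel n) (𝓡∂ (2 * n)) J ι Jbar ∧
      IsRescaledMetric (cotangentModel n) (𝓡∂ (2 * n)) (neutralMetric D) ι T Jbar h ∧
      -- contact structure on the boundary
      IsContactForm (boundaryForm (2 * n - 1) (𝓡∂ (2 * n)) Jbar T j) ∧
      -- para-CR structure on the contact distribution, induced by `J`
      IsParaCRStructure (boundaryForm (2 * n - 1) (𝓡∂ (2 * n)) Jbar T j) φ (n - 1) ∧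
      (∀ b (v : contactDistribution (boundaryForm (2 * n - 1) (𝓡∂ (2 * n)) Jbar T j) b),
        mfderiv (𝓡 (2 * n - 1)) (𝓡∂ (2 * n)) j b (φ b v) =
          Jbar (j b) (mfderiv (𝓡 (2 * n - 1)) (𝓡∂ (2 * n)) j b v)) ∧
      -- metric on the contact distribution, induced by `h` and compatible with the Levi form
      (∀ b (v w : contactDistribution (boundaryForm (2 * n - 1) (𝓡∂ (2 * n)) Jbar T j) b),
        boundaryTensor (2 * n - 1) (𝓡∂ (2 * n)) h j b v w =
          boundaryTensor (2 * n - 1) (𝓡∂ (2 * n)) h j b w v) ∧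
      (∀ b (v : contactDistribution (boundaryForm (2 * n - 1) (𝓡∂ (2 * n)) Jbar T j) b),
        (∀ w : contactDistribution (boundaryForm (2 * n - 1) (𝓡∂ (2 * n)) Jbar T j) b,
          boundaryTensor (2 * n - 1) (𝓡∂ (2 * n)) h j b v w = 0) → v = 0) ∧
      (∀ b (v w : contactDistribution (boundaryForm (2 * n - 1) (𝓡∂ (2 * n)) Jbar T j) b),
        boundaryTensor (2 * n - 1) (𝓡∂ (2 * n)) h j b v (φ b w) =
          1 / 4 * dOneForm (boundaryForm (2 * n - 1) (𝓡∂ (2 * n)) Jbar T j) b v w) ∧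
      -- explicit contact distribution and conformal metric, where `ξ_k ≠ 0` in a chart of `N`
      (∀ (x₀ : N) (k : Fin n) (p : CotangentBundle n N),
        p.proj ∈ (chartAt (EuclideanSpace ℝ (Fin n)) x₀).source → momentum x₀ k p ≠ 0 →
        (∀ w : TangentSpace (cotangentModel n) p,
          boundaryForm (2 * n - 1) (𝓡∂ (2 * n)) Jbar T j (q p)
              (mfderiv (cotangentModel n) (𝓡 (2 * n - 1)) q p w) = 0 ↔
            contactCovector x₀ k p w = 0) ∧
        ∃ c : ℝ, 0 < c ∧ ∀ v w : TangentSpace (cotangentModel n) p,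
          contactCovector x₀ k p v = 0 → contactCovector x₀ k p w = 0 →
          boundaryTensor (2 * n - 1) (𝓡∂ (2 * n)) h j (q p)
              (mfderiv (cotangentModel n) (𝓡 (2 * n - 1)) q p v)
              (mfderiv (cotangentModel n) (𝓡 (2 * n - 1)) q p w) =
            c * momentum x₀ k p * boundaryMetric D x₀ k p v w) := by
  have hDs : IsSmoothTorsionFree D := by
    obtain ⟨D₀, -, h⟩ := 𝔭.isClass
    rw [h] at hD
    exact hD.1
  obtain ⟨F⟩ := exists_fibreNorm (n := n) (N := N)
  let := F
  refine ⟨CompactifiedCotangent F, inferInstance, t2Space_compactifiedCotangent,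
    secondCountable_compactifiedCotangent, inferInstance, inferInstance, inferInstance,
    inferInstance, rayProj, interiorIncl F, definingFunction F, compactProj F, rayBoundary F,
    neutralJ D, compactJ F D, compactMetric F D, fun b => contactJ hDs b,
    neutralForm_eq hDs, isParaCProjectiveCompactification hDs,
    definingFunction_interiorIncl_pos, contMDiff_compactProj, isProperMap_compactProj,
    compactProj_interiorIncl, isRayProjection_rayProj, isBoundaryIdentification_rayBoundary,
    isExtensionOfJ_compactJ hDs, isRescaledMetric_compactMetric hDs,
    isContactForm_boundaryForm hDs, isParaCRStructure_contactJ hDs,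
    fun b v => mfderiv_contactJ hDs v, fun b v w => boundaryTensor_symm hDs v w,
    fun b v h => boundaryTensor_nondegenerate hDs v h,
    fun b v w => boundaryTensor_contactJ hDs v w, fun x₀ k p hp hk => ?_⟩
  have hp0 : p.2 ≠ 0 := fun h => hk (by rw [momentum, h]; rfl)
  exact ⟨fun w => boundaryForm_rayProj_eq_zero_iff hp0 hDs hp hk w, _,
    mul_pos (edgeWeight_pos (mem_chart_source _ _)) (inv_pos.2 (rayScale_pos hp0)),
    fun v w hv hw => boundaryTensor_rayProj hp0 hDs hp hk hv hw⟩
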